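/- Conventions. Let $X$ be a compact Riemann surface (not necessarily connected). Put $dd^c=\frac{i}{2\pi}\partial\bar\partial$, so that $dd^c\log|z|^2=\delta_0$ on $\mathbb{C}$. A divisor on $X$ is a finite formal sum $D=\sum_P a_P[P]$ with $a_P\in\mathbb{R}$; its support is $|D|=\{P: a_P\neq 0\}$, and $\delta_D=\sum_P a_P\delta_P$. The space $L^2_1(X)$ consists of the distributions $\psi\in L^2(X)$ with $\partial\psi,\bar\partial\psi\in L^2$; its topology is given by the norm $\big(\int_X|\psi|^2\nu+i\int_X\partial\psi\wedge\overline{\partial\psi}\big)^{1/2}$ for any positive continuous 2-form $\nu$. A Green function with $C^\infty$ regularity for $D$ is a real-valued distribution $h$ on $X$ such that $dd^c h+\delta_D$ is a $C^\infty$ 2-form. An $L^2_1$-Green function for $D$ is a real-valued distribution $g$ on $X$ that admits a regular splitting $g=h+\psi$, with $h$ a Green function with $C^\infty$ regularity for $D$ and $\psi\in L^2_1(X)$. Let $\varphi:X\to Y$ be a holomorphic map of compact Riemann surfaces that is not constant on any connected component of $X$, and let $e_x$ be its ramification index at $x$. For divisors, $\varphi_*\big(\sum_P a_P[P]\big)=\sum_P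 a_P[\varphi(P)]$ and $\varphi^*\big(\sum_Q b_Q[Q]\big)=\sum_Q b_Q\sum_{\varphi(P)=Q}e_P[P]$. For functions, $(\varphi_*u)(y)=\sum_{\varphi(x)=y}e_x u(x)$ and $\varphi^*v=v\circ\varphi$. For an $L^2_1$-Green function $g$ for $D$ on $X$ with regular splitting $g=h+\psi$, put $\varphi_*g:=\varphi_*h+\varphi_*\psi$. Here $h$ is given by an integrable function that is $C^\infty$ outside $|D|$, and $\varphi_*h$ is the distribution given by the push-forward of this function; $\varphi_*\psi$ is the $L^2_1$-limit of $\varphi_*s_n$ for $C^\infty$ functions $s_n\to\psi$ in $L^2_1(X)$. For an $L^2_1$-Green function $f=k+\xi$ for $E$ on $Y$, the distribution $\varphi^*f:=\varphi^*k+\varphi^*\xi$ on $X$ is defined in the same way from the pull-back of functions. Theorem. (1) For every divisor $D$ on $X$ and every $L^2_1$-Green function $g$ for $D$, the distribution $\varphi_*g$ on $Y$ is well defined (it exists and does not depend on the choices), and it is an $L^2_1$-Green function for $\varphi_*D$. (2) For every divisor $E$ on $Y$ and every $L^2_1$-Green function $f$ for $E$, the distribution $\varphi^*f$ on $X$ is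 well defined (in the same sense), and it is an $L^2_1$-Green function for $\varphi^*E$. -/

import Mathlib

open Set Filter Topology MeasureTheory TopologicalSpace
open scoped Manifold ContDiff Distributions LineDeriv

noncomputable section

namespace RiemannSurface

/-! ### Charts, distributions and functions -/

section Basic

variable (X : Type*) [TopologicalSpace X] [ChartedSpace ℂ X]

/-- The holomorphic charts of `X`: all charts of the maximal complex-analytic atlas. -/
abbrev Chart := {e : OpenPartialHomeomorph X ℂ // e ∈ IsManifold.maximalAtlas 𝓘(ℂ) ω X}

variable {X}

/-- The open set `e(U) ⊆ ℂ` onto which a chart `e : U → ℂ` maps. -/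
def Chart.range (e : Chart X) : Opens ℂ := ⟨e.1.target, e.1.open_target⟩

/-- A test function `φ` on the range of the chart `e` stands for the compactly supported smooth
2-form `φ(e) dx ∧ dy` on `X` (extended by zero outside the domain of `e`), where `x + iy = e`.
The test functions `φ` (in the chart `e`) and `φ'` (in the chart `e'`) represent the same 2-form
on `X` if both forms vanish outside the common domain and if on it their coefficients
differ by the Jacobian `|τ'|²` of the holomorphic change of coordinates `τ = e ∘ e'⁻¹`. -/
def SameTwoForm (e e' : Chart X) (φ : 𝓓(e.range, ℝ)) (φ' : 𝓓(e'.range, ℝ)) : Prop :=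
  (∀ x ∈ e.1.source ∩ e'.1.source,
      φ' (e'.1 x) = φ (e.1 x) * ‖deriv (fun z => e.1 (e'.1.symm z)) (e'.1 x)‖ ^ 2) ∧
  (∀ x ∈ e.1.source \ e'.1.source, φ (e.1 x) = 0) ∧
  (∀ x ∈ e'.1.source \ e.1.source, φ' (e'.1 x) = 0)

variable (X)

/-- The space of real-valued distributions (currents of degree zero) on `X`, in the standard local
form: a distribution is a family of distributions `T_e` on the ranges of all charts `e`
that is compatible with changes of coordinates, that is, `T_e` and `T_e'` take the same value
on test functions representing the same 2-form. -/
def Dist : Submodule ℝ (∀ e : Chart X, 𝓓'(e.range, ℝ)) where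
  carrier := {T | ∀ (e e' : Chart X) (φ : 𝓓(e.range, ℝ)) (φ' : 𝓓(e'.range, ℝ)),
    SameTwoForm e e' φ φ' → T e φ = T e' φ'}
  add_mem' := fun {S T} hS hT e e' φ φ' h => by
    change S e φ + T e φ = S e' φ' + T e' φ'
    rw [hS e e' φ φ' h, hT e e' φ φ' h]
  zero_mem' := fun _ _ _ _ _ => rfl
  smul_mem' := fun c T hT e e' φ φ' h => by
    change c • T e φ = c • T e' φ'
    rw [hT e e' φ φ' h]

variable {X}

end Basic

/-- The distribution `T` on the open set `Ω ⊆ ℂ` is given by the locally integrable function `u`: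
`T(φ) = ∫ u φ dx dy`. -/
def IsGivenBy {Ω : Opens ℂ} (T : 𝓓'(Ω, ℝ)) (u : ℂ → ℝ) : Prop :=
  LocallyIntegrableOn u (Ω : Set ℂ) volume ∧ ∀ φ : 𝓓(Ω, ℝ), T φ = ∫ z, u z * φ z

/-- `u` is locally square integrable on `Ω`. -/
def IsL2Loc (Ω : Opens ℂ) (u : ℂ → ℝ) : Prop :=
  ∀ K : Set ℂ, IsCompact K → K ⊆ Ω → MemLp u 2 (volume.restrict K)

/-- The distribution `T` on `Ω` and its partial derivatives `∂T/∂x`, `∂T/∂y` (in the sense of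
distributions) are given by the locally square integrable functions `u`, `p`, `q`. -/
def HasL2Gradient {Ω : Opens ℂ} (T : 𝓓'(Ω, ℝ)) (u p q : ℂ → ℝ) : Prop :=
  (IsL2Loc Ω u ∧ IsGivenBy T u) ∧
  (IsL2Loc Ω p ∧ IsGivenBy (∂_{(1 : ℂ)} T) p) ∧
  (IsL2Loc Ω q ∧ IsGivenBy (∂_{Complex.I} T) q)

section Spaces

variable {X : Type*} [TopologicalSpace X] [ChartedSpace ℂ X]

/-- The distribution `T` on `X` is given by the locally integrable function `u : X → ℝ`. -/
def IsGivenByFun (T : Dist X) (u : X → ℝ) : Prop :=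
  ∀ e : Chart X, IsGivenBy (T.1 e) (fun z => u (e.1.symm z))

/-! ### The space `L²₁` -/

/-- `T` is a (real-valued) element of `L²₁`: in all charts, `T` and its first
order derivatives are locally square integrable. On a compact `X` this amounts to `T`, `∂T` and
`∂̄T` being square integrable on `X` with respect to a continuous volume form. -/
def IsL21 (T : Dist X) : Prop :=
  ∀ e : Chart X, ∃ u p q : ℂ → ℝ, HasL2Gradient (T.1 e) u p q

/-- The sequence `S` converges to `T` in the `L²₁` topology: in all charts `e` and on all compact
subsets `K` of the range of `e`, the `L²` norms of `S n - T` and of its first order derivatives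
tend to zero. On a compact `X`, where finitely many pairs `(e, K)` cover, this is convergence
for the Hilbert space norms `(∫ |f|² ν + i ∫ ∂f ∧ conj(∂f))^(1/2)`, with `ν` a positive
continuous 2-form. -/
def TendstoL21 (S : ℕ → Dist X) (T : Dist X) : Prop :=
  ∀ e : Chart X, ∀ K : Set ℂ, IsCompact K → K ⊆ e.1.target →
    ∃ u p q : ℕ → ℂ → ℝ,
      (∀ n, HasL2Gradient ((S n - T).1 e) (u n) (p n) (q n)) ∧
      Tendsto (fun n => ∫ z in K, (u n z ^ 2 + p n z ^ 2 + q n z ^ 2)) atTop (𝓝 0)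

/-! ### Green functions -/

/-- The coefficient, in the chart `e`, of the 2-current `dd^c T`. With `dd^c = (i / 2π) ∂∂̄`
one has `dd^c T = (4π)⁻¹ (∂²T/∂x² + ∂²T/∂y²) dx ∧ dy`. -/
def ddc (T : Dist X) (e : Chart X) : 𝓓'(e.range, ℝ) :=
  (4 * Real.pi)⁻¹ •
    (∂_{(1 : ℂ)} (∂_{(1 : ℂ)} (T.1 e)) + ∂_{Complex.I} (∂_{Complex.I} (T.1 e)))

open Classical in
/-- The 2-current `δ_D = ∑ a_P δ_P` of a divisor `D = ∑ a_P [P]` with real coefficients, in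
the chart `e`. -/
def diracDivisor (D : X →₀ ℝ) (e : Chart X) : 𝓓'(e.range, ℝ) :=
  D.sum fun P a => if P ∈ e.1.source then a • Distribution.delta (e.1 P) else 0

/-- `h` is a Green function with `C^∞` regularity for `D`: the 2-current `dd^c h + δ_D` is a
`C^∞` 2-form, that is, of the form `w dx ∧ dy` with `w` smooth in every chart. -/
def IsSmoothGreen (D : X →₀ ℝ) (h : Dist X) : Prop :=
  ∀ e : Chart X, ∃ w : ℂ → ℝ, ContDiffOn ℝ ∞ w e.1.target ∧
    IsGivenBy (ddc h e + diracDivisor D e) w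

/-- `g = h + ψ` is a regular splitting of `g`, with respect to the divisor `D`. -/
def IsRegularSplitting (D : X →₀ ℝ) (g h ψ : Dist X) : Prop :=
  IsSmoothGreen D h ∧ IsL21 ψ ∧ g = h + ψ

/-- `g` is an `L²₁`-Green function for `D`. -/
def IsL21Green (D : X →₀ ℝ) (g : Dist X) : Prop :=
  ∃ h ψ : Dist X, IsRegularSplitting D g h ψ

end Spaces

/-! ### Pull-back and push-forward -/

section Maps

variable {X Y : Type*} [TopologicalSpace X] [ChartedSpace ℂ X]
  [TopologicalSpace Y] [ChartedSpace ℂ Y]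

/-- The ramification index of `F` at `x`: the order of vanishing at `x` of `F - F(x)`, read in
local charts. -/
def ramificationIndex (F : X → Y) (x : X) : ℕ :=
  analyticOrderNatAt
    (fun z => chartAt ℂ (F x) (F ((chartAt ℂ x).symm z)) - chartAt ℂ (F x) (F x))
    (chartAt ℂ x x)

/-- The push-forward of a function, `(F_* u)(y) = ∑_{F(x) = y} e_x u(x)`. -/
def pushFun (F : X → Y) (u : X → ℝ) : Y → ℝ :=
  fun y => ∑ᶠ x ∈ F ⁻¹' {y}, (ramificationIndex F x : ℝ) * u x

/-- The pull-back of a function, `F^* u = u ∘ F`. -/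
def pullFun (F : X → Y) (u : Y → ℝ) : X → ℝ := fun x => u (F x)

/-- The push-forward of divisors, `F_* (∑ a_P [P]) = ∑ a_P [F(P)]`. -/
def pushDivisor (F : X → Y) (D : X →₀ ℝ) : Y →₀ ℝ := D.mapDomain F

/-- The pull-back of divisors, the linear map with `F^* [Q] = ∑_{F(P) = Q} e_P [P]`. -/
def pullDivisor (F : X → Y) (E : Y →₀ ℝ) : X →₀ ℝ :=
  E.sum fun Q b => ∑ᶠ P ∈ F ⁻¹' {Q}, Finsupp.single P (b * (ramificationIndex F P : ℝ))

/-- Let `Φ` be an operator turning functions on `X` into functions on `Y`. The distribution `T` on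
`Y` is the image under `Φ` of the Green function `h` with `C^∞` regularity for `D`: the
distribution `h` is given by a function `u` that is smooth outside the support of `D`, and
`T` is given by the function `Φ u`, which has to be locally integrable. -/
def IsImageOfGreen (Φ : (X → ℝ) → (Y → ℝ)) (D : X →₀ ℝ) (h : Dist X) (T : Dist Y) : Prop :=
  ∃ u : X → ℝ, ContMDiffOn 𝓘(ℝ, ℂ) 𝓘(ℝ, ℝ) ∞ u (D.support : Set X)ᶜ ∧
    IsGivenByFun h u ∧ IsGivenByFun T (Φ u)

/-- `η` is the image of `ψ` under the extension of `Φ`, by continuity for the `L²₁` topologies,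
from smooth functions to `L²₁`: there are smooth functions `s n` converging to `ψ`
in `L²₁` such that the functions `Φ (s n)` converge to `η` in `L²₁`. -/
def IsImageOfL21 (Φ : (X → ℝ) → (Y → ℝ)) (ψ : Dist X) (η : Dist Y) : Prop :=
  ∃ (s : ℕ → X → ℝ) (S : ℕ → Dist X) (S' : ℕ → Dist Y),
    (∀ n, ContMDiff 𝓘(ℝ, ℂ) 𝓘(ℝ, ℝ) ∞ (s n)) ∧
    (∀ n, IsGivenByFun (S n) (s n)) ∧ (∀ n, IsGivenByFun (S' n) (Φ (s n))) ∧
    TendstoL21 S ψ ∧ TendstoL21 S' η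

/-- `T` is obtained from the `L²₁`-Green function `g` for `D` by choosing a regular splitting
`g = h + ψ` and adding the images of `h` and of `ψ` under `Φ`. -/
def IsImage (Φ : (X → ℝ) → (Y → ℝ)) (D : X →₀ ℝ) (g : Dist X) (T : Dist Y) : Prop :=
  ∃ h ψ : Dist X, IsRegularSplitting D g h ψ ∧
    ∃ T₁ T₂ : Dist Y, IsImageOfGreen Φ D h T₁ ∧ IsImageOfL21 Φ ψ T₂ ∧ T = T₁ + T₂

/-- `T = F_* g`, for an `L²₁`-Green function `g` for the divisor `D` on `X`. -/
def IsPushforward (F : X → Y) (D : X →₀ ℝ) (g : Dist X) (T : Dist Y) : Prop :=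
  IsImage (pushFun F) D g T

/-- `T = F^* f`, for an `L²₁`-Green function `f` for the divisor `E` on `Y`. -/
def IsPullback (F : X → Y) (E : Y →₀ ℝ) (f : Dist Y) (T : Dist X) : Prop :=
  IsImage (pullFun F) E f T

end Maps

end RiemannSurface

end

noncomputable section

set_option linter.unusedSectionVars false

namespace RiemannSurface

section

/-! ### Distributions given by functions -/

section Local

variable {Ω : Opens ℂ}

/-! Push-forward and pull-back are handled together, as a linear operator Φ from functions on one
surface to functions on the other. Two properties of Φ carry the theorem: it is bounded for the L²₁
norms on smooth functions (`IsBoundedOp`), and it sends a function with logarithmic singularities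
along a divisor to an L²₁-Green function for the image divisor.

Boundedness. In real dimension two the gradient energy is conformally invariant, so by the area
formula a holomorphic map changes it at most by a factor depending on the size of the fibres. For
the push-forward the L² part is harmless, because |τ'|² is bounded on compact sets; the difficulty
is that F_* s need not be differentiable at branch values, so that its gradient has to be found in
the weak sense. It comes from integrating d(w · (φ ∘ τ)) along the field conj(τ') v, which is
divergence free because τ' is holomorphic (`integral_fderiv_conj_deriv_eq_zero`,
`hasL2Gradient_fibreSum`). For the pull-back the roles are exchanged: s ∘ F is smooth, but its L²
norm is not controlled directly where τ' vanishes. It is compared with the L² norm on a translated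
disc free of critical points, at the price of the gradient (`exists_local_pull_bound`). As L²₁ is
complete and smooth functions are dense in it (`exists_tendstoL21`, `exists_smooth_tendstoL21`), Φ
extends to L²₁.

Green functions. By Weyl's lemma (`weyl`) a Green function with smooth regularity is a function
equal to -a log |z - P|² plus a smooth function near each P (`IsSmoothGreen.exists_logGreen`), and
conversely (`LogGreen.isSmoothGreen`). Composition with F multiplies the coefficient at a point by
its ramification index, which settles the pull-back. For the push-forward, let κ have one
singularity, at F P, and let χ be a cutoff near P. Then e_P⁻¹ χ · (κ ∘ F) has one singularity, at P,
and its push-forward is κ, because the nearby fibres have e_P points near P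
(`exists_logGreen_push`). Any other function with the same singularities differs from such models by
a smooth function, whose push-forward lies in L²₁.

Independence of the choices. If h + ψ = h' + ψ' are two regular splittings, then h - h' = ψ' - ψ is
given by a smooth function s off a finite set, and the extension of Φ to L²₁ agrees with Φ on s
(`IsBoundedOp.image_sub`). Hence both splittings have the same image
(`IsBoundedOp.existsUnique_image`). -/

theorem testFunction_lineDeriv_apply (φ : 𝓓(Ω, ℝ)) (v z : ℂ) :
    (∂_{v} φ : 𝓓(Ω, ℝ)) z = fderiv ℝ φ z v := by
  rw [TestFunction.lineDerivOp_eq_lineDerivCLM ℝ, TestFunction.lineDerivCLM_eq_fderivCLM,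
    TestFunction.fderivCLM_apply_of_le _ (by simp)]

theorem lineDeriv_apply (T : 𝓓'(Ω, ℝ)) (v : ℂ) (φ : 𝓓(Ω, ℝ)) :
    (∂_{v} T : 𝓓'(Ω, ℝ)) φ = - T (∂_{v} φ) := by
  rw [Distribution.lineDerivOp_apply_apply, map_neg]

theorem testFunction_smooth (φ : 𝓓(Ω, ℝ)) : ContDiff ℝ ∞ φ := by
  simpa using φ.contDiff

/-- A test function from a smooth function of compact support in `Ω`. -/
def mkTest (φ : ℂ → ℝ) (h : ContDiff ℝ ∞ φ) (hc : HasCompactSupport φ) (hs : tsupport φ ⊆ Ω) :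
    𝓓(Ω, ℝ) := ⟨φ, by simpa using h, hc, hs⟩

@[simp] theorem mkTest_apply (φ : ℂ → ℝ) (h : ContDiff ℝ ∞ φ) (hc : HasCompactSupport φ)
    (hs : tsupport φ ⊆ Ω) (z : ℂ) : mkTest φ h hc hs z = φ z := rfl

@[simp] theorem coe_mkTest (φ : ℂ → ℝ) (h : ContDiff ℝ ∞ φ) (hc : HasCompactSupport φ)
    (hs : tsupport φ ⊆ Ω) : (mkTest φ h hc hs : ℂ → ℝ) = φ := rfl

theorem integrable_mul_test {u : ℂ → ℝ} (hu : LocallyIntegrableOn u (Ω : Set ℂ) volume)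
    (φ : 𝓓(Ω, ℝ)) : Integrable (fun z => u z * φ z) := by
  have := φ.integrable_bilin (ContinuousLinearMap.mul ℝ ℝ) hu
  simpa [mul_comm] using this

/-- The distribution given by a locally integrable function. -/
def ofFunLocal (Ω : Opens ℂ) (u : ℂ → ℝ) : 𝓓'(Ω, ℝ) :=
  TestFunction.integralAgainstBilinCLM (ContinuousLinearMap.mul ℝ ℝ) volume u

theorem isGivenBy_ofFunLocal {u : ℂ → ℝ} (hu : LocallyIntegrableOn u (Ω : Set ℂ) volume) :
    IsGivenBy (ofFunLocal Ω u) u := by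
  refine ⟨hu, fun φ => ?_⟩
  have := TestFunction.integralAgainstBilinCLM_eq_integral
    (B := ContinuousLinearMap.mul ℝ ℝ) (f := φ) hu
  simp_rw [mul_comm (u _)]
  exact this

theorem IsGivenBy.add {T S : 𝓓'(Ω, ℝ)} {u v : ℂ → ℝ} (hT : IsGivenBy T u) (hS : IsGivenBy S v) :
    IsGivenBy (T + S) (fun z => u z + v z) := by
  refine ⟨hT.1.add hS.1, fun φ => ?_⟩
  change T φ + S φ = _
  rw [hT.2, hS.2, ← integral_add (integrable_mul_test hT.1 φ) (integrable_mul_test hS.1 φ)]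
  simp_rw [add_mul]

theorem IsGivenBy.const_smul {T : 𝓓'(Ω, ℝ)} {u : ℂ → ℝ} (hT : IsGivenBy T u) (c : ℝ) :
    IsGivenBy (c • T) (fun z => c * u z) := by
  refine ⟨hT.1.smul c, fun φ => ?_⟩
  change c • T φ = _
  rw [hT.2, smul_eq_mul, ← integral_const_mul]
  simp_rw [mul_assoc]

theorem IsGivenBy.sub {T S : 𝓓'(Ω, ℝ)} {u v : ℂ → ℝ} (hT : IsGivenBy T u) (hS : IsGivenBy S v) :
    IsGivenBy (T - S) (fun z => u z - v z) := by
  refine ⟨hT.1.sub hS.1, fun φ => ?_⟩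
  change T φ - S φ = _
  rw [hT.2, hS.2, ← integral_sub (integrable_mul_test hT.1 φ) (integrable_mul_test hS.1 φ)]
  simp_rw [sub_mul]

theorem integral_mul_test_congr {u v : ℂ → ℝ} (h : ∀ᵐ z, z ∈ Ω → u z = v z) (φ : 𝓓(Ω, ℝ)) :
    ∫ z, u z * φ z = ∫ z, v z * φ z := by
  refine integral_congr_ae ?_
  filter_upwards [h] with z hz
  by_cases hzΩ : z ∈ Ω
  · simp only [hz hzΩ]
  · have : φ z = 0 := image_eq_zero_of_notMem_tsupport fun h => hzΩ (φ.tsupport_subset h)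
    simp [this]

theorem locallyIntegrableOn_congr_ae {u v : ℂ → ℝ} (h : ∀ᵐ z, z ∈ Ω → u z = v z)
    (hu : LocallyIntegrableOn u (Ω : Set ℂ) volume) :
    LocallyIntegrableOn v (Ω : Set ℂ) volume := by
  have h' : u =ᵐ[volume.restrict (Ω : Set ℂ)] v :=
    (ae_restrict_iff' Ω.isOpen.measurableSet).2 h
  intro x hx
  obtain ⟨s, hs, hi⟩ := hu x hx
  refine ⟨s ∩ Ω, inter_mem hs self_mem_nhdsWithin, ?_⟩
  have : IntegrableOn u (s ∩ Ω) := hi.mono_set inter_subset_left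
  refine this.congr_fun_ae ?_
  exact ae_mono (Measure.restrict_mono inter_subset_right le_rfl) h'

theorem IsGivenBy.congr_ae {T : 𝓓'(Ω, ℝ)} {u v : ℂ → ℝ} (hT : IsGivenBy T u)
    (h : ∀ᵐ z, z ∈ Ω → u z = v z) : IsGivenBy T v :=
  ⟨locallyIntegrableOn_congr_ae h hT.1, fun φ => (hT.2 φ).trans (integral_mul_test_congr h φ)⟩

/-- The fundamental lemma of the calculus of variations. It makes the three functions in
`HasL2Gradient` unique almost everywhere, so that energies are well defined. -/
theorem IsGivenBy.ae_eq {T : 𝓓'(Ω, ℝ)} {u v : ℂ → ℝ} (hu : IsGivenBy T u) (hv : IsGivenBy T v) :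
    ∀ᵐ z, z ∈ Ω → u z = v z := by
  have := Ω.isOpen.ae_eq_zero_of_integral_contDiff_smul_eq_zero (hu.1.sub hv.1)
    (fun g hg hc hs => by
      have := (hu.2 (mkTest g hg hc hs)).symm.trans (hv.2 (mkTest g hg hc hs))
      simp only [mkTest_apply] at this
      have h3 : ∫ z, (u z * g z - v z * g z) = 0 := by
        refine (integral_sub (integrable_mul_test hu.1 (mkTest g hg hc hs))
          (integrable_mul_test hv.1 (mkTest g hg hc hs))).trans ?_
        simp only [mkTest_apply, this, sub_self]
      rw [← h3]
      refine integral_congr_ae (ae_of_all _ fun z => ?_)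
      simp [mul_sub, mul_comm])
  filter_upwards [this] with z hz hzΩ
  simpa [sub_eq_zero] using hz hzΩ

theorem IsGivenBy.eq {T S : 𝓓'(Ω, ℝ)} {u : ℂ → ℝ} (hT : IsGivenBy T u) (hS : IsGivenBy S u) :
    T = S := by
  ext φ
  rw [hT.2, hS.2]

theorem isGivenBy_zero : IsGivenBy (0 : 𝓓'(Ω, ℝ)) (fun _ => 0) := by
  refine ⟨locallyIntegrableOn_zero, fun φ => ?_⟩
  simp

/-! ### Locally square integrable functions -/

theorem IsL2Loc.add {u v : ℂ → ℝ} (hu : IsL2Loc Ω u) (hv : IsL2Loc Ω v) :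
    IsL2Loc Ω (fun z => u z + v z) := fun K hK hΩ => (hu K hK hΩ).add (hv K hK hΩ)

theorem IsL2Loc.const_mul {u : ℂ → ℝ} (hu : IsL2Loc Ω u) (c : ℝ) :
    IsL2Loc Ω (fun z => c * u z) := fun K hK hΩ => (hu K hK hΩ).const_mul c

theorem IsL2Loc.locallyIntegrableOn {u : ℂ → ℝ} (hu : IsL2Loc Ω u) :
    LocallyIntegrableOn u (Ω : Set ℂ) volume := by
  rw [locallyIntegrableOn_iff Ω.isOpen.isLocallyClosed]
  intro K hK hc
  have : IsFiniteMeasure ((volume : Measure ℂ).restrict K) := ⟨by simpa using hc.measure_lt_top⟩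
  exact (hu K hc hK).integrable (by norm_num)

theorem IsL2Loc.integrableOn_sq {u : ℂ → ℝ} (hu : IsL2Loc Ω u) {K : Set ℂ} (hK : IsCompact K)
    (hΩ : K ⊆ Ω) : IntegrableOn (fun z => u z ^ 2) K :=
  (hu K hK hΩ).integrable_sq

theorem isL2Loc_of_continuousOn {u : ℂ → ℝ} (hu : ContinuousOn u Ω) : IsL2Loc Ω u := by
  intro K hK hΩ
  have hc := hu.mono hΩ
  rw [memLp_two_iff_integrable_sq (hc.aestronglyMeasurable hK.measurableSet)]
  exact (hc.pow 2).integrableOn_compact hK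

theorem HasL2Gradient.add {T S : 𝓓'(Ω, ℝ)} {u p q u' p' q' : ℂ → ℝ} (h : HasL2Gradient T u p q)
    (h' : HasL2Gradient S u' p' q') :
    HasL2Gradient (T + S) (fun z => u z + u' z) (fun z => p z + p' z) (fun z => q z + q' z) := by
  obtain ⟨⟨a, b⟩, ⟨c, d⟩, e, f⟩ := h
  obtain ⟨⟨a', b'⟩, ⟨c', d'⟩, e', f'⟩ := h'
  refine ⟨⟨a.add a', b.add b'⟩, ⟨c.add c', ?_⟩, e.add e', ?_⟩
  · rw [LineDeriv.lineDerivOp_add]; exact d.add d'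
  · rw [LineDeriv.lineDerivOp_add]; exact f.add f'

theorem HasL2Gradient.const_smul {T : 𝓓'(Ω, ℝ)} {u p q : ℂ → ℝ} (h : HasL2Gradient T u p q)
    (c : ℝ) : HasL2Gradient (c • T) (fun z => c * u z) (fun z => c * p z) (fun z => c * q z) := by
  obtain ⟨⟨a, b⟩, ⟨d, e⟩, f, g⟩ := h
  refine ⟨⟨a.const_mul c, b.const_smul c⟩, ⟨d.const_mul c, ?_⟩, f.const_mul c, ?_⟩
  · rw [LineDeriv.lineDerivOp_smul]; exact e.const_smul c
  · rw [LineDeriv.lineDerivOp_smul]; exact g.const_smul c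

theorem HasL2Gradient.sub {T S : 𝓓'(Ω, ℝ)} {u p q u' p' q' : ℂ → ℝ} (h : HasL2Gradient T u p q)
    (h' : HasL2Gradient S u' p' q') :
    HasL2Gradient (T - S) (fun z => u z - u' z) (fun z => p z - p' z) (fun z => q z - q' z) := by
  have := h.add (h'.const_smul (-1))
  simpa [sub_eq_add_neg] using this

/-- The Dirichlet norm on a compact set does not depend on the chosen representatives. -/
theorem HasL2Gradient.energy_eq {T : 𝓓'(Ω, ℝ)} {u p q u' p' q' : ℂ → ℝ}
    (h : HasL2Gradient T u p q) (h' : HasL2Gradient T u' p' q') {K : Set ℂ} (hK : MeasurableSet K)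
    (hΩ : K ⊆ Ω) :
    ∫ z in K, (u z ^ 2 + p z ^ 2 + q z ^ 2) = ∫ z in K, (u' z ^ 2 + p' z ^ 2 + q' z ^ 2) := by
  refine setIntegral_congr_ae hK ?_
  filter_upwards [h.1.2.ae_eq h'.1.2, h.2.1.2.ae_eq h'.2.1.2, h.2.2.2.ae_eq h'.2.2.2]
    with z h1 h2 h3 hz
  rw [h1 (hΩ hz), h2 (hΩ hz), h3 (hΩ hz)]

theorem HasL2Gradient.integrableOn {T : 𝓓'(Ω, ℝ)} {u p q : ℂ → ℝ} (h : HasL2Gradient T u p q)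
    {K : Set ℂ} (hK : IsCompact K) (hΩ : K ⊆ Ω) :
    IntegrableOn (fun z => u z ^ 2 + p z ^ 2 + q z ^ 2) K :=
  ((h.1.1.integrableOn_sq hK hΩ).add (h.2.1.1.integrableOn_sq hK hΩ)).add
    (h.2.2.1.integrableOn_sq hK hΩ)

/-- Integration by parts against a test function. -/
theorem integral_fderiv_eq_zero {g : ℂ → ℝ} (hg : ContDiff ℝ 1 g) (hc : HasCompactSupport g)
    (v : ℂ) : ∫ z, fderiv ℝ g z v = 0 := by
  have hcd : Continuous (fun z => fderiv ℝ g z v) := by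
    have := hg.continuous_fderiv (by norm_num)
    fun_prop
  -- The other factor in the integration by parts is the constant 1, whose derivative is zero.
  have := integral_mul_fderiv_eq_neg_fderiv_mul_of_integrable (𝕜 := ℝ) (f := fun _ : ℂ => (1 : ℝ))
    (g := g) (v := v) (μ := volume) (by simp)
    (by simpa using hcd.integrable_of_hasCompactSupport (hc.fderiv_apply ℝ v))
    (by simpa using hg.continuous.integrable_of_hasCompactSupport hc)
    (by fun_prop) (fun _ _ => hg.differentiable (by norm_num) _)
  simpa using this

theorem contDiff_mul_of_tsupport {n : WithTop ℕ∞} {U : Set ℂ} (hU : IsOpen U) {f g : ℂ → ℝ}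
    (hf : ContDiffOn ℝ n f U) (hg : ContDiff ℝ n g) (hs : tsupport g ⊆ U) :
    ContDiff ℝ n (fun z => f z * g z) := by
  rw [contDiff_iff_contDiffAt]
  intro z
  by_cases hz : z ∈ tsupport g
  · exact (hf.contDiffAt (hU.mem_nhds (hs hz))).mul hg.contDiffAt
  · have : (fun z => f z * g z) =ᶠ[𝓝 z] fun _ => 0 := by
      filter_upwards [(isClosed_tsupport g).isOpen_compl.mem_nhds hz] with w hw
      rw [image_eq_zero_of_notMem_tsupport hw, mul_zero]
    exact contDiffAt_const.congr_of_eventuallyEq this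

theorem integral_mul_fderiv_test {f : ℂ → ℝ} (hf : ContDiffOn ℝ 1 f Ω) (φ : 𝓓(Ω, ℝ)) (v : ℂ) :
    ∫ z, f z * fderiv ℝ φ z v = - ∫ z, fderiv ℝ f z v * φ z := by
  have hφ : ContDiff ℝ 1 φ := (testFunction_smooth φ).of_le (by norm_cast)
  have hfl : LocallyIntegrableOn f (Ω : Set ℂ) volume :=
    hf.continuousOn.locallyIntegrableOn Ω.isOpen.measurableSet
  have hfd : LocallyIntegrableOn (fun z => fderiv ℝ f z v) (Ω : Set ℂ) volume := by
    have := hf.continuousOn_fderiv_of_isOpen Ω.isOpen le_rfl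
    exact (this.clm_apply continuousOn_const).locallyIntegrableOn Ω.isOpen.measurableSet
  have hi1 : Integrable (fun z => f z * fderiv ℝ φ z v) := by
    simpa [testFunction_lineDeriv_apply] using integrable_mul_test hfl (∂_{v} φ)
  exact integral_mul_fderiv_eq_neg_fderiv_mul_of_integrable (integrable_mul_test hfd φ) hi1
    (integrable_mul_test hfl φ) (fun z hz => (hf.contDiffAt (Ω.isOpen.mem_nhds
      (φ.tsupport_subset hz))).differentiableAt (by norm_num))
    (fun _ _ => hφ.differentiable (by norm_num) _)

/-- A continuously differentiable function has a square integrable gradient. -/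
theorem hasL2Gradient_of_contDiffOn {T : 𝓓'(Ω, ℝ)} {u : ℂ → ℝ} (hT : IsGivenBy T u)
    (hu : ContDiffOn ℝ 1 u Ω) :
    HasL2Gradient T u (fun z => fderiv ℝ u z 1) (fun z => fderiv ℝ u z Complex.I) := by
  have key : ∀ v : ℂ, IsL2Loc Ω (fun z => fderiv ℝ u z v) ∧
      IsGivenBy (∂_{v} T) (fun z => fderiv ℝ u z v) := by
    intro v
    have hc : ContinuousOn (fun z => fderiv ℝ u z v) Ω :=
      (hu.continuousOn_fderiv_of_isOpen Ω.isOpen le_rfl).clm_apply continuousOn_const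
    refine ⟨isL2Loc_of_continuousOn hc, (isL2Loc_of_continuousOn hc).locallyIntegrableOn, ?_⟩
    intro φ
    rw [lineDeriv_apply, hT.2]
    simp_rw [testFunction_lineDeriv_apply]
    rw [integral_mul_fderiv_test hu, neg_neg]
  exact ⟨⟨isL2Loc_of_continuousOn hu.continuousOn, hT⟩, key 1, key _⟩

end Local

end

section

/-! ### The logarithm as a fundamental solution of the Laplace operator -/

/-- The Laplacian of a function on `ℂ`. -/
def lap (f : ℂ → ℝ) (z : ℂ) : ℝ :=
  fderiv ℝ (fun w => fderiv ℝ f w 1) z 1 +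
    fderiv ℝ (fun w => fderiv ℝ f w Complex.I) z Complex.I

theorem contDiff_fderiv_apply {f : ℂ → ℝ} (hf : ContDiff ℝ ∞ f) (v : ℂ) :
    ContDiff ℝ ∞ (fun w => fderiv ℝ f w v) :=
  (hf.fderiv_right (m := ∞) (by simp)).clm_apply contDiff_const

theorem contDiffOn_fderiv_apply {f : ℂ → ℝ} {U : Set ℂ} (hU : IsOpen U)
    (hf : ContDiffOn ℝ ∞ f U) (v : ℂ) : ContDiffOn ℝ ∞ (fun w => fderiv ℝ f w v) U :=
  (hf.fderiv_of_isOpen (m := ∞) hU (by simp)).clm_apply contDiffOn_const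

theorem contDiff_lap {f : ℂ → ℝ} (hf : ContDiff ℝ ∞ f) : ContDiff ℝ ∞ (lap f) :=
  (contDiff_fderiv_apply (contDiff_fderiv_apply hf _) _).add
    (contDiff_fderiv_apply (contDiff_fderiv_apply hf _) _)

theorem contDiffOn_lap {f : ℂ → ℝ} {U : Set ℂ} (hU : IsOpen U) (hf : ContDiffOn ℝ ∞ f U) :
    ContDiffOn ℝ ∞ (lap f) U :=
  (contDiffOn_fderiv_apply hU (contDiffOn_fderiv_apply hU hf _) _).add
    (contDiffOn_fderiv_apply hU (contDiffOn_fderiv_apply hU hf _) _)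

theorem lap_congr {f g : ℂ → ℝ} {z : ℂ} (h : f =ᶠ[𝓝 z] g) : lap f z = lap g z := by
  have key : ∀ v : ℂ, (fun w => fderiv ℝ f w v) =ᶠ[𝓝 z] fun w => fderiv ℝ g w v := by
    intro v
    filter_upwards [h.fderiv (𝕜 := ℝ)] with w hw
    rw [hw]
  rw [lap, lap, (key 1).fderiv_eq, (key _).fderiv_eq]

theorem lap_zero (z : ℂ) : lap (fun _ => 0) z = 0 := by simp [lap]

theorem lap_eq_zero_of_notMem_tsupport {f : ℂ → ℝ} {z : ℂ} (hz : z ∉ tsupport f) : lap f z = 0 := by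
  have : f =ᶠ[𝓝 z] fun _ => 0 := notMem_tsupport_iff_eventuallyEq.1 hz
  rw [lap_congr this, lap_zero]

theorem tsupport_lap_subset (f : ℂ → ℝ) : tsupport (lap f) ⊆ tsupport f :=
  closure_minimal (fun _ hz => not_imp_comm.1 lap_eq_zero_of_notMem_tsupport hz)
    (isClosed_tsupport f)

theorem hasCompactSupport_lap {f : ℂ → ℝ} (hf : HasCompactSupport f) : HasCompactSupport (lap f) :=
  hf.mono' ((subset_tsupport _).trans (tsupport_lap_subset f))

theorem lap_comp_sub (f : ℂ → ℝ) (a z : ℂ) : lap (fun w => f (w - a)) z = lap f (z - a) := by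
  have h1 : ∀ v : ℂ, (fun w => fderiv ℝ (fun w => f (w - a)) w v) =
      fun w => (fun y => fderiv ℝ f y v) (w - a) := by
    intro v; ext w
    rw [fderiv_comp_sub]
  rw [lap, h1, h1, fderiv_comp_sub (f := fun y => fderiv ℝ f y 1),
    fderiv_comp_sub (f := fun y => fderiv ℝ f y Complex.I), lap]

theorem lap_const_mul {f : ℂ → ℝ} (c : ℝ) (z : ℂ) :
    lap (fun w => c * f w) z = c * lap f z := by
  have key : ∀ (g : ℂ → ℝ) (v : ℂ), (fun w => fderiv ℝ (fun w => c * g w) w v) =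
      fun w => c * fderiv ℝ g w v := by
    intro g v; ext w
    have := fderiv_const_smul_field (𝕜 := ℝ) (R := ℝ) (f := g) c
    have h2 := congrFun this w
    simp only [Pi.smul_def, smul_eq_mul] at h2
    rw [h2]; rfl
  have key2 : ∀ (g : ℂ → ℝ) (v w : ℂ), fderiv ℝ (fun w => c * g w) w v =
      c * fderiv ℝ g w v := fun g v w => congrFun (key g v) w
  rw [lap, key, key, key2, key2, lap]
  ring

/-- Second integration by parts. -/
theorem integral_mul_lap_test {Ω : Opens ℂ} {f : ℂ → ℝ} (hf : ContDiffOn ℝ ∞ f Ω) (φ : 𝓓(Ω, ℝ)) :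
    ∫ z, f z * lap φ z = ∫ z, lap f z * φ z := by
  have hl : ∀ {g : ℂ → ℝ}, ContDiffOn ℝ ∞ g Ω → LocallyIntegrableOn g (Ω : Set ℂ) volume :=
    fun hg => hg.continuousOn.locallyIntegrableOn Ω.isOpen.measurableSet
  have h2 : ∀ v : ℂ, ∫ z, f z * fderiv ℝ (fun w => fderiv ℝ φ w v) z v =
      ∫ z, fderiv ℝ (fun w => fderiv ℝ f w v) z v * φ z := by
    intro v
    have e1 := integral_mul_fderiv_test (hf.of_le (by norm_cast)) (∂_{v} φ) v
    have e2 := integral_mul_fderiv_test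
      ((contDiffOn_fderiv_apply Ω.isOpen hf v).of_le (by norm_cast)) φ v
    have e3 : ((∂_{v} φ : 𝓓(Ω, ℝ)) : ℂ → ℝ) = fun w => fderiv ℝ φ w v := by
      ext w; rw [testFunction_lineDeriv_apply]
    rw [e3] at e1
    rw [e1, e2, neg_neg]
  have hi : ∀ v : ℂ, Integrable (fun z => f z * fderiv ℝ (fun w => fderiv ℝ φ w v) z v) := by
    intro v
    have := integrable_mul_test (hl hf) (∂_{v} (∂_{v} φ))
    refine this.congr (ae_of_all _ fun z => ?_)
    have e3 : ((∂_{v} φ : 𝓓(Ω, ℝ)) : ℂ → ℝ) = fun w => fderiv ℝ φ w v := by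
      ext w; rw [testFunction_lineDeriv_apply]
    simp only [testFunction_lineDeriv_apply, e3]
  have hi' : ∀ v : ℂ, Integrable (fun z => fderiv ℝ (fun w => fderiv ℝ f w v) z v * φ z) := by
    intro v
    exact integrable_mul_test (hl (contDiffOn_fderiv_apply Ω.isOpen
      (contDiffOn_fderiv_apply Ω.isOpen hf v) v)) φ
  simp only [lap, mul_add, add_mul]
  rw [integral_add (hi _) (hi _), integral_add (hi' _) (hi' _), h2, h2]

theorem hasFDerivAt_normSq (z : ℂ) (ε : ℝ) :
    HasFDerivAt (fun w : ℂ => w.re ^ 2 + w.im ^ 2 + ε)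
      ((2 * z.re) • Complex.reCLM + (2 * z.im) • Complex.imCLM) z := by
  have h1 : HasFDerivAt (fun w : ℂ => w.re) Complex.reCLM z := Complex.reCLM.hasFDerivAt
  have h2 : HasFDerivAt (fun w : ℂ => w.im) Complex.imCLM z := Complex.imCLM.hasFDerivAt
  refine (((h1.pow 2).add (h2.pow 2)).add_const ε).congr_fderiv ?_
  ext v
  simp

theorem contDiff_normSq_add (ε : ℝ) : ContDiff ℝ ∞ (fun w : ℂ => w.re ^ 2 + w.im ^ 2 + ε) := by
  have h1 : ContDiff ℝ ∞ (fun w : ℂ => w.re) := Complex.reCLM.contDiff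
  have h2 : ContDiff ℝ ∞ (fun w : ℂ => w.im) := Complex.imCLM.contDiff
  exact ((h1.pow 2).add (h2.pow 2)).add contDiff_const

/-- For ε > 0 the right side is an approximate identity of total mass 4π, which is how the point
mass arises. For ε = 0 it vanishes: the logarithm is harmonic off the origin. -/
theorem lap_log_normSq_add {ε : ℝ} {z : ℂ} (hz : z.re ^ 2 + z.im ^ 2 + ε ≠ 0) :
    lap (fun w => Real.log (w.re ^ 2 + w.im ^ 2 + ε)) z =
      4 * ε / (z.re ^ 2 + z.im ^ 2 + ε) ^ 2 := by
  set N : ℂ → ℝ := fun w => w.re ^ 2 + w.im ^ 2 + ε with hN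
  have hNd := hasFDerivAt_normSq (ε := ε)
  have hcont : Continuous N := (contDiff_normSq_add ε).continuous
  have ev : ∀ᶠ w in 𝓝 z, N w ≠ 0 := hcont.continuousAt.eventually_ne hz
  have d1 : ∀ v : ℂ, (fun w => fderiv ℝ (fun w => Real.log (N w)) w v) =ᶠ[𝓝 z]
      fun w => (N w)⁻¹ * (2 * w.re * v.re + 2 * w.im * v.im) := by
    intro v
    filter_upwards [ev] with w hw
    rw [((hNd w).log hw).fderiv]
    simp [hN]
    ring
  have d2 : ∀ v : ℂ, HasFDerivAt (fun w => (N w)⁻¹ * (2 * w.re * v.re + 2 * w.im * v.im))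
      ((N z)⁻¹ • ((2 * v.re) • Complex.reCLM + (2 * v.im) • Complex.imCLM) +
        (2 * z.re * v.re + 2 * z.im * v.im) • ((-(N z ^ 2)⁻¹) •
          ((2 * z.re) • Complex.reCLM + (2 * z.im) • Complex.imCLM))) z := by
    intro v
    have a1 : HasFDerivAt (fun w => (N w)⁻¹) ((-(N z ^ 2)⁻¹) •
          ((2 * z.re) • Complex.reCLM + (2 * z.im) • Complex.imCLM)) z :=
      (hasDerivAt_inv hz).comp_hasFDerivAt z (hNd z)
    have h1 : HasFDerivAt (fun w : ℂ => w.re) Complex.reCLM z := Complex.reCLM.hasFDerivAt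
    have h2 : HasFDerivAt (fun w : ℂ => w.im) Complex.imCLM z := Complex.imCLM.hasFDerivAt
    have a2 : HasFDerivAt (fun w : ℂ => 2 * w.re * v.re + 2 * w.im * v.im)
        ((2 * v.re) • Complex.reCLM + (2 * v.im) • Complex.imCLM) z := by
      refine (((h1.const_mul 2).mul_const v.re).add
        ((h2.const_mul 2).mul_const v.im)).congr_fderiv ?_
      ext x
      simp
      ring
    exact a1.mul a2
  rw [lap, (d1 1).fderiv_eq, (d1 Complex.I).fderiv_eq, (d2 1).fderiv, (d2 Complex.I).fderiv]
  have : N z ≠ 0 := hz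
  simp
  change _ = 4 * ε / (N z) ^ 2
  field_simp
  simp only [hN]
  ring

/-- Since |log r| ≤ r⁻¹ + r, it is enough that 1/|z| is locally integrable in the plane. -/
theorem locallyIntegrable_log_norm_sq : LocallyIntegrable (fun z : ℂ => Real.log (‖z‖ ^ 2)) := by
  have h1 : LocallyIntegrable (fun z : ℂ => 2 * (‖z‖ ^ (-1 : ℝ) + ‖z‖)) := by
    refine LocallyIntegrable.smul (LocallyIntegrable.add ?_ continuous_norm.locallyIntegrable) (2 : ℝ)
    refine locallyIntegrable_of_norm_le_rpow (C := 1) (α := 1) ?_ ?_ ?_ ?_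
    · simp
    · simp
    · refine ae_of_all _ fun z => ?_
      rw [Real.norm_of_nonneg (by positivity), one_mul]
    · exact Measurable.aestronglyMeasurable (by fun_prop)
  refine h1.mono (Measurable.aestronglyMeasurable (by fun_prop)) (ae_of_all _ fun z => ?_)
  rw [Real.log_pow, Real.norm_eq_abs, abs_mul, Real.norm_of_nonneg (by positivity)]
  simp only [Nat.cast_ofNat, abs_two, Nat.ofNat_pos, mul_le_mul_iff_right₀]
  rcases eq_or_ne z 0 with rfl | hz
  · simp
  have hp : 0 < ‖z‖ := norm_pos_iff.2 hz
  rw [Real.rpow_neg_one, abs_le]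
  have e1 := Real.log_le_sub_one_of_pos hp
  have e2 := Real.log_le_sub_one_of_pos (inv_pos.2 hp)
  rw [Real.log_inv] at e2
  have := inv_pos.2 hp
  constructor <;> linarith

theorem integrable_four_div : Integrable (fun w : ℂ => 4 / (1 + ‖w‖ ^ 2) ^ 2) := by
  have := (integrable_rpow_neg_one_add_norm_sq (E := ℂ) (μ := volume) (r := 4)
    (by simp; norm_num)).const_mul 4
  refine this.congr (ae_of_all _ fun w => ?_)
  have h : (-4 / 2 : ℝ) = -((2 : ℕ) : ℝ) := by norm_num
  simp only
  rw [h, Real.rpow_neg (by positivity), Real.rpow_natCast]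
  rfl

/-- In polar coordinates the radial integrand 4y/(1 + y²)² has the primitive -2/(1 + y²). -/
theorem integral_four_div : ∫ w : ℂ, 4 / (1 + ‖w‖ ^ 2) ^ 2 = 4 * Real.pi := by
  rw [integral_fun_norm_addHaar volume (fun y => 4 / (1 + y ^ 2) ^ 2)]
  have h1 : ∫ y in Ioi (0 : ℝ), y ^ (Module.finrank ℝ ℂ - 1) • (4 / (1 + y ^ 2) ^ 2) = 0 - (-2) := by
    have hd : ∀ x ∈ Ici (0 : ℝ), HasDerivAt (fun y : ℝ => -2 / (1 + y ^ 2))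
        (x ^ (Module.finrank ℝ ℂ - 1) • (4 / (1 + x ^ 2) ^ 2)) x := by
      intro x _
      have hx : (1 + x ^ 2) ≠ 0 := by positivity
      have := (hasDerivAt_const x (-2 : ℝ)).div (((hasDerivAt_pow 2 x).const_add 1)) hx
      refine this.congr_deriv ?_
      simp
      field_simp
      ring
    have ht : Tendsto (fun y : ℝ => -2 / (1 + y ^ 2)) atTop (𝓝 0) := by
      refine Tendsto.div_atTop tendsto_const_nhds ?_
      exact tendsto_atTop_add_const_left _ _ (tendsto_pow_atTop (by norm_num))
    have := integral_Ioi_of_hasDerivAt_of_nonneg' hd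
      (fun x hx => by have : (0 : ℝ) < x := hx; positivity) ht
    rw [this]
    norm_num
  rw [h1]
  simp [Measure.real, Complex.volume_ball]
  ring

theorem norm_sq_eq (z : ℂ) : ‖z‖ ^ 2 = z.re ^ 2 + z.im ^ 2 := by
  rw [Complex.sq_norm, Complex.normSq_apply]; ring

/-- `log |z|²` is a fundamental solution of the Laplace operator, up to the factor `4π`. -/
theorem integral_log_mul_lap {φ : ℂ → ℝ} (hφ : ContDiff ℝ ∞ φ) (hc : HasCompactSupport φ) :
    ∫ z, Real.log (‖z‖ ^ 2) * lap φ z = 4 * Real.pi * φ 0 := by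
  have hl := contDiff_lap hφ
  have hlc := hasCompactSupport_lap hc
  obtain ⟨R, hR⟩ := hlc.isCompact.isBounded.exists_norm_le
  obtain ⟨M, hM⟩ := hc.exists_bound_of_continuous hφ.continuous
  -- The Laplacian is moved to the smooth function log(|z|² + ε); the substitution z = √ε w then
  -- removes ε from the kernel.
  have ids : ∀ ε : ℝ, 0 < ε → ∫ z : ℂ, Real.log (z.re ^ 2 + z.im ^ 2 + ε) * lap φ z =
      ∫ w : ℂ, 4 / (1 + ‖w‖ ^ 2) ^ 2 * φ ((Real.sqrt ε) • w) := by
    intro ε hε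
    have hs : ContDiff ℝ ∞ (fun w : ℂ => Real.log (w.re ^ 2 + w.im ^ 2 + ε)) :=
      (contDiff_normSq_add ε).log fun z => by positivity
    have e1 := integral_mul_lap_test (Ω := ⊤) hs.contDiffOn
      (mkTest φ hφ hc (by simp))
    simp only [coe_mkTest] at e1
    rw [e1]
    have hsq := Real.sq_sqrt hε.le
    have hsp := Real.sqrt_pos.2 hε
    have e2 := Measure.integral_comp_smul (volume : Measure ℂ)
      (fun z => lap (fun w => Real.log (w.re ^ 2 + w.im ^ 2 + ε)) z * φ z) (Real.sqrt ε)
    simp only [Complex.finrank_real_complex, hsq, smul_eq_mul] at e2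
    rw [abs_of_pos (by positivity), eq_comm, inv_mul_eq_iff_eq_mul₀ hε.ne'] at e2
    rw [e2, ← integral_const_mul]
    refine integral_congr_ae (ae_of_all _ fun w => ?_)
    simp only
    rw [lap_log_normSq_add (by positivity), norm_sq_eq]
    have h3 : (Real.sqrt ε • w).re ^ 2 + (Real.sqrt ε • w).im ^ 2 + ε =
        ε * (1 + (w.re ^ 2 + w.im ^ 2)) := by
      simp [mul_pow, hsq]; ring
    rw [h3]
    have : 1 + (w.re ^ 2 + w.im ^ 2) ≠ 0 := by positivity
    field_simp
  -- For 0 < ε < 1 and |z| ≤ R the regularised logarithm lies between log |z|² and log(R² + 1),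
  -- which gives an integrable majorant.
  have l1 : Tendsto (fun ε : ℝ => ∫ z : ℂ, Real.log (z.re ^ 2 + z.im ^ 2 + ε) * lap φ z)
      (𝓝[>] 0) (𝓝 (∫ z, Real.log (‖z‖ ^ 2) * lap φ z)) := by
    refine tendsto_integral_filter_of_dominated_convergence
      (fun z => |Real.log (‖z‖ ^ 2)| * |lap φ z| + |Real.log (R ^ 2 + 1)| * |lap φ z|) ?_ ?_ ?_ ?_
    · refine Eventually.of_forall fun ε => ?_
      refine Measurable.aestronglyMeasurable ?_
      have := hl.continuous.measurable
      fun_prop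
    · filter_upwards [Ioo_mem_nhdsGT (zero_lt_one' ℝ)] with ε hε
      have h0 : ∀ᵐ z : ℂ, z ≠ 0 := by simp [ae_iff]
      filter_upwards [h0] with z hz
      rw [norm_mul, Real.norm_eq_abs, Real.norm_eq_abs, ← add_mul]
      by_cases hz2 : z ∈ tsupport (lap φ)
      · refine mul_le_mul_of_nonneg_right ?_ (abs_nonneg _)
        rw [← norm_sq_eq]
        have hzp : 0 < ‖z‖ := norm_pos_iff.2 hz
        have b1 : Real.log (‖z‖ ^ 2) ≤ Real.log (‖z‖ ^ 2 + ε) :=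
          Real.log_le_log (by positivity) (by linarith [hε.1])
        have b2 : Real.log (‖z‖ ^ 2 + ε) ≤ Real.log (R ^ 2 + 1) := by
          refine Real.log_le_log (by have := hε.1; positivity) ?_
          have := hR z hz2
          have h4 : ‖z‖ ^ 2 ≤ R ^ 2 := by gcongr
          linarith [hε.2]
        rw [abs_le]
        have := neg_abs_le (Real.log (‖z‖ ^ 2))
        have := le_abs_self (Real.log (R ^ 2 + 1))
        have := abs_nonneg (Real.log (R ^ 2 + 1))
        have := abs_nonneg (Real.log (‖z‖ ^ 2))
        constructor <;> linarith
      · rw [image_eq_zero_of_notMem_tsupport hz2]; simp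
    · refine Integrable.add ?_ ?_
      · have h5 := (integrable_mul_test (Ω := ⊤)
          (locallyIntegrable_log_norm_sq.locallyIntegrableOn _) (mkTest (lap φ) hl hlc (by simp))).abs
        simpa [abs_mul] using h5
      · exact ((hl.continuous.integrable_of_hasCompactSupport hlc).abs).const_mul _
    · have h0 : ∀ᵐ z : ℂ, z ≠ 0 := by simp [ae_iff]
      filter_upwards [h0] with z hz
      refine Tendsto.mul_const _ ?_
      have hzp : 0 < ‖z‖ := norm_pos_iff.2 hz
      rw [norm_sq_eq]
      have h6 : Tendsto (fun ε : ℝ => z.re ^ 2 + z.im ^ 2 + ε) (𝓝[>] 0)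
          (𝓝 (z.re ^ 2 + z.im ^ 2 + 0)) :=
        (tendsto_const_nhds.add tendsto_id).mono_left nhdsWithin_le_nhds
      rw [add_zero] at h6
      exact h6.log (by rw [← norm_sq_eq]; positivity)
  -- Here φ(√ε w) tends to φ(0) and stays bounded, while the kernel is a fixed integrable function.
  have l2 : Tendsto (fun ε : ℝ => ∫ w : ℂ, 4 / (1 + ‖w‖ ^ 2) ^ 2 * φ ((Real.sqrt ε) • w))
      (𝓝[>] 0) (𝓝 (∫ w : ℂ, 4 / (1 + ‖w‖ ^ 2) ^ 2 * φ 0)) := by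
    refine tendsto_integral_filter_of_dominated_convergence
      (fun w => 4 / (1 + ‖w‖ ^ 2) ^ 2 * M) ?_ ?_ ?_ ?_
    · refine Eventually.of_forall fun ε => ?_
      refine Measurable.aestronglyMeasurable ?_
      have := hφ.continuous.measurable
      fun_prop
    · refine Eventually.of_forall fun ε => ae_of_all _ fun w => ?_
      rw [norm_mul, Real.norm_of_nonneg (by positivity)]
      exact mul_le_mul_of_nonneg_left (hM _) (by positivity)
    · exact integrable_four_div.mul_const _
    · refine ae_of_all _ fun w => ?_
      refine Tendsto.const_mul _ ?_
      have h7 : Continuous (fun ε : ℝ => φ (Real.sqrt ε • w)) := by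
        have := hφ.continuous
        fun_prop
      have h8 := h7.tendsto 0
      simp only [Real.sqrt_zero, zero_smul] at h8
      exact h8.mono_left nhdsWithin_le_nhds
  have l3 := tendsto_nhds_unique (l1.congr' (by
    filter_upwards [self_mem_nhdsWithin] with ε hε using ids ε hε)) l2
  rw [l3, integral_mul_const, integral_four_div]

end

section

/-! ### Convolution -/

section Conv

variable {M : Type*} [NormedAddCommGroup M] [NormedSpace ℝ M]

/-- The convolution of functions on `ℂ`. -/
def conv (f : ℂ → ℝ) (g : ℂ → M) (x : ℂ) : M := ∫ t, f t • g (x - t)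

theorem conv_eq (f : ℂ → ℝ) (g : ℂ → M) :
    conv f g = MeasureTheory.convolution f g (ContinuousLinearMap.lsmul ℝ ℝ) volume := rfl

theorem contDiff_conv {f : ℂ → ℝ} {g : ℂ → M} (hf : LocallyIntegrable f)
    (hg : ContDiff ℝ ∞ g) (hc : HasCompactSupport g) : ContDiff ℝ ∞ (conv f g) := by
  rw [conv_eq]
  exact hc.contDiff_convolution_right (n := ⊤) _ hf hg

theorem hasFDerivAt_conv {f : ℂ → ℝ} {g : ℂ → M} (hf : LocallyIntegrable f)
    (hg : ContDiff ℝ 1 g) (hc : HasCompactSupport g) (x : ℂ) :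
    HasFDerivAt (conv f g) (conv f (fderiv ℝ g) x) x := by
  have := hc.hasFDerivAt_convolution_right (ContinuousLinearMap.lsmul ℝ ℝ) hf hg x
  rw [conv_eq]
  refine this.congr_fderiv ?_
  rw [convolution_def, conv]
  refine integral_congr_ae (ae_of_all _ fun t => ?_)
  ext v
  simp

theorem integrable_conv_integrand {f : ℂ → ℝ} {g : ℂ → M} (hf : LocallyIntegrable f)
    (hg : Continuous g) (hc : HasCompactSupport g) (x : ℂ) :
    Integrable (fun t => f t • g (x - t)) :=
  hc.convolutionExists_right (ContinuousLinearMap.lsmul ℝ ℝ) hf hg x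

/-- The topology on test functions is defined by sup norms of jets. All jets of a convolution are
superpositions of translated jets of the smooth factor, with the same weight. -/
theorem iteratedFDeriv_conv {f : ℂ → ℝ} {g : ℂ → M} (hf : LocallyIntegrable f)
    (hg : ContDiff ℝ ∞ g) (hc : HasCompactSupport g) (i : ℕ) :
    iteratedFDeriv ℝ i (conv f g) = conv f (iteratedFDeriv ℝ i g) := by
  have hcd : ∀ i : ℕ, ContDiff ℝ 1 (iteratedFDeriv ℝ i g) := fun i =>
    hg.iteratedFDeriv_right (by norm_cast; simp)
  induction i with
  | zero =>
    ext x v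
    simp only [iteratedFDeriv_zero_apply]
    rw [conv, conv, ContinuousMultilinearMap.integral_apply
      (integrable_conv_integrand hf (hcd 0).continuous (hc.iteratedFDeriv 0) x)]
    simp
  | succ i ih =>
    ext1 x
    rw [iteratedFDeriv_succ_eq_comp_left, Function.comp_apply, ih,
      (hasFDerivAt_conv hf (hcd i) (hc.iteratedFDeriv i) x).fderiv, conv, conv]
    have := ContinuousLinearEquiv.integral_comp_comm (𝕜 := ℝ) (E := ℂ →L[ℝ] ℂ [×i]→L[ℝ] M)
      (F := ℂ [×(i + 1)]→L[ℝ] M) (μ := volume)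
      (continuousMultilinearCurryLeftEquiv ℝ (fun _ : Fin (i + 1) => ℂ)
      M).symm.toContinuousLinearEquiv (fun t => f t • fderiv ℝ (iteratedFDeriv ℝ i g) (x - t))
    refine this.symm.trans ?_
    refine integral_congr_ae (ae_of_all _ fun t => ?_)
    simp [iteratedFDeriv_succ_eq_comp_left]
    rfl

theorem conv_apply_eq_zero {f : ℂ → ℝ} {g : ℂ → M} {x : ℂ}
    (h : ∀ t, f t ≠ 0 → g (x - t) = 0) : conv f g x = 0 := by
  rw [conv]
  refine (integral_congr_ae (g := fun _ => 0) (ae_of_all _ fun t => ?_)).trans (by simp)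
  by_cases ht : f t = 0
  · simp [ht]
  · simp [h t ht]

theorem fderiv_conv_apply {f g : ℂ → ℝ} (hf : LocallyIntegrable f)
    (hg : ContDiff ℝ ∞ g) (hc : HasCompactSupport g) (v : ℂ) :
    (fun x => fderiv ℝ (conv f g) x v) = conv f (fun x => fderiv ℝ g x v) := by
  ext x
  rw [(hasFDerivAt_conv hf (hg.of_le (by norm_cast)) hc x).fderiv, conv, conv,
    ContinuousLinearMap.integral_apply (integrable_conv_integrand hf
      (hg.continuous_fderiv (by simp)) (hc.fderiv ℝ) x)]
  simp

theorem lap_conv {f g : ℂ → ℝ} (hf : LocallyIntegrable f)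
    (hg : ContDiff ℝ ∞ g) (hc : HasCompactSupport g) (x : ℂ) :
    lap (conv f g) x = conv f (lap g) x := by
  have key : ∀ v : ℂ, fderiv ℝ (fun w => fderiv ℝ (conv f g) w v) x v =
      conv f (fun x => fderiv ℝ (fun w => fderiv ℝ g w v) x v) x := by
    intro v
    rw [fderiv_conv_apply hf hg hc]
    exact congrFun (fderiv_conv_apply hf (contDiff_fderiv_apply hg v) (hc.fderiv_apply ℝ v) v) x
  have hi : ∀ v : ℂ, Integrable
      (fun t => f t • (fun x => fderiv ℝ (fun w => fderiv ℝ g w v) x v) (x - t)) := by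
    intro v
    exact integrable_conv_integrand hf
      (contDiff_fderiv_apply (contDiff_fderiv_apply hg v) v).continuous
      ((hc.fderiv_apply ℝ v).fderiv_apply ℝ v) x
  rw [lap, key, key, conv, conv, conv, ← integral_add (hi _) (hi _)]
  simp only [lap, smul_eq_mul, mul_add]

end Conv

/-! ### Translations as curves of bounded continuous functions -/

section Translate

open scoped BoundedContinuousFunction

variable {M : Type} [NormedAddCommGroup M]

/-- The translates of a continuous function of compact support, as bounded functions. -/
def translate (f : ℂ → M) (hf : Continuous f) (hc : HasCompactSupport f) (z : ℂ) : ℂ →ᵇ M :=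
  BoundedContinuousFunction.ofNormedAddCommGroup (fun x => f (x - z)) (by fun_prop)
    (hc.exists_bound_of_continuous hf).choose
    fun x => (hc.exists_bound_of_continuous hf).choose_spec _

@[simp] theorem translate_apply (f : ℂ → M) (hf : Continuous f) (hc : HasCompactSupport f)
    (z x : ℂ) : translate f hf hc z x = f (x - z) := rfl

variable [NormedSpace ℝ M]

/-- The derivative of f is uniformly continuous, by compactness of its support, so the difference
quotients converge in the sup norm. The derivative in z is written with real and imaginary parts so
that it is again made of translates, which permits induction on the order. -/
theorem hasFDerivAt_translate (f : ℂ → M) (hf : ContDiff ℝ ∞ f) (hc : HasCompactSupport f)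
    (z : ℂ) : HasFDerivAt (translate f hf.continuous hc)
      (-(Complex.reCLM.smulRight (translate (fun w => fderiv ℝ f w 1)
          ((hf.continuous_fderiv (by simp)).clm_apply continuous_const) (hc.fderiv_apply ℝ 1) z) +
        Complex.imCLM.smulRight (translate (fun w => fderiv ℝ f w Complex.I)
          ((hf.continuous_fderiv (by simp)).clm_apply continuous_const)
          (hc.fderiv_apply ℝ Complex.I) z))) z := by
  have hu : UniformContinuous (fderiv ℝ f) :=
    (hc.fderiv ℝ).uniformContinuous_of_continuous (hf.continuous_fderiv (by simp))
  rw [hasFDerivAt_iff_isLittleO_nhds_zero, Asymptotics.isLittleO_iff]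
  intro c hcpos
  obtain ⟨δ, hδ, hδ'⟩ := Metric.uniformContinuous_iff.1 hu c hcpos
  filter_upwards [Metric.ball_mem_nhds (0 : ℂ) hδ] with h hh
  rw [BoundedContinuousFunction.norm_le (by positivity)]
  intro x
  have hh' : ‖h‖ < δ := by simpa using hh
  have hval : (translate f hf.continuous hc (z + h) - translate f hf.continuous hc z -
      (-(Complex.reCLM.smulRight (translate (fun w => fderiv ℝ f w 1)
          ((hf.continuous_fderiv (by simp)).clm_apply continuous_const) (hc.fderiv_apply ℝ 1) z) +
        Complex.imCLM.smulRight (translate (fun w => fderiv ℝ f w Complex.I)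
          ((hf.continuous_fderiv (by simp)).clm_apply continuous_const)
          (hc.fderiv_apply ℝ Complex.I) z))) h) x =
      f (x - z - h) - f (x - z) - fderiv ℝ f (x - z) (x - z - h - (x - z)) := by
    have e1 : fderiv ℝ f (x - z) (x - z - h - (x - z)) =
        -(h.re • fderiv ℝ f (x - z) 1 + h.im • fderiv ℝ f (x - z) Complex.I) := by
      rw [← map_smul, ← map_smul, ← map_add, ← map_neg]
      congr 1
      have : h = h.re • (1 : ℂ) + h.im • Complex.I := by
        simp [Complex.re_add_im]
      rw [← this]; ring
    rw [e1]
    simp [sub_sub]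
  rw [hval]
  have hconv : Convex ℝ (Metric.ball (x - z) δ) := convex_ball _ _
  have := hconv.norm_image_sub_le_of_norm_hasFDerivWithin_le'
    (f := f) (f' := fderiv ℝ f) (φ := fderiv ℝ f (x - z)) (C := c)
    (fun y _ => (hf.differentiable (by simp) y).hasFDerivAt.hasFDerivWithinAt)
    (fun y hy => by
      rw [← dist_eq_norm]; exact (hδ' (by simpa using hy)).le)
    (Metric.mem_ball_self hδ) (y := x - z - h) (by simpa [dist_eq_norm] using hh')
  simpa using this

theorem contDiff_translate (n : ℕ) : ∀ (f : ℂ → M) (hf : ContDiff ℝ ∞ f)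
    (hc : HasCompactSupport f), ContDiff ℝ n (translate f hf.continuous hc) := by
  induction n with
  | zero =>
    intro f hf hc
    rw [Nat.cast_zero, contDiff_zero]
    exact continuous_iff_continuousAt.2 fun z => (hasFDerivAt_translate f hf hc z).continuousAt
  | succ n ih =>
    intro f hf hc
    rw [Nat.cast_succ, contDiff_succ_iff_hasFDerivAt]
    refine ⟨_, ?_, fun z => hasFDerivAt_translate f hf hc z⟩
    have hd : ∀ v : ℂ, ContDiff ℝ ∞ (fun w => fderiv ℝ f w v) := fun v =>
      (hf.fderiv_right (m := ∞) (by simp)).clm_apply contDiff_const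
    refine ContDiff.neg (ContDiff.add ?_ ?_)
    · exact contDiff_const.smulRight (ih _ (hd 1) (hc.fderiv_apply ℝ 1))
    · exact contDiff_const.smulRight (ih _ (hd _) (hc.fderiv_apply ℝ _))

end Translate

/-! ### Distributions and superpositions of translates -/

section Superposition

open scoped BoundedContinuousFunction

theorem _root_.LinearMap.exists_section_range {V W : Type*} [AddCommGroup V] [Module ℝ V]
    [AddCommGroup W] [Module ℝ W] (J : V →ₗ[ℝ] W) :
    ∃ g : J.range →ₗ[ℝ] V, ∀ y, J (g y) = y := by
  obtain ⟨g, hg⟩ := J.rangeRestrict.exists_rightInverse_of_surjective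
    (LinearMap.range_eq_top.2 J.surjective_rangeRestrict)
  exact ⟨g, fun y => by simpa using congrArg Subtype.val (LinearMap.congr_fun hg y)⟩

/-- A linear functional dominated by finitely many norms is a sum of continuous functionals. -/
theorem exists_factor {V : Type*} [AddCommGroup V] [Module ℝ V] (s : Finset ℕ) {B : ℕ → Type*}
    [∀ i, NormedAddCommGroup (B i)] [∀ i, NormedSpace ℝ (B i)] (L : V →ₗ[ℝ] ℝ)
    (j : ∀ i, V →ₗ[ℝ] B i) (C : ℝ)
    (h : ∀ φ (a : ℝ), 0 ≤ a → (∀ i ∈ s, ‖j i φ‖ ≤ a) → ‖L φ‖ ≤ C * a) :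
    ∃ Λ : ∀ i, B i →L[ℝ] ℝ, ∀ φ, L φ = ∑ i ∈ s, Λ i (j i φ) := by
  -- Since ‖L φ‖ ≤ C ‖J φ‖, the functional L factors through a bounded functional on the range of J,
  -- which Hahn–Banach extends to the whole product.
  let J : V →ₗ[ℝ] (∀ i : s, B i) := LinearMap.pi fun i => j i
  have hJ : ∀ φ, ‖L φ‖ ≤ C * ‖J φ‖ := fun φ =>
    h φ _ (norm_nonneg _) fun i hi => norm_le_pi_norm (J φ) ⟨i, hi⟩
  obtain ⟨g, hg'⟩ := J.exists_section_range
  let f : J.range →L[ℝ] ℝ := (L ∘ₗ g).mkContinuous C (fun y => by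
    have := hJ (g y)
    rw [hg'] at this
    exact this)
  obtain ⟨Λ, hΛ, -⟩ := exists_extension_norm_eq J.range f
  have hL : ∀ φ, L φ = Λ (J φ) := by
    intro φ
    have h1 := hΛ ⟨J φ, φ, rfl⟩
    have h2 : f ⟨J φ, φ, rfl⟩ = L (g ⟨J φ, φ, rfl⟩) := rfl
    -- L vanishes on the kernel of J, so the choice of the section g does not matter.
    have h3 : ‖L (φ - g ⟨J φ, φ, rfl⟩)‖ ≤ 0 := by
      refine (hJ _).trans_eq ?_
      rw [map_sub, hg']
      simp
    have h4 : L φ - L (g ⟨J φ, φ, rfl⟩) = 0 := by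
      rw [← map_sub]; exact norm_le_zero_iff.1 h3
    change Λ (J φ) = _ at h1
    rw [h1, h2]; linarith
  classical
  refine ⟨fun i => if h : i ∈ s then
    Λ ∘L (ContinuousLinearMap.single ℝ (fun i : s => B i) ⟨i, h⟩) else 0, fun φ => ?_⟩
  rw [hL, ← Finset.sum_coe_sort s]
  have : J φ = ∑ i : s, Pi.single i (J φ i) := (Finset.univ_sum_single (J φ)).symm
  conv_lhs => rw [this, map_sum]
  refine Finset.sum_congr rfl fun i _ => ?_
  simp only [Finset.coe_mem, dif_pos]
  rfl

/-- Continuity on a Fréchet space of test functions means domination by finitely many seminorms. The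
point of the factorisation is to replace that space by Banach spaces, in which vector-valued
integrals are available. -/
theorem exists_factor_jets {K : Compacts ℂ} (L : 𝓓_{K}(ℂ, ℝ) →L[ℝ] ℝ) :
    ∃ (s : Finset ℕ) (Λ : ∀ i : ℕ, (ℂ →ᵇ (ℂ [×i]→L[ℝ] ℝ)) →L[ℝ] ℝ),
      ∀ φ, L φ = ∑ i ∈ s, Λ i (ContDiffMapSupportedIn.structureMapCLM ℝ ⊤ i φ) := by
  obtain ⟨s, C, -, hC⟩ := Seminorm.bound_of_continuous
    (ContDiffMapSupportedIn.withSeminorms ℝ ℂ ℝ ⊤ K)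
    ((normSeminorm ℝ ℝ).comp L.toLinearMap) (by
      change Continuous fun φ => ‖L φ‖
      exact L.continuous.norm)
  obtain ⟨Λ, hΛ⟩ := exists_factor (B := fun i => ℂ →ᵇ (ℂ [×i]→L[ℝ] ℝ)) s L.toLinearMap
    (fun i => (ContDiffMapSupportedIn.structureMapCLM ℝ ⊤ i).toLinearMap) C (by
      intro φ a ha h
      refine (hC φ).trans ?_
      change (C : ℝ) * _ ≤ _
      refine mul_le_mul_of_nonneg_left ?_ C.2
      exact Seminorm.finset_sup_apply_le ha fun i hi => h i hi)
  exact ⟨s, Λ, hΛ⟩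

/-- An element of a Banach space that is a superposition of a curve, tested on a separating family
of functionals, is a superposition with respect to every functional. -/
theorem integral_functional_curve {B M : Type*} [NormedAddCommGroup B] [NormedSpace ℝ B]
    [CompleteSpace B] [NormedAddCommGroup M] [NormedSpace ℝ M] [CompleteSpace M] {τ : ℂ → B}
    (hτ : Continuous τ) (ev : ℂ → B →L[ℝ] M)
    (hev : ∀ b b' : B, (∀ x, ev x b = ev x b') → b = b') {φ : ℂ → ℝ} (hφ : Continuous φ)
    (hφc : HasCompactSupport φ) {b : B} (hb : ∀ x, ev x b = ∫ z, φ z • ev x (τ z))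
    (Λ : B →L[ℝ] ℝ) : Integrable (fun z => φ z * Λ (τ z)) ∧ Λ b = ∫ z, φ z * Λ (τ z) := by
  have hint : Integrable (fun z => φ z • τ z) :=
    (hφ.smul hτ).integrable_of_hasCompactSupport hφc.smul_right
  -- The vector-valued integral of the curve exists in B, and the separating functionals identify it
  -- with b.
  have key : b = ∫ z, φ z • τ z := by
    refine hev _ _ fun x => ?_
    rw [hb, ← ContinuousLinearMap.integral_comp_comm _ hint]
    simp
  refine ⟨(Λ.integrable_comp hint).congr (ae_of_all _ fun z => by simp), ?_⟩
  rw [key, ← ContinuousLinearMap.integral_comp_comm _ hint]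
  simp

theorem contDiff_functional_curve {B : Type*} [NormedAddCommGroup B] [NormedSpace ℝ B] {τ : ℂ → B}
    (hτ : ContDiff ℝ ∞ τ) (Λ : B →L[ℝ] ℝ) : ContDiff ℝ ∞ (fun z => Λ (τ z)) :=
  Λ.contDiff.comp hτ

/-- A distribution applied to the translates of a test function is a smooth function `G`, and it
commutes with superposition of translates. -/
theorem exists_superposition {K : Compacts ℂ} (L : 𝓓_{K}(ℂ, ℝ) →L[ℝ] ℝ) {κ : ℂ → ℝ}
    (hκ : ContDiff ℝ ∞ κ) (hc : HasCompactSupport κ) :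
    ∃ G : ℂ → ℝ, ContDiff ℝ ∞ G ∧
      ∀ (φ : ℂ → ℝ) (_ : Continuous φ) (_ : HasCompactSupport φ) (ψ : 𝓓_{K}(ℂ, ℝ)),
        (∀ x, ψ x = conv φ κ x) → L ψ = ∫ z, φ z * G z := by
  obtain ⟨s, Λ, hΛ⟩ := exists_factor_jets L
  have hd : ∀ i : ℕ, ContDiff ℝ ∞ (iteratedFDeriv ℝ i κ) := fun i =>
    hκ.iteratedFDeriv_right (by norm_cast)
  let τ : ∀ i : ℕ, ℂ → (ℂ →ᵇ (ℂ [×i]→L[ℝ] ℝ)) := fun i =>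
    translate (iteratedFDeriv ℝ i κ) (hd i).continuous (hc.iteratedFDeriv i)
  have hτ : ∀ i, ContDiff ℝ ∞ (τ i) := fun i =>
    contDiff_infty.2 fun n => contDiff_translate n _ (hd i) (hc.iteratedFDeriv i)
  -- Formally G(z) is L applied to the translate κ(· - z). Written through the jets it makes sense
  -- even when that translate is not supported in K.
  refine ⟨fun z => ∑ i ∈ s, Λ i (τ i z),
    ContDiff.sum fun i _ => contDiff_functional_curve (hτ i) (Λ i), fun φ hφ hφc ψ hψ => ?_⟩
  have hψ' : (ψ : ℂ → ℝ) = conv φ κ := funext hψ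
  have key : ∀ i, Integrable (fun z => φ z * Λ i (τ i z)) ∧
      Λ i (ContDiffMapSupportedIn.structureMapCLM ℝ ⊤ i ψ) = ∫ z, φ z * Λ i (τ i z) := by
    intro i
    refine integral_functional_curve (hτ i).continuous
      (fun x => BoundedContinuousFunction.evalCLM ℝ x)
      (fun b b' h => BoundedContinuousFunction.ext h) hφ hφc (fun x => ?_) (Λ i)
    change ContDiffMapSupportedIn.structureMapCLM ℝ ⊤ i ψ x = _
    rw [ContDiffMapSupportedIn.structureMapCLM_top_apply, hψ',
      iteratedFDeriv_conv hφ.locallyIntegrable hκ hc]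
    rfl
  rw [hΛ]
  simp_rw [Finset.mul_sum]
  rw [integral_finsetSum _ fun i _ => (key i).1]
  exact Finset.sum_congr rfl fun i _ => (key i).2

end Superposition

end

section

/-! ### Weyl's lemma -/

section Weyl

theorem lap_comp_const_sub {f : ℂ → ℝ} (hf : ContDiff ℝ ∞ f) (x z : ℂ) :
    lap (fun w => f (x - w)) z = lap f (x - z) := by
  have h1 : ∀ {g : ℂ → ℝ} (_ : ContDiff ℝ ∞ g) (v w : ℂ),
      fderiv ℝ (fun w => g (x - w)) w v = -fderiv ℝ g (x - w) v := by
    intro g hg v w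
    have hd : HasFDerivAt (fun w : ℂ => x - w) (-(ContinuousLinearMap.id ℝ ℂ)) w :=
      (hasFDerivAt_id w).const_sub x
    have := ((hg.differentiable (by simp) (x - w)).hasFDerivAt.comp w hd).fderiv
    rw [Function.comp_def] at this
    rw [this]
    simp
  have h2 : ∀ v : ℂ, fderiv ℝ (fun w => fderiv ℝ (fun w => f (x - w)) w v) z v =
      fderiv ℝ (fun w => fderiv ℝ f w v) (x - z) v := by
    intro v
    have e : (fun w => fderiv ℝ (fun w => f (x - w)) w v) =
        fun w => (fun y => -fderiv ℝ f y v) (x - w) := by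
      ext w; rw [h1 hf]
    rw [e, h1 (contDiff_fderiv_apply hf v).neg, fderiv_fun_neg]
    simp
  rw [lap, lap, h2, h2]

/-- The logarithmic potential, a fundamental solution of the Laplace operator. -/
def logPotential (z : ℂ) : ℝ := (4 * Real.pi)⁻¹ * Real.log (‖z‖ ^ 2)

theorem contDiffOn_log_norm_sq : ContDiffOn ℝ ∞ (fun z : ℂ => Real.log (‖z‖ ^ 2)) {0}ᶜ := by
  have : (fun z : ℂ => Real.log (‖z‖ ^ 2)) = fun z => Real.log (z.re ^ 2 + z.im ^ 2 + 0) := by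
    ext z; rw [norm_sq_eq, add_zero]
  rw [this]
  refine (contDiff_normSq_add 0).contDiffOn.log fun z hz => ?_
  rw [add_zero, ← norm_sq_eq]
  have : z ≠ 0 := hz
  positivity

theorem lap_log_norm_sq {z : ℂ} (hz : z ≠ 0) :
    lap (fun z : ℂ => Real.log (‖z‖ ^ 2)) z = 0 := by
  have : (fun z : ℂ => Real.log (‖z‖ ^ 2)) = fun z => Real.log (z.re ^ 2 + z.im ^ 2 + 0) := by
    ext z; rw [norm_sq_eq, add_zero]
  rw [this, lap_log_normSq_add]
  · simp
  · rw [add_zero, ← norm_sq_eq]; positivity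

theorem contDiffOn_logPotential : ContDiffOn ℝ ∞ logPotential {0}ᶜ :=
  contDiffOn_const.mul contDiffOn_log_norm_sq

theorem lap_logPotential {z : ℂ} (hz : z ≠ 0) : lap logPotential z = 0 := by
  change lap (fun z => (4 * Real.pi)⁻¹ * Real.log (‖z‖ ^ 2)) z = 0
  rw [lap_const_mul, lap_log_norm_sq hz, mul_zero]

theorem locallyIntegrable_logPotential : LocallyIntegrable logPotential :=
  locallyIntegrable_log_norm_sq.smul (4 * Real.pi)⁻¹

theorem integral_logPotential_mul_lap {φ : ℂ → ℝ} (hφ : ContDiff ℝ ∞ φ)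
    (hc : HasCompactSupport φ) : ∫ z, logPotential z * lap φ z = φ 0 := by
  have := integral_log_mul_lap hφ hc
  simp only [logPotential, mul_assoc]
  rw [integral_const_mul, this]
  have := Real.pi_ne_zero
  field_simp

/-- A parametrix of the Laplace operator supported in a small ball. -/
theorem exists_parametrix {ε : ℝ} (hε : 0 < ε) : ∃ P κ : ℂ → ℝ,
    Integrable P ∧ (∀ z, P z ≠ 0 → ‖z‖ < ε) ∧ HasCompactSupport P ∧
    ContDiff ℝ ∞ κ ∧ (∀ z, κ z ≠ 0 → ‖z‖ ≤ ε) ∧ HasCompactSupport κ ∧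
    ∀ (φ : ℂ → ℝ), ContDiff ℝ ∞ φ → HasCompactSupport φ →
      ∀ x, φ x = conv P (lap φ) x - conv κ φ x := by
  let η : ContDiffBump (0 : ℂ) := ⟨ε / 2, ε, by positivity, by linarith⟩
  -- The fundamental solution is P + S with P compactly supported and S smooth. Moving the Laplacian
  -- onto S gives φ = P * Δφ + ΔS * φ, whence the choice κ = -ΔS.
  let P : ℂ → ℝ := fun z => η z * logPotential z
  let S : ℂ → ℝ := fun z => (1 - η z) * logPotential z
  have hηs : ContDiff ℝ ∞ η := η.contDiff
  have hS : ContDiff ℝ ∞ S := by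
    rw [contDiff_iff_contDiffAt]
    intro z
    by_cases hz : z = 0
    · have : S =ᶠ[𝓝 z] fun _ => 0 := by
        rw [hz]
        filter_upwards [η.eventuallyEq_one] with w hw
        simp [S, hw]
      exact contDiffAt_const.congr_of_eventuallyEq this
    · exact (contDiffAt_const.sub hηs.contDiffAt).mul
        (contDiffOn_logPotential.contDiffAt (isOpen_compl_singleton.mem_nhds hz))
  have hPli : LocallyIntegrable P := by
    have := locallyIntegrable_logPotential.locallyIntegrableOn univ
    rw [← locallyIntegrableOn_univ]
    exact this.continuousOn_mul hηs.continuous.continuousOn isOpen_univ.isLocallyClosed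
  have hPc : HasCompactSupport P := η.hasCompactSupport.mul_right
  have hPi : Integrable P := by
    have h1 : IntegrableOn P (tsupport P) := hPli.integrableOn_isCompact hPc
    rwa [integrableOn_iff_integrable_of_support_subset (subset_tsupport P)] at h1
  let κ : ℂ → ℝ := fun z => -lap S z
  have hκ : ContDiff ℝ ∞ κ := (contDiff_lap hS).neg
  have hκs : ∀ z, κ z ≠ 0 → ‖z‖ ≤ ε := by
    intro z
    contrapose!
    intro hz
    have hz0 : z ≠ 0 := by rintro rfl; simp at hz; linarith
    have : S =ᶠ[𝓝 z] logPotential := by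
      filter_upwards [(isOpen_lt continuous_const continuous_norm).mem_nhds hz] with w hw
      have : η w = 0 := η.zero_of_le_dist (by simpa using le_of_lt hw)
      simp [S, this]
    simp only [κ, lap_congr this, lap_logPotential hz0, neg_zero]
  have hκc : HasCompactSupport κ := by
    refine HasCompactSupport.intro (isCompact_closedBall 0 ε) fun z hz => ?_
    by_contra h
    exact hz (by simpa using hκs z h)
  refine ⟨P, κ, hPi, ?_, hPc, hκ, hκs, hκc, fun φ hφ hc x => ?_⟩
  · intro z hz
    have : z ∈ Function.support η := left_ne_zero_of_mul hz
    rw [η.support_eq] at this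
    simpa using this
  · have hψ : ContDiff ℝ ∞ (fun w => φ (x - w)) := hφ.comp (contDiff_const.sub contDiff_id)
    have hψc : HasCompactSupport (fun w => φ (x - w)) :=
      hc.comp_homeomorph (Homeomorph.subLeft x)
    have e1 := integral_logPotential_mul_lap hψ hψc
    have e2 := integral_mul_lap_test (Ω := ⊤) hS.contDiffOn
      (mkTest (fun w => φ (x - w)) hψ hψc (by simp))
    have i1 : Integrable (fun z => P z * lap (fun w => φ (x - w)) z) := by
      have := hPli.integrable_smul_right_of_hasCompactSupport
        (contDiff_lap hψ).continuous (hasCompactSupport_lap hψc)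
      simpa using this
    have i2 : Integrable (fun z => S z * lap (fun w => φ (x - w)) z) :=
      (hS.continuous.mul (contDiff_lap hψ).continuous).integrable_of_hasCompactSupport
        (hasCompactSupport_lap hψc).mul_left
    have e3 : ∫ z, logPotential z * lap (fun w => φ (x - w)) z =
        (∫ z, P z * lap (fun w => φ (x - w)) z) + ∫ z, S z * lap (fun w => φ (x - w)) z := by
      rw [← integral_add i1 i2]
      refine integral_congr_ae (ae_of_all _ fun z => ?_)
      simp only [P, S]; ring
    simp only [coe_mkTest] at e2
    rw [e3, e2] at e1
    simp only [sub_zero] at e1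
    rw [← e1, conv, conv]
    have e4 : ∫ t, κ t • φ (x - t) = - ∫ z, lap S z * φ (x - z) := by
      rw [← integral_neg]
      simp [κ]
    rw [e4, sub_neg_eq_add]
    simp only [lap_comp_const_sub hφ, smul_eq_mul]

/-- The transpose of the convolution with an integrable function of compact support. -/
theorem exists_conv_transpose {P : ℂ → ℝ} (hP : Integrable P) (w : ℂ → ℝ) (hw : ContDiff ℝ ∞ w)
    (hwc : HasCompactSupport w) : ∃ R : ℂ → ℝ, ContDiff ℝ ∞ R ∧
      ∀ φ : ℂ → ℝ, ContDiff ℝ ∞ φ → HasCompactSupport φ →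
        ∫ x, w x * conv P φ x = ∫ y, φ y * R y := by
  have hP' : Integrable (fun t => P (-t)) := hP.comp_neg
  -- By Fubini, the transpose of the convolution with P is the convolution with the reflection of P.
  refine ⟨conv (fun t => P (-t)) w, contDiff_conv hP'.locallyIntegrable hw hwc,
    fun φ hφ hc => ?_⟩
  have hφi : Integrable φ := hφ.continuous.integrable_of_hasCompactSupport hc
  have h1 : Integrable (fun p : ℂ × ℂ => P p.2 * φ (p.1 - p.2)) (volume.prod volume) :=
    hP.convolution_integrand (ContinuousLinearMap.mul ℝ ℝ) hφi
  obtain ⟨M, hM⟩ := hwc.exists_bound_of_continuous hw.continuous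
  have h2 : Integrable (fun p : ℂ × ℂ => w p.1 * (P p.2 * φ (p.1 - p.2)))
      (volume.prod volume) := by
    refine h1.bdd_mul (c := M) ?_ (ae_of_all _ fun p => hM _)
    exact (hw.continuous.comp continuous_fst).aestronglyMeasurable
  have e1 : ∫ x, w x * conv P φ x = ∫ x, ∫ t, w x * (P t * φ (x - t)) := by
    refine integral_congr_ae (ae_of_all _ fun x => ?_)
    simp only [conv, smul_eq_mul]
    rw [integral_const_mul]
  have e2 : ∀ t, ∫ x, w x * (P t * φ (x - t)) = ∫ y, w (y + t) * (P t * φ y) := by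
    intro t
    rw [← integral_add_right_eq_self _ t]
    simp
  have h3 : Integrable (fun p : ℂ × ℂ => φ p.1 * (P (-p.2) * w (p.1 - p.2)))
      (volume.prod volume) := by
    obtain ⟨M, hM⟩ := hc.exists_bound_of_continuous hφ.continuous
    have h1 : Integrable (fun p : ℂ × ℂ => P (-p.2) * w (p.1 - p.2)) (volume.prod volume) :=
      hP'.convolution_integrand (ContinuousLinearMap.mul ℝ ℝ)
        (hw.continuous.integrable_of_hasCompactSupport hwc)
    refine h1.bdd_mul (c := M) ?_ (ae_of_all _ fun p => hM _)
    exact (hφ.continuous.comp continuous_fst).aestronglyMeasurable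
  rw [e1, integral_integral_swap h2]
  simp_rw [e2]
  have e3 : ∫ y, φ y * conv (fun t => P (-t)) w y = ∫ y, ∫ t, φ y * (P (-t) * w (y - t)) := by
    refine integral_congr_ae (ae_of_all _ fun x => ?_)
    simp only [conv, smul_eq_mul]
    rw [integral_const_mul]
  rw [e3, integral_integral_swap (f := fun y t => φ y * (P (-t) * w (y - t))) h3,
    ← integral_neg_eq_self]
  refine integral_congr_ae (ae_of_all _ fun t => ?_)
  refine integral_congr_ae (ae_of_all _ fun y => ?_)
  simp only [← sub_eq_add_neg]
  ring

theorem conv_comm (f g : ℂ → ℝ) (x : ℂ) : conv f g x = conv g f x := by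
  rw [conv, conv, ← integral_sub_left_eq_self _ volume x]
  refine integral_congr_ae (ae_of_all _ fun t => ?_)
  simp [mul_comm]

/-- Smooth cutoff functions. -/
theorem exists_cutoff {K U : Set ℂ} (hK : IsCompact K) (hU : IsOpen U) (hKU : K ⊆ U) :
    ∃ χ : ℂ → ℝ, ContDiff ℝ ∞ χ ∧ HasCompactSupport χ ∧ tsupport χ ⊆ U ∧
      (∀ᶠ z in 𝓝ˢ K, χ z = 1) ∧ ∀ z, χ z ∈ Icc (0 : ℝ) 1 := by
  obtain ⟨L, hL, hKL, hLU⟩ := exists_compact_between hK hU hKU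
  obtain ⟨f, h1, h0, hI⟩ := exists_contMDiffMap_one_nhds_of_subset_interior 𝓘(ℝ, ℂ) (n := ⊤)
    hK.isClosed hKL
  have hsub : tsupport f ⊆ L := by
    refine closure_minimal (fun z hz => ?_) hL.isClosed
    by_contra h
    exact hz (h0 z h)
  exact ⟨f, by simpa using f.contMDiff.contDiff, hL.of_isClosed_subset (isClosed_tsupport f) hsub,
    hsub.trans hLU, h1, hI⟩

variable {Ω : Opens ℂ}

/-- The Laplacian on test functions. -/
def lapTest (φ : 𝓓(Ω, ℝ)) : 𝓓(Ω, ℝ) :=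
  mkTest (lap φ) (contDiff_lap (testFunction_smooth φ)) (hasCompactSupport_lap φ.hasCompactSupport)
    ((tsupport_lap_subset φ).trans φ.tsupport_subset)

@[simp] theorem lapTest_apply (φ : 𝓓(Ω, ℝ)) (z : ℂ) : lapTest φ z = lap φ z := rfl

/-- Weyl's lemma near a compact set. -/
theorem weyl_local (T : 𝓓'(Ω, ℝ)) {w : ℂ → ℝ} (hw : ContDiffOn ℝ ∞ w Ω)
    (h : ∀ φ : 𝓓(Ω, ℝ), T (lapTest φ) = ∫ z, w z * φ z) {K₀ : Set ℂ} (hK₀ : IsCompact K₀)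
    (hKΩ : K₀ ⊆ Ω) : ∃ (U : Set ℂ) (r : ℂ → ℝ), IsOpen U ∧ K₀ ⊆ U ∧ ContDiff ℝ ∞ r ∧
      ∀ φ : 𝓓(Ω, ℝ), tsupport φ ⊆ U → T φ = ∫ z, r z * φ z := by
  obtain ⟨δ, hδ, hδΩ⟩ := hK₀.exists_cthickening_subset_open Ω.isOpen hKΩ
  -- The support of φ will lie within ε of K₀, and convolution with P or κ enlarges it by at most ε
  -- more, so everything stays within δ.
  let ε := δ / 2
  have hε : 0 < ε := by positivity
  obtain ⟨P, κ, hP, hPs, hPc, hκ, hκs, hκc, hpar⟩ := exists_parametrix hε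
  let K : Compacts ℂ := ⟨Metric.cthickening δ K₀, hK₀.cthickening⟩
  have hKsub : (K : Set ℂ) ⊆ Ω := hδΩ
  obtain ⟨G, hG, hGφ⟩ := exists_superposition
    (T.comp (TestFunction.ofSupportedInCLM ℝ hKsub)) hκ hκc
  -- Multiplying w by χ makes it smooth and compactly supported on all of ℂ without changing its
  -- integral against functions supported in K.
  obtain ⟨χ, hχ, hχc, hχs, hχ1, -⟩ := exists_cutoff K.isCompact Ω.isOpen hKsub
  have hχ1' : ∀ z ∈ K, χ z = 1 := fun z hz => hχ1.self_of_nhdsSet z hz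
  obtain ⟨R, hR, hRφ⟩ := exists_conv_transpose hP (fun z => w z * χ z)
    (contDiff_mul_of_tsupport Ω.isOpen hw hχ hχs) hχc.mul_left
  refine ⟨Metric.thickening ε K₀, fun z => R z - G z, Metric.isOpen_thickening,
    Metric.self_subset_thickening hε _, hR.sub hG, fun φ hφU => ?_⟩
  have hφs := testFunction_smooth φ
  have hφc := φ.hasCompactSupport
  have hsupp : ∀ {f : ℂ → ℝ} (_ : ∀ z, f z ≠ 0 → ‖z‖ ≤ ε),
      Function.support (conv f φ) ⊆ K := by
    intro f hf x hx
    by_contra hxK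
    refine hx (conv_apply_eq_zero fun t ht => ?_)
    by_contra hxt
    have h1 : x - t ∈ Metric.thickening ε K₀ := hφU (subset_tsupport _ hxt)
    obtain ⟨y, hy, hy'⟩ := Metric.mem_thickening_iff.1 h1
    refine hxK (Metric.mem_cthickening_of_dist_le x y δ K₀ hy ?_)
    have h2 := hf t ht
    have h3 : dist x y ≤ dist x (x - t) + dist (x - t) y := dist_triangle _ _ _
    have h4 : dist x (x - t) = ‖t‖ := by rw [dist_eq_norm]; congr 1; ring
    have h5 : δ = ε + ε := by simp only [ε]; ring
    linarith
  have hK : IsClosed (K : Set ℂ) := K.isCompact.isClosed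
  have hsP := hsupp fun z hz => (hPs z hz).le
  have hsκ := hsupp hκs
  have hcs : ∀ {f : ℂ → ℝ}, Function.support f ⊆ K → HasCompactSupport f ∧ tsupport f ⊆ K :=
    fun hf => ⟨K.isCompact.of_isClosed_subset (isClosed_tsupport _) (closure_minimal hf hK),
      closure_minimal hf hK⟩
  have hcP : ContDiff ℝ ∞ (conv P φ) := contDiff_conv hP.locallyIntegrable hφs hφc
  have hcκ : ContDiff ℝ ∞ (conv κ φ) :=
    contDiff_conv hκ.continuous.locallyIntegrable hφs hφc
  let ψ₁ : 𝓓(Ω, ℝ) := mkTest (conv P φ) hcP (hcs hsP).1 ((hcs hsP).2.trans hKsub)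
  let ψ₂ : 𝓓_{K}(ℂ, ℝ) := ContDiffMapSupportedIn.of_support_subset (by simpa using hcκ) hsκ
  -- This is φ = Δ(P * φ) - κ * φ. On the Laplacian T is known by hypothesis, and κ * φ is a
  -- superposition of translates of κ; both values are integrals of φ against smooth functions.
  have hdec : φ = lapTest ψ₁ - TestFunction.ofSupportedIn hKsub ψ₂ := by
    ext x
    have h1 : lap (conv P φ) x = conv P (lap φ) x := lap_conv hP.locallyIntegrable hφs hφc x
    change φ x = lap (conv P φ) x - conv κ φ x
    rw [h1]
    exact hpar φ hφs hφc x
  have e1 : T (lapTest ψ₁) = ∫ y, φ y * R y := by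
    rw [h, ← hRφ φ hφs hφc]
    refine integral_congr_ae (ae_of_all _ fun x => ?_)
    by_cases hx : conv P φ x = 0
    · simp [ψ₁, hx]
    · simp [ψ₁, hχ1' x (hsP hx)]
  have e2 : T (TestFunction.ofSupportedIn hKsub ψ₂) = ∫ y, φ y * G y :=
    hGφ φ hφs.continuous hφc ψ₂ fun x => conv_comm _ _ _
  have hi : ∀ {g : ℂ → ℝ}, ContDiff ℝ ∞ g → Integrable (fun y => φ y * g y) := fun hg =>
    (hφs.continuous.mul hg.continuous).integrable_of_hasCompactSupport hφc.mul_right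
  conv_lhs => rw [hdec]
  rw [map_sub, e1, e2, ← integral_sub (hi hR) (hi hG)]
  refine integral_congr_ae (ae_of_all _ fun y => ?_)
  simp only; ring

theorem test_ae_eq {Ω : Opens ℂ} {u v : ℂ → ℝ} (hu : Continuous u) (hv : Continuous v)
    {U : Set ℂ} (hU : IsOpen U) (hUΩ : U ⊆ Ω)
    (h : ∀ φ : 𝓓(Ω, ℝ), tsupport φ ⊆ U → ∫ z, u z * φ z = ∫ z, v z * φ z) :
    EqOn u v U := by
  let V : Opens ℂ := ⟨U, hU⟩
  have h1 : IsGivenBy (ofFunLocal V u) u :=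
    isGivenBy_ofFunLocal (hu.locallyIntegrable.locallyIntegrableOn _)
  have h2 : IsGivenBy (ofFunLocal V v) v :=
    isGivenBy_ofFunLocal (hv.locallyIntegrable.locallyIntegrableOn _)
  have h3 : ofFunLocal V u = ofFunLocal V v := by
    ext φ
    rw [h1.2, h2.2]
    exact h (mkTest φ (testFunction_smooth φ) φ.hasCompactSupport
      (φ.tsupport_subset.trans hUΩ)) φ.tsupport_subset
  rw [h3] at h1
  have h4 := h1.ae_eq h2
  refine MeasureTheory.Measure.eqOn_open_of_ae_eq (μ := volume) ?_ hU hu.continuousOn hv.continuousOn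
  exact (ae_restrict_iff' hU.measurableSet).2 h4

/-- Weyl's lemma: a distribution with smooth Laplacian is a smooth function. -/
theorem weyl (T : 𝓓'(Ω, ℝ)) {w : ℂ → ℝ} (hw : ContDiffOn ℝ ∞ w Ω)
    (h : ∀ φ : 𝓓(Ω, ℝ), T (lapTest φ) = ∫ z, w z * φ z) :
    ∃ r : ℂ → ℝ, ContDiffOn ℝ ∞ r Ω ∧ IsGivenBy T r := by
  choose! U r hU hKU hr hT using fun (K : Set ℂ) (hK : IsCompact K ∧ K ⊆ Ω) =>
    weyl_local T hw h hK.1 hK.2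
  have hagree : ∀ K L : Set ℂ, IsCompact K ∧ K ⊆ Ω → IsCompact L ∧ L ⊆ Ω →
      EqOn (r K) (r L) (U K ∩ U L ∩ Ω) := by
    intro K L hK hL
    refine test_ae_eq (Ω := Ω) (hr K hK).continuous (hr L hL).continuous
      (((hU K hK).inter (hU L hL)).inter Ω.isOpen) inter_subset_right fun φ hφ => ?_
    rw [← hT K hK φ fun z hz => (hφ hz).1.1, ← hT L hL φ fun z hz => (hφ hz).1.2]
  have hsing : ∀ z ∈ Ω, IsCompact ({z} : Set ℂ) ∧ {z} ⊆ (Ω : Set ℂ) := fun z hz =>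
    ⟨isCompact_singleton, singleton_subset_iff.2 hz⟩
  -- The local densities agree on overlaps, so the values at z of the densities attached to the
  -- compact sets {z} glue to one smooth function.
  have hloc : ∀ K : Set ℂ, IsCompact K ∧ K ⊆ Ω →
      EqOn (fun z => r {z} z) (r K) (U K ∩ Ω) := by
    intro K hK z hz
    exact hagree _ _ (hsing z hz.2) hK ⟨⟨hKU _ (hsing z hz.2) rfl, hz.1⟩, hz.2⟩
  have hsm : ContDiffOn ℝ ∞ (fun z => r {z} z) Ω := by
    intro z hz
    have hz' := hsing z hz
    refine ((hr {z} hz').contDiffAt.congr_of_eventuallyEq ?_).contDiffWithinAt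
    filter_upwards [(hU _ hz').mem_nhds (hKU _ hz' rfl), Ω.isOpen.mem_nhds hz] with y h1 h2
    exact hloc _ hz' ⟨h1, h2⟩
  refine ⟨fun z => r {z} z, hsm,
    hsm.continuousOn.locallyIntegrableOn Ω.isOpen.measurableSet, fun φ => ?_⟩
  have hφ : IsCompact (tsupport φ) ∧ tsupport φ ⊆ (Ω : Set ℂ) :=
    ⟨φ.hasCompactSupport, φ.tsupport_subset⟩
  rw [hT _ hφ φ (hKU _ hφ)]
  refine integral_congr_ae (ae_of_all _ fun z => ?_)
  by_cases hz : z ∈ tsupport φ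
  · simp only
    have := hloc _ hφ ⟨hKU _ hφ hz, hφ.2 hz⟩; simp only at this ⊢; rw [this]
  · simp [image_eq_zero_of_notMem_tsupport hz]

end Weyl

end

/-! ### Change of variables under injective holomorphic maps. -/

section ChangeOfVariables

theorem hasFDerivWithinAt_of_deriv {τ : ℂ → ℂ} {A : Set ℂ} {z : ℂ} (h : DifferentiableAt ℂ τ z) :
    HasFDerivWithinAt τ
      (((1 : ℂ →L[ℂ] ℂ).smulRight (deriv τ z)).restrictScalars ℝ : ℂ →L[ℝ] ℂ) A z :=
  (h.hasDerivAt.hasFDerivAt.restrictScalars ℝ).hasFDerivWithinAt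

/-- The real determinant of a complex linear map is the norm from ℂ to ℝ of its complex determinant.
-/
theorem det_restrictScalars_smulRight (a : ℂ) :
    (((1 : ℂ →L[ℂ] ℂ).smulRight a).restrictScalars ℝ : ℂ →L[ℝ] ℂ).det = ‖a‖ ^ 2 := by
  have h1 := LinearMap.det_restrictScalars (R := ℝ) (S := ℂ) (A := ℂ)
    (f := (((1 : ℂ →L[ℂ] ℂ).smulRight a : ℂ →L[ℂ] ℂ) : ℂ →ₗ[ℂ] ℂ))
  refine h1.trans ?_
  rw [Algebra.norm_complex_eq, LinearMap.det_ring]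
  simp [Complex.normSq_eq_norm_sq]

theorem lintegral_image_holomorphic {τ : ℂ → ℂ} {A : Set ℂ} (hA : MeasurableSet A)
    (hd : ∀ z ∈ A, DifferentiableAt ℂ τ z) (hi : InjOn τ A) (f : ℂ → ENNReal) :
    ∫⁻ y in τ '' A, f y = ∫⁻ z in A, ENNReal.ofReal (‖deriv τ z‖ ^ 2) * f (τ z) := by
  rw [lintegral_image_eq_lintegral_abs_det_fderiv_mul volume hA
    (fun z hz => hasFDerivWithinAt_of_deriv (hd z hz)) hi]
  simp only [det_restrictScalars_smulRight, abs_of_nonneg (sq_nonneg ‖_‖)]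

theorem integral_image_holomorphic {τ : ℂ → ℂ} {A : Set ℂ} (hA : MeasurableSet A)
    (hd : ∀ z ∈ A, DifferentiableAt ℂ τ z) (hi : InjOn τ A) (f : ℂ → ℝ) :
    ∫ y in τ '' A, f y = ∫ z in A, ‖deriv τ z‖ ^ 2 * f (τ z) := by
  rw [integral_image_eq_integral_abs_det_fderiv_smul volume hA
    (fun z hz => hasFDerivWithinAt_of_deriv (hd z hz)) hi]
  simp only [det_restrictScalars_smulRight, abs_of_nonneg (sq_nonneg ‖_‖), smul_eq_mul]

end ChangeOfVariables

/-! ### Holomorphic maps, smooth functions and distributions read in charts. -/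

section LocalMaps

variable {X Y : Type*} [TopologicalSpace X] [ChartedSpace ℂ X] [IsManifold 𝓘(ℂ) ω X]
  [TopologicalSpace Y] [ChartedSpace ℂ Y] [IsManifold 𝓘(ℂ) ω Y]

/-- The preferred chart at a point, as an element of the maximal atlas. -/
def Chart.preferred (x : X) : Chart X := ⟨chartAt ℂ x, IsManifold.chart_mem_maximalAtlas x⟩

/-- The expression of the map `F` in the charts `e` and `c`. -/
def locMap (F : X → Y) (e : Chart X) (c : Chart Y) (z : ℂ) : ℂ := c.1 (F (e.1.symm z))

/-- The open set on which the expression of `F` in the charts `e` and `c` makes sense. -/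
def locDom (F : X → Y) (e : Chart X) (c : Chart Y) : Set ℂ :=
  e.1.target ∩ e.1.symm ⁻¹' (F ⁻¹' c.1.source)

theorem mem_source_preferred (x : X) : x ∈ (Chart.preferred x).1.source := mem_chart_source ℂ x

theorem isOpen_locDom {F : X → Y} (hF : Continuous F) (e : Chart X) (c : Chart Y) :
    IsOpen (locDom F e c) :=
  e.1.symm.isOpen_inter_preimage (c.1.open_source.preimage hF)

theorem mem_locDom {F : X → Y} {e : Chart X} {c : Chart Y} {x : X} (hx : x ∈ e.1.source)
    (hc : F x ∈ c.1.source) : e.1 x ∈ locDom F e c :=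
  ⟨e.1.map_source hx, by simpa [e.1.left_inv hx] using hc⟩

theorem locMap_apply (F : X → Y) {e : Chart X} (c : Chart Y) {x : X} (hx : x ∈ e.1.source) :
    locMap F e c (e.1 x) = c.1 (F x) := by
  rw [locMap, e.1.left_inv hx]

theorem symm_locMap {F : X → Y} {e : Chart X} {c : Chart Y} {z : ℂ} (hz : z ∈ locDom F e c) :
    c.1.symm (locMap F e c z) = F (e.1.symm z) := c.1.left_inv hz.2

theorem locMap_mem_target {F : X → Y} {e : Chart X} {c : Chart Y} {z : ℂ}
    (hz : z ∈ locDom F e c) : locMap F e c z ∈ c.1.target := c.1.map_source hz.2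

theorem differentiableOn_locMap {F : X → Y} (hF : MDifferentiable 𝓘(ℂ) 𝓘(ℂ) F) (e : Chart X)
    (c : Chart Y) : DifferentiableOn ℂ (locMap F e c) (locDom F e c) := by
  intro z hz
  have he : MDifferentiableAt 𝓘(ℂ) 𝓘(ℂ) e.1.symm z :=
    (contMDiffAt_symm_of_mem_maximalAtlas e.2 hz.1).mdifferentiableAt (by simp)
  have hc : MDifferentiableAt 𝓘(ℂ) 𝓘(ℂ) c.1 (F (e.1.symm z)) :=
    (contMDiffAt_of_mem_maximalAtlas c.2 hz.2).mdifferentiableAt (by simp)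
  have := hc.comp z ((hF _).comp z he)
  exact (mdifferentiableAt_iff_differentiableAt.1 this).differentiableWithinAt

theorem analyticOnNhd_locMap {F : X → Y} (hF : MDifferentiable 𝓘(ℂ) 𝓘(ℂ) F) (e : Chart X)
    (c : Chart Y) : AnalyticOnNhd ℂ (locMap F e c) (locDom F e c) :=
  (differentiableOn_locMap hF e c).analyticOnNhd (isOpen_locDom hF.continuous e c)

theorem contDiffAt_locMap {F : X → Y} (hF : MDifferentiable 𝓘(ℂ) 𝓘(ℂ) F) {e : Chart X}
    {c : Chart Y} {z : ℂ} (hz : z ∈ locDom F e c) : ContDiffAt ℝ ∞ (locMap F e c) z :=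
  (analyticOnNhd_locMap hF e c z hz).restrictScalars (𝕜 := ℝ) |>.contDiffAt

theorem continuousAt_locMap {F : X → Y} (hF : MDifferentiable 𝓘(ℂ) 𝓘(ℂ) F) {e : Chart X}
    {c : Chart Y} {z : ℂ} (hz : z ∈ locDom F e c) : ContinuousAt (locMap F e c) z :=
  (analyticOnNhd_locMap hF e c z hz).continuousAt

/-- The composition of a function which is smooth at `F x` with a holomorphic map is smooth. -/
theorem contDiffAt_comp_map {F : X → Y} (hF : MDifferentiable 𝓘(ℂ) 𝓘(ℂ) F) (e : Chart X)
    (c : Chart Y) {s : Y → ℝ} {z : ℂ} (hz : z ∈ locDom F e c)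
    (h : ContDiffAt ℝ ∞ (s ∘ c.1.symm) (locMap F e c z)) :
    ContDiffAt ℝ ∞ ((s ∘ F) ∘ e.1.symm) z := by
  refine (h.comp z (contDiffAt_locMap hF hz)).congr_of_eventuallyEq ?_
  filter_upwards [(isOpen_locDom hF.continuous e c).mem_nhds hz] with w hw
  simp [symm_locMap hw]

theorem contDiffAt_chart_change (e e' : Chart X) {s : X → ℝ} {x : X} (hx : x ∈ e.1.source)
    (hx' : x ∈ e'.1.source) (h : ContDiffAt ℝ ∞ (s ∘ e'.1.symm) (e'.1 x)) :
    ContDiffAt ℝ ∞ (s ∘ e.1.symm) (e.1 x) := by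
  have := contDiffAt_comp_map (F := (id : X → X)) mdifferentiable_id e e'
    (mem_locDom hx hx') (s := s) (by rwa [locMap_apply _ _ hx])
  simpa using this

theorem contMDiffAt_iff_chart (e : Chart X) {s : X → ℝ} {x : X} (hx : x ∈ e.1.source) :
    ContMDiffAt 𝓘(ℝ, ℂ) 𝓘(ℝ, ℝ) ∞ s x ↔ ContDiffAt ℝ ∞ (s ∘ e.1.symm) (e.1 x) := by
  have h0 : ContMDiffAt 𝓘(ℝ, ℂ) 𝓘(ℝ, ℝ) ∞ s x ↔
      ContDiffAt ℝ ∞ (s ∘ (Chart.preferred x).1.symm) ((Chart.preferred x).1 x) := by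
    rw [contMDiffAt_iff]
    simp only [mfld_simps, contDiffWithinAt_univ]
    refine ⟨fun h => h.2, fun h => ⟨?_, h⟩⟩
    have h1 : ContinuousAt ((s ∘ (Chart.preferred x).1.symm) ∘ (Chart.preferred x).1) x :=
      ContinuousAt.comp h.continuousAt
        ((Chart.preferred x).1.continuousAt (mem_source_preferred x))
    refine h1.congr ?_
    filter_upwards [(Chart.preferred x).1.open_source.mem_nhds (mem_source_preferred x)] with y hy
    simp [(Chart.preferred x).1.left_inv hy]
  rw [h0]
  exact ⟨contDiffAt_chart_change _ _ hx (mem_source_preferred x),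
    contDiffAt_chart_change _ _ (mem_source_preferred x) hx⟩

theorem contMDiff_iff_chart {s : X → ℝ} :
    ContMDiff 𝓘(ℝ, ℂ) 𝓘(ℝ, ℝ) ∞ s ↔ ∀ e : Chart X, ContDiffOn ℝ ∞ (s ∘ e.1.symm) e.1.target := by
  constructor
  · intro h e z hz
    have := (contMDiffAt_iff_chart e (e.1.map_target hz)).1 (h _)
    rw [e.1.right_inv hz] at this
    exact this.contDiffWithinAt
  · intro h x
    have hx := mem_source_preferred x
    exact (contMDiffAt_iff_chart (Chart.preferred x) hx).2
      ((h _).contDiffAt ((Chart.preferred x).1.open_target.mem_nhds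
        ((Chart.preferred x).1.map_source hx)))

theorem contMDiff_comp_map {F : X → Y} (hF : MDifferentiable 𝓘(ℂ) 𝓘(ℂ) F) {s : Y → ℝ}
    (hs : ContMDiff 𝓘(ℝ, ℂ) 𝓘(ℝ, ℝ) ∞ s) : ContMDiff 𝓘(ℝ, ℂ) 𝓘(ℝ, ℝ) ∞ (s ∘ F) := by
  intro x
  have hx := mem_source_preferred x
  rw [contMDiffAt_iff_chart _ hx]
  refine contDiffAt_comp_map hF _ (Chart.preferred (F x))
    (mem_locDom hx (mem_source_preferred (F x))) ?_
  rw [locMap_apply _ _ hx]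
  exact (contMDiffAt_iff_chart _ (mem_source_preferred _)).1 (hs _)

/-- A change of coordinates is injective. -/
theorem injOn_locMap_id (e e' : Chart X) : InjOn (locMap id e e') (locDom id e e') := by
  intro z hz w hw h
  have h1 := congrArg e'.1.symm h
  rw [symm_locMap hz, symm_locMap hw] at h1
  exact e.1.symm.injOn hz.1 hw.1 h1

theorem locMap_id_inverse {e e' : Chart X} {z : ℂ} (hz : z ∈ locDom id e e') :
    locMap id e' e (locMap id e e' z) = z := by
  rw [locMap, symm_locMap hz]
  exact e.1.right_inv hz.1

theorem locMap_mem_locDom {e e' : Chart X} {z : ℂ} (hz : z ∈ locDom id e e') :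
    locMap id e e' z ∈ locDom id e' e :=
  ⟨locMap_mem_target hz, by
    simpa [symm_locMap hz] using e.1.map_target hz.1⟩

theorem deriv_locMap_id_ne_zero (e e' : Chart X) {z : ℂ} (hz : z ∈ locDom id e e') :
    deriv (locMap id e e') z ≠ 0 := by
  have hd := ((analyticOnNhd_locMap (F := (id : X → X)) mdifferentiable_id e e') z
    hz).differentiableAt
  have hd' := ((analyticOnNhd_locMap (F := (id : X → X)) mdifferentiable_id e' e) _
    (locMap_mem_locDom hz)).differentiableAt
  have h1 := deriv_comp z hd' hd
  have h2 : (locMap id e' e ∘ locMap id e e') =ᶠ[𝓝 z] id := by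
    filter_upwards [(isOpen_locDom continuous_id e e').mem_nhds hz] with w hw
    exact locMap_id_inverse hw
  rw [h2.deriv_eq, deriv_id] at h1
  intro h
  simp [h] at h1

/-- The change of variables formula for changes of coordinates. -/
theorem integral_chart_change (e e' : Chart X) (f : ℂ → ℝ) :
    ∫ z in locDom id e' e, f z =
      ∫ z in locDom id e e', ‖deriv (locMap id e e') z‖ ^ 2 * f (locMap id e e' z) := by
  have himg : locMap id e e' '' locDom id e e' = locDom id e' e := by
    refine Subset.antisymm ?_ fun w hw => ⟨_, locMap_mem_locDom hw, locMap_id_inverse hw⟩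
    rintro _ ⟨z, hz, rfl⟩
    exact locMap_mem_locDom hz
  rw [← himg, integral_image_holomorphic (isOpen_locDom continuous_id e e').measurableSet
    (fun z hz => ((analyticOnNhd_locMap (F := (id : X → X)) mdifferentiable_id e e') z
      hz).differentiableAt) (injOn_locMap_id e e')]

/-- The distribution on `X` given by a function that is locally integrable in all charts. -/
def ofFun (u : X → ℝ)
    (hu : ∀ e : Chart X, LocallyIntegrableOn (fun z => u (e.1.symm z)) e.1.target volume) :
    Dist X :=
  ⟨fun e => ofFunLocal e.range fun z => u (e.1.symm z), by
    intro e e' φ φ' h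
    rw [(isGivenBy_ofFunLocal (Ω := e.range) (hu e)).2 φ,
      (isGivenBy_ofFunLocal (Ω := e'.range) (hu e')).2 φ']
    have h1 : ∀ z, z ∉ locDom id e e' → u (e.1.symm z) * φ z = 0 := by
      intro z hz
      by_cases hzt : z ∈ e.1.target
      · have := h.2.1 (e.1.symm z) ⟨e.1.map_target hzt, fun hz' => hz ⟨hzt, hz'⟩⟩
        rw [e.1.right_inv hzt] at this
        rw [this, mul_zero]
      · rw [image_eq_zero_of_notMem_tsupport fun hz' => hzt (φ.tsupport_subset hz'), mul_zero]
    have h2 : ∀ z, z ∉ locDom id e' e → u (e'.1.symm z) * φ' z = 0 := by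
      intro z hz
      by_cases hzt : z ∈ e'.1.target
      · have := h.2.2 (e'.1.symm z) ⟨e'.1.map_target hzt, fun hz' => hz ⟨hzt, hz'⟩⟩
        rw [e'.1.right_inv hzt] at this
        rw [this, mul_zero]
      · rw [image_eq_zero_of_notMem_tsupport fun hz' => hzt (φ'.tsupport_subset hz'), mul_zero]
    -- Both test functions vanish outside the overlap of the charts, and there their relation is the
    -- change of variables formula.
    rw [← setIntegral_eq_integral_of_forall_compl_eq_zero h1,
      ← setIntegral_eq_integral_of_forall_compl_eq_zero h2, integral_chart_change e' e]
    refine setIntegral_congr_fun (isOpen_locDom continuous_id e' e).measurableSet fun z hz => ?_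
    have h3 := h.1 (e'.1.symm z) ⟨hz.2, e'.1.map_target hz.1⟩
    rw [e'.1.right_inv hz.1] at h3
    simp only [symm_locMap hz, id]
    rw [h3]
    change _ = _ * (_ * ‖deriv (locMap id e' e) z‖ ^ 2)
    simp only [locMap, id]
    ring⟩

theorem isGivenByFun_ofFun {u : X → ℝ}
    (hu : ∀ e : Chart X, LocallyIntegrableOn (fun z => u (e.1.symm z)) e.1.target volume) :
    IsGivenByFun (ofFun u hu) u := fun e => isGivenBy_ofFunLocal (Ω := e.range) (hu e)

theorem IsGivenByFun.dist_eq {S T : Dist X} {u : X → ℝ} (hS : IsGivenByFun S u)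
    (hT : IsGivenByFun T u) : S = T := Subtype.ext (funext fun e => (hS e).eq (hT e))

theorem IsGivenByFun.add {S T : Dist X} {u v : X → ℝ} (hS : IsGivenByFun S u)
    (hT : IsGivenByFun T v) : IsGivenByFun (S + T) (u + v) := fun e => (hS e).add (hT e)

theorem IsGivenByFun.sub {S T : Dist X} {u v : X → ℝ} (hS : IsGivenByFun S u)
    (hT : IsGivenByFun T v) : IsGivenByFun (S - T) (u - v) := fun e => (hS e).sub (hT e)

/-- A set meeting the range of a chart only in the image of a finite set is null there. -/
theorem ae_symm_notMem (e : Chart X) {N : Set X} (hN : N.Finite) :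
    ∀ᵐ z ∂volume.restrict e.1.target, e.1.symm z ∉ N := by
  rw [ae_restrict_iff' e.1.open_target.measurableSet]
  have : (e.1 '' N).Finite := hN.image _
  filter_upwards [this.countable.ae_notMem volume] with z hz hzt hzN
  exact hz ⟨_, hzN, e.1.right_inv hzt⟩

theorem IsGivenByFun.congr {T : Dist X} {u v : X → ℝ} (hT : IsGivenByFun T u) {N : Set X}
    (hN : N.Finite) (h : ∀ x ∉ N, u x = v x) : IsGivenByFun T v := fun e =>
  (hT e).congr_ae (by
    filter_upwards [(ae_restrict_iff' e.1.open_target.measurableSet).1 (ae_symm_notMem e hN)]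
      with z hz hzt
    exact h _ (hz hzt))

theorem isGivenByFun_of_contMDiff {s : X → ℝ} (hs : ContMDiff 𝓘(ℝ, ℂ) 𝓘(ℝ, ℝ) ∞ s) :
    ∃ S : Dist X, IsGivenByFun S s :=
  ⟨_, isGivenByFun_ofFun fun e => (contMDiff_iff_chart.1 hs e).continuousOn.locallyIntegrableOn
    e.1.open_target.measurableSet⟩

end LocalMaps

/-! ### The area formula: integrals of sums over fibres. -/

section AreaFormula

variable {τ : ℂ → ℂ} {U : Set ℂ}

/-- The critical points are isolated and every subset of the plane is Lindelöf. -/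
theorem countable_critical (hnc : ∀ z ∈ U, ∀ᶠ w in 𝓝[≠] z, deriv τ w ≠ 0) :
    {z ∈ U | deriv τ z = 0}.Countable := by
  obtain ⟨t, ht, htc, hcov⟩ := countable_cover_nhdsWithin (s := U)
    (f := fun z => {w | w ≠ z → deriv τ w ≠ 0}) fun z hz =>
      mem_nhdsWithin_of_mem_nhds (eventually_nhdsWithin_iff.1 (hnc z hz))
  refine htc.mono fun z hz => ?_
  obtain ⟨w, hw, hzw⟩ := mem_iUnion₂.1 (hcov hz.1)
  by_contra hzt
  exact hzw (fun h => hzt (h ▸ hw)) hz.2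

/-- The regular set of a holomorphic map is a countable disjoint union of measurable sets of
injectivity. -/
theorem exists_injective_pieces (hU : IsOpen U) (hτ : AnalyticOnNhd ℂ τ U) :
    ∃ A : ℕ → Set ℂ, (∀ k, MeasurableSet (A k)) ∧ Pairwise (Function.onFun Disjoint A) ∧
      (∀ k, InjOn τ (A k)) ∧ ⋃ k, A k = {z ∈ U | deriv τ z ≠ 0} := by
  set R := {z ∈ U | deriv τ z ≠ 0} with hR
  have hRo : IsOpen R := by
    have := (hτ.deriv.continuousOn).isOpen_inter_preimage hU (isOpen_compl_singleton (x := (0 : ℂ)))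
    exact this
  have hloc : ∀ z ∈ R, ∃ W : Set ℂ, IsOpen W ∧ z ∈ W ∧ InjOn τ W := by
    intro z hz
    have h := (hτ z hz.1).hasStrictDerivAt
    let H := h.hasStrictFDerivAt_equiv hz.2 |>.toOpenPartialHomeomorph τ
    exact ⟨H.source, H.open_source,
      (h.hasStrictFDerivAt_equiv hz.2).mem_toOpenPartialHomeomorph_source, H.injOn⟩
  choose! W hWo hzW hWi using hloc
  rcases R.eq_empty_or_nonempty with hemp | hne
  · exact ⟨fun _ => ∅, fun _ => MeasurableSet.empty, fun _ _ _ => disjoint_bot_left,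
      fun _ => injOn_empty _, by rw [hemp, iUnion_empty]⟩
  obtain ⟨t, ht, htc, hcov⟩ := countable_cover_nhdsWithin (s := R) (f := W) fun z hz =>
      mem_nhdsWithin_of_mem_nhds ((hWo z hz).mem_nhds (hzW z hz))
  have htne : t.Nonempty := by
    obtain ⟨z, hz⟩ := hne
    obtain ⟨w, hw, -⟩ := mem_iUnion₂.1 (hcov hz)
    exact ⟨w, hw⟩
  obtain ⟨g, rfl⟩ := htc.exists_eq_range htne
  refine ⟨disjointed fun k => W (g k) ∩ R, fun k => ?_, disjoint_disjointed _, fun k => ?_, ?_⟩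
  · exact MeasurableSet.disjointed
      (fun k => ((hWo _ (ht (mem_range_self k))).inter hRo).measurableSet) k
  · exact (hWi _ (ht (mem_range_self k))).mono
      ((disjointed_subset _ _).trans inter_subset_left)
  · rw [iUnion_disjointed]
    refine Subset.antisymm (iUnion_subset fun k => inter_subset_right) fun z hz => ?_
    obtain ⟨w, ⟨k, rfl⟩, hzw⟩ := mem_iUnion₂.1 (hcov hz)
    exact mem_iUnion.2 ⟨k, hzw, hz⟩

/-- The sum of the values of `f` over the points of `U` lying above a given point. -/
def fibreSum {M : Type*} [AddCommMonoid M] (τ : ℂ → ℂ) (U : Set ℂ) (f : ℂ → M) (y : ℂ) : M :=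
  ∑ᶠ z ∈ U ∩ τ ⁻¹' {y}, f z

/-- The function `f` on `A`, transported along a map `τ` which is injective on `A`. -/
def transport {M : Type*} [Zero M] (τ : ℂ → ℂ) (A : Set ℂ) (f : ℂ → M) : ℂ → M :=
  Function.extend (A.domRestrict τ) (A.domRestrict f) 0

theorem transport_apply {M : Type*} [Zero M] {A : Set ℂ} (hA : InjOn τ A) (f : ℂ → M) {z : ℂ}
    (hz : z ∈ A) : transport τ A f (τ z) = f z :=
  (injOn_iff_injective.1 hA).extend_apply _ _ (⟨z, hz⟩ : A)

theorem transport_of_notMem {M : Type*} [Zero M] {A : Set ℂ} (f : ℂ → M) {y : ℂ}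
    (hy : y ∉ τ '' A) : transport τ A f y = 0 :=
  Function.extend_apply' _ _ _ fun ⟨z, hz⟩ => hy ⟨z, z.2, hz⟩

theorem measurable_transport {M : Type*} [Zero M] [MeasurableSpace M] {A : Set ℂ}
    (hA : MeasurableSet A) (hi : InjOn τ A) (hc : ContinuousOn τ A) {f : ℂ → M}
    (hf : Measurable f) : Measurable (transport τ A f) :=
  (hc.measurableEmbedding hA hi).measurable_extend (hf.comp measurable_subtype_coe)
    measurable_const

theorem lintegral_transport {A : Set ℂ} (hA : MeasurableSet A) (hi : InjOn τ A)
    (hd : ∀ z ∈ A, DifferentiableAt ℂ τ z) (f : ℂ → ENNReal) :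
    ∫⁻ y, transport τ A f y = ∫⁻ z in A, ENNReal.ofReal (‖deriv τ z‖ ^ 2) * f z := by
  have himg : MeasurableSet (τ '' A) :=
    hA.image_of_continuousOn_injOn (fun z hz => (hd z hz).continuousAt.continuousWithinAt) hi
  have h1 : ∫⁻ y, transport τ A f y = ∫⁻ y in τ '' A, transport τ A f y := by
    rw [← lintegral_indicator himg]
    refine lintegral_congr fun y => ?_
    by_cases hy : y ∈ τ '' A
    · rw [indicator_of_mem hy]
    · rw [indicator_of_notMem hy, transport_of_notMem f hy]
  rw [h1, lintegral_image_holomorphic hA hd hi]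
  exact setLIntegral_congr_fun hA fun z hz => by simp only [transport_apply hi f hz]

theorem integral_transport {A : Set ℂ} (hA : MeasurableSet A) (hi : InjOn τ A)
    (hd : ∀ z ∈ A, DifferentiableAt ℂ τ z) (f : ℂ → ℝ) :
    ∫ y, transport τ A f y = ∫ z in A, ‖deriv τ z‖ ^ 2 * f z := by
  rw [← setIntegral_eq_integral_of_forall_compl_eq_zero (s := τ '' A)
    fun y hy => transport_of_notMem f hy, integral_image_holomorphic hA hd hi]
  exact setIntegral_congr_fun hA fun z hz => by simp only [transport_apply hi f hz]

theorem fibreSum_eq_sum {M : Type*} [AddCommMonoid M] {y : ℂ} (hfin : (U ∩ τ ⁻¹' {y}).Finite)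
    (f : ℂ → M) : fibreSum τ U f y = ∑ z ∈ hfin.toFinset, f z :=
  finsum_mem_eq_finite_toFinset_sum f hfin

/-- Every point above a regular value lies in exactly one piece, and each piece contains at most one
such point. This reduces integrals of fibre sums to the injective change of variables, piece by
piece. -/
theorem hasSum_transport {M : Type*} [AddCommMonoid M] [TopologicalSpace M] [ContinuousAdd M]
    {A : ℕ → Set ℂ} (hdisj : Pairwise (Function.onFun Disjoint A)) (hi : ∀ k, InjOn τ (A k))
    (hA : ⋃ k, A k = {z ∈ U | deriv τ z ≠ 0}) {y : ℂ} (hfin : (U ∩ τ ⁻¹' {y}).Finite)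
    (hy : ∀ z ∈ U, τ z = y → deriv τ z ≠ 0) (f : ℂ → M) :
    HasSum (fun k => transport τ (A k) f y) (fibreSum τ U f y) := by
  classical
  have hterm : ∀ k, transport τ (A k) f y =
      ∑ z ∈ hfin.toFinset, if z ∈ A k then f z else 0 := by
    intro k
    by_cases hyk : y ∈ τ '' A k
    · obtain ⟨z, hz, rfl⟩ := hyk
      have hzU : z ∈ U := by
        have : z ∈ ⋃ k, A k := mem_iUnion.2 ⟨k, hz⟩
        rw [hA] at this
        exact this.1
      rw [transport_apply (hi k) f hz, Finset.sum_eq_single_of_mem z]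
      · rw [if_pos hz]
      · simp [hzU]
      · intro w hw hwz
        rw [if_neg]
        intro hwA
        have : w ∈ U ∩ τ ⁻¹' {τ z} := by simpa using hw
        exact hwz (hi k hwA hz this.2)
    · rw [transport_of_notMem f hyk, Finset.sum_eq_zero]
      intro z hz
      have : z ∈ U ∩ τ ⁻¹' {y} := by simpa using hz
      rw [if_neg]
      exact fun h => hyk ⟨z, h, this.2⟩
  rw [fibreSum_eq_sum hfin, funext hterm]
  refine hasSum_sum fun z hz => ?_
  have hz' : z ∈ U ∩ τ ⁻¹' {y} := by simpa using hz
  have : z ∈ ⋃ k, A k := by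
    rw [hA]
    exact ⟨hz'.1, hy z hz'.1 hz'.2⟩
  obtain ⟨k, hk⟩ := mem_iUnion.1 this
  have := hasSum_single (f := fun k => if z ∈ A k then f z else 0) k fun j hj => by
    rw [if_neg]
    exact fun h => (hdisj hj).le_bot ⟨h, hk⟩
  simpa [hk] using this

variable (hU : IsOpen U) (hτ : AnalyticOnNhd ℂ τ U)
  (hnc : ∀ z ∈ U, ∀ᶠ w in 𝓝[≠] z, deriv τ w ≠ 0) (hfin : ∀ y, (U ∩ τ ⁻¹' {y}).Finite)

include hnc in
theorem ae_regular_value : ∀ᵐ y : ℂ, ∀ z ∈ U, τ z = y → deriv τ z ≠ 0 := by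
  filter_upwards [((countable_critical hnc).image τ).ae_notMem volume] with y hy z hz hzy h
  exact hy ⟨z, ⟨hz, h⟩, hzy⟩

include hU hτ hnc hfin

theorem restrict_regular_eq : volume.restrict {z ∈ U | deriv τ z ≠ 0} = volume.restrict U := by
  refine Measure.restrict_congr_set ?_
  filter_upwards [(countable_critical hnc).ae_notMem volume] with z hz
  refine propext ⟨fun h => h.1, fun h => ⟨h, fun h' => hz ⟨h, h'⟩⟩⟩

/-- The area formula for holomorphic maps. -/
theorem lintegral_fibreSum {f : ℂ → ENNReal} (hf : Measurable f) :
    AEMeasurable (fibreSum τ U f) ∧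
      ∫⁻ y, fibreSum τ U f y = ∫⁻ z in U, ENNReal.ofReal (‖deriv τ z‖ ^ 2) * f z := by
  obtain ⟨A, hAm, hdisj, hi, hA⟩ := exists_injective_pieces hU hτ
  have hAU : ∀ k, ∀ z ∈ A k, z ∈ U := fun k z hz => by
    have : z ∈ ⋃ k, A k := mem_iUnion.2 ⟨k, hz⟩
    rw [hA] at this
    exact this.1
  have hd : ∀ k, ∀ z ∈ A k, DifferentiableAt ℂ τ z := fun k z hz =>
    (hτ z (hAU k z hz)).differentiableAt
  have hm : ∀ k, Measurable (transport τ (A k) f) := fun k =>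
    measurable_transport (hAm k) (hi k)
      (fun z hz => (hd k z hz).continuousAt.continuousWithinAt) hf
  have hae : (fun y => ∑' k, transport τ (A k) f y) =ᵐ[volume] fibreSum τ U f := by
    filter_upwards [ae_regular_value hnc] with y hy
    exact (hasSum_transport hdisj hi hA (hfin y) hy f).tsum_eq
  refine ⟨(AEMeasurable.tsum fun k => (hm k).aemeasurable).congr hae, ?_⟩
  rw [← lintegral_congr_ae hae, lintegral_tsum fun k => (hm k).aemeasurable]
  simp_rw [fun k => lintegral_transport (hAm k) (hi k) (hd k) f]
  rw [← lintegral_iUnion hAm hdisj, hA, restrict_regular_eq hU hτ hnc hfin]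

theorem aemeasurable_fibreSum {f : ℂ → ℝ} (hf : Measurable f) :
    AEMeasurable (fibreSum τ U f) := by
  obtain ⟨A, hAm, hdisj, hi, hA⟩ := exists_injective_pieces hU hτ
  have hAU : ∀ k, ∀ z ∈ A k, z ∈ U := fun k z hz => by
    have : z ∈ ⋃ k, A k := mem_iUnion.2 ⟨k, hz⟩
    rw [hA] at this
    exact this.1
  have hm : ∀ k, Measurable (transport τ (A k) f) := fun k =>
    measurable_transport (hAm k) (hi k)
      (fun z hz => (hτ z (hAU k z hz)).continuousAt.continuousWithinAt) hf
  refine aemeasurable_of_tendsto_metrizable_ae atTop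
    (f := fun (s : Finset ℕ) y => ∑ k ∈ s, transport τ (A k) f y)
    (fun s => (Finset.measurable_sum s fun k _ => hm k).aemeasurable) ?_
  filter_upwards [ae_regular_value hnc] with y hy
  exact hasSum_transport hdisj hi hA (hfin y) hy f

theorem enorm_fibreSum_le (f : ℂ → ℝ) (y : ℂ) :
    ‖fibreSum τ U f y‖ₑ ≤ fibreSum τ U (fun z => ‖f z‖ₑ) y := by
  rw [fibreSum_eq_sum (hfin y), fibreSum_eq_sum (hfin y)]
  exact enorm_sum_le _ _

/-- Cauchy–Schwarz on a fibre with at most N points; this is how the size of the fibres enters the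
L² bounds. -/
theorem enorm_fibreSum_sq_le {N : ℕ} (hN : ∀ y, (U ∩ τ ⁻¹' {y}).ncard ≤ N) (f : ℂ → ℝ) (y : ℂ) :
    ‖fibreSum τ U f y‖ₑ ^ 2 ≤ N * fibreSum τ U (fun z => ‖f z‖ₑ ^ 2) y := by
  rw [fibreSum_eq_sum (hfin y), fibreSum_eq_sum (hfin y)]
  have h1 : ∀ x : ℝ, ‖x‖ₑ ^ 2 = ENNReal.ofReal (x ^ 2) := fun x => by
    rw [← ofReal_norm, ← ENNReal.ofReal_pow (norm_nonneg _), Real.norm_eq_abs, sq_abs]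
  simp only [h1]
  rw [← ENNReal.ofReal_sum_of_nonneg fun _ _ => sq_nonneg _, ← ENNReal.ofReal_natCast,
    ← ENNReal.ofReal_mul (by positivity)]
  refine ENNReal.ofReal_le_ofReal (sq_sum_le_card_mul_sum_sq.trans ?_)
  have : (hfin y).toFinset.card ≤ N := by
    rw [← ncard_eq_toFinset_card _ (hfin y)]
    exact hN y
  gcongr

/-- The signed form of `lintegral_fibreSum`. Its unsigned form, applied to |f|, supplies the
absolute convergence that permits summation under the integral. -/
theorem integral_fibreSum {f : ℂ → ℝ} (hf : Measurable f)
    (hint : IntegrableOn (fun z => ‖deriv τ z‖ ^ 2 * f z) U) :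
    Integrable (fibreSum τ U f) ∧
      ∫ y, fibreSum τ U f y = ∫ z in U, ‖deriv τ z‖ ^ 2 * f z := by
  have h1 : ∀ z, ENNReal.ofReal (‖deriv τ z‖ ^ 2) * ‖f z‖ₑ = ‖‖deriv τ z‖ ^ 2 * f z‖ₑ := by
    intro z
    rw [enorm_mul, Real.enorm_eq_ofReal (sq_nonneg _)]
  have hlt := (lintegral_fibreSum hU hτ hnc hfin hf.enorm).2
  simp only [h1] at hlt
  refine ⟨⟨(aemeasurable_fibreSum hU hτ hnc hfin hf).aestronglyMeasurable, ?_⟩, ?_⟩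
  · refine lt_of_le_of_lt (lintegral_mono fun y => enorm_fibreSum_le hU hτ hnc hfin f y) ?_
    rw [hlt]
    exact hint.2
  obtain ⟨A, hAm, hdisj, hi, hA⟩ := exists_injective_pieces hU hτ
  have hAU : ∀ k, ∀ z ∈ A k, z ∈ U := fun k z hz => by
    have : z ∈ ⋃ k, A k := mem_iUnion.2 ⟨k, hz⟩
    rw [hA] at this
    exact this.1
  have hd : ∀ k, ∀ z ∈ A k, DifferentiableAt ℂ τ z := fun k z hz =>
    (hτ z (hAU k z hz)).differentiableAt
  have hm : ∀ k, Measurable (transport τ (A k) f) := fun k =>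
    measurable_transport (hAm k) (hi k)
      (fun z hz => (hd k z hz).continuousAt.continuousWithinAt) hf
  have hae : (fun y => ∑' k, transport τ (A k) f y) =ᵐ[volume] fibreSum τ U f := by
    filter_upwards [ae_regular_value hnc] with y hy
    exact (hasSum_transport hdisj hi hA (hfin y) hy f).tsum_eq
  have henorm : ∀ k y, ‖transport τ (A k) f y‖ₑ = transport τ (A k) (fun z => ‖f z‖ₑ) y := by
    intro k y
    by_cases hy : y ∈ τ '' A k
    · obtain ⟨z, hz, rfl⟩ := hy
      rw [transport_apply (hi k) f hz, transport_apply (hi k) _ hz]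
    · rw [transport_of_notMem f hy, transport_of_notMem _ hy, enorm_zero]
  rw [← integral_congr_ae hae, integral_tsum fun k => (hm k).aestronglyMeasurable]
  · simp_rw [fun k => integral_transport (hAm k) (hi k) (hd k) f]
    rw [← integral_iUnion hAm hdisj, hA, restrict_regular_eq hU hτ hnc hfin]
    rw [hA]
    exact hint.mono_set fun z hz => hz.1
  · simp_rw [henorm, fun k => lintegral_transport (hAm k) (hi k) (hd k) fun z => ‖f z‖ₑ, h1]
    rw [← lintegral_iUnion hAm hdisj, hA, restrict_regular_eq hU hτ hnc hfin]
    exact hint.2.ne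

end AreaFormula

/-! ### Local normal form z ↦ z^m of a holomorphic function. -/

section NormalForm

/-- The m-th roots of b are the multiples of one of them by the powers of a primitive root of unity.
-/
theorem ncard_setOf_pow_eq {m : ℕ} (hm : m ≠ 0) {b : ℂ} (hb : b ≠ 0) :
    {w : ℂ | w ^ m = b}.ncard = m := by
  obtain ⟨α, hα⟩ := IsAlgClosed.exists_pow_nat_eq b (Nat.pos_of_ne_zero hm)
  have hα0 : α ≠ 0 := by
    rintro rfl
    exact hb (by rw [← hα, zero_pow hm])
  have hζ := Complex.isPrimitiveRoot_exp m hm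
  have h1 : {w : ℂ | w ^ m = b} =
      (fun k => Complex.exp (2 * Real.pi * Complex.I / m) ^ k * α) '' (Finset.range m) := by
    ext w
    have h2 : w ^ m = b ↔ w ∈ Polynomial.nthRoots m b :=
      (Polynomial.mem_nthRoots (Nat.pos_of_ne_zero hm)).symm
    rw [mem_ofPred_eq, h2, hζ.nthRoots_eq hα]
    simp
  rw [h1, (hζ.injOn_pow_mul hα0).ncard_image]
  simp

theorem analyticOrderAt_ne_top_of_punctured {τ : ℂ → ℂ} {p : ℂ}
    (hnc : ∀ᶠ z in 𝓝[≠] p, τ z ≠ τ p) : analyticOrderAt (fun z => τ z - τ p) p ≠ ⊤ := by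
  intro h
  have h1 := (analyticOrderAt_eq_top.1 h).filter_mono (nhdsWithin_le_nhds (s := {p}ᶜ))
  obtain ⟨z, h2, h3⟩ := (h1.and hnc).exists
  exact h3 (sub_eq_zero.1 h2)

/-- Near a point `p`, a holomorphic function is an `m`-fold branched cover, with `m` the order of
vanishing of `τ - τ p`. -/
theorem exists_branched_nhds {τ : ℂ → ℂ} {p : ℂ} (hτ : AnalyticAt ℂ τ p)
    (hnc : ∀ᶠ z in 𝓝[≠] p, τ z ≠ τ p) {W : Set ℂ} (hW : W ∈ 𝓝 p) :
    ∃ W' ⊆ W, IsOpen W' ∧ p ∈ W' ∧ ∃ V, IsOpen V ∧ τ p ∈ V ∧ W' ∩ τ ⁻¹' {τ p} = {p} ∧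
      ∀ y ∈ V, y ≠ τ p →
        (W' ∩ τ ⁻¹' {y}).ncard = analyticOrderNatAt (fun z => τ z - τ p) p := by
  have hfa : AnalyticAt ℂ (fun z => τ z - τ p) p := by fun_prop
  obtain ⟨g, hg, hgp, hfg⟩ := hfa.analyticOrderAt_ne_top.1
    (analyticOrderAt_ne_top_of_punctured hnc)
  set m := analyticOrderNatAt (fun z => τ z - τ p) p with hmdef
  have hm : m ≠ 0 := by
    intro h0
    have := hfg.self_of_nhds
    simp [h0] at this
    exact hgp this.symm
  obtain ⟨a, ha⟩ := IsAlgClosed.exists_pow_nat_eq (g p) (Nat.pos_of_ne_zero hm)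
  have ha0 : a ≠ 0 := by
    rintro rfl
    exact hgp (by rw [← ha, zero_pow hm])
  have hslit : g p / g p ∈ Complex.slitPlane := by simp [div_self hgp]
  -- An m-th root of τ - τ p = (z - p)^m g. The quotient g/g(p) is close to 1, so the principal
  -- logarithm gives it an analytic m-th root, and a is an m-th root of g(p). As ζ'(p) = a ≠ 0, ζ is
  -- a local coordinate.
  set ζ : ℂ → ℂ := fun z => (z - p) * (a * Complex.exp (Complex.log (g z / g p) / m)) with hζ
  have hga : AnalyticAt ℂ (fun z => a * Complex.exp (Complex.log (g z / g p) / m)) p := by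
    have h1 : AnalyticAt ℂ (fun z => Complex.log (g z / g p)) p :=
      (hg.div analyticAt_const hgp).clog hslit
    fun_prop (disch := simpa using hm)
  have hζa : AnalyticAt ℂ ζ p := by fun_prop
  have hζp : ζ p = 0 := by simp [hζ]
  have hζd : deriv ζ p = a := by
    have h1 : HasDerivAt (fun z : ℂ => z - p) 1 p := (hasDerivAt_id p).sub_const p
    have h2 := h1.mul hga.differentiableAt.hasDerivAt
    have h3 : HasDerivAt ζ a p := by
      refine h2.congr_deriv ?_
      simp [div_self hgp]
    exact h3.deriv
  have hζm : ∀ᶠ z in 𝓝 p, τ z - τ p = ζ z ^ m := by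
    have hg0 : ∀ᶠ z in 𝓝 p, g z ≠ 0 := hg.continuousAt.eventually_ne hgp
    filter_upwards [hfg, hg0] with z hz hz0
    have hmC : (m : ℂ) ≠ 0 := by exact_mod_cast hm
    rw [hz, hζ, smul_eq_mul]
    simp only [mul_pow, ha, ← Complex.exp_nat_mul]
    rw [mul_div_cancel₀ _ hmC, Complex.exp_log (div_ne_zero hz0 hgp), mul_div_cancel₀ _ hgp]
  obtain ⟨O, hOsub, hO, hpO⟩ := eventually_nhds_iff.1 (hζm.and hW)
  have hstr := hζa.hasStrictDerivAt
  have hd0 : deriv ζ p ≠ 0 := by rwa [hζd]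
  let H := (hstr.hasStrictFDerivAt_equiv hd0).toOpenPartialHomeomorph ζ
  have hHs : p ∈ H.source := (hstr.hasStrictFDerivAt_equiv hd0).mem_toOpenPartialHomeomorph_source
  have hHc : ∀ z, H z = ζ z := fun z => rfl
  let H' := H.restrOpen O hO
  have hH's : H'.source = H.source ∩ O := rfl
  have hH'c : ∀ z, H' z = ζ z := fun z => rfl
  have hpH' : p ∈ H'.source := ⟨hHs, hpO⟩
  have h0t : (0 : ℂ) ∈ H'.target := by
    have := H'.map_source hpH'
    rwa [hH'c, hζp] at this
  obtain ⟨δ, hδ, hball⟩ := Metric.isOpen_iff.1 H'.open_target 0 h0t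
  -- W' corresponds under ζ to the disc of radius δ. The m-th roots of any number of modulus less
  -- than δ^m lie in that disc, so fibres above the disc of radius δ^m are complete sets of m-th
  -- roots.
  set W' := H'.source ∩ H' ⁻¹' Metric.ball 0 δ with hW'
  have hW'O : W' ⊆ O := fun z hz => hz.1.2
  refine ⟨W', fun z hz => (hOsub z (hW'O hz)).2, H'.isOpen_inter_preimage Metric.isOpen_ball,
    ⟨hpH', by simp [hH'c, hζp, hδ]⟩, Metric.ball (τ p) (δ ^ m), Metric.isOpen_ball,
    Metric.mem_ball_self (by positivity), ?_, ?_⟩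
  · ext z
    constructor
    · rintro ⟨hz, hzp⟩
      have h1 := (hOsub z (hW'O hz)).1
      rw [show τ z = τ p from hzp, sub_self] at h1
      have h2 : ζ z = 0 := pow_eq_zero_iff hm |>.1 h1.symm
      exact H'.injOn hz.1 hpH' (by rw [hH'c, hH'c, h2, hζp])
    · rintro rfl
      exact ⟨⟨hpH', by simp [hH'c, hζp, hδ]⟩, rfl⟩
  · intro y hy hyp
    have hb : y - τ p ≠ 0 := sub_ne_zero.2 hyp
    rw [← ncard_setOf_pow_eq hm hb]
    have himg : ζ '' (W' ∩ τ ⁻¹' {y}) = {w | w ^ m = y - τ p} := by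
      ext w
      constructor
      · rintro ⟨z, ⟨hz, hzy⟩, rfl⟩
        have h1 := (hOsub z (hW'O hz)).1
        rw [show τ z = y from hzy] at h1
        exact h1.symm
      · intro hw
        have hw' : ‖w‖ < δ := by
          have h1 : ‖w‖ ^ m < δ ^ m := by
            rw [← norm_pow, show w ^ m = y - τ p from hw, ← dist_eq_norm]
            exact hy
          exact lt_of_pow_lt_pow_left₀ m hδ.le h1
        have hwt : w ∈ H'.target := hball (by simpa using hw')
        have hz := H'.map_target hwt
        have hzw : ζ (H'.symm w) = w := H'.right_inv hwt
        refine ⟨H'.symm w, ⟨⟨hz, ?_⟩, ?_⟩, hzw⟩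
        · change ζ (H'.symm w) ∈ Metric.ball (0 : ℂ) δ
          rw [hzw]
          simpa using hw'
        · have h1 := (hOsub _ hz.2).1
          rw [hzw, show w ^ m = y - τ p from hw] at h1
          simpa using h1
    rw [← himg]
    exact (InjOn.ncard_image fun z hz w hw h => H'.injOn hz.1.1 hw.1.1 h).symm

end NormalForm

/-! ### Fibres and ramification of a non-constant holomorphic map. -/

section Fibres

/-- In a compact space, a set without accumulation points is finite. -/
theorem finite_of_isolated {X : Type*} [TopologicalSpace X] [CompactSpace X] {S : Set X}
    (h : ∀ x, ∀ᶠ y in 𝓝[≠] x, y ∉ S) : S.Finite := by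
  obtain ⟨t, -, ht⟩ := isCompact_univ.elim_nhds_subcover (fun x => {y | y ≠ x → y ∉ S})
    fun x _ => eventually_nhdsWithin_iff.1 (h x)
  refine t.finite_toSet.subset fun y hy => ?_
  obtain ⟨x, hx, hyx⟩ := mem_iUnion₂.1 (ht (mem_univ y))
  by_contra hyt
  exact hyx (fun h => hyt (h ▸ hx)) hy

variable {X Y : Type*} [TopologicalSpace X] [ChartedSpace ℂ X] [IsManifold 𝓘(ℂ) ω X]
  [TopologicalSpace Y] [ChartedSpace ℂ Y] [IsManifold 𝓘(ℂ) ω Y]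

theorem tendsto_symm_punctured (e : Chart X) {x : X} (hx : x ∈ e.1.source) :
    Tendsto e.1.symm (𝓝[≠] (e.1 x)) (𝓝[≠] x) := by
  refine tendsto_nhdsWithin_iff.2 ⟨?_, ?_⟩
  · have := e.1.continuousAt_symm (e.1.map_source hx)
    rw [ContinuousAt, e.1.left_inv hx] at this
    exact this.mono_left nhdsWithin_le_nhds
  · filter_upwards [self_mem_nhdsWithin, mem_nhdsWithin_of_mem_nhds
      (e.1.open_target.mem_nhds (e.1.map_source hx))] with z hz hzt h
    exact hz (by rw [← e.1.right_inv hzt, show e.1.symm z = x from h]; rfl)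

theorem tendsto_chart_punctured (e : Chart X) {x : X} (hx : x ∈ e.1.source) :
    Tendsto e.1 (𝓝[≠] x) (𝓝[≠] (e.1 x)) := by
  refine tendsto_nhdsWithin_iff.2 ⟨(e.1.continuousAt hx).mono_left nhdsWithin_le_nhds, ?_⟩
  filter_upwards [self_mem_nhdsWithin, mem_nhdsWithin_of_mem_nhds
      (e.1.open_source.mem_nhds hx)] with y hy hys h
  exact hy (e.1.injOn hys hx h)

/-- A map that is not constant on any connected component takes each value only at isolated
points. -/
theorem eventually_ne_of_nonconstant [T2Space Y] {F : X → Y} (hF : MDifferentiable 𝓘(ℂ) 𝓘(ℂ) F)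
    (hnc : ∀ x : X, ∃ x' ∈ connectedComponent x, F x' ≠ F x) (x : X) (y : Y) :
    ∀ᶠ x' in 𝓝[≠] x, F x' ≠ y := by
  -- The dichotomy for zeros of analytic functions, applied to F - y in charts.
  have key : ∀ z, (∀ᶠ x' in 𝓝 z, F x' = y) ∨ ∀ᶠ x' in 𝓝[≠] z, F x' ≠ y := by
    intro z
    by_cases hz : F z = y
    · have hzs := mem_source_preferred z
      have hcs := mem_source_preferred (F z)
      set e := Chart.preferred z
      set c := Chart.preferred (F z)
      have hdom := mem_locDom (F := F) hzs hcs
      have hdomn := (isOpen_locDom hF.continuous e c).mem_nhds hdom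
      have ha : AnalyticAt ℂ (fun w => locMap F e c w - c.1 y) (e.1 z) :=
        (analyticOnNhd_locMap hF e c _ hdom).sub analyticAt_const
      have hcont := e.1.continuousAt hzs
      rcases ha.eventually_eq_zero_or_eventually_ne_zero with h | h
      · left
        filter_upwards [hcont.eventually (h.and hdomn), e.1.open_source.mem_nhds hzs]
          with x' h1 h2
        have h3 := sub_eq_zero.1 h1.1
        rw [locMap_apply _ _ h2] at h3
        have h4 : F x' ∈ c.1.source := by
          have := h1.2.2
          simpa [e.1.left_inv h2] using this
        exact c.1.injOn h4 (hz ▸ hcs) h3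
      · right
        filter_upwards [(tendsto_chart_punctured e hzs).eventually h,
          mem_nhdsWithin_of_mem_nhds (e.1.open_source.mem_nhds hzs)] with x' h1 h2 h3
        apply h1
        rw [locMap_apply _ _ h2, h3, sub_self]
    · right
      exact (hF.continuous.continuousAt.eventually_ne hz).filter_mono nhdsWithin_le_nhds
  rcases key x with h | h
  · exfalso
    -- The set where F is locally equal to y is open, and closed by the dichotomy. It would contain
    -- a whole connected component, on which F is not constant.
    set S := {z | ∀ᶠ x' in 𝓝 z, F x' = y} with hS
    have hSo : IsOpen S := isOpen_setOfPred_eventually_nhds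
    have hSc : IsClosed S := by
      rw [← isOpen_compl_iff, isOpen_iff_mem_nhds]
      intro z hz
      have h1 := (key z).resolve_left hz
      have h2 := eventually_nhdsWithin_iff.1 h1
      filter_upwards [h2] with x' hx' hx'S
      by_cases hxz : x' = z
      · exact hz (hxz ▸ hx'S)
      · exact hx' hxz (hx'S.self_of_nhds)
    have hsub := IsClopen.connectedComponent_subset ⟨hSc, hSo⟩ (show x ∈ S from h)
    obtain ⟨x', hx', hne⟩ := hnc x
    exact hne (((hsub hx').self_of_nhds).trans (h.self_of_nhds).symm)
  · exact h

section NonConstant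

variable {F : X → Y} (hF : MDifferentiable 𝓘(ℂ) 𝓘(ℂ) F)
  (hiso : ∀ (x : X) (y : Y), ∀ᶠ x' in 𝓝[≠] x, F x' ≠ y)

include hF hiso

theorem eventually_locMap_ne (e : Chart X) (c : Chart Y) {z : ℂ} (hz : z ∈ locDom F e c) :
    ∀ᶠ w in 𝓝[≠] z, locMap F e c w ≠ locMap F e c z := by
  have h1 := hiso (e.1.symm z) (F (e.1.symm z))
  have h2 := tendsto_symm_punctured e (e.1.map_target hz.1)
  rw [e.1.right_inv hz.1] at h2
  filter_upwards [h2.eventually h1, mem_nhdsWithin_of_mem_nhds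
    ((isOpen_locDom hF.continuous e c).mem_nhds hz)] with w hw hwd h
  exact hw (c.1.injOn hwd.2 hz.2 h)

/-- Otherwise the analytic function `deriv (locMap F e c)` would vanish near z, and the map would be
locally constant. -/
theorem eventually_deriv_locMap_ne_zero (e : Chart X) (c : Chart Y) {z : ℂ}
    (hz : z ∈ locDom F e c) : ∀ᶠ w in 𝓝[≠] z, deriv (locMap F e c) w ≠ 0 := by
  have ha := analyticOnNhd_locMap hF e c z hz
  have hne := analyticOrderAt_ne_top_of_punctured (eventually_locMap_ne hF hiso e c hz)
  rcases ha.deriv.eventually_eq_zero_or_eventually_ne_zero with h | h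
  · exfalso
    apply hne
    have hd : deriv (fun w => locMap F e c w - locMap F e c z) = deriv (locMap F e c) := by
      funext w
      rw [deriv_sub_const]
    rw [← analyticOrderAt_deriv_eq_top_iff_of_eq_zero
      (f := fun w => locMap F e c w - locMap F e c z) (ha.sub analyticAt_const) (sub_self _), hd]
    exact analyticOrderAt_eq_top.2 h
  · exact h

/-- The index is defined in the preferred charts. By the chain rule non-vanishing of the derivative
does not depend on the charts, so it may be tested in any pair. -/
theorem ramificationIndex_eq_one (e : Chart X) (c : Chart Y) {x : X} (hx : x ∈ e.1.source)
    (hc : F x ∈ c.1.source) (h : deriv (locMap F e c) (e.1 x) ≠ 0) :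
    ramificationIndex F x = 1 := by
  have hxs := mem_source_preferred x
  have hcs := mem_source_preferred (F x)
  set e' := Chart.preferred x with he'
  set c' := Chart.preferred (F x) with hc'
  have hd := mem_locDom (F := F) hx hc
  have hid : e'.1 x ∈ locDom id e' e := mem_locDom hxs hx
  have hid' : c.1 (F x) ∈ locDom id c c' := mem_locDom hc hcs
  have e1 : locMap id e' e (e'.1 x) = e.1 x := locMap_apply id e hxs
  have e2 : locMap F e c (e.1 x) = c.1 (F x) := locMap_apply F c hx
  have h1 : locMap F e' c' =ᶠ[𝓝 (e'.1 x)]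
      locMap id c c' ∘ (locMap F e c ∘ locMap id e' e) := by
    filter_upwards [(isOpen_locDom continuous_id e' e).mem_nhds hid,
      (continuousAt_locMap mdifferentiable_id hid).eventually
        ((isOpen_locDom hF.continuous e c).mem_nhds (e1 ▸ hd))] with w hw hw'
    simp only [Function.comp]
    rw [locMap, locMap, symm_locMap hw', symm_locMap hw]
    rfl
  have d1 := (analyticOnNhd_locMap (F := (id : X → X)) mdifferentiable_id e' e _ hid)
  have d2 := analyticOnNhd_locMap hF e c _ hd
  have d3 := (analyticOnNhd_locMap (F := (id : Y → Y)) mdifferentiable_id c c' _ hid')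
  have h2 : deriv (locMap F e' c') (e'.1 x) ≠ 0 := by
    have d4 : DifferentiableAt ℂ (locMap F e c) (locMap id e' e (e'.1 x)) := by
      rw [e1]; exact d2.differentiableAt
    have d5 : DifferentiableAt ℂ (locMap id c c')
        ((locMap F e c ∘ locMap id e' e) (e'.1 x)) := by
      rw [Function.comp, e1, e2]; exact d3.differentiableAt
    rw [h1.deriv_eq, deriv_comp _ d5 (d4.comp _ d1.differentiableAt),
      deriv_comp _ d4 d1.differentiableAt]
    refine mul_ne_zero ?_ (mul_ne_zero ?_ (deriv_locMap_id_ne_zero e' e hid))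
    · rw [Function.comp, e1, e2]
      exact deriv_locMap_id_ne_zero c c' hid'
    · rwa [e1]
  have h3 := (analyticOnNhd_locMap hF e' c' _
    (mem_locDom hxs hcs)).analyticOrderAt_sub_eq_one_of_deriv_ne_zero h2
  rw [locMap_apply _ _ hxs] at h3
  change (analyticOrderAt _ _).toNat = 1
  have h4 : analyticOrderAt (fun z => chartAt ℂ (F x) (F ((chartAt ℂ x).symm z)) -
      chartAt ℂ (F x) (F x)) (chartAt ℂ x x) = 1 := h3
  rw [h4]
  rfl

theorem eventually_ramificationIndex_eq_one (x : X) :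
    ∀ᶠ x' in 𝓝[≠] x, ramificationIndex F x' = 1 := by
  have hxs := mem_source_preferred x
  have hcs := mem_source_preferred (F x)
  filter_upwards [(tendsto_chart_punctured _ hxs).eventually
      (eventually_deriv_locMap_ne_zero hF hiso _ _ (mem_locDom (F := F) hxs hcs)),
    mem_nhdsWithin_of_mem_nhds ((Chart.preferred x).1.open_source.mem_nhds hxs),
    mem_nhdsWithin_of_mem_nhds (hF.continuous.continuousAt.preimage_mem_nhds
      ((Chart.preferred (F x)).1.open_source.mem_nhds hcs))] with x' h1 h2 h3
  exact ramificationIndex_eq_one hF hiso _ _ h2 h3 h1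

theorem finite_ramified [CompactSpace X] : {x | ramificationIndex F x ≠ 1}.Finite :=
  finite_of_isolated fun x => (eventually_ramificationIndex_eq_one hF hiso x).mono
    fun _ h h' => h' h

theorem finite_fibre [CompactSpace X] (y : Y) : (F ⁻¹' {y}).Finite :=
  finite_of_isolated fun x => hiso x y

/-- Near `P`, the map `F` is a branched cover of degree `ramificationIndex F P`, branched at
most at `P`. -/
theorem exists_branched_nhds_map (P : X) {W : Set X} (hW : W ∈ 𝓝 P) :
    ∃ W' ⊆ W, IsOpen W' ∧ P ∈ W' ∧ ∃ V, IsOpen V ∧ F P ∈ V ∧ W' ∩ F ⁻¹' {F P} = {P} ∧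
      ∀ y ∈ V, y ≠ F P → (W' ∩ F ⁻¹' {y}).ncard = ramificationIndex F P := by
  have hxs := mem_source_preferred P
  have hcs := mem_source_preferred (F P)
  set e := Chart.preferred P with he
  set c := Chart.preferred (F P) with hc
  have hd := mem_locDom (F := F) hxs hcs
  have hWn : e.1.symm ⁻¹' W ∩ locDom F e c ∈ 𝓝 (e.1 P) := by
    refine inter_mem ?_ ((isOpen_locDom hF.continuous e c).mem_nhds hd)
    refine (e.1.continuousAt_symm (e.1.map_source hxs)).preimage_mem_nhds ?_
    rwa [e.1.left_inv hxs]
  obtain ⟨W', hW'W, hW'o, hpW', V, hVo, hpV, hfib, hcard⟩ := exists_branched_nhds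
    (analyticOnNhd_locMap hF e c _ hd) (eventually_locMap_ne hF hiso e c hd) hWn
  rw [locMap_apply _ _ hxs] at hpV hfib hcard
  have hfe : ∀ y ∈ c.1.source, (e.1.source ∩ e.1 ⁻¹' W') ∩ F ⁻¹' {y} =
      e.1.symm '' (W' ∩ locMap F e c ⁻¹' {c.1 y}) := by
    intro y hy
    ext x
    constructor
    · rintro ⟨⟨h1, h2⟩, h3⟩
      refine ⟨e.1 x, ⟨h2, ?_⟩, e.1.left_inv h1⟩
      rw [mem_preimage, locMap_apply _ _ h1, show F x = y from h3]
      rfl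
    · rintro ⟨z, ⟨h1, h2⟩, rfl⟩
      have hz := (hW'W h1).2
      refine ⟨⟨e.1.map_target hz.1, ?_⟩, ?_⟩
      · rw [mem_preimage, e.1.right_inv hz.1]
        exact h1
      · exact c.1.injOn hz.2 hy h2
  refine ⟨e.1.source ∩ e.1 ⁻¹' W', ?_, e.1.isOpen_inter_preimage hW'o, ⟨hxs, hpW'⟩,
    c.1.source ∩ c.1 ⁻¹' V, c.1.isOpen_inter_preimage hVo, ⟨hcs, hpV⟩, ?_, ?_⟩
  · rintro x ⟨h1, h2⟩
    have := (hW'W h2).1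
    simpa [e.1.left_inv h1] using this
  · rw [hfe _ hcs, hfib, image_singleton, e.1.left_inv hxs]
  · intro y hy hyP
    rw [hfe y hy.1, InjOn.ncard_image fun z hz w hw h =>
      e.1.symm.injOn (hW'W hz.1).2.1 (hW'W hw.1).2.1 h,
      hcard _ hy.2 fun h => hyP (c.1.injOn hy.1 hcs h), ← locMap_apply F c hxs]
    rw [locMap_apply F c hxs]
    rfl

/-- As F is a closed map, fibres near that of Q lie in the union of branched neighbourhoods of the
points above Q. This bounds the fibres locally, and compactness of Y makes the bound uniform. -/
theorem exists_fibre_bound [CompactSpace X] [T2Space X] [CompactSpace Y] [T2Space Y] :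
    ∃ N : ℕ, ∀ y : Y, (F ⁻¹' {y}).ncard ≤ N := by
  classical
  have hloc : ∀ Q : Y, ∃ V ∈ 𝓝 Q, ∃ N : ℕ, ∀ y ∈ V, (F ⁻¹' {y}).ncard ≤ N := by
    intro Q
    have hfin := finite_fibre hF hiso Q
    choose W _ hWo hPW V hVo hPV hfib hcard using fun P : X =>
      exists_branched_nhds_map hF hiso P (univ_mem (f := 𝓝 P))
    set G := ⋃ P ∈ hfin.toFinset, W P with hG
    have hGo : IsOpen G := isOpen_biUnion fun P _ => hWo P
    have hclosed : IsClosed (F '' Gᶜ) :=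
      (hGo.isClosed_compl.isCompact.image hF.continuous).isClosed
    have hQ : Q ∈ (F '' Gᶜ)ᶜ := by
      rintro ⟨x, hx, hxQ⟩
      exact hx (mem_iUnion₂.2 ⟨x, by simpa using hxQ, hPW x⟩)
    -- The summand 1 covers the fibre of Q itself, which has one point in each neighbourhood; so no
    -- lower bound on the ramification index is needed.
    refine ⟨(F '' Gᶜ)ᶜ ∩ ⋂ P ∈ hfin.toFinset, V P, inter_mem (hclosed.isOpen_compl.mem_nhds hQ)
      ((Filter.biInter_finset_mem _).2 fun P hP => (hVo P).mem_nhds ?_),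
      ∑ P ∈ hfin.toFinset, (ramificationIndex F P + 1), ?_⟩
    · have : F P = Q := by simpa using hP
      exact this ▸ hPV P
    · intro y hy
      have h1 : F ⁻¹' {y} ⊆ ⋃ P ∈ hfin.toFinset, (W P ∩ F ⁻¹' {y}) := by
        intro x hx
        have hxG : x ∈ G := by
          by_contra hxG
          exact hy.1 ⟨x, hxG, hx⟩
        obtain ⟨P, hP, hxP⟩ := mem_iUnion₂.1 hxG
        exact mem_iUnion₂.2 ⟨P, hP, hxP, hx⟩
      have h2 : (⋃ P ∈ hfin.toFinset, (W P ∩ F ⁻¹' {y})).Finite :=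
        Set.Finite.biUnion (hfin.toFinset.finite_toSet) fun P _ =>
          (finite_fibre hF hiso y).subset inter_subset_right
      refine (ncard_le_ncard h1 h2).trans ?_
      refine (Finset.set_ncard_biUnion_le _ _).trans (Finset.sum_le_sum fun P hP => ?_)
      have hPQ : F P = Q := by simpa using hP
      by_cases hyQ : y = F P
      · rw [hyQ, hfib P, ncard_singleton]
        omega
      · rw [hcard P y (mem_iInter₂.1 hy.2 P hP) hyQ]
        omega
  choose V hV N hN using hloc
  obtain ⟨t, -, ht⟩ := isCompact_univ.elim_nhds_subcover V fun Q _ => hV Q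
  refine ⟨∑ Q ∈ t, N Q, fun y => ?_⟩
  obtain ⟨Q, hQ, hy⟩ := mem_iUnion₂.1 (ht (mem_univ y))
  exact (hN Q y hy).trans (Finset.single_le_sum (f := N) (fun _ _ => Nat.zero_le _) hQ)

end NonConstant

end Fibres

/-! ### The Dirichlet density and the divergence free field conj(τ') v. -/

section DivergenceFree

/-- The density of the `W^{1,2}` norm. -/
def dirichlet (w : ℂ → ℝ) (z : ℂ) : ℝ :=
  w z ^ 2 + fderiv ℝ w z 1 ^ 2 + fderiv ℝ w z Complex.I ^ 2

theorem dirichlet_nonneg (w : ℂ → ℝ) (z : ℂ) : 0 ≤ dirichlet w z := by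
  unfold dirichlet; positivity

theorem fderiv_apply_eq (w : ℂ → ℝ) (z h : ℂ) :
    fderiv ℝ w z h = h.re * fderiv ℝ w z 1 + h.im * fderiv ℝ w z Complex.I := by
  have : h = h.re • (1 : ℂ) + h.im • Complex.I := by
    simp [Complex.re_add_im]
  conv_lhs => rw [this]
  simp only [map_add, map_smul, smul_eq_mul]

theorem sq_fderiv_apply_le (w : ℂ → ℝ) (z h : ℂ) :
    fderiv ℝ w z h ^ 2 ≤ ‖h‖ ^ 2 * dirichlet w z := by
  rw [fderiv_apply_eq, ← Complex.normSq_eq_norm_sq, Complex.normSq_apply, dirichlet]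
  nlinarith [sq_nonneg (h.re * fderiv ℝ w z Complex.I - h.im * fderiv ℝ w z 1),
    mul_nonneg (sq_nonneg h.re) (sq_nonneg (w z)), mul_nonneg (sq_nonneg h.im) (sq_nonneg (w z))]

theorem continuous_dirichlet {w : ℂ → ℝ} (hw : ContDiff ℝ ∞ w) : Continuous (dirichlet w) := by
  have h1 := hw.continuous
  have h2 := hw.continuous_fderiv (by simp)
  unfold dirichlet
  fun_prop

theorem integrable_dirichlet {w : ℂ → ℝ} (hw : ContDiff ℝ ∞ w) (hc : HasCompactSupport w) :
    Integrable (dirichlet w) := by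
  refine (continuous_dirichlet hw).integrable_of_hasCompactSupport (hc.mono' fun z hz => ?_)
  by_contra hzs
  have h1 : w z = 0 := image_eq_zero_of_notMem_tsupport hzs
  have h2 : fderiv ℝ w z = 0 := by
    by_contra h
    exact hzs (support_fderiv_subset ℝ h)
  exact hz (by simp [dirichlet, h1, h2])

variable {τ : ℂ → ℂ} {U : Set ℂ}

theorem measurable_indicator_of_continuousOn (hU : IsOpen U) {f : ℂ → ℝ} (hf : ContinuousOn f U) :
    Measurable (U.indicator f) := by
  classical
  rw [← piecewise_eq_indicator]
  exact hf.measurable_piecewise continuousOn_const hU.measurableSet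

theorem integrableOn_of_support (hU : IsOpen U) {f : ℂ → ℝ} (hf : ContinuousOn f U) {M : Set ℂ}
    (hM : IsCompact M) (hMU : M ⊆ U) (h : ∀ z ∈ U, z ∉ M → f z = 0) : IntegrableOn f U := by
  have h1 : IntegrableOn f M := (hf.mono hMU).integrableOn_compact hM
  refine (integrableOn_iff_integrable_of_support_subset (f := U.indicator f) (s := U)
    support_indicator_subset).1 ?_ |>.integrableOn.congr_fun (fun z hz => indicator_of_mem hz f)
    hU.measurableSet
  refine Integrable.integrableOn ?_
  refine (integrableOn_iff_integrable_of_support_subset (s := M) fun z hz => ?_).1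
    (h1.congr_fun (fun z hz => (indicator_of_mem (hMU hz) f).symm) hM.measurableSet)
  by_contra hzM
  have hzU : z ∈ U := support_indicator_subset hz
  exact hz (by rw [indicator_of_mem hzU, h z hzU hzM])

theorem contDiff_of_support (hU : IsOpen U) {f : ℂ → ℝ} (hf : ContDiffOn ℝ ∞ f U) {M : Set ℂ}
    (hM : IsClosed M) (hMU : M ⊆ U) (h : ∀ z, z ∉ M → f z = 0) : ContDiff ℝ ∞ f := by
  rw [contDiff_iff_contDiffAt]
  intro z
  by_cases hz : z ∈ U
  · exact hf.contDiffAt (hU.mem_nhds hz)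
  · have : f =ᶠ[𝓝 z] fun _ => 0 := by
      filter_upwards [hM.isOpen_compl.mem_nhds fun h => hz (hMU h)] with y hy
      exact h y hy
    exact contDiffAt_const.congr_of_eventuallyEq this

/-- The conjugate of a holomorphic function is a divergence free vector field. -/
theorem integral_fderiv_conj_deriv_eq_zero (hU : IsOpen U) (hτ : AnalyticOnNhd ℂ τ U) (v : ℂ)
    {H : ℂ → ℝ} (hH : ContDiff ℝ ∞ H) (hc : HasCompactSupport H) (hs : tsupport H ⊆ U) :
    ∫ z, fderiv ℝ H z (star (deriv τ z) * v) = 0 := by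
  -- L1 and L2 give the real components of conj(τ') v. By the Cauchy–Riemann equations its
  -- divergence vanishes, so the derivative of H along it is the divergence of H conj(τ') v, and the
  -- integral of a compactly supported divergence is zero.
  set L1 : ℂ →L[ℝ] ℝ := Complex.reCLM ∘L (ContinuousLinearMap.mul ℝ ℂ v) ∘L
    (Complex.conjCLE : ℂ →L[ℝ] ℂ) with hL1
  set L2 : ℂ →L[ℝ] ℝ := Complex.imCLM ∘L (ContinuousLinearMap.mul ℝ ℂ v) ∘L
    (Complex.conjCLE : ℂ →L[ℝ] ℂ) with hL2
  have hL1a : ∀ z, L1 z = (star z * v).re := fun z => by simp [hL1, mul_comm]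
  have hL2a : ∀ z, L2 z = (star z * v).im := fun z => by simp [hL2, mul_comm]
  have hd : ∀ z ∈ U, HasFDerivAt (deriv τ)
      (((1 : ℂ →L[ℂ] ℂ).smulRight (deriv (deriv τ) z)).restrictScalars ℝ : ℂ →L[ℝ] ℂ) z :=
    fun z hz => ((hτ.deriv z hz).differentiableAt.hasDerivAt.hasFDerivAt).restrictScalars ℝ
  have hds : ContDiffOn ℝ ∞ (deriv τ) U := fun z hz =>
    (((hτ.deriv z hz).restrictScalars (𝕜 := ℝ)).contDiffAt).contDiffWithinAt
  have hK : ∀ L : ℂ →L[ℝ] ℝ, ContDiff ℝ ∞ (fun z => L (deriv τ z) * H z) ∧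
      HasCompactSupport (fun z => L (deriv τ z) * H z) := fun L => by
    have hcs : HasCompactSupport (fun z => L (deriv τ z) * H z) := hc.mul_left
    refine ⟨contDiff_of_support hU (((show ContDiff ℝ ∞ L from L.contDiff).comp_contDiffOn hds).mul hH.contDiffOn)
      (isClosed_tsupport H) hs fun z hz => ?_, hcs⟩
    rw [image_eq_zero_of_notMem_tsupport hz, mul_zero]
  have hi1 := integral_fderiv_eq_zero ((hK L1).1.of_le (by norm_cast)) (hK L1).2 (1 : ℂ)
  have hi2 := integral_fderiv_eq_zero ((hK L2).1.of_le (by norm_cast)) (hK L2).2 Complex.I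
  have hint : ∀ (L : ℂ →L[ℝ] ℝ) (v' : ℂ), Integrable fun z => fderiv ℝ (fun z => L (deriv τ z) * H z) z v' :=
    fun L v' => (((hK L).1.continuous_fderiv (by simp)).clm_apply
      continuous_const).integrable_of_hasCompactSupport ((hK L).2.fderiv_apply ℝ v')
  have hsum := integral_add (hint L1 1) (hint L2 Complex.I)
  rw [hi1, hi2, add_zero] at hsum
  rw [← hsum]
  refine integral_congr_ae (ae_of_all _ fun z => ?_)
  by_cases hz : z ∈ U
  · have hHd : DifferentiableAt ℝ H z := hH.differentiable (by simp) z
    have hLd : ∀ L : ℂ →L[ℝ] ℝ, ∀ v', fderiv ℝ (fun z => L (deriv τ z) * H z) z v' =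
        L (deriv τ z) * fderiv ℝ H z v' + H z * L (v' * deriv (deriv τ) z) := by
      intro L v'
      have h1 := (L.hasFDerivAt.comp z (hd z hz)).mul hHd.hasFDerivAt
      have h2 : fderiv ℝ (fun z => L (deriv τ z) * H z) z = _ := h1.fderiv
      rw [h2]
      simp
    beta_reduce
    rw [hLd L1 1, hLd L2 Complex.I, fderiv_apply_eq]
    simp only [hL1a, hL2a]
    simp
    ring
  · have hz' : z ∉ tsupport H := fun h => hz (hs h)
    have h0 : ∀ L : ℂ →L[ℝ] ℝ, (fun z => L (deriv τ z) * H z) =ᶠ[𝓝 z] fun _ => 0 := fun L => by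
      filter_upwards [(isClosed_tsupport H).isOpen_compl.mem_nhds hz'] with y hy
      rw [image_eq_zero_of_notMem_tsupport hy, mul_zero]
    have h1 : fderiv ℝ H z = 0 := by
      by_contra h
      exact hz' (support_fderiv_subset ℝ h)
    simp [(h0 L1).fderiv_eq, (h0 L2).fderiv_eq, h1]

end DivergenceFree

/-! ### The weak gradient of a push-forward and its energy. -/

section PushEnergy

variable {τ : ℂ → ℂ} {U : Set ℂ} {N : ℕ} (hU : IsOpen U) (hτ : AnalyticOnNhd ℂ τ U)
  (hnc : ∀ z ∈ U, ∀ᶠ w in 𝓝[≠] z, deriv τ w ≠ 0) (hfin : ∀ y, (U ∩ τ ⁻¹' {y}).Finite)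
  (hN : ∀ y, (U ∩ τ ⁻¹' {y}).ncard ≤ N)

theorem fibreSum_congr {M : Type*} [AddCommMonoid M] {f g : ℂ → M} {y : ℂ}
    (h : ∀ z ∈ U, τ z = y → f z = g z) : fibreSum τ U f y = fibreSum τ U g y :=
  finsum_mem_congr rfl fun z hz => h z hz.1 hz.2

include hfin in
theorem fibreSum_mul (f : ℂ → ℝ) (φ : ℂ → ℝ) (y : ℂ) :
    fibreSum τ U f y * φ y = fibreSum τ U (fun z => f z * φ (τ z)) y := by
  rw [fibreSum_eq_sum (hfin y), fibreSum_eq_sum (hfin y), Finset.sum_mul]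
  refine Finset.sum_congr rfl fun z hz => ?_
  have : z ∈ U ∩ τ ⁻¹' {y} := by simpa using hz
  rw [show τ z = y from this.2]

include hU hτ hnc hfin hN

/-- The `L²` bound for sums over fibres. -/
theorem memLp_fibreSum {f : ℂ → ℝ} (hf : Measurable f) {G : ℂ → ℝ} (hG : Integrable G)
    (hG0 : ∀ z, 0 ≤ G z) {L : Set ℂ} (hL : MeasurableSet L)
    (hb : ∀ z ∈ U, τ z ∈ L → ‖deriv τ z‖ ^ 2 * f z ^ 2 ≤ G z) :
    MemLp (fibreSum τ U f) 2 (volume.restrict L) ∧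
      ∫ y in L, fibreSum τ U f y ^ 2 ≤ N * ∫ z, G z := by
  have hsq : ∀ x : ℝ, ‖x‖ₑ ^ 2 = ENNReal.ofReal (x ^ 2) := fun x => by
    rw [← ofReal_norm, ← ENNReal.ofReal_pow (norm_nonneg _), Real.norm_eq_abs, sq_abs]
  have hcont : ContinuousOn τ U := hτ.continuousOn
  have hUL : MeasurableSet (U ∩ τ ⁻¹' L) := by
    have := (hcont.domRestrict.measurable hL)
    have h2 := (MeasurableEmbedding.subtype_coe hU.measurableSet).measurableSet_image' this
    convert h2 using 1
    ext z
    simp [and_comm]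
  have hfm : Measurable ((U ∩ τ ⁻¹' L).indicator fun z => ‖f z‖ₑ ^ 2) :=
    (hf.enorm.pow_const 2).indicator hUL
  -- Cauchy–Schwarz in each fibre, followed by the area formula for f² on the part of U above L.
  have hkey : ∫⁻ y in L, ‖fibreSum τ U f y‖ₑ ^ 2 ≤ ENNReal.ofReal (N * ∫ z, G z) := by
    calc ∫⁻ y in L, ‖fibreSum τ U f y‖ₑ ^ 2
        ≤ ∫⁻ y in L, N * fibreSum τ U (fun z => ‖f z‖ₑ ^ 2) y :=
          lintegral_mono fun y => enorm_fibreSum_sq_le hU hτ hnc hfin hN f y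
      _ = N * ∫⁻ y in L, fibreSum τ U (fun z => ‖f z‖ₑ ^ 2) y :=
          lintegral_const_mul' _ _ (by simp)
      _ ≤ N * ∫⁻ y, fibreSum τ U ((U ∩ τ ⁻¹' L).indicator fun z => ‖f z‖ₑ ^ 2) y := by
          gcongr _ * ?_
          rw [← lintegral_indicator hL]
          refine lintegral_mono fun y => ?_
          by_cases hy : y ∈ L
          · rw [indicator_of_mem hy]
            refine le_of_eq (fibreSum_congr fun z hz hzy => ?_)
            have : z ∈ U ∩ τ ⁻¹' L := ⟨hz, by rw [mem_preimage, hzy]; exact hy⟩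
            rw [indicator_of_mem this]
          · rw [indicator_of_notMem hy]
            exact zero_le
      _ = N * ∫⁻ z in U, ENNReal.ofReal (‖deriv τ z‖ ^ 2) *
            (U ∩ τ ⁻¹' L).indicator (fun z => ‖f z‖ₑ ^ 2) z := by
          rw [(lintegral_fibreSum hU hτ hnc hfin hfm).2]
      _ ≤ N * ∫⁻ z in U, ENNReal.ofReal (G z) := by
          gcongr _ * ?_
          refine setLIntegral_mono' hU.measurableSet fun z hz => ?_
          by_cases hzL : τ z ∈ L
          · have : z ∈ U ∩ τ ⁻¹' L := ⟨hz, hzL⟩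
            rw [indicator_of_mem this, hsq, ← ENNReal.ofReal_mul (by positivity)]
            exact ENNReal.ofReal_le_ofReal (hb z hz hzL)
          · have : z ∉ U ∩ τ ⁻¹' L := fun h => hzL h.2
            rw [indicator_of_notMem this, mul_zero]
            exact zero_le
      _ ≤ N * ∫⁻ z, ENNReal.ofReal (G z) := by
          gcongr _ * ?_
          exact setLIntegral_le_lintegral _ _
      _ = ENNReal.ofReal (N * ∫ z, G z) := by
          rw [← ofReal_integral_eq_lintegral_ofReal hG (ae_of_all _ hG0),
            ENNReal.ofReal_mul (by positivity), ENNReal.ofReal_natCast]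
  have hmeas : AEStronglyMeasurable (fibreSum τ U f) (volume.restrict L) :=
    (aemeasurable_fibreSum hU hτ hnc hfin hf).aestronglyMeasurable.restrict
  have hmem : MemLp (fibreSum τ U f) 2 (volume.restrict L) := by
    refine ⟨hmeas, ?_⟩
    rw [eLpNorm_lt_top_iff_lintegral_rpow_enorm_lt_top (by norm_num) (by norm_num)]
    refine lt_of_le_of_lt (le_of_eq_of_le ?_ hkey) ENNReal.ofReal_lt_top
    simp
  refine ⟨hmem, ?_⟩
  rw [integral_eq_lintegral_of_nonneg_ae (ae_of_all _ fun _ => sq_nonneg _)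
    (hmeas.pow 2)]
  simp only [hsq] at hkey
  exact ENNReal.toReal_le_of_le_ofReal
    (mul_nonneg (Nat.cast_nonneg _) (integral_nonneg hG0)) hkey

/-- The push-forward of a compactly supported smooth function under a holomorphic map has a square
integrable gradient, controlled by the `W^{1,2}` norm of the function. -/
theorem hasL2Gradient_fibreSum (V : Opens ℂ) {K : Set ℂ}
    (hK : ∀ L ⊆ (V : Set ℂ), IsCompact L → IsCompact (K ∩ (U ∩ τ ⁻¹' L)))
    {L : Set ℂ} (hLV : L ⊆ V) (hL : IsCompact L) :
    ∃ C : ℝ, 0 ≤ C ∧ ∀ w : ℂ → ℝ, ContDiff ℝ ∞ w → HasCompactSupport w → tsupport w ⊆ K →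
      ∃ p q : ℂ → ℝ, HasL2Gradient (ofFunLocal V (fibreSum τ U w)) (fibreSum τ U w) p q ∧
        ∫ y in L, (fibreSum τ U w y ^ 2 + p y ^ 2 + q y ^ 2) ≤ C * ∫ z, dirichlet w z := by
  have hdc : ContinuousOn (fun z => ‖deriv τ z‖ ^ 2) U := (hτ.deriv.continuousOn.norm).pow 2
  have hbd : ∀ L ⊆ (V : Set ℂ), IsCompact L → ∃ B : ℝ, 0 ≤ B ∧
      ∀ z ∈ K ∩ (U ∩ τ ⁻¹' L), ‖deriv τ z‖ ^ 2 ≤ B := by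
    intro L hLV hL
    obtain ⟨B, hB⟩ := (hK L hLV hL).exists_bound_of_continuousOn
      (hdc.mono fun z hz => hz.2.1)
    refine ⟨max B 0, le_max_right _ _, fun z hz => ((le_abs_self _).trans (hB z hz)).trans
      (le_max_left _ _)⟩
  -- The L² part needs a bound for the Jacobian |τ'|², which holds on the compact part of K above L.
  have hfst : ∀ w : ℂ → ℝ, ContDiff ℝ ∞ w → HasCompactSupport w → tsupport w ⊆ K →
      ∀ L ⊆ (V : Set ℂ), IsCompact L → ∀ B : ℝ, 0 ≤ B →
      (∀ z ∈ K ∩ (U ∩ τ ⁻¹' L), ‖deriv τ z‖ ^ 2 ≤ B) →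
      MemLp (fibreSum τ U w) 2 (volume.restrict L) ∧
        ∫ y in L, fibreSum τ U w y ^ 2 ≤ N * (B * ∫ z, dirichlet w z) := by
    intro w hw hwc hwK L hLV hL B hB0 hB
    rw [← integral_const_mul]
    refine memLp_fibreSum hU hτ hnc hfin hN hw.continuous.measurable
      ((integrable_dirichlet hw hwc).const_mul B)
      (fun z => mul_nonneg hB0 (dirichlet_nonneg w z)) hL.measurableSet fun z hz hzL => ?_
    by_cases hzK : z ∈ K
    · refine mul_le_mul (hB z ⟨hzK, hz, hzL⟩) ?_ (sq_nonneg _) hB0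
      unfold dirichlet
      nlinarith [sq_nonneg (fderiv ℝ w z 1), sq_nonneg (fderiv ℝ w z Complex.I)]
    · rw [image_eq_zero_of_notMem_tsupport fun h => hzK (hwK h)]
      simpa using mul_nonneg hB0 (dirichlet_nonneg w z)
  have hsnd : ∀ w : ℂ → ℝ, ContDiff ℝ ∞ w → HasCompactSupport w → tsupport w ⊆ K →
      ∀ v : ℂ, ‖v‖ = 1 → ∃ p : ℂ → ℝ,
      (∀ L : Set ℂ, MeasurableSet L → MemLp p 2 (volume.restrict L) ∧
        ∫ y in L, p y ^ 2 ≤ N * ∫ z, dirichlet w z) ∧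
      ∀ φ : 𝓓(V, ℝ), ∫ y, fibreSum τ U w y * fderiv ℝ φ y v = - ∫ y, p y * φ y := by
    intro w hw hwc hwK v hv
    have hcont : ContinuousOn τ U := hτ.continuousOn
    have hwd : ContinuousOn (fun z => fderiv ℝ w z (star (deriv τ z) * v)) U :=
      (hw.continuous_fderiv (by simp)).continuousOn.clm_apply
        ((hτ.deriv.continuousOn.star).mul continuousOn_const)
    -- Where τ is invertible, the derivative of w ∘ τ⁻¹ along v is dw(v/τ') = dw(conj(τ') v)/|τ'|².
    -- At critical points division by zero gives f the value 0, which is consistent with `hfU`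
    -- because both sides vanish there.
    set f : ℂ → ℝ := fun z => U.indicator (fun z => fderiv ℝ w z (star (deriv τ z) * v)) z /
      U.indicator (fun z => ‖deriv τ z‖ ^ 2) z with hf
    have hfm : Measurable f := (measurable_indicator_of_continuousOn hU hwd).div
      (measurable_indicator_of_continuousOn hU hdc)
    have hfU : ∀ z ∈ U, ‖deriv τ z‖ ^ 2 * f z = fderiv ℝ w z (star (deriv τ z) * v) := by
      intro z hz
      simp only [hf, indicator_of_mem hz]
      by_cases h0 : deriv τ z = 0
      · simp [h0]
      · have : ‖deriv τ z‖ ^ 2 ≠ 0 := by simpa using h0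
        field_simp
    refine ⟨fibreSum τ U f, fun L hL => ?_, fun φ => ?_⟩
    · refine memLp_fibreSum hU hτ hnc hfin hN hfm (integrable_dirichlet hw hwc)
        (dirichlet_nonneg w) hL fun z hz hzL => ?_
      by_cases h0 : deriv τ z = 0
      · simpa [h0] using dirichlet_nonneg w z
      -- Conformal invariance: (|τ'|² f)² ≤ |τ'|² · `dirichlet w`, and one factor |τ'|² cancels.
      -- Hence no bound on τ' and no compactness of L is needed for the gradient.
      · have h1 := sq_fderiv_apply_le w z (star (deriv τ z) * v)
        rw [← hfU z hz, norm_mul, hv, mul_one, norm_star] at h1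
        have h2 : 0 < ‖deriv τ z‖ ^ 2 := by positivity
        nlinarith
    · have hφs := testFunction_smooth φ
      set M := K ∩ (U ∩ τ ⁻¹' tsupport φ) with hM
      have hMc : IsCompact M := hK _ φ.tsupport_subset φ.hasCompactSupport
      have hMU : M ⊆ U := fun z hz => hz.2.1
      have hτs : ContDiffOn ℝ ∞ τ U := fun z hz =>
        (((hτ z hz).restrictScalars (𝕜 := ℝ)).contDiffAt).contDiffWithinAt
      have hwz : ∀ z ∉ K, w z = 0 := fun z hz =>
        image_eq_zero_of_notMem_tsupport fun h => hz (hwK h)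
      have hwz' : ∀ z ∉ K, fderiv ℝ w z = 0 := fun z hz => by
        by_contra h
        exact hz (hwK (support_fderiv_subset ℝ h))
      have hφz : ∀ y ∉ tsupport φ, φ y = 0 := fun y hy => image_eq_zero_of_notMem_tsupport hy
      have hφz' : ∀ y ∉ tsupport φ, fderiv ℝ φ y = 0 := fun y hy => by
        by_contra h
        exact hy (support_fderiv_subset ℝ h)
      -- H is w · (φ ∘ τ) extended by zero. It is smooth with support in the compact set M, because
      -- the part of the support of w above the support of φ stays inside U.
      set H : ℂ → ℝ := fun z => w z * U.indicator (fun z => φ (τ z)) z with hH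
      have hHU : ∀ z ∈ U, H z = w z * φ (τ z) := fun z hz => by
        simp only [hH, indicator_of_mem hz]
      have hHM : ∀ z, z ∉ M → H z = 0 := by
        intro z hz
        by_cases hzK : z ∈ K
        · by_cases hzU : z ∈ U
          · rw [hHU z hzU, hφz _ fun h => hz ⟨hzK, hzU, h⟩, mul_zero]
          · simp only [hH, indicator_of_notMem hzU, mul_zero]
        · simp only [hH, hwz z hzK, zero_mul]
      have hHs : ContDiff ℝ ∞ H := by
        refine contDiff_of_support hU ?_ hMc.isClosed hMU hHM
        exact (hw.contDiffOn.mul (hφs.comp_contDiffOn hτs)).congr hHU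
      have hHt : tsupport H ⊆ M := closure_minimal (fun z hz => by
        by_contra h
        exact hz (hHM z h)) hMc.isClosed
      have hHc : HasCompactSupport H := hMc.of_isClosed_subset (isClosed_tsupport H) hHt
      have hdiv := integral_fderiv_conj_deriv_eq_zero hU hτ v hHs hHc (hHt.trans hMU)
      have hφd : ContinuousOn (fun z => fderiv ℝ φ (τ z) v) U :=
        ((hφs.continuous_fderiv (by simp)).comp_continuousOn hcont).clm_apply continuousOn_const
      -- As conj(τ') v τ' = |τ'|² v, the product rule produces both terms of the weak derivative
      -- identity, each with the Jacobian factor required by the area formula.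
      have hpt : ∀ z ∈ U, fderiv ℝ H z (star (deriv τ z) * v) =
          ‖deriv τ z‖ ^ 2 * (w z * fderiv ℝ φ (τ z) v) +
            ‖deriv τ z‖ ^ 2 * (f z * φ (τ z)) := by
        intro z hz
        have h1 : H =ᶠ[𝓝 z] fun z => w z * φ (τ z) := by
          filter_upwards [hU.mem_nhds hz] with y hy
          exact hHU y hy
        have h2 := ((hw.differentiable (by simp) z).hasFDerivAt).mul
          (((hφs.differentiable (by simp) (τ z)).hasFDerivAt).comp z
            ((hτ z hz).differentiableAt.hasDerivAt.hasFDerivAt.restrictScalars ℝ))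
        have h3 : fderiv ℝ (fun z => w z * φ (τ z)) z = _ := h2.fderiv
        have h4 : star (deriv τ z) * v * deriv τ z = (‖deriv τ z‖ ^ 2) • v := by
          have := Complex.conj_mul' (deriv τ z)
          simp only [Complex.real_smul, Complex.ofReal_pow, ← this, starRingEnd_apply]
          ring
        rw [h1.fderiv_eq, h3, ← mul_assoc _ (f z), hfU z hz]
        simp only [add_apply, smul_apply, ContinuousLinearMap.comp_apply,
          ContinuousLinearMap.coe_restrictScalars', ContinuousLinearMap.toSpanSingleton_apply, smul_eq_mul, Function.comp]
        rw [h4]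
        rw [map_smul, smul_eq_mul]
        ring
      have hi1 : IntegrableOn (fun z => ‖deriv τ z‖ ^ 2 * (w z * fderiv ℝ φ (τ z) v)) U := by
        refine integrableOn_of_support hU (hdc.mul (hw.continuous.continuousOn.mul hφd)) hMc hMU
          fun z hzU hz => ?_
        by_cases hzK : z ∈ K
        · rw [hφz' _ fun h => hz ⟨hzK, hzU, h⟩]
          simp
        · simp [hwz z hzK]
      have hi2 : IntegrableOn (fun z => ‖deriv τ z‖ ^ 2 * (f z * φ (τ z))) U := by
        have : IntegrableOn (fun z => fderiv ℝ w z (star (deriv τ z) * v) * φ (τ z)) U := by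
          refine integrableOn_of_support hU
            (hwd.mul (hφs.continuous.comp_continuousOn hcont)) hMc hMU fun z hzU hz => ?_
          by_cases hzK : z ∈ K
          · rw [hφz _ fun h => hz ⟨hzK, hzU, h⟩, mul_zero]
          · simp [hwz' z hzK]
        refine this.congr_fun (fun z hz => ?_) hU.measurableSet
        simp only
        rw [← hfU z hz, mul_assoc]
      have hUint : ∫ z in U, fderiv ℝ H z (star (deriv τ z) * v) = 0 := by
        rw [setIntegral_eq_integral_of_forall_compl_eq_zero, hdiv]
        intro z hz
        have : fderiv ℝ H z = 0 := by
          by_contra h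
          exact hz (hMU (hHt (support_fderiv_subset ℝ h)))
        rw [this]
        rfl
      rw [setIntegral_congr_fun hU.measurableSet hpt, integral_add hi1 hi2] at hUint
      have hg1 : Measurable (U.indicator fun z => w z * fderiv ℝ φ (τ z) v) :=
        measurable_indicator_of_continuousOn hU (hw.continuous.continuousOn.mul hφd)
      have hg2 : Measurable (fun z => f z * U.indicator (fun z => φ (τ z)) z) :=
        hfm.mul (measurable_indicator_of_continuousOn hU (hφs.continuous.comp_continuousOn hcont))
      have e1 : ∀ z ∈ U, ‖deriv τ z‖ ^ 2 * U.indicator (fun z => w z * fderiv ℝ φ (τ z) v) z =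
          ‖deriv τ z‖ ^ 2 * (w z * fderiv ℝ φ (τ z) v) := fun z hz => by
        rw [indicator_of_mem hz]
      have e2 : ∀ z ∈ U, ‖deriv τ z‖ ^ 2 * (f z * U.indicator (fun z => φ (τ z)) z) =
          ‖deriv τ z‖ ^ 2 * (f z * φ (τ z)) := fun z hz => by
        rw [indicator_of_mem hz]
      have r1 := (integral_fibreSum hU hτ hnc hfin hg1
        (hi1.congr_fun (fun z hz => (e1 z hz).symm) hU.measurableSet)).2
      have r2 := (integral_fibreSum hU hτ hnc hfin hg2
        (hi2.congr_fun (fun z hz => (e2 z hz).symm) hU.measurableSet)).2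
      rw [setIntegral_congr_fun hU.measurableSet e1] at r1
      rw [setIntegral_congr_fun hU.measurableSet e2] at r2
      rw [← r1, ← r2] at hUint
      rw [← eq_neg_iff_add_eq_zero] at hUint
      have t1 : ∀ y, fibreSum τ U w y * fderiv ℝ φ y v =
          fibreSum τ U (U.indicator fun z => w z * fderiv ℝ φ (τ z) v) y := fun y => by
        rw [fibreSum_mul hfin w fun y => fderiv ℝ φ y v]
        exact fibreSum_congr fun z hz _ => by rw [indicator_of_mem hz]
      have t2 : ∀ y, fibreSum τ U f y * φ y =
          fibreSum τ U (fun z => f z * U.indicator (fun z => φ (τ z)) z) y := fun y => by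
        rw [fibreSum_mul hfin f φ]
        exact fibreSum_congr fun z hz _ => by rw [indicator_of_mem hz]
      simp_rw [t1, t2]
      exact hUint
  obtain ⟨B, hB0, hB⟩ := hbd L hLV hL
  refine ⟨N * B + N + N, by positivity, fun w hw hwc hwK => ?_⟩
  obtain ⟨p, hp, hpd⟩ := hsnd w hw hwc hwK 1 (by simp)
  obtain ⟨q, hq, hqd⟩ := hsnd w hw hwc hwK Complex.I (by simp)
  have hloc : IsL2Loc V (fibreSum τ U w) := by
    intro L' hL' hLV'
    obtain ⟨B', hB0', hB'⟩ := hbd L' hLV' hL'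
    exact (hfst w hw hwc hwK L' hLV' hL' B' hB0' hB').1
  have hgiv := isGivenBy_ofFunLocal hloc.locallyIntegrableOn
  have hpl : IsL2Loc V p := fun L' hL' _ => (hp L' hL'.measurableSet).1
  have hql : IsL2Loc V q := fun L' hL' _ => (hq L' hL'.measurableSet).1
  have hgrad : HasL2Gradient (ofFunLocal V (fibreSum τ U w)) (fibreSum τ U w) p q := by
    refine ⟨⟨hloc, hgiv⟩, ⟨hpl, hpl.locallyIntegrableOn, fun φ => ?_⟩,
      hql, hql.locallyIntegrableOn, fun φ => ?_⟩
    · rw [lineDeriv_apply, hgiv.2]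
      simp_rw [testFunction_lineDeriv_apply]
      rw [hpd φ, neg_neg]
    · rw [lineDeriv_apply, hgiv.2]
      simp_rw [testFunction_lineDeriv_apply]
      rw [hqd φ, neg_neg]
  refine ⟨p, q, hgrad, ?_⟩
  have s1 := hloc.integrableOn_sq hL hLV
  have s2 := hpl.integrableOn_sq hL hLV
  have s3 := hql.integrableOn_sq hL hLV
  have hsum : ∫ y in L, (fibreSum τ U w y ^ 2 + p y ^ 2 + q y ^ 2) =
      (∫ y in L, fibreSum τ U w y ^ 2) + (∫ y in L, p y ^ 2) + ∫ y in L, q y ^ 2 := by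
    rw [← integral_add s1 s2]
    exact integral_add (s1.add s2) s3
  rw [hsum]
  have b1 := (hfst w hw hwc hwK L hLV hL B hB0 hB).2
  have b2 := (hp L hL.measurableSet).2
  have b3 := (hq L hL.measurableSet).2
  linarith

end PushEnergy

/-! ### Energies of distributions on compact sets. -/

section Energy

variable {Ω : Opens ℂ}

/-- The distribution `T` has square integrable gradient, and its `W^{1,2}` norm squared on `K` is
at most `C`. -/
def EnergyLE (T : 𝓓'(Ω, ℝ)) (K : Set ℂ) (C : ℝ) : Prop :=
  ∃ u p q : ℂ → ℝ, HasL2Gradient T u p q ∧ ∫ z in K, (u z ^ 2 + p z ^ 2 + q z ^ 2) ≤ C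

theorem EnergyLE.mono {T : 𝓓'(Ω, ℝ)} {K : Set ℂ} {C C' : ℝ} (h : EnergyLE T K C) (hC : C ≤ C') :
    EnergyLE T K C' := by
  obtain ⟨u, p, q, h1, h2⟩ := h
  exact ⟨u, p, q, h1, h2.trans hC⟩

theorem EnergyLE.integral_le {T : 𝓓'(Ω, ℝ)} {K : Set ℂ} {C : ℝ} (h : EnergyLE T K C)
    (hK : IsCompact K) (hKΩ : K ⊆ Ω) {u p q : ℂ → ℝ} (hg : HasL2Gradient T u p q) :
    ∫ z in K, (u z ^ 2 + p z ^ 2 + q z ^ 2) ≤ C := by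
  obtain ⟨u', p', q', h1, h2⟩ := h
  rwa [hg.energy_eq h1 hK.measurableSet hKΩ]

theorem EnergyLE.nonneg {T : 𝓓'(Ω, ℝ)} {K : Set ℂ} {C : ℝ} (h : EnergyLE T K C) : 0 ≤ C := by
  obtain ⟨u, p, q, -, h2⟩ := h
  exact (integral_nonneg fun z => by positivity).trans h2

theorem energyLE_zero (K : Set ℂ) : EnergyLE (0 : 𝓓'(Ω, ℝ)) K 0 := by
  have h0 : IsL2Loc Ω fun _ => (0 : ℝ) := isL2Loc_of_continuousOn continuousOn_const
  refine ⟨fun _ => 0, fun _ => 0, fun _ => 0, ⟨⟨h0, isGivenBy_zero⟩, ⟨h0, ?_⟩, h0, ?_⟩, by simp⟩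
  · rw [LineDeriv.lineDerivOp_zero]; exact isGivenBy_zero
  · rw [LineDeriv.lineDerivOp_zero]; exact isGivenBy_zero

theorem EnergyLE.neg {T : 𝓓'(Ω, ℝ)} {K : Set ℂ} {C : ℝ} (h : EnergyLE T K C) :
    EnergyLE (-T) K C := by
  obtain ⟨u, p, q, h1, h2⟩ := h
  have := h1.const_smul (-1)
  rw [neg_one_smul] at this
  exact ⟨_, _, _, this, by simpa using h2⟩

theorem EnergyLE.add {T S : 𝓓'(Ω, ℝ)} {K : Set ℂ} {A B : ℝ} (hK : IsCompact K) (hKΩ : K ⊆ Ω)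
    (hT : EnergyLE T K A) (hS : EnergyLE S K B) : EnergyLE (T + S) K (2 * (A + B)) := by
  obtain ⟨u, p, q, h1, h2⟩ := hT
  obtain ⟨u', p', q', h1', h2'⟩ := hS
  refine ⟨_, _, _, h1.add h1', ?_⟩
  have i1 := h1.integrableOn hK hKΩ
  have i2 := h1'.integrableOn hK hKΩ
  calc ∫ z in K, ((u z + u' z) ^ 2 + (p z + p' z) ^ 2 + (q z + q' z) ^ 2)
      ≤ ∫ z in K, 2 * ((u z ^ 2 + p z ^ 2 + q z ^ 2) + (u' z ^ 2 + p' z ^ 2 + q' z ^ 2)) := by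
        refine integral_mono ((h1.add h1').integrableOn hK hKΩ) ((i1.add i2).const_mul 2)
          fun z => ?_
        simp only
        nlinarith [sq_nonneg (u z - u' z), sq_nonneg (p z - p' z), sq_nonneg (q z - q' z)]
    _ ≤ 2 * (A + B) := by
        rw [integral_const_mul, integral_add i1 i2]
        linarith

theorem EnergyLE.sub {T S : 𝓓'(Ω, ℝ)} {K : Set ℂ} {A B : ℝ} (hK : IsCompact K) (hKΩ : K ⊆ Ω)
    (hT : EnergyLE T K A) (hS : EnergyLE S K B) : EnergyLE (T - S) K (2 * (A + B)) := by
  rw [sub_eq_add_neg]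
  exact hT.add hK hKΩ hS.neg

/-- The two-term inequality is iterated, each step costing a factor 2; only finiteness of the
constant matters. -/
theorem EnergyLE.sum {ι : Type*} {T : ι → 𝓓'(Ω, ℝ)} {K : Set ℂ} {C : ι → ℝ} (hK : IsCompact K)
    (hKΩ : K ⊆ Ω) (s : Finset ι) (h : ∀ i ∈ s, EnergyLE (T i) K (C i)) :
    EnergyLE (∑ i ∈ s, T i) K (2 ^ s.card * ∑ i ∈ s, C i) := by
  classical
  induction s using Finset.induction_on with
  | empty => simpa using energyLE_zero K
  | insert a s ha ih =>
    have h1 := h a (Finset.mem_insert_self a s)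
    have h2 := ih fun i hi => h i (Finset.mem_insert_of_mem hi)
    rw [Finset.sum_insert ha, Finset.sum_insert ha, Finset.card_insert_of_notMem ha]
    refine (h1.add hK hKΩ h2).mono ?_
    have h3 : 1 ≤ (2 : ℝ) ^ s.card := one_le_pow₀ (by norm_num)
    rw [pow_succ]
    nlinarith [h1.nonneg]

/-- The energy of a smooth function is its Dirichlet integral. -/
theorem energyLE_iff_of_contDiffOn {T : 𝓓'(Ω, ℝ)} {u : ℂ → ℝ} (hT : IsGivenBy T u)
    (hu : ContDiffOn ℝ ∞ u Ω) {K : Set ℂ} (hK : IsCompact K) (hKΩ : K ⊆ Ω) {C : ℝ} :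
    EnergyLE T K C ↔ ∫ z in K, dirichlet u z ≤ C := by
  have hg := hasL2Gradient_of_contDiffOn hT (hu.of_le (by norm_cast))
  exact ⟨fun h => h.integral_le hK hKΩ hg, fun h => ⟨_, _, _, hg, h⟩⟩

end Energy

/-! ### Extension by zero from a chart and smooth partitions of unity. -/

section Extension

variable {X Y : Type*} [TopologicalSpace X] [ChartedSpace ℂ X] [IsManifold 𝓘(ℂ) ω X]
  [TopologicalSpace Y] [ChartedSpace ℂ Y] [IsManifold 𝓘(ℂ) ω Y]

open Classical in
/-- Extension by zero of a function living in a chart. -/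
def extendChart (e : Chart X) (w : ℂ → ℝ) (x : X) : ℝ := if x ∈ e.1.source then w (e.1 x) else 0

open Classical in
/-- A function on `X` read in a chart, extended by zero. -/
def readChart (e : Chart X) (s : X → ℝ) (z : ℂ) : ℝ := if z ∈ e.1.target then s (e.1.symm z) else 0

theorem extendChart_apply {e : Chart X} (w : ℂ → ℝ) {x : X} (hx : x ∈ e.1.source) :
    extendChart e w x = w (e.1 x) := if_pos hx

theorem extendChart_symm {e : Chart X} (w : ℂ → ℝ) {z : ℂ} (hz : z ∈ e.1.target) :
    extendChart e w (e.1.symm z) = w z := by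
  rw [extendChart_apply w (e.1.map_target hz), e.1.right_inv hz]

theorem extendChart_of_notMem {e : Chart X} (w : ℂ → ℝ) {x : X} (hx : x ∉ e.1.source) :
    extendChart e w x = 0 := if_neg hx

/-- The image of K in X is compact, hence closed as X is Hausdorff, so the extension vanishes near
every point outside the domain of the chart. -/
theorem contMDiff_extendChart [T2Space X] {e : Chart X} {w : ℂ → ℝ} (hw : ContDiff ℝ ∞ w)
    {K : Set ℂ} (hK : IsCompact K) (hKe : K ⊆ e.1.target) (hwK : tsupport w ⊆ K) :
    ContMDiff 𝓘(ℝ, ℂ) 𝓘(ℝ, ℝ) ∞ (extendChart e w) := by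
  intro x
  by_cases hx : x ∈ e.1.source
  · rw [contMDiffAt_iff_chart e hx]
    refine hw.contDiffAt.congr_of_eventuallyEq ?_
    filter_upwards [e.1.open_target.mem_nhds (e.1.map_source hx)] with z hz
    exact extendChart_symm w hz
  · have hcl : IsClosed (e.1.symm '' K) :=
      (hK.image_of_continuousOn (e.1.continuousOn_symm.mono hKe)).isClosed
    have hxK : x ∉ e.1.symm '' K := by
      rintro ⟨z, hz, rfl⟩
      exact hx (e.1.map_target (hKe hz))
    have : extendChart e w =ᶠ[𝓝 x] fun _ => 0 := by
      filter_upwards [hcl.isOpen_compl.mem_nhds hxK] with y hy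
      by_cases hys : y ∈ e.1.source
      · rw [extendChart_apply w hys]
        refine image_eq_zero_of_notMem_tsupport fun h => hy ⟨e.1 y, hwK h, e.1.left_inv hys⟩
      · exact extendChart_of_notMem w hys
    exact contMDiffAt_const.congr_of_eventuallyEq this

theorem extendChart_readChart {e : Chart X} {s : X → ℝ} (h : ∀ x ∉ e.1.source, s x = 0) :
    extendChart e (readChart e s) = s := by
  funext x
  by_cases hx : x ∈ e.1.source
  · rw [extendChart_apply _ hx, readChart, if_pos (e.1.map_source hx), e.1.left_inv hx]
  · rw [extendChart_of_notMem _ hx, h x hx]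

theorem contDiff_readChart {e : Chart X} {s : X → ℝ}
    (hs : ContMDiff 𝓘(ℝ, ℂ) 𝓘(ℝ, ℝ) ∞ s) {K : Set ℂ} (hK : IsCompact K) (hKe : K ⊆ e.1.target)
    (h : ∀ x, s x ≠ 0 → x ∈ e.1.source ∧ e.1 x ∈ K) :
    ContDiff ℝ ∞ (readChart e s) ∧ tsupport (readChart e s) ⊆ K := by
  have h0 : ∀ z ∉ K, readChart e s z = 0 := by
    intro z hz
    unfold readChart
    split_ifs with hzt
    · by_contra hne
      have := (h _ hne).2
      rw [e.1.right_inv hzt] at this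
      exact hz this
    · rfl
  refine ⟨contDiff_of_support e.1.open_target ((contMDiff_iff_chart.1 hs e).congr fun z hz =>
    if_pos hz) hK.isClosed hKe h0, closure_minimal (fun z hz => ?_) hK.isClosed⟩
  by_contra hzK
  exact hz (h0 z hzK)

/-- A finite smooth partition of unity subordinate to charts. -/
theorem exists_partition (X : Type*) [TopologicalSpace X] [ChartedSpace ℂ X]
    [IsManifold 𝓘(ℂ) ω X] [T2Space X] [CompactSpace X] :
    ∃ (t : Finset X) (K : X → Set ℂ) (χ : X → X → ℝ),
      (∀ i, IsCompact (K i) ∧ K i ⊆ (Chart.preferred i).1.target) ∧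
      (∀ i, ContMDiff 𝓘(ℝ, ℂ) 𝓘(ℝ, ℝ) ∞ (χ i)) ∧
      (∀ i x, χ i x ≠ 0 → x ∈ (Chart.preferred i).1.source ∧ (Chart.preferred i).1 x ∈ K i) ∧
      ∀ x, ∑ i ∈ t, χ i x = 1 := by
  have hcut : ∀ i : X, ∃ θ : ℂ → ℝ, ContDiff ℝ ∞ θ ∧ HasCompactSupport θ ∧
      tsupport θ ⊆ (Chart.preferred i).1.target ∧ θ ((Chart.preferred i).1 i) = 1 ∧
      ∀ z, 0 ≤ θ z := by
    intro i
    obtain ⟨θ, h1, h2, h3, h4, h5⟩ := exists_cutoff (isCompact_singleton (x := (Chart.preferred i).1 i))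
      (Chart.preferred i).1.open_target
      (singleton_subset_iff.2 ((Chart.preferred i).1.map_source (mem_source_preferred i)))
    refine ⟨θ, h1, h2, h3, ?_, fun z => (h5 z).1⟩
    rw [nhdsSet_singleton] at h4
    exact h4.self_of_nhds
  choose θ hθs hθc hθt hθ1 hθ0 using hcut
  have hbs : ∀ i, ContMDiff 𝓘(ℝ, ℂ) 𝓘(ℝ, ℝ) ∞ (extendChart (Chart.preferred i) (θ i)) :=
    fun i => contMDiff_extendChart (hθs i) (hθc i) (hθt i) Subset.rfl
  have hb0 : ∀ i x, 0 ≤ extendChart (Chart.preferred i) (θ i) x := by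
    intro i x
    unfold extendChart
    split_ifs
    exacts [hθ0 i _, le_rfl]
  obtain ⟨t, -, ht⟩ := isCompact_univ.elim_nhds_subcover
    (fun i => {x | 0 < extendChart (Chart.preferred i) (θ i) x}) fun i _ =>
      ((hbs i).continuous.continuousAt.eventually (lt_mem_nhds (by
        rw [extendChart_apply _ (mem_source_preferred i), hθ1]; exact one_pos)))
  set σ : X → ℝ := fun x => ∑ i ∈ t, extendChart (Chart.preferred i) (θ i) x with hσ
  have hσpos : ∀ x, 0 < σ x := by
    intro x
    obtain ⟨i, hi, hx⟩ := mem_iUnion₂.1 (ht (mem_univ x))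
    exact Finset.sum_pos' (fun j _ => hb0 j x) ⟨i, hi, hx⟩
  have hσs : ContMDiff 𝓘(ℝ, ℂ) 𝓘(ℝ, ℝ) ∞ σ := contMDiff_finsetSum fun i _ => hbs i
  refine ⟨t, fun i => tsupport (θ i),
    fun i x => extendChart (Chart.preferred i) (θ i) x * (σ x)⁻¹,
    fun i => ⟨hθc i, hθt i⟩, fun i => ?_, fun i x hx => ?_, fun x => ?_⟩
  · rw [contMDiff_iff_chart]
    intro e
    exact (contMDiff_iff_chart.1 (hbs i) e).mul
      ((contMDiff_iff_chart.1 hσs e).inv fun z _ => (hσpos _).ne')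
  · have h1 := left_ne_zero_of_mul hx
    by_cases hxs : x ∈ (Chart.preferred i).1.source
    · rw [extendChart_apply _ hxs] at h1
      exact ⟨hxs, subset_tsupport _ h1⟩
    · exact absurd (extendChart_of_notMem _ hxs) h1
  · rw [← Finset.sum_mul]
    exact mul_inv_cancel₀ (hσpos x).ne'

end Extension

/-! ### Push-forward of functions supported in a chart. -/

section Push

variable {X Y : Type*} [TopologicalSpace X] [ChartedSpace ℂ X] [IsManifold 𝓘(ℂ) ω X]
  [TopologicalSpace Y] [ChartedSpace ℂ Y] [IsManifold 𝓘(ℂ) ω Y]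
  [T2Space X] [CompactSpace X] [T2Space Y] [CompactSpace Y]
  {F : X → Y} (hF : MDifferentiable 𝓘(ℂ) 𝓘(ℂ) F)
  (hiso : ∀ (x : X) (y : Y), ∀ᶠ x' in 𝓝[≠] x, F x' ≠ y)

theorem injOn_symm_fibre (F : X → Y) (e : Chart X) (c : Chart Y) (y : ℂ) :
    MapsTo e.1.symm (locDom F e c ∩ locMap F e c ⁻¹' {y}) (F ⁻¹' {c.1.symm y}) ∧
      InjOn e.1.symm (locDom F e c ∩ locMap F e c ⁻¹' {y}) := by
  refine ⟨fun z hz => ?_, fun z hz w hw h => e.1.symm.injOn hz.1.1 hw.1.1 h⟩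
  rw [mem_preimage, ← symm_locMap hz.1, show locMap F e c z = y from hz.2]
  rfl

include hF hiso

theorem finite_fibre_locMap (e : Chart X) (c : Chart Y) (y : ℂ) :
    (locDom F e c ∩ locMap F e c ⁻¹' {y}).Finite :=
  Set.Finite.of_injOn (injOn_symm_fibre F e c y).1 (injOn_symm_fibre F e c y).2
    (finite_fibre hF hiso _)

theorem ncard_fibre_locMap_le {N : ℕ} (hN : ∀ y : Y, (F ⁻¹' {y}).ncard ≤ N) (e : Chart X)
    (c : Chart Y) (y : ℂ) : (locDom F e c ∩ locMap F e c ⁻¹' {y}).ncard ≤ N :=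
  (ncard_le_ncard_of_injOn _ (injOn_symm_fibre F e c y).1 (injOn_symm_fibre F e c y).2
    (finite_fibre hF hiso _)).trans (hN _)

/-- The properness needed by `hasL2Gradient_fibreSum`. Although `locDom F e c` is only open, the
part of K above L is cut out by the closed preimage of a compact subset of Y. -/
theorem isCompact_inter_locDom (e : Chart X) (c : Chart Y) {K L : Set ℂ} (hK : IsCompact K)
    (hKe : K ⊆ e.1.target) (hL : IsCompact L) (hLc : L ⊆ c.1.target) :
    IsCompact (K ∩ (locDom F e c ∩ locMap F e c ⁻¹' L)) := by
  have hcl : IsClosed (F ⁻¹' (c.1.symm '' L)) :=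
    (hL.image_of_continuousOn (c.1.continuousOn_symm.mono hLc)).isClosed.preimage hF.continuous
  have h1 : IsClosed (K ∩ e.1.symm ⁻¹' (F ⁻¹' (c.1.symm '' L))) :=
    (e.1.continuousOn_symm.mono hKe).preimage_isClosed_of_isClosed hK.isClosed hcl
  convert hK.of_isClosed_subset h1 inter_subset_left using 1
  ext z
  refine and_congr_right fun hz => ⟨fun h => ⟨_, h.2, symm_locMap h.1⟩, ?_⟩
  rintro ⟨l, hl, hlz⟩
  have h2 : z ∈ locDom F e c := ⟨hKe hz, by
    rw [mem_preimage, mem_preimage, ← hlz]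
    exact c.1.map_target (hLc hl)⟩
  refine ⟨h2, ?_⟩
  rw [mem_preimage, locMap, ← hlz, c.1.right_inv (hLc hl)]
  exact hl

/-- `fibreSum` counts points without multiplicity, whence the restriction to unramified fibres. The
excluded values form a finite set, which distributions given by functions do not see. -/
theorem pushFun_extendChart (e : Chart X) (c : Chart Y) (w : ℂ → ℝ) {y : ℂ}
    (hy : y ∈ c.1.target) (hr : ∀ x, F x = c.1.symm y → ramificationIndex F x = 1) :
    pushFun F (extendChart e w) (c.1.symm y) =
      fibreSum (locMap F e c) (locDom F e c) w y := by
  have h1 : pushFun F (extendChart e w) (c.1.symm y) =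
      ∑ᶠ x ∈ F ⁻¹' {c.1.symm y}, extendChart e w x :=
    finsum_mem_congr rfl fun x hx => by rw [hr x hx, Nat.cast_one, one_mul]
  rw [h1, finsum_mem_inter_support_eq' _ _ (F ⁻¹' {c.1.symm y} ∩ e.1.source)]
  · refine (finsum_mem_eq_of_bijOn e.1.symm ⟨?_, (injOn_symm_fibre F e c y).2, ?_⟩ ?_).symm
    · exact fun z hz => ⟨(injOn_symm_fibre F e c y).1 hz, e.1.map_target hz.1.1⟩
    · rintro x ⟨hx, hxs⟩
      have hFx : F x ∈ c.1.source := by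
        rw [show F x = c.1.symm y from hx]
        exact c.1.map_target hy
      refine ⟨e.1 x, ⟨mem_locDom hxs hFx, ?_⟩, e.1.left_inv hxs⟩
      rw [mem_preimage, locMap_apply F c hxs, show F x = c.1.symm y from hx, c.1.right_inv hy]
      rfl
    · exact fun z hz => (extendChart_symm w hz.1.1).symm
  · intro x hx
    refine ⟨fun h => ⟨h, ?_⟩, fun h => h.1⟩
    by_contra hxs
    exact hx (extendChart_of_notMem w hxs)

/-- The basic estimate for push-forwards of functions supported in a chart. -/
theorem push_extendChart_energy (e : Chart X) (c : Chart Y) {K L : Set ℂ} (hK : IsCompact K)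
    (hKe : K ⊆ e.1.target) (hL : IsCompact L) (hLc : L ⊆ c.1.target) :
    ∃ C : ℝ, 0 ≤ C ∧ ∀ w : ℂ → ℝ, ContDiff ℝ ∞ w → tsupport w ⊆ K →
      LocallyIntegrableOn (fun y => pushFun F (extendChart e w) (c.1.symm y)) c.1.target volume ∧
      ∀ T : 𝓓'(c.range, ℝ), IsGivenBy T (fun y => pushFun F (extendChart e w) (c.1.symm y)) →
        EnergyLE T L (C * ∫ z, dirichlet w z) := by
  obtain ⟨N, hN⟩ := exists_fibre_bound hF hiso
  obtain ⟨C, hC0, hC⟩ := hasL2Gradient_fibreSum (isOpen_locDom hF.continuous e c)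
    (analyticOnNhd_locMap hF e c) (fun z hz => eventually_deriv_locMap_ne_zero hF hiso e c hz)
    (finite_fibre_locMap hF hiso e c) (ncard_fibre_locMap_le hF hiso hN e c) c.range
    (fun L' hL' hL'c => isCompact_inter_locDom hF hiso e c hK hKe hL'c hL') hLc hL
  refine ⟨C, hC0, fun w hw hwK => ?_⟩
  obtain ⟨p, q, hg, hE⟩ := hC w hw (hK.of_isClosed_subset (isClosed_tsupport w) hwK) hwK
  have hae : ∀ᵐ y, y ∈ c.range → fibreSum (locMap F e c) (locDom F e c) w y =
      pushFun F (extendChart e w) (c.1.symm y) := by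
    have := ae_symm_notMem c ((finite_ramified hF hiso).image F)
    rw [ae_restrict_iff' c.1.open_target.measurableSet] at this
    filter_upwards [this] with y hy hyt
    refine (pushFun_extendChart hF hiso e c w hyt fun x hx => ?_).symm
    by_contra h
    exact hy hyt ⟨x, h, hx⟩
  have hgiv := hg.1.2.congr_ae hae
  refine ⟨hgiv.1, fun T hT => ?_⟩
  rw [hT.eq hgiv]
  exact ⟨_, _, _, hg, hE⟩

theorem pushFun_eq_sum (u : X → ℝ) (y : Y) : pushFun F u y =
    ∑ x ∈ (finite_fibre hF hiso y).toFinset, (ramificationIndex F x : ℝ) * u x :=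
  finsum_mem_eq_finite_toFinset_sum _ _

theorem pushFun_sub (u v : X → ℝ) : pushFun F (u - v) = pushFun F u - pushFun F v := by
  funext y
  simp only [Pi.sub_apply, pushFun_eq_sum hF hiso, mul_sub, Finset.sum_sub_distrib]

theorem pushFun_sum {ι : Type*} (t : Finset ι) (u : ι → X → ℝ) :
    pushFun F (fun x => ∑ i ∈ t, u i x) = fun y => ∑ i ∈ t, pushFun F (u i) y := by
  funext y
  simp only [pushFun_eq_sum hF hiso, Finset.mul_sum]
  exact Finset.sum_comm

end Push

/-! ### Bounded operators, and boundedness of the push-forward. -/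

section

variable {X Y : Type*} [TopologicalSpace X] [ChartedSpace ℂ X] [IsManifold 𝓘(ℂ) ω X]
  [TopologicalSpace Y] [ChartedSpace ℂ Y] [IsManifold 𝓘(ℂ) ω Y]

/-- The operator `Φ` on functions is linear, does not see finite sets, and is bounded on smooth
functions for the `L²₁` topologies. -/
structure IsBoundedOp (Φ : (X → ℝ) → (Y → ℝ)) : Prop where
  sub : ∀ u v, Φ (u - v) = Φ u - Φ v
  congr_finite : ∀ (u v : X → ℝ) (S : Set X), S.Finite → (∀ x ∉ S, u x = v x) →
    ∃ S' : Set Y, S'.Finite ∧ ∀ y ∉ S', Φ u y = Φ v y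
  isGivenBy : ∀ s, ContMDiff 𝓘(ℝ, ℂ) 𝓘(ℝ, ℝ) ∞ s → ∃ T : Dist Y, IsGivenByFun T (Φ s)
  bounded : ∀ (c : Chart Y) (L : Set ℂ), IsCompact L → L ⊆ c.1.target →
    ∃ P : Set (Chart X × Set ℂ), P.Finite ∧ (∀ p ∈ P, IsCompact p.2 ∧ p.2 ⊆ p.1.1.target) ∧
      ∃ C : ℝ, 0 ≤ C ∧ ∀ (s : X → ℝ) (S : Dist X) (T : Dist Y) (A : ℝ),
        ContMDiff 𝓘(ℝ, ℂ) 𝓘(ℝ, ℝ) ∞ s → IsGivenByFun S s → IsGivenByFun T (Φ s) → 0 ≤ A →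
        (∀ p ∈ P, EnergyLE (S.1 p.1) p.2 A) → EnergyLE (T.1 c) L (C * A)

/-- From |a∇b + b∇a|² ≤ 2(a²|∇b|² + b²|∇a|²). -/
theorem dirichlet_mul_le {f g : ℂ → ℝ} {z : ℂ} (hf : DifferentiableAt ℝ f z)
    (hg : DifferentiableAt ℝ g z) :
    dirichlet (fun z => f z * g z) z ≤ 2 * dirichlet f z * dirichlet g z := by
  have h1 : fderiv ℝ (fun z => f z * g z) z = f z • fderiv ℝ g z + g z • fderiv ℝ f z :=
    fderiv_fun_mul hf hg
  unfold dirichlet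
  rw [h1]
  simp only [add_apply, smul_apply, smul_eq_mul]
  set a := f z
  set b := g z
  set a1 := fderiv ℝ f z 1
  set a2 := fderiv ℝ f z Complex.I
  set b1 := fderiv ℝ g z 1
  set b2 := fderiv ℝ g z Complex.I
  have h2 : 0 ≤ (a * b1 - b * a1) ^ 2 + (a * b2 - b * a2) ^ 2 + (a * b) ^ 2 +
      2 * ((a1 * b1) ^ 2 + (a1 * b2) ^ 2 + (a2 * b1) ^ 2 + (a2 * b2) ^ 2) := by positivity
  nlinarith

theorem integral_dirichlet_eq {w : ℂ → ℝ} {K : Set ℂ} (hwK : tsupport w ⊆ K) :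
    ∫ z, dirichlet w z = ∫ z in K, dirichlet w z := by
  refine (setIntegral_eq_integral_of_forall_compl_eq_zero fun z hz => ?_).symm
  have h1 : w z = 0 := image_eq_zero_of_notMem_tsupport fun h => hz (hwK h)
  have h2 : fderiv ℝ w z = 0 := by
    by_contra h
    exact hz (hwK (support_fderiv_subset ℝ h))
  simp [dirichlet, h1, h2]

theorem continuousOn_dirichlet {U : Set ℂ} (hU : IsOpen U) {w : ℂ → ℝ} (hw : ContDiffOn ℝ ∞ w U) :
    ContinuousOn (dirichlet w) U := by
  have h1 := hw.continuousOn
  have h2 := hw.continuousOn_fderiv_of_isOpen hU (by simp)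
  unfold dirichlet
  exact ((h1.pow 2).add ((h2.clm_apply continuousOn_const).pow 2)).add
    ((h2.clm_apply continuousOn_const).pow 2)

theorem dirichlet_congr {f g : ℂ → ℝ} {z : ℂ} (h : f =ᶠ[𝓝 z] g) : dirichlet f z = dirichlet g z := by
  unfold dirichlet
  rw [h.eq_of_nhds, h.fderiv_eq]

/-- Cutting off a smooth function in a chart is bounded for the Dirichlet norms. -/
theorem exists_dirichlet_cutoff_bound (e : Chart X) {χ : X → ℝ}
    (hχ : ContMDiff 𝓘(ℝ, ℂ) 𝓘(ℝ, ℝ) ∞ χ) {K : Set ℂ} (hK : IsCompact K) (hKe : K ⊆ e.1.target)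
    (hs : ∀ x, χ x ≠ 0 → x ∈ e.1.source ∧ e.1 x ∈ K) :
    ∃ B : ℝ, 0 ≤ B ∧ ∀ s : X → ℝ, ContMDiff 𝓘(ℝ, ℂ) 𝓘(ℝ, ℝ) ∞ s →
      ∫ z, dirichlet (readChart e (fun x => χ x * s x)) z ≤
        B * ∫ z in K, dirichlet (s ∘ e.1.symm) z := by
  have hχe := contMDiff_iff_chart.1 hχ e
  have ho := e.1.open_target
  have hcχ := (continuousOn_dirichlet ho hχe).mono hKe
  obtain ⟨M, hM⟩ := hK.exists_bound_of_continuousOn hcχ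
  refine ⟨2 * max M 0, by positivity, fun s hss => ?_⟩
  have hse := contMDiff_iff_chart.1 hss e
  have hprod : ContMDiff 𝓘(ℝ, ℂ) 𝓘(ℝ, ℝ) ∞ (fun x => χ x * s x) := by
    rw [contMDiff_iff_chart]
    intro e'
    exact (contMDiff_iff_chart.1 hχ e').mul (contMDiff_iff_chart.1 hss e')
  obtain ⟨hw, hwK⟩ := contDiff_readChart hprod hK hKe fun x hx => hs x (left_ne_zero_of_mul hx)
  rw [integral_dirichlet_eq hwK, ← integral_const_mul]
  have hci := (continuousOn_dirichlet ho hse).mono hKe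
  refine setIntegral_mono_on ((continuous_dirichlet hw).continuousOn.integrableOn_compact hK)
    ((hci.integrableOn_compact hK).const_mul _) hK.measurableSet fun z hz => ?_
  have hzt := hKe hz
  have h1 : readChart e (fun x => χ x * s x) =ᶠ[𝓝 z]
      fun z => (χ ∘ e.1.symm) z * (s ∘ e.1.symm) z := by
    filter_upwards [ho.mem_nhds hzt] with y hy
    simp [readChart, hy]
  rw [dirichlet_congr h1]
  refine (dirichlet_mul_le ((hχe.contDiffAt (ho.mem_nhds hzt)).differentiableAt (by simp))
    ((hse.contDiffAt (ho.mem_nhds hzt)).differentiableAt (by simp))).trans ?_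
  refine mul_le_mul_of_nonneg_right ?_ (dirichlet_nonneg _ _)
  have := (le_abs_self _).trans (hM z hz)
  nlinarith [le_max_left M 0]

theorem finite_sum_apply {ι : Type*} (t : Finset ι) (T : ι → Dist Y) (c : Chart Y) :
    (∑ i ∈ t, T i).1 c = ∑ i ∈ t, (T i).1 c := by
  rw [Submodule.coe_sum, Finset.sum_apply]

theorem IsGivenByFun.finset_sum {ι : Type*} (t : Finset ι) {T : ι → Dist Y} {u : ι → Y → ℝ}
    (h : ∀ i ∈ t, IsGivenByFun (T i) (u i)) :
    IsGivenByFun (∑ i ∈ t, T i) (fun y => ∑ i ∈ t, u i y) := by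
  classical
  induction t using Finset.induction_on with
  | empty =>
    simp only [Finset.sum_empty]
    exact fun e => isGivenBy_zero
  | insert a s ha ih =>
    simp only [Finset.sum_insert ha]
    exact (h a (Finset.mem_insert_self a s)).add
      (ih fun i hi => h i (Finset.mem_insert_of_mem hi))

variable [T2Space X] [CompactSpace X] [T2Space Y] [CompactSpace Y]
  {F : X → Y} (hF : MDifferentiable 𝓘(ℂ) 𝓘(ℂ) F)
  (hiso : ∀ (x : X) (y : Y), ∀ᶠ x' in 𝓝[≠] x, F x' ≠ y)

include hF hiso

theorem exists_dist_push_extendChart (e : Chart X) {w : ℂ → ℝ} (hw : ContDiff ℝ ∞ w)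
    (hwc : HasCompactSupport w) (hwe : tsupport w ⊆ e.1.target) :
    ∃ T : Dist Y, IsGivenByFun T (pushFun F (extendChart e w)) := by
  refine ⟨_, isGivenByFun_ofFun fun c => ?_⟩
  -- Only local integrability is wanted here, so the compact set on which the energy is measured is
  -- taken to be empty.
  obtain ⟨C, -, hC⟩ := push_extendChart_energy hF hiso e c hwc hwe isCompact_empty
    (empty_subset _)
  exact (hC w hw Subset.rfl).1

/-- The push-forward of functions is bounded for the `L²₁` topologies. -/
theorem isBoundedOp_pushFun : IsBoundedOp (pushFun F) := by
  obtain ⟨t, K, χ, hK, hχ, hχK, hsum⟩ := exists_partition X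
  have hprod : ∀ (s : X → ℝ), ContMDiff 𝓘(ℝ, ℂ) 𝓘(ℝ, ℝ) ∞ s → ∀ i,
      ContMDiff 𝓘(ℝ, ℂ) 𝓘(ℝ, ℝ) ∞ (fun x => χ i x * s x) := by
    intro s hs i
    rw [contMDiff_iff_chart]
    intro e'
    exact (contMDiff_iff_chart.1 (hχ i) e').mul (contMDiff_iff_chart.1 hs e')
  have hread : ∀ (s : X → ℝ), ContMDiff 𝓘(ℝ, ℂ) 𝓘(ℝ, ℝ) ∞ s → ∀ i,
      ContDiff ℝ ∞ (readChart (Chart.preferred i) fun x => χ i x * s x) ∧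
      tsupport (readChart (Chart.preferred i) fun x => χ i x * s x) ⊆ K i := fun s hs i =>
    contDiff_readChart (hprod s hs i) (hK i).1 (hK i).2
      fun x hx => hχK i x (left_ne_zero_of_mul hx)
  have hdec : ∀ s : X → ℝ, s = fun x => ∑ i ∈ t,
      extendChart (Chart.preferred i) (readChart (Chart.preferred i) fun x => χ i x * s x) x := by
    intro s
    funext x
    have : ∀ i, extendChart (Chart.preferred i)
        (readChart (Chart.preferred i) fun x => χ i x * s x) = fun x => χ i x * s x := fun i =>
      extendChart_readChart fun x hx => by
        by_contra h
        exact hx (hχK i x (left_ne_zero_of_mul h)).1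
    simp_rw [this, ← Finset.sum_mul, hsum, one_mul]
  have hdist : ∀ (s : X → ℝ), ContMDiff 𝓘(ℝ, ℂ) 𝓘(ℝ, ℝ) ∞ s → ∃ T : X → Dist Y, ∀ i,
      IsGivenByFun (T i) (pushFun F (extendChart (Chart.preferred i)
        (readChart (Chart.preferred i) fun x => χ i x * s x))) := by
    intro s hs
    choose T hT using fun i => exists_dist_push_extendChart hF hiso (Chart.preferred i)
      (hread s hs i).1 ((hK i).1.of_isClosed_subset (isClosed_tsupport _) (hread s hs i).2)
      ((hread s hs i).2.trans (hK i).2)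
    exact ⟨T, hT⟩
  have hpush : ∀ (s : X → ℝ) (T : X → Dist Y), (∀ i,
      IsGivenByFun (T i) (pushFun F (extendChart (Chart.preferred i)
        (readChart (Chart.preferred i) fun x => χ i x * s x)))) →
      IsGivenByFun (∑ i ∈ t, T i) (pushFun F s) := by
    intro s T hT
    have := IsGivenByFun.finset_sum t fun i _ => hT i
    rw [← pushFun_sum hF hiso] at this
    rwa [← hdec s] at this
  refine ⟨pushFun_sub hF hiso, fun u v S hS h => ?_, fun s hs => ?_, fun c L hL hLc => ?_⟩
  · refine ⟨F '' S, hS.image F, fun y hy => finsum_mem_congr rfl fun x hx => ?_⟩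
    rw [h x fun hxS => hy ⟨x, hxS, hx⟩]
  · obtain ⟨T, hT⟩ := hdist s hs
    exact ⟨_, hpush s T hT⟩
  · choose B hB0 hB using fun i => exists_dirichlet_cutoff_bound (Chart.preferred i) (hχ i)
      (hK i).1 (hK i).2 (hχK i)
    choose C hC0 hC using fun i => push_extendChart_energy hF hiso (Chart.preferred i) c
      (hK i).1 (hK i).2 hL hLc
    -- Cutting off with χ i costs the factor B i, pushing forward the piece costs C i, and summing
    -- the pieces costs a power of 2.
    refine ⟨(fun i => (Chart.preferred i, K i)) '' t, t.finite_toSet.image _, ?_,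
      2 ^ t.card * ∑ i ∈ t, C i * B i, mul_nonneg (by positivity)
        (Finset.sum_nonneg fun i _ => mul_nonneg (hC0 i) (hB0 i)), ?_⟩
    · rintro _ ⟨i, -, rfl⟩
      exact hK i
    · intro s S T A hs hS hT hA hE
      obtain ⟨T', hT'⟩ := hdist s hs
      rw [hT.dist_eq (hpush s T' hT'), finite_sum_apply, mul_assoc, Finset.sum_mul]
      refine EnergyLE.sum hL hLc t fun i hi => ?_
      refine ((hC i _ (hread s hs i).1 (hread s hs i).2).2 _ (hT' i c)).mono ?_
      rw [mul_assoc]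
      refine mul_le_mul_of_nonneg_left ((hB i s hs).trans
        (mul_le_mul_of_nonneg_left ?_ (hB0 i))) (hC0 i)
      exact (energyLE_iff_of_contDiffOn (hS (Chart.preferred i))
        (contMDiff_iff_chart.1 hs _) (hK i).1 (hK i).2).1 (hE _ (mem_image_of_mem _ hi))

end

/-! ### Local energy estimates for pull-backs. -/

section Poincare

theorem setIntegral_translate_le {f : ℂ → ℝ} {B D : Set ℂ} {a : ℂ} (hf : IntegrableOn f D)
    (hf0 : ∀ z, 0 ≤ f z) (h : ∀ z ∈ B, z + a ∈ D) :
    ∫ z in B, f (z + a) ≤ ∫ z in D, f z := by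
  have hmp : MeasurePreserving (fun z : ℂ => z + a) := measurePreserving_add_right volume a
  have hemb : MeasurableEmbedding (fun z : ℂ => z + a) := measurableEmbedding_addRight a
  rw [← hmp.setIntegral_preimage_emb hemb f D]
  refine setIntegral_mono_set ((hmp.integrableOn_comp_preimage hemb).2 hf)
    (ae_of_all _ fun z => hf0 _) (ae_of_all _ fun z hz => h z hz)

theorem setIntegral_biUnion_le {ι : Type*} (t : Finset ι) {f : ℂ → ℝ} (hf0 : ∀ z, 0 ≤ f z)
    {B : ι → Set ℂ} (hf : ∀ i ∈ t, IntegrableOn f (B i)) :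
    ∫ z in ⋃ i ∈ t, B i, f z ≤ ∑ i ∈ t, ∫ z in B i, f z := by
  classical
  induction t using Finset.induction_on with
  | empty => simp
  | insert a s ha ih =>
    have h1 := hf a (Finset.mem_insert_self a s)
    have hs : ∀ i ∈ s, IntegrableOn f (B i) := fun i hi => hf i (Finset.mem_insert_of_mem hi)
    have h2 : IntegrableOn f (⋃ i ∈ s, B i) := (integrableOn_finset_iUnion (s := s)).2 hs
    rw [Finset.sum_insert ha, Finset.set_biUnion_insert]
    calc ∫ z in B a ∪ ⋃ i ∈ s, B i, f z
        ≤ ∫ z, f z ∂(volume.restrict (B a) + volume.restrict (⋃ i ∈ s, B i)) :=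
          integral_mono_measure (Measure.restrict_union_le _ _) (ae_of_all _ hf0)
            (integrable_add_measure.2 ⟨h1, h2⟩)
      _ = (∫ z in B a, f z) + ∫ z in ⋃ i ∈ s, B i, f z := integral_add_measure h1 h2
      _ ≤ _ := by gcongr; exact ih hs

/-- The variance of g on the unit interval is non-negative. -/
theorem sq_intervalIntegral_le {g : ℝ → ℝ} (hg : ContinuousOn g (Icc 0 1)) :
    (∫ t in (0 : ℝ)..1, g t) ^ 2 ≤ ∫ t in Icc (0 : ℝ) 1, g t ^ 2 := by
  set m := ∫ t in (0 : ℝ)..1, g t with hm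
  have hm' : m = ∫ t in Icc (0 : ℝ) 1, g t := by
    rw [hm, intervalIntegral.integral_of_le zero_le_one, integral_Icc_eq_integral_Ioc]
  have i1 : IntegrableOn g (Icc (0 : ℝ) 1) := hg.integrableOn_compact isCompact_Icc
  have i2 : IntegrableOn (fun t => g t ^ 2) (Icc (0 : ℝ) 1) :=
    (hg.pow 2).integrableOn_compact isCompact_Icc
  have h0 : 0 ≤ ∫ t in Icc (0 : ℝ) 1, (g t - m) ^ 2 := integral_nonneg fun t => sq_nonneg _
  have h1 : ∫ t in Icc (0 : ℝ) 1, (g t - m) ^ 2 =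
      (∫ t in Icc (0 : ℝ) 1, g t ^ 2) - ∫ t in Icc (0 : ℝ) 1, (2 * m * g t - m ^ 2) := by
    have i3 : IntegrableOn (fun t => 2 * m * g t - m ^ 2) (Icc (0 : ℝ) 1) :=
      Integrable.sub (i1.const_mul _) (integrable_const _)
    rw [← integral_sub i2 i3]
    refine integral_congr_ae (ae_of_all _ fun t => ?_)
    simp only
    ring
  rw [h1, integral_sub (i1.const_mul _) (integrable_const _), integral_const_mul, ← hm'] at h0
  simp at h0
  nlinarith

/-- The `L²` norm on a ball is controlled by the `L²` norm on a translate and the gradient. -/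
theorem integral_sq_le_translate {u : ℂ → ℝ} {U : Set ℂ} (hU : IsOpen U)
    (hu : ContDiffOn ℝ ∞ u U) {B D : Set ℂ} (hB : IsCompact B) (hD : IsCompact D) (hDU : D ⊆ U)
    {a : ℂ} (h : ∀ z ∈ B, ∀ t ∈ Icc (0 : ℝ) 1, z + t • a ∈ D) :
    ∫ z in B, u z ^ 2 ≤ 2 * (∫ z in B, u (z + a) ^ 2) + 2 * ∫ z in D, fderiv ℝ u z a ^ 2 := by
  have hud := hu.continuousOn_fderiv_of_isOpen hU (by simp)
  have hBD : B ⊆ D := fun z hz => by simpa using h z hz 0 (by simp)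
  have hua : ContinuousOn (fun z => fderiv ℝ u z a) D :=
    (hud.clm_apply continuousOn_const).mono hDU
  have hcont : ContinuousOn (fun q : ℂ × ℝ => fderiv ℝ u (q.1 + q.2 • a) a ^ 2)
      (B ×ˢ Icc (0 : ℝ) 1) := by
    refine ContinuousOn.pow (hua.comp (by fun_prop) fun q hq => ?_) 2
    exact h q.1 hq.1 q.2 hq.2
  have hint : Integrable (Function.uncurry fun (z : ℂ) (t : ℝ) => fderiv ℝ u (z + t • a) a ^ 2)
      ((volume.restrict B).prod (volume.restrict (Icc (0 : ℝ) 1))) := by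
    rw [Measure.prod_restrict]
    exact hcont.integrableOn_compact (hB.prod isCompact_Icc)
  -- The difference u(z + a) - u(z) is the integral of the derivative along the segment, and its
  -- square is at most the integral of the squared derivative.
  have hpt : ∀ z ∈ B, u z ^ 2 ≤ 2 * u (z + a) ^ 2 +
      2 * ∫ t in Icc (0 : ℝ) 1, fderiv ℝ u (z + t • a) a ^ 2 := by
    intro z hz
    have hc1 : ContinuousOn (fun t : ℝ => fderiv ℝ u (z + t • a) a) (Icc 0 1) :=
      hua.comp (by fun_prop) fun t ht => h z hz t ht
    have hderiv : ∀ t ∈ uIcc (0 : ℝ) 1,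
        HasDerivAt (fun t : ℝ => u (z + t • a)) (fderiv ℝ u (z + t • a) a) t := by
      intro t ht
      rw [uIcc_of_le zero_le_one] at ht
      have h1 : DifferentiableAt ℝ u (z + t • a) :=
        (hu.contDiffAt (hU.mem_nhds (hDU (h z hz t ht)))).differentiableAt (by simp)
      have h2 : HasDerivAt (fun t : ℝ => z + t • a) a t := by
        simpa using ((hasDerivAt_id t).smul_const a).const_add z
      exact h1.hasFDerivAt.comp_hasDerivAt t h2
    have hft := intervalIntegral.integral_eq_sub_of_hasDerivAt hderiv
      (by
        refine ContinuousOn.intervalIntegrable ?_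
        rwa [uIcc_of_le zero_le_one])
    have hsq := sq_intervalIntegral_le hc1
    rw [hft] at hsq
    simp only [one_smul, zero_smul, add_zero] at hsq
    -- The identity used is 2b² + 2(b - a)² - a² = (2b - a)².
    nlinarith [sq_nonneg (2 * u (z + a) - u z)]
  have hcu : ContinuousOn u D := hu.continuousOn.mono hDU
  have hcua : ContinuousOn (fun z => u (z + a)) B :=
    hcu.comp (by fun_prop) fun z hz => by simpa using h z hz 1 (by simp)
  have i1 : IntegrableOn (fun z => u (z + a) ^ 2) B := (hcua.pow 2).integrableOn_compact hB
  have i2 : IntegrableOn (fun z => ∫ t in Icc (0 : ℝ) 1, fderiv ℝ u (z + t • a) a ^ 2) B :=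
    hint.integral_prod_left
  have i4 : IntegrableOn (fun z => 2 * u (z + a) ^ 2 +
      2 * ∫ t in Icc (0 : ℝ) 1, fderiv ℝ u (z + t • a) a ^ 2) B :=
    Integrable.add (i1.const_mul 2) (i2.const_mul 2)
  have i3 : IntegrableOn (fun z => u z ^ 2) B :=
    ((hcu.mono hBD).pow 2).integrableOn_compact hB
  calc ∫ z in B, u z ^ 2
      ≤ ∫ z in B, (2 * u (z + a) ^ 2 +
          2 * ∫ t in Icc (0 : ℝ) 1, fderiv ℝ u (z + t • a) a ^ 2) :=
        setIntegral_mono_on i3 i4 hB.measurableSet hpt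
    _ = 2 * (∫ z in B, u (z + a) ^ 2) +
          2 * ∫ z in B, ∫ t in Icc (0 : ℝ) 1, fderiv ℝ u (z + t • a) a ^ 2 := by
        rw [← integral_const_mul, ← integral_const_mul]
        exact integral_add (i1.const_mul 2) (i2.const_mul 2)
    _ ≤ 2 * (∫ z in B, u (z + a) ^ 2) + 2 * ∫ z in D, fderiv ℝ u z a ^ 2 := by
        gcongr
        rw [integral_integral_swap hint]
        have hDi : IntegrableOn (fun z => fderiv ℝ u z a ^ 2) D :=
          (hua.pow 2).integrableOn_compact hD
        have hle : ∀ t ∈ Icc (0 : ℝ) 1, ∫ z in B, fderiv ℝ u (z + t • a) a ^ 2 ≤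
            ∫ z in D, fderiv ℝ u z a ^ 2 := fun t ht =>
          setIntegral_translate_le hDi (fun z => sq_nonneg _)
            fun z hz => h z hz t ht
        calc ∫ t in Icc (0 : ℝ) 1, ∫ z in B, fderiv ℝ u (z + t • a) a ^ 2
            ≤ ∫ t in Icc (0 : ℝ) 1, ∫ z in D, fderiv ℝ u z a ^ 2 :=
              setIntegral_mono_on hint.integral_prod_right
                (integrableOn_const (by simp)) measurableSet_Icc hle
          _ = ∫ z in D, fderiv ℝ u z a ^ 2 := by simp

variable {τ : ℂ → ℂ} {U : Set ℂ} {N : ℕ} (hU : IsOpen U) (hτ : AnalyticOnNhd ℂ τ U)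
  (hnc : ∀ z ∈ U, ∀ᶠ w in 𝓝[≠] z, deriv τ w ≠ 0) (hfin : ∀ y, (U ∩ τ ⁻¹' {y}).Finite)
  (hN : ∀ y, (U ∩ τ ⁻¹' {y}).ncard ≤ N)

include hU hτ hnc hfin hN

/-- By the area formula the left side integrates a fibre sum that is at most N g, because each value
is taken at most N times. -/
theorem integral_comp_le {D : Set ℂ} (hD : IsCompact D) (hDU : D ⊆ U) {g : ℂ → ℝ}
    (hg : ContinuousOn g (τ '' D)) (hg0 : ∀ z, 0 ≤ g z) :
    ∫ z in D, ‖deriv τ z‖ ^ 2 * g (τ z) ≤ N * ∫ y in τ '' D, g y := by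
  classical
  have hcτ : ContinuousOn τ D := hτ.continuousOn.mono hDU
  have hgτ : ContinuousOn (fun z => g (τ z)) D := hg.comp hcτ (mapsTo_image τ D)
  have hK : IsCompact (τ '' D) := hD.image_of_continuousOn hcτ
  set f : ℂ → ℝ := D.indicator fun z => g (τ z) with hf
  have hfm : Measurable f := by
    rw [hf, ← piecewise_eq_indicator]
    exact hgτ.measurable_piecewise continuousOn_const hD.measurableSet
  have hprod : (fun z => ‖deriv τ z‖ ^ 2 * f z) =
      D.indicator fun z => ‖deriv τ z‖ ^ 2 * g (τ z) := by
    funext z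
    by_cases hz : z ∈ D
    · simp only [hf, indicator_of_mem hz]
    · simp only [hf, indicator_of_notMem hz, mul_zero]
  have hcd : ContinuousOn (fun z => ‖deriv τ z‖ ^ 2 * g (τ z)) D :=
    (((hτ.deriv.continuousOn.mono hDU).norm).pow 2).mul hgτ
  have hint : IntegrableOn (fun z => ‖deriv τ z‖ ^ 2 * f z) U := by
    rw [hprod]
    exact ((hcd.integrableOn_compact hD).integrable_indicator hD.measurableSet).integrableOn
  obtain ⟨h1, h2⟩ := integral_fibreSum hU hτ hnc hfin hfm hint
  have h3 : ∫ z in U, ‖deriv τ z‖ ^ 2 * f z = ∫ z in D, ‖deriv τ z‖ ^ 2 * g (τ z) := by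
    rw [hprod, setIntegral_indicator hD.measurableSet, inter_eq_self_of_subset_right hDU]
  rw [← h3, ← h2, ← integral_const_mul, ← integral_indicator hK.measurableSet]
  have hgK : IntegrableOn (fun y => N * g y) (τ '' D) :=
    (hg.integrableOn_compact hK).const_mul _
  refine integral_mono h1 (hgK.integrable_indicator hK.measurableSet) fun y => ?_
  by_cases hy : y ∈ τ '' D
  · rw [indicator_of_mem hy, fibreSum_eq_sum (hfin y)]
    calc ∑ z ∈ (hfin y).toFinset, f z ≤ ∑ z ∈ (hfin y).toFinset, g y := by
          refine Finset.sum_le_sum fun z hz => ?_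
          have hz' : z ∈ U ∩ τ ⁻¹' {y} := by simpa using hz
          by_cases hzD : z ∈ D
          · simp only [hf, indicator_of_mem hzD]
            rw [show τ z = y from hz'.2]
          · simp only [hf, indicator_of_notMem hzD]
            exact hg0 y
      _ ≤ N * g y := by
          rw [Finset.sum_const, nsmul_eq_mul]
          refine mul_le_mul_of_nonneg_right ?_ (hg0 y)
          rw [← ncard_eq_toFinset_card _ (hfin y)]
          exact_mod_cast hN y
  · rw [indicator_of_notMem hy]
    refine (finsum_mem_eq_zero_of_forall_eq_zero fun z hz => ?_).le
    have : z ∉ D := fun h => hy ⟨z, h, hz.2⟩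
    simp only [hf, indicator_of_notMem this]

/-- The basic estimate for pull-backs under holomorphic maps, near a point. -/
theorem exists_local_pull_bound {p : ℂ} (hp : p ∈ U) :
    ∃ B ∈ 𝓝 p, IsCompact B ∧ ∃ D, IsCompact D ∧ D ⊆ U ∧ B ⊆ D ∧ ∃ C : ℝ, 0 ≤ C ∧
      ∀ (V : Set ℂ) (v : ℂ → ℝ), IsOpen V → τ '' D ⊆ V → MapsTo τ U V → ContDiffOn ℝ ∞ v V →
        ∫ z in B, dirichlet (v ∘ τ) z ≤ C * ∫ y in τ '' D, dirichlet v y := by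
  obtain ⟨ε, hε, hball⟩ := Metric.nhds_basis_closedBall.mem_iff.1
    (inter_mem (hU.mem_nhds hp) (eventually_nhdsWithin_iff.1 (hnc p hp)))
  -- The disc B of radius r about p and its translate B' by 3r both lie in the disc D of radius 4r =
  -- ε. B' avoids p, the only possible zero of τ' in D, so |τ'|² has a positive minimum δ on B'.
  set r := ε / 4 with hr
  have hr0 : 0 < r := by positivity
  set D := Metric.closedBall p ε with hD
  set B := Metric.closedBall p r with hB
  set B' := Metric.closedBall (p + (3 * r : ℝ)) r with hB'
  have hDc : IsCompact D := isCompact_closedBall _ _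
  have hDU : D ⊆ U := fun z hz => (hball hz).1
  have hBD : B ⊆ D := Metric.closedBall_subset_closedBall (by linarith)
  have hB'D : B' ⊆ D := by
    refine Metric.closedBall_subset_closedBall' ?_
    rw [dist_self_add_left, Complex.norm_real, Real.norm_of_nonneg (by positivity)]
    linarith
  have hB'p : p ∉ B' := by
    rw [hB', Metric.mem_closedBall, dist_self_add_right, Complex.norm_real,
      Real.norm_of_nonneg (by positivity)]
    linarith
  have hdc : ContinuousOn (fun z => ‖deriv τ z‖ ^ 2) U := (hτ.deriv.continuousOn.norm).pow 2
  obtain ⟨z₀, hz₀, hmin⟩ := (isCompact_closedBall (p + ((3 * r : ℝ) : ℂ)) r).exists_isMinOn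
    ⟨_, Metric.mem_closedBall_self hr0.le⟩ (hdc.mono (hB'D.trans hDU))
  set δ := ‖deriv τ z₀‖ ^ 2 with hδ
  have hδ0 : 0 < δ := by
    have : deriv τ z₀ ≠ 0 := (hball (hB'D hz₀)).2 fun h => hB'p (h ▸ hz₀)
    positivity
  refine ⟨B, Metric.closedBall_mem_nhds p hr0, isCompact_closedBall _ _, D, hDc, hDU, hBD,
    N * (2 * δ⁻¹ + 2 * (3 * r) ^ 2 + 1), by positivity, fun V v hV hDV hUV hv => ?_⟩
  set K := τ '' D with hK
  set u := v ∘ τ with hu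
  have hτs : ContDiffOn ℝ ∞ τ U := fun z hz =>
    (((hτ z hz).restrictScalars (𝕜 := ℝ)).contDiffAt).contDiffWithinAt
  have hus : ContDiffOn ℝ ∞ u U := hv.comp hτs hUV
  have hKc : IsCompact K := hDc.image_of_continuousOn (hτ.continuousOn.mono hDU)
  set g : ℂ → ℝ := fun y => fderiv ℝ v y 1 ^ 2 + fderiv ℝ v y Complex.I ^ 2 with hg
  have hvd := hv.continuousOn_fderiv_of_isOpen hV (by simp)
  have hgc : ContinuousOn g K := (((hvd.clm_apply continuousOn_const).pow 2).add
    ((hvd.clm_apply continuousOn_const).pow 2)).mono hDV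
  have hvc : ContinuousOn (fun y => v y ^ 2) K := (hv.continuousOn.mono hDV).pow 2
  have hgi := hgc.integrableOn_compact hKc (μ := volume)
  have hvi := hvc.integrableOn_compact hKc (μ := volume)
  have hsplit : ∫ y in K, dirichlet v y = (∫ y in K, v y ^ 2) + ∫ y in K, g y := by
    rw [← integral_add hvi hgi]
    exact integral_congr_ae (ae_of_all _ fun y => add_assoc _ _ _)
  -- Since τ is conformal, the squared gradient is multiplied by the Jacobian exactly, and the
  -- gradient energy passes through critical points without loss.
  have hchain : ∀ z ∈ U, fderiv ℝ u z 1 ^ 2 + fderiv ℝ u z Complex.I ^ 2 =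
      ‖deriv τ z‖ ^ 2 * g (τ z) := by
    intro z hz
    have h1 := ((hv.contDiffAt (hV.mem_nhds (hUV hz))).differentiableAt
      (by simp)).hasFDerivAt.comp z
      ((hτ z hz).differentiableAt.hasDerivAt.hasFDerivAt.restrictScalars ℝ)
    have h2 : fderiv ℝ u z = _ := h1.fderiv
    rw [h2]
    simp only [ContinuousLinearMap.comp_apply, ContinuousLinearMap.coe_restrictScalars',
      ContinuousLinearMap.toSpanSingleton_apply, smul_eq_mul, one_mul]
    rw [fderiv_apply_eq v (τ z) (deriv τ z), fderiv_apply_eq v (τ z) (Complex.I * deriv τ z),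
      ← Complex.normSq_eq_norm_sq, Complex.normSq_apply]
    simp only [hg, Complex.mul_re, Complex.mul_im, Complex.I_re, Complex.I_im]
    ring
  have hgrad : ∫ z in D, (fderiv ℝ u z 1 ^ 2 + fderiv ℝ u z Complex.I ^ 2) ≤
      N * ∫ y in K, g y := by
    rw [setIntegral_congr_fun hDc.measurableSet fun z hz => hchain z (hDU hz)]
    exact integral_comp_le hU hτ hnc hfin hN hDc hDU hgc fun y => by positivity
  have hud := hus.continuousOn_fderiv_of_isOpen hU (by simp)
  have hgu : ContinuousOn (fun z => fderiv ℝ u z 1 ^ 2 + fderiv ℝ u z Complex.I ^ 2) D :=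
    (((hud.clm_apply continuousOn_const).pow 2).add
      ((hud.clm_apply continuousOn_const).pow 2)).mono hDU
  have huc : ContinuousOn (fun z => u z ^ 2) D := (hus.continuousOn.pow 2).mono hDU
  have hgui := hgu.integrableOn_compact hDc (μ := volume)
  have hL2 : ∫ z in D, ‖deriv τ z‖ ^ 2 * u z ^ 2 ≤ N * ∫ y in K, v y ^ 2 :=
    integral_comp_le hU hτ hnc hfin hN hDc hDU hvc fun y => sq_nonneg _
  -- The area formula controls u² only with the weight |τ'|²; on B' the weight can be removed at the
  -- cost of δ⁻¹.
  have hB'i : ∫ z in B', u z ^ 2 ≤ δ⁻¹ * (N * ∫ y in K, v y ^ 2) := by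
    rw [le_inv_mul_iff₀ hδ0, ← integral_const_mul]
    have hcd : ContinuousOn (fun z => ‖deriv τ z‖ ^ 2 * u z ^ 2) D := (hdc.mono hDU).mul huc
    have hcdi := hcd.integrableOn_compact hDc (μ := volume)
    calc ∫ z in B', δ * u z ^ 2 ≤ ∫ z in B', ‖deriv τ z‖ ^ 2 * u z ^ 2 := by
          refine setIntegral_mono_on (((huc.mono hB'D).integrableOn_compact
            (isCompact_closedBall _ _)).const_mul _) (hcdi.mono_set hB'D)
            measurableSet_closedBall fun z hz => ?_
          exact mul_le_mul_of_nonneg_right (hmin hz) (sq_nonneg _)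
      _ ≤ ∫ z in D, ‖deriv τ z‖ ^ 2 * u z ^ 2 :=
          setIntegral_mono_set hcdi (ae_of_all _ fun z => by positivity)
            (ae_of_all _ hB'D)
      _ ≤ _ := hL2
  -- The L² norm on B, where τ' may vanish, is traded for the L² norm on B' and the gradient on D.
  have htr := integral_sq_le_translate hU hus (isCompact_closedBall p r) hDc hDU
    (a := ((3 * r : ℝ) : ℂ)) (by
      intro z hz t ht
      rw [Metric.mem_closedBall] at hz ⊢
      calc dist (z + t • ((3 * r : ℝ) : ℂ)) p ≤ dist (z + t • ((3 * r : ℝ) : ℂ)) z + dist z p :=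
            dist_triangle _ _ _
        _ ≤ 3 * r + r := by
            refine add_le_add ?_ hz
            rw [dist_self_add_left, norm_smul, Complex.norm_real, Real.norm_of_nonneg ht.1,
              Real.norm_of_nonneg (by positivity : (0 : ℝ) ≤ 3 * r)]
            nlinarith [ht.2]
        _ = ε := by rw [hr]; ring)
  have htl : ∫ z in B, u (z + ((3 * r : ℝ) : ℂ)) ^ 2 ≤ ∫ z in B', u z ^ 2 :=
    setIntegral_translate_le (f := fun z => u z ^ 2)
      ((huc.mono hB'D).integrableOn_compact (isCompact_closedBall _ _)) (fun z => sq_nonneg _)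
      fun z hz => by
        rw [hB', Metric.mem_closedBall, dist_add_right]
        exact hz
  have hgr : ∫ z in D, fderiv ℝ u z ((3 * r : ℝ) : ℂ) ^ 2 ≤
      (3 * r) ^ 2 * ∫ z in D, (fderiv ℝ u z 1 ^ 2 + fderiv ℝ u z Complex.I ^ 2) := by
    rw [← integral_const_mul]
    refine setIntegral_mono_on ((((hud.clm_apply continuousOn_const).pow 2).mono
      hDU).integrableOn_compact hDc) (hgui.const_mul _) hDc.measurableSet fun z hz => ?_
    rw [fderiv_apply_eq]
    simp only [Complex.ofReal_re, Complex.ofReal_im, zero_mul, add_zero]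
    nlinarith [sq_nonneg (3 * r * fderiv ℝ u z Complex.I)]
  have hBsplit : ∫ z in B, dirichlet u z = (∫ z in B, u z ^ 2) +
      ∫ z in B, (fderiv ℝ u z 1 ^ 2 + fderiv ℝ u z Complex.I ^ 2) := by
    rw [← integral_add ((huc.mono hBD).integrableOn_compact (isCompact_closedBall _ _))
      (hgui.mono_set hBD)]
    exact integral_congr_ae (ae_of_all _ fun y => add_assoc _ _ _)
  have hBg : ∫ z in B, (fderiv ℝ u z 1 ^ 2 + fderiv ℝ u z Complex.I ^ 2) ≤
      ∫ z in D, (fderiv ℝ u z 1 ^ 2 + fderiv ℝ u z Complex.I ^ 2) :=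
    setIntegral_mono_set hgui (ae_of_all _ fun z => by positivity) (ae_of_all _ hBD)
  have hv0 : 0 ≤ ∫ y in K, v y ^ 2 := integral_nonneg fun y => sq_nonneg _
  have hg0 : 0 ≤ ∫ y in K, g y := integral_nonneg fun y => by positivity
  rw [hBsplit, hsplit]
  set Iv := ∫ y in K, v y ^ 2
  set Ig := ∫ y in K, g y
  set Du := ∫ z in D, (fderiv ℝ u z 1 ^ 2 + fderiv ℝ u z Complex.I ^ 2)
  have hN0 : (0 : ℝ) ≤ N := Nat.cast_nonneg N
  have hδi : 0 < δ⁻¹ := inv_pos.2 hδ0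
  have s1 : ∫ z in B, u z ^ 2 ≤ 2 * (δ⁻¹ * (N * Iv)) + 2 * ((3 * r) ^ 2 * (N * Ig)) := by
    have := mul_le_mul_of_nonneg_left hgrad (sq_nonneg (3 * r))
    linarith
  have e1 : 0 ≤ N * Iv * (2 * (3 * r) ^ 2 + 1) := by positivity
  have e2 : 0 ≤ N * Ig * (2 * δ⁻¹) := by positivity
  nlinarith

end Poincare

/-! ### Boundedness of the pull-back. -/

section Pull

variable {X Y : Type*} [TopologicalSpace X] [ChartedSpace ℂ X] [IsManifold 𝓘(ℂ) ω X]
  [TopologicalSpace Y] [ChartedSpace ℂ Y] [IsManifold 𝓘(ℂ) ω Y]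
  [T2Space X] [CompactSpace X] [T2Space Y] [CompactSpace Y]
  {F : X → Y} (hF : MDifferentiable 𝓘(ℂ) 𝓘(ℂ) F)
  (hiso : ∀ (x : X) (y : Y), ∀ᶠ x' in 𝓝[≠] x, F x' ≠ y)

include hF hiso

/-- The pull-back of functions is bounded for the `L²₁` topologies. -/
theorem isBoundedOp_pullFun : IsBoundedOp (pullFun F) := by
  refine ⟨fun _ _ => rfl, fun u v S hS h => ?_, fun s hs => ?_, fun e L hL hLe => ?_⟩
  · exact ⟨F ⁻¹' S, hS.preimage' fun y _ => finite_fibre hF hiso y, fun x hx => h _ hx⟩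
  · exact isGivenByFun_of_contMDiff (contMDiff_comp_map hF hs)
  · obtain ⟨N, hN⟩ := exists_fibre_bound hF hiso
    -- Points outside the range of the chart receive empty data, so that charts and constants can be
    -- chosen for all of ℂ at once.
    have hloc : ∀ p : ℂ, ∃ (c : Chart Y) (B K : Set ℂ) (C : ℝ), p ∈ e.1.target →
        (B ∈ 𝓝 p ∧ IsCompact B ∧ IsCompact K ∧ K ⊆ c.1.target ∧ B ⊆ e.1.target ∧ 0 ≤ C ∧
        ∀ s : Y → ℝ, ContMDiff 𝓘(ℝ, ℂ) 𝓘(ℝ, ℝ) ∞ s →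
          ∫ z in B, dirichlet ((s ∘ F) ∘ e.1.symm) z ≤
            C * ∫ y in K, dirichlet (s ∘ c.1.symm) y) := by
      intro p
      set c := Chart.preferred (F (e.1.symm p))
      by_cases hp : p ∈ e.1.target
      · have hpU : p ∈ locDom F e c := ⟨hp, mem_source_preferred _⟩
        obtain ⟨B, hBp, hB, D, hD, hDU, hBD, C, hC0, hC⟩ := exists_local_pull_bound
          (isOpen_locDom hF.continuous e c) (analyticOnNhd_locMap hF e c)
          (fun z hz => eventually_deriv_locMap_ne_zero hF hiso e c hz)
          (finite_fibre_locMap hF hiso e c) (ncard_fibre_locMap_le hF hiso hN e c) hpU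
        have hmt : MapsTo (locMap F e c) (locDom F e c) c.1.target :=
          fun z hz => locMap_mem_target hz
        have himg : locMap F e c '' D ⊆ c.1.target := (image_mono hDU).trans hmt.image_subset
        refine ⟨c, B, locMap F e c '' D, C, fun _ => ⟨hBp, hB, hD.image_of_continuousOn
          ((analyticOnNhd_locMap hF e c).continuousOn.mono hDU), himg,
          (hBD.trans hDU).trans fun z hz => hz.1, hC0, fun s hs => ?_⟩⟩
        rw [← setIntegral_congr_fun hB.measurableSet (fun z hz => ?_)]
        · exact hC _ _ c.1.open_target himg hmt (contMDiff_iff_chart.1 hs c)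
        · refine dirichlet_congr ?_
          filter_upwards [(isOpen_locDom hF.continuous e c).mem_nhds (hDU (hBD hz))] with w hw
          simp [symm_locMap hw]
      · exact ⟨c, ∅, ∅, 0, fun h => absurd h hp⟩
    choose c B K C hprop using hloc
    obtain ⟨t, htL, ht⟩ := hL.elim_nhds_subcover B fun p hp => (hprop p (hLe hp)).1
    have ht' : ∀ p ∈ t, p ∈ e.1.target := fun p hp => hLe (htL p hp)
    refine ⟨(fun p => (c p, K p)) '' t, t.finite_toSet.image _, ?_, ∑ p ∈ t, C p,
      Finset.sum_nonneg fun p hp => (hprop p (ht' p hp)).2.2.2.2.2.1, ?_⟩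
    · rintro _ ⟨p, hp, rfl⟩
      exact ⟨(hprop p (ht' p hp)).2.2.1, (hprop p (ht' p hp)).2.2.2.1⟩
    · intro s S T A hs hS hT hA hE
      have hss := contMDiff_iff_chart.1 (contMDiff_comp_map hF hs) e
      rw [energyLE_iff_of_contDiffOn (hT e) hss hL hLe]
      have hcd := continuousOn_dirichlet e.1.open_target hss
      have hii : ∀ p ∈ t, IntegrableOn (dirichlet ((s ∘ F) ∘ e.1.symm)) (B p) := fun p hp =>
        (hcd.mono (hprop p (ht' p hp)).2.2.2.2.1).integrableOn_compact (hprop p (ht' p hp)).2.1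
      calc ∫ z in L, dirichlet ((s ∘ F) ∘ e.1.symm) z
          ≤ ∫ z in ⋃ p ∈ t, B p, dirichlet ((s ∘ F) ∘ e.1.symm) z :=
            setIntegral_mono_set ((integrableOn_finset_iUnion (s := t)).2 hii)
              (ae_of_all _ fun z => dirichlet_nonneg _ z) (ae_of_all _ ht)
        _ ≤ ∑ p ∈ t, ∫ z in B p, dirichlet ((s ∘ F) ∘ e.1.symm) z :=
            setIntegral_biUnion_le t (dirichlet_nonneg _) hii
        _ ≤ ∑ p ∈ t, C p * A := by
            refine Finset.sum_le_sum fun p hp => ?_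
            obtain ⟨-, -, hK, hKc, -, hC0, hb⟩ := hprop p (ht' p hp)
            refine (hb s hs).trans (mul_le_mul_of_nonneg_left ?_ hC0)
            exact (energyLE_iff_of_contDiffOn (hS (c p)) (contMDiff_iff_chart.1 hs _) hK hKc).1
              (hE _ (mem_image_of_mem _ hp))
        _ = (∑ p ∈ t, C p) * A := by rw [Finset.sum_mul]

end Pull

/-! ### Completeness of L² and of W^{1,2} in the local sense. -/

section Completeness

variable {α : Type*} [MeasurableSpace α] {μ : Measure α}

/-- The quadratic polynomial t ↦ ∫ (f + t g)² is non-negative, so its discriminant is at most zero.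
-/
theorem sq_integral_mul_le {f g : α → ℝ} (hf : MemLp f 2 μ) (hg : MemLp g 2 μ) :
    (∫ x, f x * g x ∂μ) ^ 2 ≤ (∫ x, f x ^ 2 ∂μ) * ∫ x, g x ^ 2 ∂μ := by
  have i1 := hf.integrable_sq
  have i2 := hg.integrable_sq
  have i3 : Integrable (fun x => f x * g x) μ := hf.integrable_mul hg
  have h : ∀ t : ℝ, 0 ≤ (∫ x, g x ^ 2 ∂μ) * (t * t) + (2 * ∫ x, f x * g x ∂μ) * t +
      ∫ x, f x ^ 2 ∂μ := by
    intro t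
    have h0 : 0 ≤ ∫ x, (f x + t * g x) ^ 2 ∂μ := integral_nonneg fun x => sq_nonneg _
    have h1 : ∫ x, (f x + t * g x) ^ 2 ∂μ =
        ∫ x, (t ^ 2 * g x ^ 2 + (2 * t * (f x * g x) + f x ^ 2)) ∂μ :=
      integral_congr_ae (ae_of_all _ fun x => by simp only; ring)
    have i4 : Integrable (fun x => 2 * t * (f x * g x) + f x ^ 2) μ := (i3.const_mul _).add i1
    rw [h1, integral_add (i2.const_mul _) i4,
      integral_add (i3.const_mul _) i1, integral_const_mul, integral_const_mul] at h0
    nlinarith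
  have := discrim_le_zero h
  rw [discrim] at this
  nlinarith

theorem sq_norm_toLp {f : α → ℝ} (hf : MemLp f 2 μ) : ‖hf.toLp f‖ ^ 2 = ∫ x, f x ^ 2 ∂μ := by
  rw [Lp.norm_toLp, hf.eLpNorm_eq_integral_rpow_norm (by norm_num) (by norm_num),
    ENNReal.toReal_ofReal (by positivity), ← Real.rpow_natCast, ← Real.rpow_mul
    (integral_nonneg fun x => by positivity)]
  simp

theorem exists_limit_of_cauchy_sq {u : ℕ → α → ℝ} (hu : ∀ n, MemLp (u n) 2 μ)
    (hc : ∀ ε > 0, ∃ n₀, ∀ m ≥ n₀, ∀ n ≥ n₀, ∫ x, (u m x - u n x) ^ 2 ∂μ ≤ ε) :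
    ∃ f, MemLp f 2 μ ∧ Tendsto (fun n => ∫ x, (u n x - f x) ^ 2 ∂μ) atTop (𝓝 0) := by
  have hcs : CauchySeq fun n => (hu n).toLp (u n) := by
    rw [Metric.cauchySeq_iff]
    intro ε hε
    obtain ⟨n₀, hn₀⟩ := hc (ε ^ 2 / 2) (by positivity)
    refine ⟨n₀, fun m hm n hn => ?_⟩
    rw [dist_eq_norm, ← MemLp.toLp_sub]
    have h1 := sq_norm_toLp ((hu m).sub (hu n))
    have h2 := hn₀ m hm n hn
    have h3 : ‖((hu m).sub (hu n)).toLp (u m - u n)‖ ^ 2 < ε ^ 2 := by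
      rw [h1]
      simp only [Pi.sub_apply]
      nlinarith [sq_pos_of_pos hε]
    exact lt_of_pow_lt_pow_left₀ 2 hε.le h3
  obtain ⟨g, hg⟩ := cauchySeq_tendsto_of_complete hcs
  refine ⟨g, Lp.memLp g, ?_⟩
  have h1 := (tendsto_iff_norm_sub_tendsto_zero.1 hg).pow 2
  rw [zero_pow (by norm_num)] at h1
  refine h1.congr fun n => ?_
  have h2 : (hu n).toLp (u n) - g = ((hu n).sub (Lp.memLp g)).toLp (u n - ⇑g) := by
    rw [MemLp.toLp_sub (hu n) (Lp.memLp g), Lp.toLp_coeFn]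
  rw [h2, sq_norm_toLp]
  rfl

theorem integral_sq_sub_le {f g h : α → ℝ} (hf : MemLp f 2 μ) (hg : MemLp g 2 μ)
    (hh : MemLp h 2 μ) :
    ∫ x, (f x - g x) ^ 2 ∂μ ≤ 2 * (∫ x, (h x - f x) ^ 2 ∂μ) + 2 * ∫ x, (h x - g x) ^ 2 ∂μ := by
  have i1 : Integrable (fun x => 2 * (h x - f x) ^ 2) μ := (hh.sub hf).integrable_sq.const_mul 2
  have i2 : Integrable (fun x => 2 * (h x - g x) ^ 2) μ := (hh.sub hg).integrable_sq.const_mul 2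
  rw [← integral_const_mul, ← integral_const_mul, ← integral_add i1 i2]
  refine integral_mono (hf.sub hg).integrable_sq (i1.add i2) fun x => ?_
  change (f x - g x) ^ 2 ≤ 2 * (h x - f x) ^ 2 + 2 * (h x - g x) ^ 2
  nlinarith [sq_nonneg (h x - f x + (h x - g x))]

theorem ae_eq_of_tendsto_sq {u : ℕ → α → ℝ} {f g : α → ℝ} (hu : ∀ n, MemLp (u n) 2 μ)
    (hf : MemLp f 2 μ) (hg : MemLp g 2 μ)
    (h1 : Tendsto (fun n => ∫ x, (u n x - f x) ^ 2 ∂μ) atTop (𝓝 0))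
    (h2 : Tendsto (fun n => ∫ x, (u n x - g x) ^ 2 ∂μ) atTop (𝓝 0)) : f =ᵐ[μ] g := by
  have h3 : ∫ x, (f x - g x) ^ 2 ∂μ ≤ 0 := by
    have h4 := (h1.const_mul 2).add (h2.const_mul 2)
    simp only [mul_zero, add_zero] at h4
    exact ge_of_tendsto' h4 fun n => integral_sq_sub_le hf hg (hu n)
  have h5 := le_antisymm h3 (integral_nonneg fun x => sq_nonneg _)
  have i1 : Integrable (fun x => (f x - g x) ^ 2) μ := (hf.sub hg).integrable_sq
  rw [integral_eq_zero_iff_of_nonneg (fun x => sq_nonneg _) i1] at h5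
  filter_upwards [h5] with x hx
  exact sub_eq_zero.1 (pow_eq_zero_iff (two_ne_zero) |>.1 hx)

theorem exists_compact_exhaustion (Ω : Opens ℂ) : ∃ K : ℕ → Set ℂ, (∀ j, IsCompact (K j)) ∧
    (∀ j, K j ⊆ Ω) ∧ ∀ L ⊆ (Ω : Set ℂ), IsCompact L → ∃ j, L ⊆ K j := by
  have : LocallyCompactSpace Ω := Ω.isOpen.locallyCompactSpace
  let E : CompactExhaustion Ω := CompactExhaustion.choice Ω
  refine ⟨fun j => (↑) '' E j, fun j => (E.isCompact j).image continuous_subtype_val,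
    fun j => by rintro _ ⟨z, -, rfl⟩; exact z.2, fun L hL hLc => ?_⟩
  have h1 : IsCompact ((↑) ⁻¹' L : Set Ω) := by
    refine Subtype.isCompact_iff.2 ?_
    have : ((↑) : Ω → ℂ) '' ((↑) ⁻¹' L) = L := by
      ext z
      exact ⟨fun ⟨w, hw, h⟩ => h ▸ hw, fun hz => ⟨⟨z, hL hz⟩, hz, rfl⟩⟩
    rwa [this]
  obtain ⟨j, hj⟩ := E.exists_superset_of_isCompact h1
  exact ⟨j, fun z hz => ⟨⟨z, hL hz⟩, hj hz, rfl⟩⟩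

/-- Local square integrability is complete. -/
theorem exists_l2Loc_limit {Ω : Opens ℂ} {u : ℕ → ℂ → ℝ} (hu : ∀ n, IsL2Loc Ω (u n))
    (hc : ∀ K ⊆ (Ω : Set ℂ), IsCompact K → ∀ ε > 0, ∃ n₀, ∀ m ≥ n₀, ∀ n ≥ n₀,
      ∫ z in K, (u m z - u n z) ^ 2 ≤ ε) :
    ∃ f, IsL2Loc Ω f ∧ ∀ K ⊆ (Ω : Set ℂ), IsCompact K →
      Tendsto (fun n => ∫ z in K, (u n z - f z) ^ 2) atTop (𝓝 0) := by
  classical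
  obtain ⟨K, hKc, hKΩ, hKex⟩ := exists_compact_exhaustion Ω
  choose f hf hlim using fun j => exists_limit_of_cauchy_sq
    (fun n => hu n (K j) (hKc j) (hKΩ j)) (hc (K j) (hKΩ j) (hKc j))
  have hmono : ∀ (j : ℕ) (L : Set ℂ), L ⊆ K j →
      Tendsto (fun n => ∫ z in L, (u n z - f j z) ^ 2) atTop (𝓝 0) := by
    intro j L hL
    refine squeeze_zero (fun n => integral_nonneg fun z => sq_nonneg _) (fun n => ?_) (hlim j)
    exact setIntegral_mono_set ((hu n (K j) (hKc j) (hKΩ j)).sub (hf j)).integrable_sq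
      (ae_of_all _ fun z => sq_nonneg _) (ae_of_all _ hL)
  have hagree : ∀ i j, ∀ᵐ z, z ∈ K i ∩ K j → f i z = f j z := by
    intro i j
    rw [← ae_restrict_iff' ((hKc i).inter (hKc j)).measurableSet]
    have m1 : ∀ {g : ℂ → ℝ} {k : ℕ}, K i ∩ K j ⊆ K k → MemLp g 2 (volume.restrict (K k)) →
        MemLp g 2 (volume.restrict (K i ∩ K j)) := fun hs hg =>
      hg.mono_measure (Measure.restrict_mono hs le_rfl)
    exact ae_eq_of_tendsto_sq (fun n => m1 inter_subset_left (hu n (K i) (hKc i) (hKΩ i)))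
      (m1 inter_subset_left (hf i)) (m1 inter_subset_right (hf j))
      (hmono i _ inter_subset_left) (hmono j _ inter_subset_right)
  have hcov : ∀ z ∈ Ω, ∃ j, z ∈ K j := fun z hz => by
    obtain ⟨j, hj⟩ := hKex {z} (singleton_subset_iff.2 hz) isCompact_singleton
    exact ⟨j, hj rfl⟩
  -- The limits on the members of the exhaustion agree almost everywhere on overlaps. The index used
  -- at z may vary from point to point; as there are countably many indices, the exceptional sets
  -- still form a null set.
  set g : ℂ → ℝ := fun z => if h : z ∈ Ω then f (hcov z h).choose z else 0 with hg
  have hgf : ∀ j, ∀ᵐ z, z ∈ K j → g z = f j z := by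
    intro j
    filter_upwards [ae_all_iff.2 fun i => hagree i j] with z hz hzj
    have hzΩ : z ∈ Ω := hKΩ j hzj
    simp only [hg, dif_pos hzΩ]
    exact hz _ ⟨(hcov z hzΩ).choose_spec, hzj⟩
  have hgf' : ∀ j, ∀ L ⊆ K j, MeasurableSet L → g =ᵐ[volume.restrict L] f j := by
    intro j L hL hLm
    rw [EventuallyEq, ae_restrict_iff' hLm]
    filter_upwards [hgf j] with z hz hzL
    exact hz (hL hzL)
  refine ⟨g, fun L hLc hL => ?_, fun L hL hLc => ?_⟩
  · obtain ⟨j, hj⟩ := hKex L hL hLc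
    exact ((hf j).mono_measure (Measure.restrict_mono hj le_rfl)).ae_eq
      (hgf' j L hj hLc.measurableSet).symm
  · obtain ⟨j, hj⟩ := hKex L hL hLc
    refine (hmono j L hj).congr fun n => integral_congr_ae ?_
    filter_upwards [hgf' j L hj hLc.measurableSet] with z hz
    rw [hz]

theorem tendsto_integral_mul_test {Ω : Opens ℂ} {u : ℕ → ℂ → ℝ} {f : ℂ → ℝ}
    (hu : ∀ n, IsL2Loc Ω (u n)) (hf : IsL2Loc Ω f)
    (h : ∀ K ⊆ (Ω : Set ℂ), IsCompact K →
      Tendsto (fun n => ∫ z in K, (u n z - f z) ^ 2) atTop (𝓝 0)) (φ : 𝓓(Ω, ℝ)) :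
    Tendsto (fun n => ∫ z, u n z * φ z) atTop (𝓝 (∫ z, f z * φ z)) := by
  set K := tsupport φ with hK
  have hKc : IsCompact K := φ.hasCompactSupport
  have hKΩ : K ⊆ Ω := φ.tsupport_subset
  have hφ : MemLp φ 2 (volume.restrict K) :=
    isL2Loc_of_continuousOn (Ω := Ω) (testFunction_smooth φ).continuous.continuousOn K hKc hKΩ
  have hdiff : ∀ n, (∫ z, u n z * φ z) - ∫ z, f z * φ z = ∫ z in K, (u n z - f z) * φ z := by
    intro n
    rw [← integral_sub (integrable_mul_test (hu n).locallyIntegrableOn φ)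
      (integrable_mul_test hf.locallyIntegrableOn φ),
      setIntegral_eq_integral_of_forall_compl_eq_zero]
    · exact integral_congr_ae (ae_of_all _ fun z => by simp only; ring)
    · intro z hz
      rw [image_eq_zero_of_notMem_tsupport hz, mul_zero]
  rw [tendsto_iff_norm_sub_tendsto_zero]
  have h1 : Tendsto (fun n => Real.sqrt ((∫ z in K, (u n z - f z) ^ 2) * ∫ z in K, φ z ^ 2))
      atTop (𝓝 0) := by
    have := ((h K hKΩ hKc).mul_const (∫ z in K, φ z ^ 2)).sqrt
    simpa using this
  refine squeeze_zero (fun n => norm_nonneg _) (fun n => ?_) h1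
  rw [hdiff n, Real.norm_eq_abs]
  exact Real.abs_le_sqrt (sq_integral_mul_le ((hu n K hKc hKΩ).sub (hf K hKc hKΩ)) hφ)

/-- A Cauchy sequence for the local `W^{1,2}` norms converges. -/
theorem exists_l2Gradient_limit {Ω : Opens ℂ} {T : ℕ → 𝓓'(Ω, ℝ)} {u p q : ℕ → ℂ → ℝ}
    (hT : ∀ n, HasL2Gradient (T n) (u n) (p n) (q n))
    (hc : ∀ K ⊆ (Ω : Set ℂ), IsCompact K → ∀ ε > 0, ∃ n₀, ∀ m ≥ n₀, ∀ n ≥ n₀,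
      EnergyLE (T m - T n) K ε) :
    ∃ f g h : ℂ → ℝ, HasL2Gradient (ofFunLocal Ω f) f g h ∧
      (∀ K ⊆ (Ω : Set ℂ), IsCompact K → Tendsto (fun n => ∫ z in K,
        ((u n z - f z) ^ 2 + (p n z - g z) ^ 2 + (q n z - h z) ^ 2)) atTop (𝓝 0)) ∧
      ∀ φ : 𝓓(Ω, ℝ), Tendsto (fun n => T n φ) atTop (𝓝 (ofFunLocal Ω f φ)) := by
  have hE : ∀ K ⊆ (Ω : Set ℂ), IsCompact K → ∀ ε > 0, ∃ n₀, ∀ m ≥ n₀, ∀ n ≥ n₀,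
      ∫ z in K, ((u m z - u n z) ^ 2 + (p m z - p n z) ^ 2 + (q m z - q n z) ^ 2) ≤ ε := by
    intro K hK hKc ε hε
    obtain ⟨n₀, hn₀⟩ := hc K hK hKc ε hε
    exact ⟨n₀, fun m hm n hn => (hn₀ m hm n hn).integral_le hKc hK ((hT m).sub (hT n))⟩
  have hcomp : ∀ v : ℕ → ℂ → ℝ, (∀ n, IsL2Loc Ω (v n)) →
      (∀ m n z, (v m z - v n z) ^ 2 ≤
        (u m z - u n z) ^ 2 + (p m z - p n z) ^ 2 + (q m z - q n z) ^ 2) →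
      ∃ f, IsL2Loc Ω f ∧ ∀ K ⊆ (Ω : Set ℂ), IsCompact K →
        Tendsto (fun n => ∫ z in K, (v n z - f z) ^ 2) atTop (𝓝 0) := by
    intro v hv hle
    refine exists_l2Loc_limit hv fun K hK hKc ε hε => ?_
    obtain ⟨n₀, hn₀⟩ := hE K hK hKc ε hε
    refine ⟨n₀, fun m hm n hn => le_trans ?_ (hn₀ m hm n hn)⟩
    exact integral_mono ((hv m K hKc hK).sub (hv n K hKc hK)).integrable_sq
      (((hT m).sub (hT n)).integrableOn hKc hK) (hle m n)
  obtain ⟨f, hf, hfl⟩ := hcomp u (fun n => (hT n).1.1) fun m n z => by nlinarith [sq_nonneg (p m z - p n z), sq_nonneg (q m z - q n z)]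
  obtain ⟨g, hg, hgl⟩ := hcomp p (fun n => (hT n).2.1.1) fun m n z => by nlinarith [sq_nonneg (u m z - u n z), sq_nonneg (q m z - q n z)]
  obtain ⟨h, hh, hhl⟩ := hcomp q (fun n => (hT n).2.2.1) fun m n z => by nlinarith [sq_nonneg (u m z - u n z), sq_nonneg (p m z - p n z)]
  have hfg := isGivenBy_ofFunLocal hf.locallyIntegrableOn
  have hlim : ∀ φ : 𝓓(Ω, ℝ), Tendsto (fun n => T n φ) atTop (𝓝 (ofFunLocal Ω f φ)) := by
    intro φ
    rw [hfg.2 φ]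
    exact (tendsto_integral_mul_test (fun n => (hT n).1.1) hf hfl φ).congr
      fun n => ((hT n).1.2.2 φ).symm
  -- Tested on a fixed φ, both sides of the identity defining the weak derivative converge, so weak
  -- derivatives pass to L² limits.
  have hder : ∀ (v : ℂ) (r : ℕ → ℂ → ℝ) (k : ℂ → ℝ), (∀ n, IsL2Loc Ω (r n)) → IsL2Loc Ω k →
      (∀ n, IsGivenBy (∂_{v} (T n)) (r n)) →
      (∀ K ⊆ (Ω : Set ℂ), IsCompact K →
        Tendsto (fun n => ∫ z in K, (r n z - k z) ^ 2) atTop (𝓝 0)) →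
      IsGivenBy (∂_{v} (ofFunLocal Ω f)) k := by
    intro v r k hr hk hgr hrk
    refine ⟨hk.locallyIntegrableOn, fun φ => ?_⟩
    rw [lineDeriv_apply]
    have h1 := (hlim (∂_{v} φ)).neg
    have h2 := tendsto_integral_mul_test hr hk hrk φ
    refine tendsto_nhds_unique h1 (h2.congr fun n => ?_)
    rw [← (hgr n).2, lineDeriv_apply]
  refine ⟨f, g, h, ⟨⟨hf, hfg⟩, ⟨hg, hder 1 p g (fun n => (hT n).2.1.1) hg
    (fun n => (hT n).2.1.2) hgl⟩, hh, hder Complex.I q h (fun n => (hT n).2.2.1) hh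
    (fun n => (hT n).2.2.2) hhl⟩, fun K hK hKc => ?_, hlim⟩
  have h1 := ((hfl K hK hKc).add (hgl K hK hKc)).add (hhl K hK hKc)
  simp only [add_zero] at h1
  refine h1.congr fun n => ?_
  have i1 := (((hT n).1.1 K hKc hK).sub (hf K hKc hK)).integrable_sq
  have i2 := (((hT n).2.1.1 K hKc hK).sub (hg K hKc hK)).integrable_sq
  have i3 := (((hT n).2.2.1 K hKc hK).sub (hh K hKc hK)).integrable_sq
  have e1 := integral_add i1 i2
  have e2 := integral_add (i1.add i2) i3
  simp only [Pi.sub_apply, Pi.add_apply] at e1 e2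
  rw [e2, e1]

end Completeness

/-! ### Completeness of L²₁ on a surface. -/

section Dist

variable {X : Type*} [TopologicalSpace X] [ChartedSpace ℂ X] [IsManifold 𝓘(ℂ) ω X]

theorem coe_sub_apply (S T : Dist X) (e : Chart X) : (S - T).1 e = S.1 e - T.1 e := rfl

/-- The space `L²₁` is complete. -/
theorem exists_tendstoL21 {S : ℕ → Dist X} (hS : ∀ n, IsL21 (S n))
    (hc : ∀ (e : Chart X) (K : Set ℂ), IsCompact K → K ⊆ e.1.target → ∀ ε > 0, ∃ n₀, ∀ m ≥ n₀,
      ∀ n ≥ n₀, EnergyLE ((S m - S n).1 e) K ε) :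
    ∃ T : Dist X, IsL21 T ∧ TendstoL21 S T ∧
      ∀ (e : Chart X) (φ : 𝓓(e.range, ℝ)), Tendsto (fun n => (S n).1 e φ) atTop (𝓝 (T.1 e φ)) := by
  choose u p q hg using hS
  choose f g h hfgh hlim hdist using fun e : Chart X => exists_l2Gradient_limit
    (fun n => hg n e) fun K hK hKc => hc e K hKc hK
  refine ⟨⟨fun e => ofFunLocal e.range (f e), fun e e' φ φ' hφ => ?_⟩,
    fun e => ⟨f e, g e, h e, hfgh e⟩, fun e K hK hKe => ?_, hdist⟩
  -- Compatibility with changes of coordinates is inherited from the approximating distributions, by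
  -- convergence on each test function.
  · refine tendsto_nhds_unique (hdist e φ) ((hdist e' φ').congr fun n => ?_)
    exact ((S n).2 e e' φ φ' hφ).symm
  · exact ⟨_, _, _, fun n => (hg n e).sub (hfgh e), hlim e K hKe hK⟩

theorem TendstoL21.energyLE {S : ℕ → Dist X} {T : Dist X} (h : TendstoL21 S T) (e : Chart X)
    {K : Set ℂ} (hK : IsCompact K) (hKe : K ⊆ e.1.target) {ε : ℝ} (hε : 0 < ε) :
    ∃ n₀, ∀ n ≥ n₀, EnergyLE ((S n - T).1 e) K ε := by
  obtain ⟨u, p, q, h1, h2⟩ := h e K hK hKe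
  obtain ⟨n₀, hn₀⟩ := eventually_atTop.1 (h2.eventually (gt_mem_nhds hε))
  exact ⟨n₀, fun n hn => ⟨u n, p n, q n, h1 n, (hn₀ n hn).le⟩⟩

end Dist

/-! ### Mollification in the plane. -/

section Mollify

/-- A smooth probability density on `ℂ`, supported in a ball. -/
structure IsMollifier (ρ : ℂ → ℝ) (δ : ℝ) : Prop where
  smooth : ContDiff ℝ ∞ ρ
  compact : HasCompactSupport ρ
  nonneg : ∀ x, 0 ≤ ρ x
  support : Function.support ρ ⊆ Metric.ball 0 δ
  integral : ∫ x, ρ x = 1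

theorem exists_isMollifier {δ : ℝ} (hδ : 0 < δ) : ∃ ρ, IsMollifier ρ δ := by
  let b : ContDiffBump (0 : ℂ) := ⟨δ / 2, δ, by positivity, by linarith⟩
  exact ⟨b.normed volume, b.contDiff_normed, b.hasCompactSupport_normed,
    fun x => b.nonneg_normed x, b.support_normed_eq.subset, b.integral_normed⟩

variable {ρ : ℂ → ℝ} {δ : ℝ}

/-- Jensen's inequality for the probability density ρ(x - ·): with a the mean of f, integrate 2a f -
a² ≤ f². -/
theorem IsMollifier.sq_conv_le (hρ : IsMollifier ρ δ) {f : ℂ → ℝ} (hf : MemLp f 2 volume) (x : ℂ) :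
    conv f ρ x ^ 2 ≤ conv (fun z => f z ^ 2) ρ x := by
  have hl : LocallyIntegrable f := hf.locallyIntegrable (by norm_num)
  have i1 : Integrable (fun t => f t * ρ (x - t)) :=
    integrable_conv_integrand hl hρ.smooth.continuous hρ.compact x
  have i2 : Integrable (fun t => f t ^ 2 * ρ (x - t)) :=
    integrable_conv_integrand hf.integrable_sq.locallyIntegrable hρ.smooth.continuous hρ.compact x
  have i3 : Integrable (fun t => ρ (x - t)) :=
    (integrable_of_integral_eq_one hρ.integral).comp_sub_left x
  have h3 : ∫ t, ρ (x - t) = 1 := by rw [integral_sub_left_eq_self ρ volume x, hρ.integral]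
  set a := conv f ρ x with ha
  have ha' : a = ∫ t, f t * ρ (x - t) := rfl
  have h := integral_mono (((i1.const_mul (2 * a)).sub (i3.const_mul (a ^ 2)))) i2 fun t => by
    change 2 * a * (f t * ρ (x - t)) - a ^ 2 * ρ (x - t) ≤ f t ^ 2 * ρ (x - t)
    nlinarith [mul_nonneg (hρ.nonneg (x - t)) (sq_nonneg (f t - a))]
  have h5 : ∫ t, (2 * a * (f t * ρ (x - t)) - a ^ 2 * ρ (x - t)) = 2 * a * a - a ^ 2 := by
    rw [integral_sub (i1.const_mul _) (i3.const_mul _), integral_const_mul, integral_const_mul, h3,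
      ← ha', mul_one]
  change ∫ t, (2 * a * (f t * ρ (x - t)) - a ^ 2 * ρ (x - t)) ≤ _ at h
  rw [h5] at h
  change a ^ 2 ≤ ∫ t, f t ^ 2 * ρ (x - t)
  linarith

theorem IsMollifier.continuous_conv (hρ : IsMollifier ρ δ) {f : ℂ → ℝ}
    (hf : LocallyIntegrable f) : Continuous (conv f ρ) :=
  (contDiff_conv hf hρ.smooth hρ.compact).continuous

theorem IsMollifier.memLp_conv (hρ : IsMollifier ρ δ) {f : ℂ → ℝ} (hf : MemLp f 2 volume) :
    MemLp (conv f ρ) 2 volume ∧ ∫ x, conv f ρ x ^ 2 ≤ ∫ x, f x ^ 2 := by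
  have hl : LocallyIntegrable f := hf.locallyIntegrable (by norm_num)
  have hρi := integrable_of_integral_eq_one hρ.integral
  have i1 : Integrable (conv (fun z => f z ^ 2) ρ) :=
    hf.integrable_sq.integrable_convolution (ContinuousLinearMap.lsmul ℝ ℝ) hρi
  have h1 : ∫ x, conv (fun z => f z ^ 2) ρ x = ∫ x, f x ^ 2 := by
    rw [conv_eq, integral_convolution _ hf.integrable_sq hρi, hρ.integral]
    simp
  have hc := hρ.continuous_conv hl
  have i2 : Integrable (fun x => conv f ρ x ^ 2) := by
    refine i1.mono' (hc.pow 2).aestronglyMeasurable (ae_of_all _ fun x => ?_)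
    rw [Real.norm_of_nonneg (sq_nonneg _)]
    exact hρ.sq_conv_le hf x
  refine ⟨(memLp_two_iff_integrable_sq hc.aestronglyMeasurable).2 i2, ?_⟩
  rw [← h1]
  exact integral_mono i2 i1 fun x => hρ.sq_conv_le hf x

/-- A weighted mean over a δ-ball differs from h(x) by at most ε, and the difference vanishes
outside the unit neighbourhood of K. -/
theorem IsMollifier.integral_sq_conv_sub_le (hρ : IsMollifier ρ δ) (hδ : δ ≤ 1) {h : ℂ → ℝ}
    (hh : Continuous h) {K : Set ℂ} (hK : IsCompact K) (hs : tsupport h ⊆ K) {ε : ℝ}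
    (hε : 0 ≤ ε) (hu : ∀ x y, dist x y < δ → dist (h x) (h y) ≤ ε) :
    ∫ x, (conv h ρ x - h x) ^ 2 ≤ ε ^ 2 * volume.real (Metric.cthickening 1 K) := by
  have hKc : IsCompact (Metric.cthickening 1 K) := hK.cthickening
  have h0 : ∀ x ∉ Metric.cthickening 1 K, (conv h ρ x - h x) ^ 2 = 0 := by
    intro x hx
    have hxK : ∀ t ∈ K, 1 < dist x t := fun t ht => by
      by_contra! hc
      exact hx (Metric.mem_cthickening_of_dist_le x t 1 K ht hc)
    have h1 : h x = 0 := by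
      by_contra hc
      have := hxK x (hs (subset_tsupport _ hc))
      simp at this
      linarith
    have h2 : conv h ρ x = 0 := by
      refine conv_apply_eq_zero fun t ht => ?_
      by_contra hc
      have h3 := hρ.support hc
      rw [mem_ball_zero_iff, ← dist_eq_norm] at h3
      linarith [hxK t (hs (subset_tsupport _ ht))]
    rw [h1, h2]; simp
  have h1 : ∀ x, |conv h ρ x - h x| ≤ ε := fun x => by
    have := dist_convolution_le (f := ρ) (g := h) (μ := volume) (x₀ := x) (z₀ := h x) hε
      hρ.support hρ.nonneg hρ.integral hh.aestronglyMeasurable fun y hy => hu y x hy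
    rw [conv_comm]
    exact this
  rw [← setIntegral_eq_integral_of_forall_compl_eq_zero h0]
  refine (setIntegral_mono_on ?_ (integrableOn_const hKc.measure_lt_top.ne)
    hKc.measurableSet fun x _ => sq_le_sq' (neg_le_of_abs_le (h1 x)) (le_of_abs_le (h1 x))).trans_eq
    ?_
  · have hc := hρ.continuous_conv hh.locallyIntegrable
    exact ((hc.sub hh).pow 2).continuousOn.integrableOn_compact hKc
  · rw [setIntegral_const, smul_eq_mul, mul_comm]

/-- Mollifications converge in `L²`. -/
theorem tendsto_conv_mollifier {ρ : ℕ → ℂ → ℝ} {δ : ℕ → ℝ} (hρ : ∀ n, IsMollifier (ρ n) (δ n))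
    (hδ : Tendsto δ atTop (𝓝 0)) {f : ℂ → ℝ} (hf : MemLp f 2 volume) :
    Tendsto (fun n => ∫ x, (conv f (ρ n) x - f x) ^ 2) atTop (𝓝 0) := by
  rw [Metric.tendsto_atTop]
  intro ε hε
  obtain ⟨h, hc, hfh, hh, hLp⟩ := (show MemLp f (ENNReal.ofReal 2) volume by
    simpa using hf).exists_hasCompactSupport_integral_rpow_sub_le (by norm_num)
    (show (0 : ℝ) < ε / 16 by positivity)
  simp only [ENNReal.ofReal_ofNat] at hLp
  have hfh : ∫ x, (f x - h x) ^ 2 ≤ ε / 16 := by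
    refine (integral_congr_ae (ae_of_all _ fun x => ?_)).trans_le hfh
    simp
  set V := volume.real (Metric.cthickening 1 (tsupport h)) with hV
  have hV0 : 0 ≤ V := measureReal_nonneg
  obtain ⟨η, hη, hηV⟩ : ∃ η > 0, η ^ 2 * V < ε / 16 := by
    have h1 : Tendsto (fun η : ℝ => η ^ 2 * V) (𝓝[>] 0) (𝓝 0) := by
      have : Continuous fun η : ℝ => η ^ 2 * V := by fun_prop
      simpa using (this.tendsto 0).mono_left nhdsWithin_le_nhds
    obtain ⟨η, h2, h3⟩ := ((h1.eventually (gt_mem_nhds (show 0 < ε / 16 by positivity))).and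
      self_mem_nhdsWithin).exists
    exact ⟨η, h3, h2⟩
  obtain ⟨r, hr, hru⟩ := Metric.uniformContinuous_iff.1 (hc.uniformContinuous_of_continuous hh) η hη
  obtain ⟨n₀, hn₀⟩ := eventually_atTop.1
    ((hδ.eventually (gt_mem_nhds hr)).and (hδ.eventually (gt_mem_nhds one_pos)))
  refine ⟨n₀, fun n hn => ?_⟩
  have h1 := (hρ n).integral_sq_conv_sub_le (hn₀ n hn).2.le hh hc subset_rfl hη.le
    fun x y hxy => (hru (hxy.trans (hn₀ n hn).1)).le
  have hd : MemLp (fun x => f x - h x) 2 volume := hf.sub hLp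
  have h2 := ((hρ n).memLp_conv hd).2
  have hconv : ∀ x, conv (fun x => f x - h x) (ρ n) x = conv f (ρ n) x - conv h (ρ n) x := by
    intro x
    rw [conv, conv, conv, ← integral_sub
      (integrable_conv_integrand (hf.locallyIntegrable (by norm_num)) (hρ n).smooth.continuous
        (hρ n).compact x)
      (integrable_conv_integrand (hLp.locallyIntegrable (by norm_num)) (hρ n).smooth.continuous
        (hρ n).compact x)]
    simp only [sub_smul]
  have m1 := ((hρ n).memLp_conv hf).1
  have m2 := ((hρ n).memLp_conv hLp).1
  simp only [hconv] at h2
  -- The comparison runs from f * ρ to h * ρ, then to h and to f. With each step at most ε/16, the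
  -- total is 2/16 + 2(2/16 + 2/16) = 10/16 of ε.
  have e1 := integral_sq_sub_le m1 hf m2
  have e2 : ∫ x, (conv h (ρ n) x - conv f (ρ n) x) ^ 2 ≤ ε / 16 := by
    refine le_trans (le_of_eq ?_) (h2.trans hfh)
    exact integral_congr_ae (ae_of_all _ fun x => by ring)
  have e3 := integral_sq_sub_le m2 hf hLp
  have e4 : ∫ x, (h x - conv h (ρ n) x) ^ 2 ≤ ε / 16 := by
    refine le_trans (le_of_eq ?_) (h1.trans hηV.le)
    exact integral_congr_ae (ae_of_all _ fun x => by ring)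
  have e5 : ∫ x, (h x - f x) ^ 2 ≤ ε / 16 := by
    refine le_trans (le_of_eq ?_) hfh
    exact integral_congr_ae (ae_of_all _ fun x => by ring)
  rw [dist_zero_right, Real.norm_of_nonneg (integral_nonneg fun x => sq_nonneg _)]
  linarith

theorem IsL2Loc.memLp_cutoff {Ω : Opens ℂ} {u χ : ℂ → ℝ} (hu : IsL2Loc Ω u) (hχ : Continuous χ)
    (hc : HasCompactSupport χ) (hs : tsupport χ ⊆ Ω) : MemLp (fun z => χ z * u z) 2 volume := by
  obtain ⟨C, hC⟩ := hc.exists_bound_of_continuous hχ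
  have h1 : MemLp (fun z => χ z * u z) 2 (volume.restrict (tsupport χ)) :=
    MemLp.mul (p := ⊤) (q := 2) (hu _ hc hs)
      (memLp_top_of_bound hχ.aestronglyMeasurable C (ae_of_all _ hC))
  rw [← memLp_indicator_iff_restrict (isClosed_tsupport χ).measurableSet] at h1
  suffices h : (fun z => χ z * u z) = (tsupport χ).indicator fun z => χ z * u z by rwa [h]
  funext z
  by_cases hz : z ∈ tsupport χ
  · rw [indicator_of_mem hz]
  · rw [indicator_of_notMem hz, image_eq_zero_of_notMem_tsupport hz, zero_mul]

/-- The product rule for weak derivatives. -/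
theorem integral_cutoff_mul_fderiv {Ω : Opens ℂ} {T : 𝓓'(Ω, ℝ)} {u p χ φ : ℂ → ℝ} {v : ℂ}
    (hu : IsGivenBy T u) (hp : IsGivenBy (∂_{v} T) p) (hχ : ContDiff ℝ ∞ χ)
    (hc : HasCompactSupport χ) (hs : tsupport χ ⊆ Ω) (hφ : ContDiff ℝ ∞ φ) :
    ∫ z, χ z * u z * fderiv ℝ φ z v =
      - ∫ z, (χ z * p z + fderiv ℝ χ z v * u z) * φ z := by
  have hχv : ContDiff ℝ ∞ fun z => fderiv ℝ χ z v :=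
    (hχ.fderiv_right (by norm_cast)).clm_apply contDiff_const
  have hφv : ContDiff ℝ ∞ fun z => fderiv ℝ φ z v :=
    (hφ.fderiv_right (by norm_cast)).clm_apply contDiff_const
  have hsv : tsupport (fun z => fderiv ℝ χ z v) ⊆ tsupport χ :=
    tsupport_fderiv_apply_subset ℝ v
  let t1 : 𝓓(Ω, ℝ) := mkTest (fun z => χ z * φ z) (hχ.mul hφ) hc.mul_right
    ((tsupport_mul_subset_left).trans hs)
  let t2 : 𝓓(Ω, ℝ) := mkTest (fun z => fderiv ℝ χ z v * φ z) (hχv.mul hφ)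
    (hc.fderiv_apply ℝ v).mul_right ((tsupport_mul_subset_left).trans (hsv.trans hs))
  let t3 : 𝓓(Ω, ℝ) := mkTest (fun z => χ z * fderiv ℝ φ z v) (hχ.mul hφv) hc.mul_right
    ((tsupport_mul_subset_left).trans hs)
  have h1 := hp.2 t1
  rw [lineDeriv_apply, hu.2] at h1
  have i2 : Integrable fun z => u z * (fderiv ℝ χ z v * φ z) := integrable_mul_test hu.1 t2
  have i3 : Integrable fun z => u z * (χ z * fderiv ℝ φ z v) := integrable_mul_test hu.1 t3
  have i1 : Integrable fun z => p z * (χ z * φ z) := integrable_mul_test hp.1 t1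
  have h2 : ∫ z, u z * (∂_{v} t1 : 𝓓(Ω, ℝ)) z =
      (∫ z, u z * (χ z * fderiv ℝ φ z v)) + ∫ z, u z * (fderiv ℝ χ z v * φ z) := by
    rw [← integral_add i3 i2]
    refine integral_congr_ae (ae_of_all _ fun z => ?_)
    beta_reduce
    rw [testFunction_lineDeriv_apply]
    have : fderiv ℝ (t1 : ℂ → ℝ) z = χ z • fderiv ℝ φ z + φ z • fderiv ℝ χ z :=
      fderiv_fun_mul (hχ.differentiable (by simp) z) (hφ.differentiable (by simp) z)
    rw [this]
    simp only [add_apply, smul_apply, smul_eq_mul]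
    ring
  rw [h2] at h1
  have h1' : -((∫ z, u z * (χ z * fderiv ℝ φ z v)) + ∫ z, u z * (fderiv ℝ χ z v * φ z)) =
    ∫ z, p z * (χ z * φ z) := h1
  have h3 : ∫ z, (χ z * p z + fderiv ℝ χ z v * u z) * φ z =
      (∫ z, p z * (χ z * φ z)) + ∫ z, u z * (fderiv ℝ χ z v * φ z) := by
    rw [← integral_add i1 i2]
    exact integral_congr_ae (ae_of_all _ fun z => by ring)
  have h4 : ∫ z, χ z * u z * fderiv ℝ φ z v = ∫ z, u z * (χ z * fderiv ℝ φ z v) :=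
    integral_congr_ae (ae_of_all _ fun z => by ring)
  rw [h3, h4, ← h1']
  ring

/-- The weak derivative is tested on t ↦ ρ(x - t), whose derivative in t is minus the translated
derivative of ρ. -/
theorem IsMollifier.fderiv_conv_of_weak (hρ : IsMollifier ρ δ) {f g : ℂ → ℝ} {v : ℂ}
    (hf : LocallyIntegrable f)
    (hfg : ∀ φ : ℂ → ℝ, ContDiff ℝ ∞ φ → ∫ z, f z * fderiv ℝ φ z v = - ∫ z, g z * φ z) (x : ℂ) :
    fderiv ℝ (conv f ρ) x v = conv g ρ x := by
  have h1 := hfg (fun t => ρ (x - t)) (hρ.smooth.comp (contDiff_const.sub contDiff_id))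
  have h2 : ∀ t, fderiv ℝ (fun t => ρ (x - t)) t v = - fderiv ℝ ρ (x - t) v := fun t => by
    have h3 : HasFDerivAt (fun t => x - t) (-ContinuousLinearMap.id ℝ ℂ) t := by
      simpa using (hasFDerivAt_id (𝕜 := ℝ) t).const_sub x
    have h4 := ((hρ.smooth.differentiable (by simp) (x - t)).hasFDerivAt.comp t h3).fderiv
    rw [Function.comp_def] at h4
    rw [h4]
    simp
  simp only [h2, mul_neg, integral_neg, neg_inj] at h1
  rw [congrFun (fderiv_conv_apply hf hρ.smooth hρ.compact v) x]
  exact h1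

theorem IsMollifier.tsupport_conv_subset (hρ : IsMollifier ρ δ) {f : ℂ → ℝ} {K M : Set ℂ}
    (hf : ∀ z ∉ K, f z = 0) (hM : IsClosed M) (hKM : Metric.cthickening δ K ⊆ M) :
    tsupport (conv f ρ) ⊆ M := by
  refine closure_minimal (fun x hx => ?_) hM
  by_contra hc
  refine hx (conv_apply_eq_zero fun t ht => ?_)
  by_contra h
  have h3 := hρ.support h
  rw [mem_ball_zero_iff, ← dist_eq_norm] at h3
  refine hc (hKM (Metric.mem_cthickening_of_dist_le x t δ K ?_ h3.le))
  by_contra hK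
  exact ht (hf t hK)

/-- A distribution with square integrable gradient, localized by a cutoff function, is a limit of
smooth functions in `W^{1,2}`. -/
theorem exists_smooth_approx {Ω : Opens ℂ} {T : 𝓓'(Ω, ℝ)} {u p q χ : ℂ → ℝ}
    (h : HasL2Gradient T u p q) (hχ : ContDiff ℝ ∞ χ) (hc : HasCompactSupport χ) {M : Set ℂ}
    (hM : IsClosed M) (hχM : tsupport χ ⊆ interior M) (hMΩ : M ⊆ Ω) :
    ∃ w : ℕ → ℂ → ℝ, (∀ n, ContDiff ℝ ∞ (w n)) ∧ (∀ n, tsupport (w n) ⊆ M) ∧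
      (∀ ε > 0, ∃ n₀, ∀ m ≥ n₀, ∀ n ≥ n₀, ∫ z, dirichlet (fun z => w m z - w n z) z ≤ ε) ∧
      ∀ φ : ℂ → ℝ, MemLp φ 2 volume →
        Tendsto (fun n => ∫ z, w n z * φ z) atTop (𝓝 (∫ z, χ z * u z * φ z)) := by
  have hs : tsupport χ ⊆ Ω := hχM.trans (interior_subset.trans hMΩ)
  obtain ⟨δ, hδ, hδM⟩ :=
    IsCompact.exists_cthickening_subset_open (s := tsupport χ) hc isOpen_interior hχM
  have hδn : ∀ n : ℕ, 0 < δ / (n + 1) := fun n => by positivity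
  choose ρ hρ using fun n : ℕ => exists_isMollifier (hδn n)
  have hδ0 : Tendsto (fun n : ℕ => δ / ((n : ℝ) + 1)) atTop (𝓝 0) := by
    simpa [div_eq_mul_inv] using (tendsto_one_div_add_atTop_nhds_zero_nat (𝕜 := ℝ)).const_mul δ
  have hcv : ∀ v, ContDiff ℝ ∞ fun z => fderiv ℝ χ z v := fun v =>
    (hχ.fderiv_right (by norm_cast)).clm_apply contDiff_const
  have hsv : ∀ v, tsupport (fun z => fderiv ℝ χ z v) ⊆ Ω := fun v =>
    (tsupport_fderiv_apply_subset ℝ v).trans hs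
  -- After the cutoff, g and k are the weak partial derivatives of f on all of ℂ. All three
  -- functions are in L², and mollification commutes with weak derivatives.
  set f : ℂ → ℝ := fun z => χ z * u z with hf
  set g : ℂ → ℝ := fun z => χ z * p z + fderiv ℝ χ z 1 * u z with hg
  set k : ℂ → ℝ := fun z => χ z * q z + fderiv ℝ χ z Complex.I * u z with hk
  have mf : MemLp f 2 volume := h.1.1.memLp_cutoff hχ.continuous hc hs
  have mg : MemLp g 2 volume := (h.2.1.1.memLp_cutoff hχ.continuous hc hs).add
    (h.1.1.memLp_cutoff (hcv 1).continuous (hc.fderiv_apply ℝ 1) (hsv 1))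
  have mk : MemLp k 2 volume := (h.2.2.1.memLp_cutoff hχ.continuous hc hs).add
    (h.1.1.memLp_cutoff (hcv Complex.I).continuous (hc.fderiv_apply ℝ Complex.I) (hsv Complex.I))
  have lf : LocallyIntegrable f := mf.locallyIntegrable (by norm_num)
  have hfg : ∀ n x, fderiv ℝ (conv f (ρ n)) x 1 = conv g (ρ n) x := fun n x =>
    (hρ n).fderiv_conv_of_weak lf (fun φ hφ => integral_cutoff_mul_fderiv h.1.2 h.2.1.2 hχ hc hs hφ)
      x
  have hfk : ∀ n x, fderiv ℝ (conv f (ρ n)) x Complex.I = conv k (ρ n) x := fun n x =>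
    (hρ n).fderiv_conv_of_weak lf (fun φ hφ => integral_cutoff_mul_fderiv h.1.2 h.2.2.2 hχ hc hs hφ)
      x
  have hw : ∀ n, ContDiff ℝ ∞ (conv f (ρ n)) := fun n =>
    contDiff_conv lf (hρ n).smooth (hρ n).compact
  have hmem : ∀ {f : ℂ → ℝ}, MemLp f 2 volume → ∀ n, MemLp (conv f (ρ n)) 2 volume := fun hf n =>
    ((hρ n).memLp_conv hf).1
  refine ⟨fun n => conv f (ρ n), hw, fun n => ?_, fun ε hε => ?_, fun φ hφ => ?_⟩
  · refine (hρ n).tsupport_conv_subset (K := tsupport χ) (fun z hz => ?_) hM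
      (((Metric.cthickening_mono (div_le_self hδ.le (by simp)) _).trans hδM).trans interior_subset)
    rw [hf]
    simp [image_eq_zero_of_notMem_tsupport hz]
  -- With ε/12 for each mollification, `integral_sq_sub_le` bounds each of the three terms of the
  -- Dirichlet norm by 4ε/12 = ε/3.
  · have hev : ∀ {f : ℂ → ℝ}, MemLp f 2 volume →
        ∀ᶠ n in atTop, ∫ x, (conv f (ρ n) x - f x) ^ 2 < ε / 12 := fun hf =>
      (tendsto_conv_mollifier hρ hδ0 hf).eventually (gt_mem_nhds (by positivity))
    obtain ⟨n₀, hn₀⟩ := eventually_atTop.1 ((hev mf).and ((hev mg).and (hev mk)))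
    have hd : ∀ {f : ℂ → ℝ}, MemLp f 2 volume → ∀ m n,
        ∫ x, (conv f (ρ m) x - f x) ^ 2 < ε / 12 → ∫ x, (conv f (ρ n) x - f x) ^ 2 < ε / 12 →
        ∫ x, (conv f (ρ m) x - conv f (ρ n) x) ^ 2 ≤ ε / 3 := by
      intro f hf m n h1 h2
      have h3 := integral_sq_sub_le (hmem hf m) (hmem hf n) hf
      have h4 : ∀ n, ∫ x, (f x - conv f (ρ n) x) ^ 2 = ∫ x, (conv f (ρ n) x - f x) ^ 2 := fun n =>
        integral_congr_ae (ae_of_all _ fun x => by ring)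
      rw [h4, h4] at h3
      linarith
    refine ⟨n₀, fun m hm n hn => ?_⟩
    have i : ∀ {f : ℂ → ℝ}, MemLp f 2 volume →
        Integrable fun x => (conv f (ρ m) x - conv f (ρ n) x) ^ 2 := fun hf =>
      ((hmem hf m).sub (hmem hf n)).integrable_sq
    have h1 : ∀ z, dirichlet (fun z => conv f (ρ m) z - conv f (ρ n) z) z =
        (conv f (ρ m) z - conv f (ρ n) z) ^ 2 + (conv g (ρ m) z - conv g (ρ n) z) ^ 2 +
          (conv k (ρ m) z - conv k (ρ n) z) ^ 2 := by
      intro z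
      rw [dirichlet, fderiv_fun_sub ((hw m).differentiable (by simp) z)
        ((hw n).differentiable (by simp) z)]
      simp only [sub_apply, hfg, hfk]
    simp only [h1]
    have i12 : Integrable fun z => (conv f (ρ m) z - conv f (ρ n) z) ^ 2 +
      (conv g (ρ m) z - conv g (ρ n) z) ^ 2 := (i mf).add (i mg)
    rw [integral_add i12 (i mk), integral_add (i mf) (i mg)]
    have a := hn₀ m hm
    have b := hn₀ n hn
    linarith [hd mf m n a.1 b.1, hd mg m n a.2.1 b.2.1, hd mk m n a.2.2 b.2.2]
  · have h1 : ∀ n, |(∫ z, conv f (ρ n) z * φ z) - ∫ z, f z * φ z| ≤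
        √((∫ z, (conv f (ρ n) z - f z) ^ 2) * ∫ z, φ z ^ 2) := fun n => by
      have i1 : Integrable fun z => conv f (ρ n) z * φ z := (hmem mf n).integrable_mul hφ
      have i2 : Integrable fun z => f z * φ z := mf.integrable_mul hφ
      rw [← integral_sub i1 i2]
      refine Real.abs_le_sqrt ?_
      have := sq_integral_mul_le ((hmem mf n).sub mf) hφ
      simpa only [Pi.sub_apply, sub_mul] using this
    rw [tendsto_iff_dist_tendsto_zero]
    refine squeeze_zero (fun n => dist_nonneg) h1 ?_
    have h2 := ((tendsto_conv_mollifier hρ hδ0 mf).mul_const (∫ z, φ z ^ 2)).sqrt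
    simpa using h2

end Mollify

/-! ### Density of smooth functions in L²₁. -/

section Density

variable {X : Type*} [TopologicalSpace X] [ChartedSpace ℂ X] [IsManifold 𝓘(ℂ) ω X]
  [T2Space X] [CompactSpace X]

theorem testFunction_sum_apply {Ω : Opens ℂ} {ι : Type*} (t : Finset ι) (φ : ι → 𝓓(Ω, ℝ)) (z : ℂ) :
    (∑ i ∈ t, φ i) z = ∑ i ∈ t, φ i z := by
  classical
  induction t using Finset.induction_on with
  | empty => rfl
  | insert a t ha ih => rw [Finset.sum_insert ha, Finset.sum_insert ha, ← ih]; rfl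

theorem distribution_sum_apply {Ω : Opens ℂ} {ι : Type*} (t : Finset ι) (T : ι → 𝓓'(Ω, ℝ))
    (φ : 𝓓(Ω, ℝ)) : (∑ i ∈ t, T i) φ = ∑ i ∈ t, T i φ := by
  classical
  induction t using Finset.induction_on with
  | empty => rfl
  | insert a t ha ih => rw [Finset.sum_insert ha, Finset.sum_insert ha, ← ih]; rfl

theorem eventually_id_ne (x y : X) : ∀ᶠ x' in 𝓝[≠] x, id x' ≠ y := by
  by_cases h : y = x
  · subst h; exact self_mem_nhdsWithin
  · exact nhdsWithin_le_nhds (isOpen_ne.mem_nhds (Ne.symm h))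

/-- With F the identity, the push-forward estimates compare the energies of one function in two
different charts. -/
theorem pushFun_id (u : X → ℝ) : pushFun id u = u := by
  funext x
  have h : ramificationIndex (id : X → X) x = 1 :=
    ramificationIndex_eq_one mdifferentiable_id eventually_id_ne (Chart.preferred x)
      (Chart.preferred x) (mem_source_preferred x) (mem_source_preferred x)
      (deriv_locMap_id_ne_zero _ _ (mem_locDom (mem_source_preferred x) (mem_source_preferred x)))
  rw [pushFun, preimage_id, finsum_mem_singleton, h, Nat.cast_one, one_mul]

open Classical in
/-- The product of a test function in a chart `c` with a smooth function supported in another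
chart `e` can be read in the chart `e`. -/
theorem exists_transport (e c : Chart X) {s : X → ℝ} (hs : ContMDiff 𝓘(ℝ, ℂ) 𝓘(ℝ, ℝ) ∞ s)
    {K : Set ℂ} (hK : IsCompact K) (hKe : K ⊆ e.1.target)
    (hsK : ∀ x, s x ≠ 0 → x ∈ e.1.source ∧ e.1 x ∈ K) (φ : 𝓓(c.range, ℝ)) :
    ∃ (φ₁ : 𝓓(c.range, ℝ)) (φ₂ : 𝓓(e.range, ℝ)), SameTwoForm c e φ₁ φ₂ ∧
      (∀ z ∈ c.1.target, φ₁ z = s (c.1.symm z) * φ z) ∧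
      (∀ z ∈ e.1.target, φ₂ z = if z ∈ locDom id e c then s (e.1.symm z) *
        (φ (locMap id e c z) * ‖deriv (locMap id e c) z‖ ^ 2) else 0) := by
  have hφs := testFunction_smooth φ
  have hφ0 : ∀ z, z ∉ c.1.target → φ z = 0 := fun z hz =>
    image_eq_zero_of_notMem_tsupport fun h => hz (φ.tsupport_subset h)
  have hc1 : ContDiffOn ℝ ∞ (fun z => s (c.1.symm z) * φ z) c.1.target :=
    (contMDiff_iff_chart.1 hs c).mul hφs.contDiffOn
  have h1z : ∀ z ∉ tsupport φ, s (c.1.symm z) * φ z = 0 := fun z hz => by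
    rw [image_eq_zero_of_notMem_tsupport hz, mul_zero]
  have hc1' := contDiff_of_support c.1.open_target hc1 (isClosed_tsupport φ) φ.tsupport_subset h1z
  have hcl1 : tsupport (fun z => s (c.1.symm z) * φ z) ⊆ tsupport φ :=
    closure_minimal (fun z hz => by_contra fun h => hz (h1z z h)) (isClosed_tsupport φ)
  set D := locDom (id : X → X) e c with hD
  set τ := locMap (id : X → X) e c with hτ
  have hDo : IsOpen D := isOpen_locDom continuous_id e c
  -- The product s φ in the coordinate of e, with the Jacobian factor. The support of s makes it
  -- vanish outside a compact subset of the overlap, so extension by zero is smooth.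
  set g : ℂ → ℝ := fun z => if z ∈ D then s (e.1.symm z) * (φ (τ z) * ‖deriv τ z‖ ^ 2) else 0
    with hg
  set M := K ∩ (D ∩ τ ⁻¹' tsupport φ) with hM
  have hMc : IsCompact M := isCompact_inter_locDom mdifferentiable_id eventually_id_ne e c hK hKe φ.hasCompactSupport
    φ.tsupport_subset
  have hMD : M ⊆ D := fun z hz => hz.2.1
  have hτa := analyticOnNhd_locMap (F := (id : X → X)) mdifferentiable_id e c
  have hg1 : ContDiffOn ℝ ∞ g D := by
    have : ContDiffOn ℝ ∞ (fun z => s (e.1.symm z) * (φ (τ z) * ‖deriv τ z‖ ^ 2)) D := by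
      intro z hz
      have a1 : ContDiffAt ℝ ∞ (fun z => s (e.1.symm z)) z :=
        (contMDiff_iff_chart.1 hs e).contDiffAt (e.1.open_target.mem_nhds hz.1)
      have a2 : ContDiffAt ℝ ∞ (fun z => φ (τ z)) z :=
        hφs.contDiffAt.comp z (contDiffAt_locMap mdifferentiable_id hz)
      have a3 : ContDiffAt ℝ ∞ (deriv τ) z :=
        ((hτa z hz).deriv.restrictScalars (𝕜 := ℝ)).contDiffAt
      exact (a1.mul (a2.mul (a3.norm_sq ℝ))).contDiffWithinAt
    exact this.congr fun z hz => if_pos hz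
  have h2z : ∀ z ∉ M, g z = 0 := fun z hz => by
    by_cases hzD : z ∈ D
    · rw [hg]
      simp only [if_pos hzD]
      by_cases h : τ z ∈ tsupport φ
      · have : s (e.1.symm z) = 0 := by
          by_contra h0
          have := (hsK _ h0).2
          rw [e.1.right_inv hzD.1] at this
          exact hz ⟨this, hzD, h⟩
        rw [this, zero_mul]
      · rw [image_eq_zero_of_notMem_tsupport h, zero_mul, mul_zero]
    · exact if_neg hzD
  have hg2 := contDiff_of_support hDo hg1 hMc.isClosed hMD h2z
  have hcl2 : tsupport g ⊆ M :=
    closure_minimal (fun z hz => by_contra fun h => hz (h2z z h)) hMc.isClosed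
  have hcs1 : HasCompactSupport (fun z => s (c.1.symm z) * φ z) :=
    HasCompactSupport.mul_left φ.hasCompactSupport
  have hcs2 : HasCompactSupport g := HasCompactSupport.of_support_subset_isCompact hMc
    ((subset_tsupport g).trans hcl2)
  refine ⟨mkTest _ hc1' hcs1 (hcl1.trans φ.tsupport_subset), mkTest g hg2 hcs2
    (hcl2.trans (inter_subset_left.trans hKe)), ⟨?_, ?_, ?_⟩, ?_, ?_⟩
  · rintro x ⟨hxc, hxe⟩
    have hxD : e.1 x ∈ D := mem_locDom hxe hxc
    rw [mkTest_apply, mkTest_apply, hg]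
    simp only [if_pos hxD]
    rw [e.1.left_inv hxe, c.1.left_inv hxc, hτ, locMap_apply _ _ hxe, mul_assoc]
    rfl
  · rintro x ⟨hxc, hxe⟩
    rw [mkTest_apply, c.1.left_inv hxc]
    have : s x = 0 := by_contra fun h => hxe (hsK x h).1
    rw [this, zero_mul]
  · rintro x ⟨hxe, hxc⟩
    rw [mkTest_apply]
    refine if_neg fun h => hxc ?_
    have := h.2
    rwa [mem_preimage, mem_preimage, e.1.left_inv hxe] at this
  · intro z _; rfl
  · intro z _; rfl

/-- Smooth functions are dense in `L²₁`. -/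
theorem exists_smooth_tendstoL21 {ψ : Dist X} (hψ : IsL21 ψ) :
    ∃ (s : ℕ → X → ℝ) (S : ℕ → Dist X), (∀ n, ContMDiff 𝓘(ℝ, ℂ) 𝓘(ℝ, ℝ) ∞ (s n)) ∧
      (∀ n, IsGivenByFun (S n) (s n)) ∧ TendstoL21 S ψ := by
  obtain ⟨t, K, χ, hK, hχ, hχK, hχ1⟩ := exists_partition X
  let e : X → Chart X := fun i => Chart.preferred i
  choose u p q hg using fun i => hψ (e i)
  choose M hM hKM hMe using fun i =>
    exists_compact_between (hK i).1 (e i).1.open_target (hK i).2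
  have hr := fun i => contDiff_readChart (hχ i) (hK i).1 (hK i).2 (hχK i)
  choose w hws hwM hwc hwlim using fun i => exists_smooth_approx (hg i) (hr i).1
    ((hK i).1.of_isClosed_subset (isClosed_tsupport _) (hr i).2) (hM i).isClosed
    ((hr i).2.trans (hKM i)) (hMe i)
  have hsm : ∀ i n, ContMDiff 𝓘(ℝ, ℂ) 𝓘(ℝ, ℝ) ∞ (extendChart (e i) (w i n)) := fun i n =>
    contMDiff_extendChart (hws i n) (hM i) (hMe i) (hwM i n)
  choose B hB using fun i n => isGivenByFun_of_contMDiff (hsm i n)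
  set s : ℕ → X → ℝ := fun n x => ∑ i ∈ t, extendChart (e i) (w i n) x with hs
  set S : ℕ → Dist X := fun n => ∑ i ∈ t, B i n with hS
  have hss : ∀ n, ContMDiff 𝓘(ℝ, ℂ) 𝓘(ℝ, ℝ) ∞ (s n) := fun n =>
    contMDiff_finsetSum fun i _ => hsm i n
  have hSs : ∀ n, IsGivenByFun (S n) (s n) := fun n => IsGivenByFun.finset_sum t fun i _ => hB i n
  have hS21 : ∀ n, IsL21 (S n) := fun n c => ⟨_, _, _, hasL2Gradient_of_contDiffOn (hSs n c)
    ((contMDiff_iff_chart.1 (hss n) c).of_le (by norm_cast))⟩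
  -- Each piece is Cauchy in its own chart; `push_extendChart_energy` for the identity map transfers
  -- this to an arbitrary chart c.
  have hcauchy : ∀ (c : Chart X) (L : Set ℂ), IsCompact L → L ⊆ c.1.target → ∀ ε > 0, ∃ n₀,
      ∀ m ≥ n₀, ∀ n ≥ n₀, EnergyLE ((S m - S n).1 c) L ε := by
    intro c L hL hLc ε hε
    choose C hC0 hC using fun i => push_extendChart_energy (F := (id : X → X)) mdifferentiable_id
      eventually_id_ne (e i) c (hM i) (hMe i) hL hLc
    set A := 2 ^ t.card * ∑ i ∈ t, C i with hA
    have hA0 : 0 ≤ A := mul_nonneg (by positivity) (Finset.sum_nonneg fun i _ => hC0 i)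
    choose N hN using fun i => hwc i (ε / (A + 1)) (by positivity)
    refine ⟨t.sup N, fun m hm n hn => ?_⟩
    have h1 : ∀ i ∈ t, EnergyLE ((B i m - B i n).1 c) L (C i * (ε / (A + 1))) := by
      intro i hi
      have hsub : IsGivenBy ((B i m - B i n).1 c) fun y => pushFun id
          (extendChart (e i) fun z => w i m z - w i n z) (c.1.symm y) := by
        have := (hB i m).sub (hB i n) c
        rw [pushFun_id]
        convert this using 2
        rename_i y
        by_cases hy : c.1.symm y ∈ (e i).1.source
        · simp only [Pi.sub_apply, extendChart_apply _ hy]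
        · simp only [Pi.sub_apply, extendChart_of_notMem _ hy, sub_self]
      have hts : tsupport (fun z => w i m z - w i n z) ⊆ M i :=
        closure_minimal (fun z hz => by_contra fun h => hz (by
          simp only
          rw [image_eq_zero_of_notMem_tsupport fun h' => h (hwM i m h'),
            image_eq_zero_of_notMem_tsupport fun h' => h (hwM i n h'), sub_self]))
          (hM i).isClosed
      refine (((hC i) _ ((hws i m).sub (hws i n)) hts).2 _ hsub).mono ?_
      exact mul_le_mul_of_nonneg_left (hN i m ((Finset.le_sup hi).trans hm) n
        ((Finset.le_sup hi).trans hn)) (hC0 i)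
    have h2 : (S m - S n).1 c = ∑ i ∈ t, (B i m - B i n).1 c := by
      rw [← finite_sum_apply, Finset.sum_sub_distrib (fun i => B i m) (fun i => B i n)]
    rw [h2]
    refine (EnergyLE.sum hL hLc t h1).mono ?_
    rw [← Finset.sum_mul, ← mul_assoc, ← hA, mul_div_assoc', div_le_iff₀ (by positivity)]
    nlinarith
  -- Completeness provides some limit T in L²₁. That T is ψ then only requires convergence on each
  -- test function.
  obtain ⟨T, hT21, hT, hTlim⟩ := exists_tendstoL21 hS21 hcauchy
  have hlim : ∀ (c : Chart X) (φ : 𝓓(c.range, ℝ)),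
      Tendsto (fun n => (S n).1 c φ) atTop (𝓝 (ψ.1 c φ)) := by
    intro c φ
    choose φ₁ φ₂ hsame hφ₁ hφ₂ using fun i => exists_transport (e i) c (hχ i) (hK i).1 (hK i).2
      (hχK i) φ
    have hsum : φ = ∑ i ∈ t, φ₁ i := by
      ext z
      rw [testFunction_sum_apply]
      by_cases hz : z ∈ c.1.target
      · rw [Finset.sum_congr rfl fun i _ => hφ₁ i z hz, ← Finset.sum_mul, hχ1, one_mul]
      · rw [image_eq_zero_of_notMem_tsupport (f := φ) fun h => hz (φ.tsupport_subset h)]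
        exact (Finset.sum_eq_zero fun i _ => image_eq_zero_of_notMem_tsupport (f := φ₁ i)
          fun h => hz ((φ₁ i).tsupport_subset h)).symm
    have hi : ∀ i, Tendsto (fun n => (B i n).1 c φ) atTop (𝓝 (ψ.1 c (φ₁ i))) := by
      intro i
      -- As ξ is 1 on `M i`, which contains the supports of all `w i n`, inserting it changes no
      -- integral, and it lets the test form be moved to the chart `e i`.
      obtain ⟨ξ, hξ, hξc, hξe, hξ1, -⟩ := exists_cutoff (hM i) (e i).1.open_target (hMe i)
      have hΞ : ∀ x, extendChart (e i) ξ x ≠ 0 → x ∈ (e i).1.source ∧ (e i).1 x ∈ tsupport ξ := by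
        intro x hx
        by_cases hxs : x ∈ (e i).1.source
        · rw [extendChart_apply _ hxs] at hx
          exact ⟨hxs, subset_tsupport _ hx⟩
        · exact absurd (extendChart_of_notMem _ hxs) hx
      obtain ⟨a, b, hab, ha, hb⟩ := exists_transport (e i) c
        (contMDiff_extendChart hξ hξc hξe Subset.rfl) hξc hξe hΞ φ
      have h1 : ∀ n, (B i n).1 c φ = ∫ z, w i n z * b z := by
        intro n
        have h2 : (B i n).1 c φ = (B i n).1 c a := by
          rw [(hB i n c).2, (hB i n c).2]
          refine integral_congr_ae (ae_of_all _ fun z => ?_)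
          beta_reduce
          by_cases hz : z ∈ c.1.target
          · rw [ha z hz]
            by_cases hx : c.1.symm z ∈ (e i).1.source
            · rw [extendChart_apply _ hx, extendChart_apply _ hx]
              by_cases hzM : (e i).1 (c.1.symm z) ∈ M i
              · rw [(Filter.Eventually.self_of_nhdsSet hξ1) _ hzM, one_mul]
              · rw [image_eq_zero_of_notMem_tsupport fun h => hzM (hwM i n h), zero_mul, zero_mul]
            · rw [extendChart_of_notMem _ hx, zero_mul, zero_mul]
          · rw [image_eq_zero_of_notMem_tsupport (f := φ) fun h => hz (φ.tsupport_subset h),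
              image_eq_zero_of_notMem_tsupport (f := a) fun h => hz (a.tsupport_subset h)]
        rw [h2, (B i n).2 c (e i) a b hab, (hB i n (e i)).2]
        refine integral_congr_ae (ae_of_all _ fun z => ?_)
        beta_reduce
        by_cases hz : z ∈ (e i).1.target
        · rw [extendChart_symm _ hz]
        · rw [image_eq_zero_of_notMem_tsupport (f := b) fun h => hz (b.tsupport_subset h), mul_zero,
            mul_zero]
      have h3 : ψ.1 c (φ₁ i) = ∫ z, readChart (e i) (χ i) z * u i z * b z := by
        rw [ψ.2 c (e i) _ _ (hsame i), (hg i).1.2.2]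
        refine integral_congr_ae (ae_of_all _ fun z => ?_)
        beta_reduce
        by_cases hz : z ∈ (e i).1.target
        · rw [hφ₂ i z hz, hb z hz, readChart, if_pos hz]
          by_cases hzD : z ∈ locDom id (e i) c
          · rw [if_pos hzD, if_pos hzD, extendChart_symm _ hz]
            by_cases hzK : z ∈ K i
            · rw [(Filter.Eventually.self_of_nhdsSet hξ1) _ (interior_subset (hKM i hzK))]
              ring
            · have : χ i ((e i).1.symm z) = 0 := by
                by_contra h
                have := (hχK i _ h).2
                rw [(e i).1.right_inv hz] at this
                exact hzK this
              rw [this]; ring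
          · rw [if_neg hzD, if_neg hzD, mul_zero, mul_zero]
        · rw [image_eq_zero_of_notMem_tsupport (f := b) fun h => hz (b.tsupport_subset h),
            image_eq_zero_of_notMem_tsupport (f := φ₂ i) fun h => hz ((φ₂ i).tsupport_subset h),
            mul_zero, mul_zero]
      simp only [h1, h3]
      exact hwlim i b ((testFunction_smooth b).continuous.memLp_of_hasCompactSupport
        b.hasCompactSupport)
    have h4 : ∀ n, (S n).1 c φ = ∑ i ∈ t, (B i n).1 c φ := fun n => by
      rw [hS, finite_sum_apply, distribution_sum_apply]
    have h5 : ψ.1 c φ = ∑ i ∈ t, ψ.1 c (φ₁ i) := by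
      conv_lhs => rw [hsum]
      rw [map_sum]
    simp only [h4, h5]
    exact tendsto_finsetSum t fun i _ => hi i
  have hTψ : T = ψ := by
    refine Subtype.ext (funext fun c => ?_)
    ext φ
    exact tendsto_nhds_unique (hTlim c φ) (hlim c φ)
  exact ⟨s, S, hss, hSs, hTψ ▸ hT⟩

end Density

/-! ### Extension of bounded operators to L²₁. -/

section Extension

/-- If the energy vanishes on the support of φ, Cauchy–Schwarz gives T φ = 0. -/
theorem eq_zero_of_energyLE {Ω : Opens ℂ} {T : 𝓓'(Ω, ℝ)}
    (h : ∀ K ⊆ (Ω : Set ℂ), IsCompact K → ∀ ε > 0, EnergyLE T K ε) : T = 0 := by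
  ext φ
  change T φ = 0
  have hK : IsCompact (tsupport φ) := φ.hasCompactSupport
  have hKΩ : tsupport φ ⊆ (Ω : Set ℂ) := φ.tsupport_subset
  obtain ⟨u, p, q, hg, -⟩ := h _ hKΩ hK 1 one_pos
  have h0 : ∫ z in tsupport φ, (u z ^ 2 + p z ^ 2 + q z ^ 2) ≤ 0 :=
    le_of_forall_pos_le_add fun ε hε => by
      rw [zero_add]; exact (h _ hKΩ hK ε hε).integral_le hK hKΩ hg
  have h1 : ∫ z in tsupport φ, u z ^ 2 ≤ 0 :=
    (integral_mono (hg.1.1.integrableOn_sq hK hKΩ) (hg.integrableOn hK hKΩ) fun z => by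
      change u z ^ 2 ≤ u z ^ 2 + p z ^ 2 + q z ^ 2
      nlinarith [sq_nonneg (p z), sq_nonneg (q z)]).trans h0
  have h2 := sq_integral_mul_le (hg.1.1 _ hK hKΩ)
    (((testFunction_smooth φ).continuous.memLp_of_hasCompactSupport φ.hasCompactSupport
      (μ := volume) (p := 2)).restrict (tsupport φ))
  have h3 : ∫ z in tsupport φ, u z * φ z = T φ := by
    rw [hg.1.2.2]
    refine setIntegral_eq_integral_of_forall_compl_eq_zero fun z hz => ?_
    rw [image_eq_zero_of_notMem_tsupport hz, mul_zero]
  rw [h3, le_antisymm h1 (integral_nonneg fun z => sq_nonneg _), zero_mul] at h2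
  exact pow_eq_zero_iff two_ne_zero |>.1 (le_antisymm h2 (sq_nonneg _))

variable {X Y : Type*} [TopologicalSpace X] [ChartedSpace ℂ X] [IsManifold 𝓘(ℂ) ω X]
  [TopologicalSpace Y] [ChartedSpace ℂ Y] [IsManifold 𝓘(ℂ) ω Y]
  {Φ : (X → ℝ) → (Y → ℝ)}

theorem IsL21.sub {S T : Dist X} (hS : IsL21 S) (hT : IsL21 T) : IsL21 (S - T) := fun e => by
  obtain ⟨u, p, q, h⟩ := hS e
  obtain ⟨u', p', q', h'⟩ := hT e
  exact ⟨_, _, _, h.sub h'⟩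

theorem IsL21.add {S T : Dist X} (hS : IsL21 S) (hT : IsL21 T) : IsL21 (S + T) := fun e => by
  obtain ⟨u, p, q, h⟩ := hS e
  obtain ⟨u', p', q', h'⟩ := hT e
  exact ⟨_, _, _, h.add h'⟩

theorem IsGivenByFun.isL21 {S : Dist X} {s : X → ℝ} (h : IsGivenByFun S s)
    (hs : ContMDiff 𝓘(ℝ, ℂ) 𝓘(ℝ, ℝ) ∞ s) : IsL21 S := fun e =>
  ⟨_, _, _, hasL2Gradient_of_contDiffOn (h e)
    ((contMDiff_iff_chart.1 hs e).of_le (by norm_cast))⟩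

theorem exists_energyLE_finite {S : Dist X} (hS : IsL21 S) {P : Set (Chart X × Set ℂ)}
    (hP : P.Finite) : ∃ A, 0 ≤ A ∧ ∀ p ∈ P, EnergyLE (S.1 p.1) p.2 A := by
  choose u p q hg using hS
  let E : Chart X × Set ℂ → ℝ := fun r => ∫ z in r.2, (u r.1 z ^ 2 + p r.1 z ^ 2 + q r.1 z ^ 2)
  have hE : ∀ r, 0 ≤ E r := fun r => integral_nonneg fun z => by positivity
  refine ⟨∑ r ∈ hP.toFinset, E r, Finset.sum_nonneg fun r _ => hE r, fun r hr =>
    ⟨u r.1, p r.1, q r.1, hg r.1, ?_⟩⟩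
  exact Finset.single_le_sum (f := E) (fun r _ => hE r) (hP.mem_toFinset.2 hr)

theorem IsBoundedOp.isL21 (hΦ : IsBoundedOp Φ) {s : X → ℝ}
    (hs : ContMDiff 𝓘(ℝ, ℂ) 𝓘(ℝ, ℝ) ∞ s) {T : Dist Y} (hT : IsGivenByFun T (Φ s)) : IsL21 T := by
  intro c
  obtain ⟨S, hS⟩ := isGivenByFun_of_contMDiff hs
  obtain ⟨P, hPf, hP, C, hC, h⟩ := hΦ.bounded c ∅ isCompact_empty (empty_subset _)
  obtain ⟨A, hA, hA'⟩ := exists_energyLE_finite (hS.isL21 hs) hPf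
  obtain ⟨u, p, q, hg, -⟩ := h s S T A hs hS hT hA hA'
  exact ⟨u, p, q, hg⟩

/-- Vanishing energies of smooth functions are preserved by bounded operators. -/
theorem IsBoundedOp.energyLE_tendsto (hΦ : IsBoundedOp Φ) {ι : Type*} {l : Filter ι}
    {s : ι → X → ℝ} {S : ι → Dist X} {T : ι → Dist Y}
    (hs : ∀ n, ContMDiff 𝓘(ℝ, ℂ) 𝓘(ℝ, ℝ) ∞ (s n)) (hS : ∀ n, IsGivenByFun (S n) (s n))
    (hT : ∀ n, IsGivenByFun (T n) (Φ (s n)))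
    (h : ∀ (e : Chart X) (K : Set ℂ), IsCompact K → K ⊆ e.1.target → ∀ ε > 0,
      ∀ᶠ n in l, EnergyLE ((S n).1 e) K ε)
    (c : Chart Y) {L : Set ℂ} (hL : IsCompact L) (hLc : L ⊆ c.1.target) {ε : ℝ} (hε : 0 < ε) :
    ∀ᶠ n in l, EnergyLE ((T n).1 c) L ε := by
  obtain ⟨P, hPf, hP, C, hC, hb⟩ := hΦ.bounded c L hL hLc
  have h1 : ∀ᶠ n in l, ∀ p ∈ P, EnergyLE ((S n).1 p.1) p.2 (ε / (C + 1)) :=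
    hPf.eventually_all.2 fun p hp => h p.1 p.2 (hP p hp).1 (hP p hp).2 _ (by positivity)
  filter_upwards [h1] with n hn
  refine (hb (s n) (S n) (T n) _ (hs n) (hS n) (hT n) (by positivity) hn).mono ?_
  rw [mul_div_assoc', div_le_iff₀ (by positivity)]
  nlinarith

theorem TendstoL21.eventually_energyLE {S : ℕ → Dist X} {T : Dist X} (h : TendstoL21 S T)
    (e : Chart X) {K : Set ℂ} (hK : IsCompact K) (hKe : K ⊆ e.1.target) {ε : ℝ} (hε : 0 < ε) :
    ∀ᶠ n in atTop, EnergyLE ((S n - T).1 e) K ε :=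
  eventually_atTop.2 (h.energyLE e hK hKe hε)

/-- Convergence in L²₁ already contains, for the empty compact set, that S 0 - T has square
integrable derivatives in every chart. -/
theorem TendstoL21.isL21 {S : ℕ → Dist X} {T : Dist X} (h : TendstoL21 S T)
    (hS : ∀ n, IsL21 (S n)) : IsL21 T := by
  have h1 : IsL21 (S 0 - T) := fun e => by
    obtain ⟨u, p, q, h1, -⟩ := h e ∅ isCompact_empty (empty_subset _)
    exact ⟨_, _, _, h1 0⟩
  have h2 : S 0 - (S 0 - T) = T := by abel
  exact h2 ▸ (hS 0).sub h1

theorem IsBoundedOp.isL21_image (hΦ : IsBoundedOp Φ) {ψ : Dist X} {η : Dist Y}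
    (h : IsImageOfL21 Φ ψ η) : IsL21 η := by
  obtain ⟨s, S, S', hs, hS, hS', -, h2⟩ := h
  exact h2.isL21 fun n => hΦ.isL21 (hs n) (hS' n)

/-- Bounded operators extend to `L²₁`. -/
theorem IsBoundedOp.exists_image [T2Space X] [CompactSpace X] (hΦ : IsBoundedOp Φ) {ψ : Dist X}
    (hψ : IsL21 ψ) : ∃ η, IsImageOfL21 Φ ψ η := by
  obtain ⟨s, S, hs, hS, hlim⟩ := exists_smooth_tendstoL21 hψ
  choose S' hS' using fun n => hΦ.isGivenBy (s n) (hs n)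
  have hc : ∀ (c : Chart Y) (L : Set ℂ), IsCompact L → L ⊆ c.1.target → ∀ ε > 0, ∃ n₀, ∀ m ≥ n₀,
      ∀ n ≥ n₀, EnergyLE ((S' m - S' n).1 c) L ε := by
    intro c L hL hLc ε hε
    -- Taken along pairs of indices, boundedness turns the Cauchy sequence S into the Cauchy
    -- sequence S'.
    have h1 := hΦ.energyLE_tendsto (l := (atTop : Filter (ℕ × ℕ)))
      (s := fun n => s n.1 - s n.2) (S := fun n => S n.1 - S n.2) (T := fun n => S' n.1 - S' n.2)
      (fun n => (hs n.1).sub (hs n.2)) (fun n => (hS n.1).sub (hS n.2))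
      (fun n => by rw [hΦ.sub]; exact (hS' n.1).sub (hS' n.2))
      (fun e K hK hKe ε hε => by
        have h2 := hlim.eventually_energyLE e hK hKe (show 0 < ε / 4 by positivity)
        rw [← prod_atTop_atTop_eq]
        filter_upwards [h2.prod_mk h2] with n hn
        have h3 := hn.1.sub hK hKe hn.2
        have h4 : S n.1 - ψ - (S n.2 - ψ) = S n.1 - S n.2 := by abel
        rw [← coe_sub_apply, h4] at h3
        exact h3.mono (by linarith)) c hL hLc hε
    obtain ⟨n₀, hn₀⟩ := eventually_atTop_prod_self'.1 h1
    exact ⟨n₀, hn₀⟩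
  obtain ⟨η, -, hη, -⟩ := exists_tendstoL21 (fun n => hΦ.isL21 (hs n) (hS' n)) hc
  exact ⟨η, s, S, S', hs, hS, hS', hlim, hη⟩

/-- The extension of a bounded operator to `L²₁` is unique and agrees with the operator on smooth
functions. -/
theorem IsBoundedOp.image_sub (hΦ : IsBoundedOp Φ) {ψ ψ' : Dist X} {η η' : Dist Y}
    (h : IsImageOfL21 Φ ψ η) (h' : IsImageOfL21 Φ ψ' η') {v : X → ℝ}
    (hv : ContMDiff 𝓘(ℝ, ℂ) 𝓘(ℝ, ℝ) ∞ v) (hV : IsGivenByFun (ψ' - ψ) v) :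
    IsGivenByFun (η' - η) (Φ v) := by
  obtain ⟨s, S, S', hs, hS, hS', h1, h2⟩ := h
  obtain ⟨r, R, R', hr, hR, hR', h3, h4⟩ := h'
  obtain ⟨V', hV'⟩ := hΦ.isGivenBy v hv
  suffices hz : η' - η - V' = 0 by
    have h0 : η' - η = V' := sub_eq_zero.1 hz
    rw [h0]; exact hV'
  refine Subtype.ext (funext fun c => eq_zero_of_energyLE fun L hLc hL ε hε => ?_)
  -- The smooth functions r n - s n - v tend to zero in L²₁, hence so do their images. For v = 0
  -- this is independence of the approximating sequence.
  have h5 := hΦ.energyLE_tendsto (l := atTop)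
    (s := fun n => r n - s n - v) (S := fun n => R n - S n - (ψ' - ψ))
    (T := fun n => R' n - S' n - V')
    (fun n => ((hr n).sub (hs n)).sub hv) (fun n => ((hR n).sub (hS n)).sub hV)
    (fun n => by rw [hΦ.sub, hΦ.sub]; exact ((hR' n).sub (hS' n)).sub hV')
    (fun e K hK hKe ε hε => by
      filter_upwards [h1.eventually_energyLE e hK hKe (show 0 < ε / 4 by positivity),
        h3.eventually_energyLE e hK hKe (show 0 < ε / 4 by positivity)] with n hn hn'
      have h6 := hn'.sub hK hKe hn
      have h7 : R n - ψ' - (S n - ψ) = R n - S n - (ψ' - ψ) := by abel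
      rw [← coe_sub_apply, h7] at h6
      exact h6.mono (by linarith)) c hL hLc (show 0 < ε / 16 by positivity)
  -- Two subtractions turn three bounds ε/16 into 2(1/16 + 2(1/16 + 1/16)) ε = 10ε/16.
  obtain ⟨n, e1, e2, e3⟩ := (h5.and ((h2.eventually_energyLE c hL hLc
    (show 0 < ε / 16 by positivity)).and
    (h4.eventually_energyLE c hL hLc (show 0 < ε / 16 by positivity)))).exists
  have e4 := e1.sub hL hLc (e3.sub hL hLc e2)
  rw [← coe_sub_apply, ← coe_sub_apply] at e4
  have e5 : R' n - S' n - V' - (R' n - η' - (S' n - η)) = η' - η - V' := by abel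
  rw [e5] at e4
  exact e4.mono (by linarith)

end Extension

/-! ### Logarithmic singularities in the plane. -/

section LogSing

/-- Up to a smooth function, `f` is `-a log |z - p|²` near `p`. -/
def HasLogSing (a : ℝ) (f : ℂ → ℝ) (p : ℂ) : Prop :=
  ∃ r : ℂ → ℝ, ContDiffAt ℝ ∞ r p ∧ ∀ᶠ z in 𝓝[≠] p, f z = r z - a * Real.log (‖z - p‖ ^ 2)

theorem HasLogSing.add {a b : ℝ} {f g : ℂ → ℝ} {p : ℂ} (hf : HasLogSing a f p)
    (hg : HasLogSing b g p) : HasLogSing (a + b) (fun z => f z + g z) p := by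
  obtain ⟨r, hr, h1⟩ := hf
  obtain ⟨s, hs, h2⟩ := hg
  refine ⟨fun z => r z + s z, hr.add hs, ?_⟩
  filter_upwards [h1, h2] with z h3 h4
  rw [h3, h4]; ring

theorem HasLogSing.const_mul {a : ℝ} {f : ℂ → ℝ} {p : ℂ} (hf : HasLogSing a f p) (c : ℝ) :
    HasLogSing (c * a) (fun z => c * f z) p := by
  obtain ⟨r, hr, h1⟩ := hf
  refine ⟨fun z => c * r z, contDiffAt_const.mul hr, ?_⟩
  filter_upwards [h1] with z h3
  rw [h3]; ring

theorem HasLogSing.congr {a : ℝ} {f g : ℂ → ℝ} {p : ℂ} (hf : HasLogSing a f p)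
    (h : ∀ᶠ z in 𝓝[≠] p, f z = g z) : HasLogSing a g p := by
  obtain ⟨r, hr, h1⟩ := hf
  refine ⟨r, hr, ?_⟩
  filter_upwards [h1, h] with z h3 h4
  rw [← h4, h3]

theorem hasLogSing_of_contDiffAt {f : ℂ → ℝ} {p : ℂ} (hf : ContDiffAt ℝ ∞ f p) :
    HasLogSing 0 f p := ⟨f, hf, Eventually.of_forall fun z => by ring⟩

theorem contDiffAt_log_norm_sq_comp {g : ℂ → ℂ} {p : ℂ} (hg : ContDiffAt ℝ ∞ g p) (h0 : g p ≠ 0) :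
    ContDiffAt ℝ ∞ (fun z => Real.log (‖g z‖ ^ 2)) p :=
  (hg.norm_sq ℝ).log (by positivity)

/-- Writing τ - τ p = (z - p)^n g with g(p) ≠ 0 gives log |τ - τ p|² = n log |z - p|² + log |g|²,
and the last term is smooth. -/
theorem HasLogSing.comp {b : ℝ} {k : ℂ → ℝ} {τ : ℂ → ℂ} {p : ℂ} (hk : HasLogSing b k (τ p))
    (hτ : AnalyticAt ℂ τ p) (hn : analyticOrderAt (fun z => τ z - τ p) p ≠ ⊤) :
    HasLogSing (b * analyticOrderNatAt (fun z => τ z - τ p) p) (fun z => k (τ z)) p := by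
  obtain ⟨r, hr, h1⟩ := hk
  obtain ⟨g, hg, hg0, hgτ⟩ := (AnalyticAt.analyticOrderAt_ne_top (hτ.sub analyticAt_const)).1 hn
  set n := analyticOrderNatAt (fun z => τ z - τ p) p with hnn
  have hgc : ContDiffAt ℝ ∞ g p := (hg.restrictScalars (𝕜 := ℝ)).contDiffAt
  have hτc : ContDiffAt ℝ ∞ τ p := (hτ.restrictScalars (𝕜 := ℝ)).contDiffAt
  refine ⟨fun z => r (τ z) - b * Real.log (‖g z‖ ^ 2), (hr.comp p hτc).sub
    (contDiffAt_const.mul (contDiffAt_log_norm_sq_comp hgc hg0)), ?_⟩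
  have hne : ∀ᶠ z in 𝓝[≠] p, g z ≠ 0 :=
    (hg.continuousAt.eventually_ne hg0).filter_mono nhdsWithin_le_nhds
  have htend : ∀ᶠ z in 𝓝[≠] p, τ z ≠ τ p → k (τ z) = r (τ z) - b * Real.log (‖τ z - τ p‖ ^ 2) :=
    (hτ.continuousAt.eventually (eventually_nhdsWithin_iff.1 h1)).filter_mono nhdsWithin_le_nhds
  filter_upwards [hne, htend, hgτ.filter_mono nhdsWithin_le_nhds, self_mem_nhdsWithin]
    with z h2 h3 h4 h5
  have hz : z - p ≠ 0 := sub_ne_zero.2 h5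
  have h6 : τ z - τ p = (z - p) ^ n * g z := h4
  rw [h3 (sub_ne_zero.1 (h6 ▸ mul_ne_zero (pow_ne_zero _ hz) h2)), h6, norm_mul, norm_pow, mul_pow,
    Real.log_mul (by positivity) (by positivity), ← pow_mul, mul_comm n 2, pow_mul, Real.log_pow]
  ring

theorem integrableAtFilter_log (p : ℂ) :
    IntegrableAtFilter (fun z : ℂ => Real.log (‖z - p‖ ^ 2)) (𝓝 p) := by
  obtain ⟨s, hs, hi⟩ := locallyIntegrable_log_norm_sq 0
  refine ⟨(fun z => z - p) ⁻¹' s, ?_, ?_⟩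
  · refine (continuous_id.sub continuous_const).continuousAt.preimage_mem_nhds ?_
    simpa using hs
  · have h1 : MeasurePreserving (fun z : ℂ => z - p) := measurePreserving_sub_right volume p
    exact (h1.integrableOn_comp_preimage
      (Homeomorph.subRight p).isClosedEmbedding.measurableEmbedding).2 hi

theorem HasLogSing.integrableAtFilter {a : ℝ} {f : ℂ → ℝ} {p : ℂ} (hf : HasLogSing a f p) :
    IntegrableAtFilter f (𝓝 p) := by
  obtain ⟨r, hr, h1⟩ := hf
  obtain ⟨V, hV, hrV⟩ := (hr.of_le (m := 1) (by norm_cast)).contDiffOn le_rfl (by simp)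
  obtain ⟨U, hUV, hU, hpU⟩ := mem_nhds_iff.1 hV
  have i1 : IntegrableAtFilter r (𝓝 p) :=
    ((hrV.mono hUV).continuousOn.locallyIntegrableOn hU.measurableSet p hpU).filter_mono
      (by rw [hU.nhdsWithin_eq hpU])
  have i2 : IntegrableAtFilter (fun z => a * Real.log (‖z - p‖ ^ 2)) (𝓝 p) :=
    (integrableAtFilter_log p).smul a
  obtain ⟨s, hs, hi⟩ := i1.sub i2
  obtain ⟨t, ht, htp⟩ := mem_nhdsWithin_iff_exists_mem_nhds_inter.1 h1
  obtain ⟨O, hO, hOo, hpO⟩ := mem_nhds_iff.1 (inter_mem hs ht)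
  refine ⟨O, hOo.mem_nhds hpO, (hi.mono_set (hO.trans inter_subset_left)).congr ?_⟩
  have h0 : ∀ᵐ z : ℂ, z ≠ p := by simp [ae_iff]
  filter_upwards [ae_restrict_mem hOo.measurableSet, ae_restrict_of_ae h0] with z hz hzp
  exact (htp ⟨(hO hz).2, hzp⟩).symm

end LogSing

/-! ### Functions with logarithmic singularities along a divisor. -/

section LogGreen

variable {X Y : Type*} [TopologicalSpace X] [ChartedSpace ℂ X] [IsManifold 𝓘(ℂ) ω X]
  [TopologicalSpace Y] [ChartedSpace ℂ Y] [IsManifold 𝓘(ℂ) ω Y]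

/-- The function `u` has logarithmic singularities described by the divisor `D`. -/
def LogGreen (D : X →₀ ℝ) (u : X → ℝ) : Prop :=
  ∀ (e : Chart X) (x : X), x ∈ e.1.source → HasLogSing (D x) (fun z => u (e.1.symm z)) (e.1 x)

/-- A change of coordinates takes its value to order one, so `HasLogSing.comp` preserves the
coefficient. -/
theorem HasLogSing.of_chart {e e' : Chart X} {x : X} (hx : x ∈ e.1.source) (hx' : x ∈ e'.1.source)
    {a : ℝ} {u : X → ℝ} (h : HasLogSing a (fun z => u (e'.1.symm z)) (e'.1 x)) :
    HasLogSing a (fun z => u (e.1.symm z)) (e.1 x) := by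
  have hd : e.1 x ∈ locDom id e e' := mem_locDom hx hx'
  have ha := analyticOnNhd_locMap (F := (id : X → X)) mdifferentiable_id e e' _ hd
  have h1 := ha.analyticOrderAt_sub_eq_one_of_deriv_ne_zero (deriv_locMap_id_ne_zero e e' hd)
  have h2 : locMap id e e' (e.1 x) = e'.1 x := locMap_apply id e' hx
  have h3 := HasLogSing.comp (τ := locMap id e e') (h2.symm ▸ h) ha (by rw [h1]; simp)
  rw [analyticOrderNatAt, h1, ENat.toNat_one, Nat.cast_one, mul_one] at h3
  refine h3.congr (Eventually.filter_mono nhdsWithin_le_nhds ?_)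
  filter_upwards [(isOpen_locDom continuous_id e e').mem_nhds hd] with z hz
  rw [symm_locMap hz]; rfl

theorem logGreen_iff {D : X →₀ ℝ} {u : X → ℝ} : LogGreen D u ↔ ∀ x : X, ∃ e : Chart X,
    x ∈ e.1.source ∧ HasLogSing (D x) (fun z => u (e.1.symm z)) (e.1 x) :=
  ⟨fun h x => ⟨_, mem_source_preferred x, h _ x (mem_source_preferred x)⟩, fun h _ x hx => by
    obtain ⟨e', hx', h'⟩ := h x
    exact h'.of_chart hx hx'⟩

theorem LogGreen.add {D E : X →₀ ℝ} {u v : X → ℝ} (hu : LogGreen D u) (hv : LogGreen E v) :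
    LogGreen (D + E) (fun x => u x + v x) := fun e x hx => (hu e x hx).add (hv e x hx)

theorem LogGreen.const_mul {D : X →₀ ℝ} {u : X → ℝ} (hu : LogGreen D u) (c : ℝ) :
    LogGreen (c • D) (fun x => c * u x) := fun e x hx => (hu e x hx).const_mul c

theorem logGreen_zero_of_contMDiff {u : X → ℝ} (hu : ContMDiff 𝓘(ℝ, ℂ) 𝓘(ℝ, ℝ) ∞ u) :
    LogGreen 0 u := fun e x hx =>
  hasLogSing_of_contDiffAt ((contMDiffAt_iff_chart e hx).1 (hu x))

theorem LogGreen.sum {ι : Type*} (t : Finset ι) {D : ι → X →₀ ℝ} {u : ι → X → ℝ}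
    (h : ∀ i ∈ t, LogGreen (D i) (u i)) : LogGreen (∑ i ∈ t, D i) (fun x => ∑ i ∈ t, u i x) := by
  classical
  induction t using Finset.induction_on with
  | empty =>
    simp only [Finset.sum_empty]
    exact logGreen_zero_of_contMDiff contMDiff_const
  | insert a t ha ih =>
    simp only [Finset.sum_insert ha]
    exact (h a (Finset.mem_insert_self _ _)).add
      (ih fun i hi => h i (Finset.mem_insert_of_mem hi))

theorem LogGreen.exists_dist [T1Space X] {D : X →₀ ℝ} {u : X → ℝ} (hu : LogGreen D u) :
    ∃ T : Dist X, IsGivenByFun T u :=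
  ⟨_, isGivenByFun_ofFun fun e z hz => by
    have := hu e _ (e.1.map_target hz)
    rw [e.1.right_inv hz] at this
    exact this.integrableAtFilter.filter_mono nhdsWithin_le_nhds⟩

theorem HasLogSing.comp_map {F : X → Y} (hF : MDifferentiable 𝓘(ℂ) 𝓘(ℂ) F)
    (hiso : ∀ (x : X) (y : Y), ∀ᶠ x' in 𝓝[≠] x, F x' ≠ y) {x : X} {a : ℝ} {k : Y → ℝ}
    (h : HasLogSing a (fun z => k ((Chart.preferred (F x)).1.symm z))
      ((Chart.preferred (F x)).1 (F x))) :
    HasLogSing (a * ramificationIndex F x) (fun z => k (F ((Chart.preferred x).1.symm z)))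
      ((Chart.preferred x).1 x) := by
  set e := Chart.preferred x with he
  set c := Chart.preferred (F x) with hc
  have hxs : x ∈ e.1.source := mem_source_preferred x
  have hd : e.1 x ∈ locDom F e c := mem_locDom hxs (mem_source_preferred (F x))
  have ha := analyticOnNhd_locMap hF e c _ hd
  have h2 : locMap F e c (e.1 x) = c.1 (F x) := locMap_apply F c hxs
  have h1 : analyticOrderAt (fun z => locMap F e c z - locMap F e c (e.1 x)) (e.1 x) ≠ ⊤ := by
    exact analyticOrderAt_ne_top_of_punctured (eventually_locMap_ne hF hiso e c hd)
  have h3 := HasLogSing.comp (τ := locMap F e c) (h2.symm ▸ h) ha h1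
  rw [h2] at h3
  have h4 : analyticOrderNatAt (fun z => locMap F e c z - c.1 (F x)) (e.1 x) =
      ramificationIndex F x := rfl
  rw [h4] at h3
  refine h3.congr (Eventually.filter_mono nhdsWithin_le_nhds ?_)
  filter_upwards [(isOpen_locDom hF.continuous e c).mem_nhds hd] with z hz
  rw [symm_locMap hz]

theorem pullDivisor_apply [CompactSpace X] {F : X → Y} (hF : MDifferentiable 𝓘(ℂ) 𝓘(ℂ) F)
    (hiso : ∀ (x : X) (y : Y), ∀ᶠ x' in 𝓝[≠] x, F x' ≠ y) (E : Y →₀ ℝ) (x : X) :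
    pullDivisor F E x = E (F x) * ramificationIndex F x := by
  classical
  have h1 : ∀ (Q : Y) (b : ℝ), (∑ᶠ P ∈ F ⁻¹' {Q},
      Finsupp.single P (b * (ramificationIndex F P : ℝ))) x =
      if F x = Q then b * ramificationIndex F x else 0 := by
    intro Q b
    rw [finsum_mem_eq_finite_toFinset_sum _ (finite_fibre hF hiso Q), Finsupp.finsetSum_apply]
    simp only [Finsupp.single_apply, Finset.sum_ite_eq', Set.Finite.mem_toFinset, mem_preimage,
      mem_singleton_iff]
  rw [pullDivisor, Finsupp.sum, Finsupp.finsetSum_apply]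
  simp only [h1, Finset.sum_ite_eq, Finsupp.mem_support_iff]
  split_ifs with h
  · rfl
  · rw [not_not.1 h, zero_mul]

theorem LogGreen.pull [CompactSpace X] {F : X → Y} (hF : MDifferentiable 𝓘(ℂ) 𝓘(ℂ) F)
    (hiso : ∀ (x : X) (y : Y), ∀ᶠ x' in 𝓝[≠] x, F x' ≠ y) {E : Y →₀ ℝ} {k : Y → ℝ}
    (hk : LogGreen E k) : LogGreen (pullDivisor F E) (pullFun F k) :=
  logGreen_iff.2 fun x => ⟨_, mem_source_preferred x, by
    rw [pullDivisor_apply hF hiso]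
    exact HasLogSing.comp_map hF hiso (hk _ _ (mem_source_preferred (F x)))⟩

/-- There are functions with a single logarithmic singularity, supported near that point. -/
theorem exists_logGreen_single [T2Space X] (P : X) {N : Set X} (hN : N ∈ 𝓝 P) :
    ∃ κ : X → ℝ, LogGreen (Finsupp.single P 1) κ ∧
      (∀ x ≠ P, ContMDiffAt 𝓘(ℝ, ℂ) 𝓘(ℝ, ℝ) ∞ κ x) ∧ ∀ x ∉ N, κ x = 0 := by
  have hP := mem_source_preferred P
  set e := Chart.preferred P with he
  have hmem : e.1.symm ⁻¹' N ∩ e.1.target ∈ 𝓝 (e.1 P) := by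
    refine inter_mem ?_ (e.1.open_target.mem_nhds (e.1.map_source hP))
    refine (e.1.continuousAt_symm (e.1.map_source hP)).preimage_mem_nhds ?_
    rwa [e.1.left_inv hP]
  obtain ⟨U, hU, hUo, hPU⟩ := mem_nhds_iff.1 hmem
  obtain ⟨ξ, hξ, hξc, hξU, hξ1, -⟩ := exists_cutoff (isCompact_singleton (x := e.1 P)) hUo
    (singleton_subset_iff.2 hPU)
  have hξe : tsupport ξ ⊆ e.1.target := hξU.trans (hU.trans inter_subset_right)
  -- The sign is the one for which dd^c κ + δ_P is smooth.
  set κ : X → ℝ := fun x => extendChart e ξ x * (-Real.log (‖e.1 x - e.1 P‖ ^ 2)) with hκ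
  have hs := contMDiff_extendChart hξ hξc hξe Subset.rfl
  have h0 : ∀ x, x ∉ e.1.symm '' tsupport ξ → extendChart e ξ x = 0 := by
    intro x hx
    by_cases hxs : x ∈ e.1.source
    · rw [extendChart_apply _ hxs]
      exact image_eq_zero_of_notMem_tsupport fun h => hx ⟨_, h, e.1.left_inv hxs⟩
    · exact extendChart_of_notMem _ hxs
  have hcl : IsClosed (e.1.symm '' tsupport ξ) :=
    (IsCompact.image_of_continuousOn hξc (e.1.continuousOn_symm.mono hξe)).isClosed
  have hsm : ∀ x ≠ P, ContMDiffAt 𝓘(ℝ, ℂ) 𝓘(ℝ, ℝ) ∞ κ x := by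
    intro x hx
    by_cases hxs : x ∈ e.1.source
    · refine (hs x).mul ((contMDiffAt_iff_chart e hxs).2 ?_)
      have hne : e.1 x - e.1 P ≠ 0 := sub_ne_zero.2 fun h => hx (e.1.injOn hxs hP h)
      refine ((contDiffAt_log_norm_sq_comp (contDiffAt_id.sub contDiffAt_const)
        hne).neg).congr_of_eventuallyEq ?_
      filter_upwards [e.1.open_target.mem_nhds (e.1.map_source hxs)] with z hz
      simp only [Function.comp, e.1.right_inv hz, id]
    · have h1 : κ =ᶠ[𝓝 x] fun _ => 0 := by
        have hx' : x ∉ e.1.symm '' tsupport ξ := by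
          rintro ⟨z, hz, rfl⟩
          exact hxs (e.1.map_target (hξe hz))
        filter_upwards [hcl.isOpen_compl.mem_nhds hx'] with y hy
        rw [hκ]
        simp only [h0 y hy, zero_mul]
      exact contMDiffAt_const.congr_of_eventuallyEq h1
  refine ⟨κ, logGreen_iff.2 fun x => ?_, hsm, fun x hx => ?_⟩
  · by_cases hx : x = P
    · subst hx
      refine ⟨e, hP, ?_⟩
      rw [Finsupp.single_eq_same]
      refine ⟨fun _ => 0, contDiffAt_const, Eventually.filter_mono nhdsWithin_le_nhds ?_⟩
      rw [nhdsSet_singleton] at hξ1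
      filter_upwards [hξ1, e.1.open_target.mem_nhds (e.1.map_source hP)] with z hz hzt
      rw [hκ]
      simp only [extendChart_symm _ hzt, hz, e.1.right_inv hzt]
      ring
    · refine ⟨_, mem_source_preferred x, ?_⟩
      rw [Finsupp.single_eq_of_ne (by exact hx)]
      exact hasLogSing_of_contDiffAt ((contMDiffAt_iff_chart _ (mem_source_preferred x)).1
        (hsm x hx))
  · rw [hκ]
    simp only
    rw [h0 x, zero_mul]
    rintro ⟨z, hz, rfl⟩
    exact hx (hU (hξU hz)).1

end LogGreen

/-! ### Green functions with smooth regularity and functions with logarithmic singularities. -/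

section Green

variable {X : Type*} [TopologicalSpace X] [ChartedSpace ℂ X] [IsManifold 𝓘(ℂ) ω X]

theorem neBot_nhdsNE_chart (x : X) : (𝓝[≠] x).NeBot :=
  (tendsto_symm_punctured (Chart.preferred x) (mem_source_preferred x)).neBot

/-- A function whose singularities are all removable is smooth up to a finite set. -/
theorem LogGreen.exists_smooth [T2Space X] [CompactSpace X] {u : X → ℝ} (hu : LogGreen 0 u) :
    ∃ (s : X → ℝ) (N : Set X), ContMDiff 𝓘(ℝ, ℂ) 𝓘(ℝ, ℝ) ∞ s ∧ N.Finite ∧ ∀ x ∉ N, u x = s x := by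
  choose r hr hur using fun x : X => hu (Chart.preferred x) x (mem_source_preferred x)
  -- `σ x` is the smooth function equal to u near x except perhaps at x. The diagonal value `σ x x`
  -- repairs u at x, and continuity forces s to agree with `σ x` on a full neighbourhood.
  set σ : X → X → ℝ := fun x y => r x ((Chart.preferred x).1 y) with hσ
  have hc : ∀ x, ∀ᶠ y in 𝓝 x, ContinuousAt (σ x) y := by
    intro x
    have h1 : ∀ᶠ z in 𝓝 ((Chart.preferred x).1 x), ContinuousAt (r x) z :=
      (((hr x).of_le (m := 1) (by norm_cast)).eventually (by simp)).mono fun z hz =>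
        hz.continuousAt
    have hx := mem_source_preferred x
    filter_upwards [((Chart.preferred x).1.continuousAt hx).eventually h1,
      (Chart.preferred x).1.open_source.mem_nhds hx] with y hy hys
    exact ContinuousAt.comp hy ((Chart.preferred x).1.continuousAt hys)
  have hσu : ∀ x, ∀ᶠ y in 𝓝[≠] x, u y = σ x y := by
    intro x
    have hx := mem_source_preferred x
    filter_upwards [(tendsto_chart_punctured _ hx).eventually (hur x), mem_nhdsWithin_of_mem_nhds
      ((Chart.preferred x).1.open_source.mem_nhds hx)] with y hy hys
    rw [(Chart.preferred x).1.left_inv hys] at hy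
    simpa using hy
  set s : X → ℝ := fun x => σ x x with hs
  have hss : ∀ x, s =ᶠ[𝓝 x] σ x := by
    intro x
    have h1 : ∀ᶠ y in 𝓝[≠] x, s y = σ x y := by
      filter_upwards [eventually_eventually_nhdsWithin.2 (hσu x), self_mem_nhdsWithin,
        mem_nhdsWithin_of_mem_nhds (hc x)] with y hy hyx hyc
      have h2 : ∀ᶠ z in 𝓝[≠] y, u z = σ x z := by
        rw [(isOpen_compl_singleton).nhdsWithin_eq hyx] at hy
        exact hy.filter_mono nhdsWithin_le_nhds
      have h3 : σ y =ᶠ[𝓝[≠] y] σ x := by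
        filter_upwards [h2, hσu y] with z e1 e2
        rw [← e1, ← e2]
      have := neBot_nhdsNE_chart y
      have h4 : Tendsto (σ y) (𝓝[≠] y) (𝓝 (σ y y)) :=
        ((hc y).self_of_nhds).tendsto.mono_left nhdsWithin_le_nhds
      exact tendsto_nhds_unique (h4.congr' h3) (hyc.tendsto.mono_left nhdsWithin_le_nhds)
    rw [eventually_nhdsWithin_iff] at h1
    filter_upwards [h1] with y hy
    by_cases hyx : y = x
    · rw [hyx]
    · exact hy hyx
  refine ⟨s, {x | u x ≠ s x}, fun x => ?_, finite_of_isolated fun x => ?_, fun x hx => ?_⟩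
  · refine ContMDiffAt.congr_of_eventuallyEq ?_ (hss x)
    have hx := mem_source_preferred x
    refine (contMDiffAt_iff_chart _ hx).2 ((hr x).congr_of_eventuallyEq ?_)
    filter_upwards [(Chart.preferred x).1.open_target.mem_nhds
      ((Chart.preferred x).1.map_source hx)] with z hz
    simp only [Function.comp, hσ, (Chart.preferred x).1.right_inv hz]
  · filter_upwards [hσu x, (hss x).filter_mono nhdsWithin_le_nhds] with y h1 h2
    exact fun h => h (h1.trans h2.symm)
  · by_contra h; exact hx h

theorem ddc_apply (T : Dist X) (e : Chart X) (φ : 𝓓(e.range, ℝ)) :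
    ddc T e φ = (4 * Real.pi)⁻¹ * T.1 e (lapTest φ) := by
  have h1 : ∀ v : ℂ, (∂_{v} (∂_{v} (T.1 e)) : 𝓓'(e.range, ℝ)) φ = T.1 e (∂_{v} (∂_{v} φ)) := by
    intro v
    rw [lineDeriv_apply, lineDeriv_apply, neg_neg]
  have h2 : lapTest φ = ∂_{(1 : ℂ)} (∂_{(1 : ℂ)} φ) + ∂_{Complex.I} (∂_{Complex.I} φ) := by
    ext z
    change lap φ z = (∂_{(1 : ℂ)} (∂_{(1 : ℂ)} φ) : 𝓓(e.range, ℝ)) z +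
      (∂_{Complex.I} (∂_{Complex.I} φ) : 𝓓(e.range, ℝ)) z
    have h3 : ∀ v : ℂ, (∂_{v} (∂_{v} φ) : 𝓓(e.range, ℝ)) z =
        fderiv ℝ (fun w => fderiv ℝ φ w v) z v := by
      intro v
      rw [testFunction_lineDeriv_apply]
      have : ((∂_{v} φ : 𝓓(e.range, ℝ)) : ℂ → ℝ) = fun w => fderiv ℝ φ w v :=
        funext fun w => testFunction_lineDeriv_apply φ v w
      rw [this]
    rw [h3, h3]
    rfl
  rw [h2, map_add, ← h1, ← h1]
  rfl

open Classical in
theorem diracDivisor_apply (D : X →₀ ℝ) (e : Chart X) (φ : 𝓓(e.range, ℝ)) :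
    diracDivisor D e φ = D.sum fun P a => if P ∈ e.1.source then a * φ (e.1 P) else 0 := by
  rw [diracDivisor, Finsupp.sum, distribution_sum_apply]
  refine Finset.sum_congr rfl fun P _ => ?_
  beta_reduce
  split_ifs <;> rfl

theorem isSmoothGreen_iff {D : X →₀ ℝ} {h : Dist X} : IsSmoothGreen D h ↔
    ∀ e : Chart X, ∃ w : ℂ → ℝ, ContDiffOn ℝ ∞ w e.1.target ∧ ∀ φ : 𝓓(e.range, ℝ),
      (4 * Real.pi)⁻¹ * h.1 e (lapTest φ) + diracDivisor D e φ = ∫ z, w z * φ z := by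
  refine forall_congr' fun e => exists_congr fun w => and_congr_right fun hw => ?_
  refine ⟨fun h' φ => ?_, fun h' => ⟨hw.continuousOn.locallyIntegrableOn
    e.1.open_target.measurableSet, fun φ => ?_⟩⟩
  · rw [← h'.2 φ, ← ddc_apply]; rfl
  · rw [← h' φ, ← ddc_apply]; rfl

theorem diracDivisor_add (D E : X →₀ ℝ) (e : Chart X) (φ : 𝓓(e.range, ℝ)) :
    diracDivisor (D + E) e φ = diracDivisor D e φ + diracDivisor E e φ := by
  rw [diracDivisor_apply, diracDivisor_apply, diracDivisor_apply]
  refine Finsupp.sum_add_index' (fun P => ?_) fun P a b => ?_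
  · simp
  · split_ifs <;> ring

theorem diracDivisor_smul (c : ℝ) (D : X →₀ ℝ) (e : Chart X) (φ : 𝓓(e.range, ℝ)) :
    diracDivisor (c • D) e φ = c * diracDivisor D e φ := by
  rw [diracDivisor_apply, diracDivisor_apply, Finsupp.sum_smul_index' (fun P => by simp),
    Finsupp.mul_sum]
  refine Finsupp.sum_congr fun P _ => ?_
  split_ifs
  · rw [smul_eq_mul, mul_assoc]
  · rw [mul_zero]

theorem IsSmoothGreen.add {D E : X →₀ ℝ} {h k : Dist X} (hD : IsSmoothGreen D h)
    (hE : IsSmoothGreen E k) : IsSmoothGreen (D + E) (h + k) := by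
  rw [isSmoothGreen_iff] at *
  intro e
  obtain ⟨w, hw, h1⟩ := hD e
  obtain ⟨w', hw', h2⟩ := hE e
  refine ⟨fun z => w z + w' z, hw.add hw', fun φ => ?_⟩
  have l : ∀ {w : ℂ → ℝ}, ContDiffOn ℝ ∞ w e.1.target → Integrable fun z => w z * φ z := fun hw =>
    integrable_mul_test (Ω := e.range)
      (hw.continuousOn.locallyIntegrableOn e.1.open_target.measurableSet) φ
  simp only [add_mul]
  rw [integral_add (l hw) (l hw'), ← h1, ← h2, diracDivisor_add]
  change _ * (h.1 e (lapTest φ) + k.1 e (lapTest φ)) + _ = _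
  ring

theorem IsSmoothGreen.const_smul {D : X →₀ ℝ} {h : Dist X} (hD : IsSmoothGreen D h) (c : ℝ) :
    IsSmoothGreen (c • D) (c • h) := by
  rw [isSmoothGreen_iff] at *
  intro e
  obtain ⟨w, hw, h1⟩ := hD e
  refine ⟨fun z => c * w z, contDiffOn_const.mul hw, fun φ => ?_⟩
  simp only [mul_assoc]
  rw [integral_const_mul, ← h1, diracDivisor_smul]
  change _ * (c * h.1 e (lapTest φ)) + _ = _
  ring

theorem isSmoothGreen_zero : IsSmoothGreen (0 : X →₀ ℝ) 0 := by
  rw [isSmoothGreen_iff]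
  refine fun e => ⟨fun _ => 0, contDiffOn_const, fun φ => ?_⟩
  rw [diracDivisor_apply]
  simp only [Finsupp.sum_zero_index, zero_mul, integral_zero, add_zero]
  change _ * (0 : ℝ) = 0
  rw [mul_zero]

theorem IsSmoothGreen.sum {ι : Type*} (t : Finset ι) {D : ι → X →₀ ℝ} {h : ι → Dist X}
    (hD : ∀ i ∈ t, IsSmoothGreen (D i) (h i)) : IsSmoothGreen (∑ i ∈ t, D i) (∑ i ∈ t, h i) := by
  classical
  induction t using Finset.induction_on with
  | empty => exact isSmoothGreen_zero
  | insert a t ha ih =>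
    rw [Finset.sum_insert ha, Finset.sum_insert ha]
    exact (hD a (Finset.mem_insert_self _ _)).add
      (ih fun i hi => hD i (Finset.mem_insert_of_mem hi))

theorem IsGivenByFun.isSmoothGreen_zero {h : Dist X} {s : X → ℝ} (hs : IsGivenByFun h s)
    (hsm : ContMDiff 𝓘(ℝ, ℂ) 𝓘(ℝ, ℝ) ∞ s) : IsSmoothGreen 0 h := by
  rw [isSmoothGreen_iff]
  intro e
  have h1 := contMDiff_iff_chart.1 hsm e
  refine ⟨fun z => (4 * Real.pi)⁻¹ * lap (s ∘ e.1.symm) z, ?_, fun φ => ?_⟩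
  · exact contDiffOn_const.mul (contDiffOn_lap e.1.open_target h1)
  · rw [diracDivisor_apply, Finsupp.sum_zero_index, add_zero, (hs e).2]
    simp only [mul_assoc]
    rw [integral_const_mul]
    congr 1
    exact integral_mul_lap_test (Ω := e.range) h1 φ

theorem integral_log_sub_mul_lap {φ : ℂ → ℝ} (hφ : ContDiff ℝ ∞ φ) (hc : HasCompactSupport φ)
    (p : ℂ) : ∫ z, Real.log (‖z - p‖ ^ 2) * lap φ z = 4 * Real.pi * φ p := by
  have h1 := integral_log_mul_lap (φ := fun z => φ (z - -p))
    (hφ.comp (contDiff_id.sub contDiff_const)) (hc.comp_homeomorph (Homeomorph.subRight (-p)))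
  have h2 : ∀ z, lap (fun z => φ (z - -p)) z = lap φ (z + p) := fun z => by
    rw [lap_comp_sub, sub_neg_eq_add]
  simp only [h2] at h1
  rw [sub_neg_eq_add, zero_add] at h1
  rw [← h1, ← integral_add_right_eq_self _ p]
  simp only [add_sub_cancel_right]

/-- In a chart containing P, adding log |z - p|² to κ and filling in the value at p gives a smooth
function R. The remaining -log |z - p|² contributes exactly -δ_P to dd^c. -/
theorem IsGivenByFun.isSmoothGreen_single [T1Space X] {h : Dist X} {κ : X → ℝ} {P : X}
    (hκ : IsGivenByFun h κ) (hL : LogGreen (Finsupp.single P 1) κ)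
    (hsm : ∀ x ≠ P, ContMDiffAt 𝓘(ℝ, ℂ) 𝓘(ℝ, ℝ) ∞ κ x) :
    IsSmoothGreen (Finsupp.single P 1) h := by
  classical
  rw [isSmoothGreen_iff]
  intro e
  have hsz : ∀ z ∈ e.1.target, e.1.symm z ≠ P → ContDiffAt ℝ ∞ (κ ∘ e.1.symm) z := by
    intro z hz hne
    have := (contMDiffAt_iff_chart e (e.1.map_target hz)).1 (hsm _ hne)
    rwa [e.1.right_inv hz] at this
  have hdirac : ∀ φ : 𝓓(e.range, ℝ), diracDivisor (Finsupp.single P 1) e φ =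
      if P ∈ e.1.source then φ (e.1 P) else 0 := by
    intro φ
    rw [diracDivisor_apply, Finsupp.sum_single_index (by simp), one_mul]
  simp only [hdirac]
  by_cases hP : P ∈ e.1.source
  · set p := e.1 P with hp
    obtain ⟨r, hr, hrκ⟩ := hL e P hP
    rw [Finsupp.single_eq_same] at hrκ
    set R : ℂ → ℝ := fun z => if z = p then r p else κ (e.1.symm z) + Real.log (‖z - p‖ ^ 2)
      with hR
    have hR1 : ContDiffOn ℝ ∞ R e.1.target := by
      intro z hz
      refine ContDiffAt.contDiffWithinAt ?_
      by_cases hzp : z = p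
      · subst hzp
        refine hr.congr_of_eventuallyEq ?_
        filter_upwards [eventually_nhdsWithin_iff.1 hrκ] with z hz
        by_cases hzp : z = p
        · rw [hR, hzp]; simp only [if_true]
        · rw [hR]
          simp only [if_neg hzp]
          rw [hz hzp]
          ring
      · have hne : e.1.symm z ≠ P := fun h => hzp (by rw [hp, ← h, e.1.right_inv hz])
        refine ((hsz z hz hne).add (contDiffAt_log_norm_sq_comp
          (contDiffAt_id.sub contDiffAt_const) (sub_ne_zero.2 hzp))).congr_of_eventuallyEq ?_
        filter_upwards [isOpen_ne.mem_nhds hzp] with w hw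
        rw [hR]
        simp only [if_neg hw]
        rfl
    have hgl : LocallyIntegrableOn (fun z => Real.log (‖z - p‖ ^ 2)) (e.range : Set ℂ) volume := by
      intro z _
      refine IntegrableAtFilter.filter_mono nhdsWithin_le_nhds ?_
      by_cases hzp : z = p
      · rw [hzp]; exact integrableAtFilter_log p
      · exact (hasLogSing_of_contDiffAt (contDiffAt_log_norm_sq_comp
          (contDiffAt_id.sub contDiffAt_const) (sub_ne_zero.2 hzp))).integrableAtFilter
    have hg : IsGivenBy (h.1 e) (fun z => R z - Real.log (‖z - p‖ ^ 2)) := by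
      refine (hκ e).congr_ae ?_
      have h0 : ∀ᵐ z : ℂ, z ≠ p := by simp [ae_iff]
      filter_upwards [h0] with z hz _
      rw [hR]
      simp only [if_neg hz, add_sub_cancel_right]
    refine ⟨fun z => (4 * Real.pi)⁻¹ * lap R z,
      contDiffOn_const.mul (contDiffOn_lap e.1.open_target hR1), fun φ => ?_⟩
    have i1 : Integrable fun z => R z * lap φ z := integrable_mul_test (Ω := e.range)
      (hR1.continuousOn.locallyIntegrableOn e.1.open_target.measurableSet) (lapTest φ)
    have i2 : Integrable fun z => Real.log (‖z - p‖ ^ 2) * lap φ z :=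
      integrable_mul_test hgl (lapTest φ)
    rw [if_pos hP, hg.2]
    simp only [lapTest_apply, sub_mul, mul_assoc]
    rw [integral_sub i1 i2, integral_log_sub_mul_lap (testFunction_smooth φ) φ.hasCompactSupport,
      integral_const_mul, integral_mul_lap_test (Ω := e.range) hR1 φ]
    have := Real.pi_ne_zero
    field_simp
    ring
  · have h1 : ContDiffOn ℝ ∞ (κ ∘ e.1.symm) e.1.target := fun z hz =>
      (hsz z hz fun h => hP (h ▸ e.1.map_target hz)).contDiffWithinAt
    refine ⟨fun z => (4 * Real.pi)⁻¹ * lap (κ ∘ e.1.symm) z,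
      contDiffOn_const.mul (contDiffOn_lap e.1.open_target h1), fun φ => ?_⟩
    rw [if_neg hP, add_zero, (hκ e).2]
    simp only [mul_assoc]
    rw [integral_const_mul]
    congr 1
    exact integral_mul_lap_test (Ω := e.range) h1 φ

theorem IsGivenByFun.const_smul {T : Dist X} {u : X → ℝ} (hT : IsGivenByFun T u) (c : ℝ) :
    IsGivenByFun (c • T) (fun x => c * u x) := fun e => (hT e).const_smul c

/-- For each divisor there is a Green function with `C^∞` regularity, smooth outside the
support. -/
theorem exists_green [T2Space X] (D : X →₀ ℝ) : ∃ (h : Dist X) (u : X → ℝ), IsSmoothGreen D h ∧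
    IsGivenByFun h u ∧ LogGreen D u ∧ ∀ x ∉ D.support, ContMDiffAt 𝓘(ℝ, ℂ) 𝓘(ℝ, ℝ) ∞ u x := by
  choose κ hκ hsm _ using fun P : X => exists_logGreen_single P univ_mem
  choose T hT using fun P => (hκ P).exists_dist
  have hD : ∑ P ∈ D.support, D P • Finsupp.single P (1 : ℝ) = D := by
    conv_rhs => rw [← Finsupp.sum_single D]
    exact Finset.sum_congr rfl fun P _ => by rw [Finsupp.smul_single, smul_eq_mul, mul_one]
  refine ⟨∑ P ∈ D.support, D P • T P, fun x => ∑ P ∈ D.support, D P * κ P x, ?_, ?_, ?_, ?_⟩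
  · conv_lhs => rw [← hD]
    exact IsSmoothGreen.sum _ fun P _ =>
      ((hT P).isSmoothGreen_single (hκ P) (hsm P)).const_smul (D P)
  · exact IsGivenByFun.finset_sum _ fun P _ => (hT P).const_smul (D P)
  · conv_lhs => rw [← hD]
    exact LogGreen.sum _ fun P _ => (hκ P).const_mul (D P)
  · intro x hx
    exact contMDiffAt_finsetSum fun P hP => contMDiffAt_const.mul
      (hsm P x fun h => hx (h ▸ hP))

theorem LogGreen.sub {D E : X →₀ ℝ} {u v : X → ℝ} (hu : LogGreen D u) (hv : LogGreen E v) :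
    LogGreen (D - E) (u - v) := by
  have := hu.add (hv.const_mul (-1))
  rw [neg_one_smul, ← sub_eq_add_neg] at this
  convert this using 2
  simp [sub_eq_add_neg]

/-- A function with logarithmic singularities defines a Green function with `C^∞` regularity. -/
theorem LogGreen.isSmoothGreen [T2Space X] [CompactSpace X] {D : X →₀ ℝ} {u : X → ℝ}
    (hu : LogGreen D u) {T : Dist X} (hT : IsGivenByFun T u) : IsSmoothGreen D T := by
  -- The difference from a reference Green function for D has only removable singularities, hence is
  -- a smooth function up to a finite set.
  obtain ⟨h, v, h1, h2, h3, -⟩ := exists_green D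
  have h4 := hu.sub h3
  rw [sub_self] at h4
  obtain ⟨s, N, hs, hN, hsN⟩ := h4.exists_smooth
  have h5 : IsGivenByFun (T - h) s := (hT.sub h2).congr hN hsN
  have h6 := (h5.isSmoothGreen_zero hs).add h1
  have h7 : T - h + h = T := by abel
  rwa [zero_add, h7] at h6

end Green

/-! ### Representation of smooth Green functions by functions. -/

section Representation

variable {X : Type*} [TopologicalSpace X] [ChartedSpace ℂ X] [IsManifold 𝓘(ℂ) ω X]
  [T2Space X] [CompactSpace X]

/-- Continuous representatives of a distribution in two charts agree. -/
theorem isGivenBy_chart_change {h : Dist X} (e c : Chart X) {f g : ℂ → ℝ}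
    (hf : IsGivenBy (h.1 e) f) (hg : IsGivenBy (h.1 c) g) (hfc : ContinuousOn f e.1.target)
    (hgc : ContinuousOn g c.1.target) {y : ℂ} (hy : y ∈ locDom id c e) :
    g y = f (locMap id c e y) := by
  have hU : IsOpen (locDom (id : X → X) c e) := isOpen_locDom continuous_id c e
  have hτc : ContinuousOn (locMap (id : X → X) c e) (locDom id c e) := fun z hz =>
    (continuousAt_locMap mdifferentiable_id hz).continuousWithinAt
  have hfτ : ContinuousOn (fun z => f (locMap id c e z)) (locDom id c e) :=
    hfc.comp hτc fun z hz => locMap_mem_target hz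
  have hgU : ContinuousOn g (locDom id c e) := hgc.mono inter_subset_left
  have hd : ContinuousOn (fun z => g z - f (locMap id c e z)) (locDom id c e) := hgU.sub hfτ
  have hae := hU.ae_eq_zero_of_integral_contDiff_smul_eq_zero
    (hd.locallyIntegrableOn hU.measurableSet) (μ := volume) fun φ hφ hφc hφU => by
    set ψ : 𝓓(c.range, ℝ) := mkTest φ hφ hφc (hφU.trans inter_subset_left) with hψ
    have hψφ : ∀ z, ψ z = φ z := fun z => rfl
    have hK : IsCompact (locMap id c e '' tsupport φ) :=
      IsCompact.image_of_continuousOn hφc (hτc.mono hφU)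
    have hKe : locMap id c e '' tsupport φ ⊆ e.1.target := by
      rintro _ ⟨z, hz, rfl⟩
      exact locMap_mem_target (hφU hz)
    -- Since ξ is 1 on the image of the support of φ, the transported test forms represent all of φ
    -- in the chart e.
    obtain ⟨ξ, hξ, hξc, hξe, hξ1, -⟩ := exists_cutoff hK e.1.open_target hKe
    have hξK : ∀ z ∈ tsupport φ, ξ (locMap id c e z) = 1 := fun z hz =>
      hξ1.self_of_nhdsSet _ (mem_image_of_mem _ hz)
    have hs : ∀ x, extendChart e ξ x ≠ 0 → x ∈ e.1.source ∧ e.1 x ∈ tsupport ξ := by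
      intro x hx
      by_cases hxs : x ∈ e.1.source
      · rw [extendChart_apply _ hxs] at hx
        exact ⟨hxs, subset_tsupport _ hx⟩
      · exact absurd (extendChart_of_notMem _ hxs) hx
    obtain ⟨φ₁, φ₂, h12, h1, h2⟩ := exists_transport e c
      (contMDiff_extendChart hξ hξc hξe Subset.rfl) hξc hξe hs ψ
    have e1 : h.1 c φ₁ = ∫ z, g z * φ z := by
      rw [hg.2]
      refine integral_congr_ae (ae_of_all _ fun z => ?_)
      beta_reduce
      by_cases hz : z ∈ c.1.target
      · rw [h1 z hz, hψφ]
        by_cases hzφ : z ∈ tsupport φ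
        · have h3 : extendChart e ξ (c.1.symm z) = 1 := by
            rw [extendChart_apply _ (show c.1.symm z ∈ e.1.source from (hφU hzφ).2)]
            exact hξK z hzφ
          rw [h3, one_mul]
        · rw [image_eq_zero_of_notMem_tsupport hzφ, mul_zero]
      · rw [image_eq_zero_of_notMem_tsupport (f := φ₁) fun h => hz (φ₁.tsupport_subset h),
          image_eq_zero_of_notMem_tsupport (f := φ) fun h => hz (hφU h).1]
    have e2 : h.1 e φ₂ = ∫ z in locDom id c e, f (locMap id c e z) * φ z := by
      have h3 := integral_chart_change e c fun z => f (locMap id c e z) * φ z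
      rw [h3, hf.2, ← setIntegral_eq_integral_of_forall_compl_eq_zero (s := locDom id e c)]
      · refine setIntegral_congr_fun (isOpen_locDom continuous_id e c).measurableSet fun z hz => ?_
        rw [h2 z hz.1, if_pos hz, locMap_id_inverse hz, hψφ, extendChart_symm _ hz.1]
        by_cases hzφ : locMap id e c z ∈ tsupport φ
        · have := hξK _ hzφ
          rw [locMap_id_inverse hz] at this
          rw [this]
          ring
        · rw [image_eq_zero_of_notMem_tsupport hzφ]
          ring
      · intro z hz
        by_cases hzt : z ∈ e.1.target
        · rw [h2 z hzt, if_neg hz, mul_zero]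
        · rw [image_eq_zero_of_notMem_tsupport (f := φ₂) fun h => hzt (φ₂.tsupport_subset h),
            mul_zero]
    have e3 : ∫ z, g z * φ z = ∫ z in locDom id c e, g z * φ z := by
      refine (setIntegral_eq_integral_of_forall_compl_eq_zero fun z hz => ?_).symm
      rw [image_eq_zero_of_notMem_tsupport fun h => hz (hφU h), mul_zero]
    have hint : ∀ {k : ℂ → ℝ}, ContinuousOn k (locDom id c e) →
        IntegrableOn (fun z => k z * φ z) (locDom id c e) := fun hk =>
      (integrable_mul_test (Ω := ⟨_, hU⟩) (hk.locallyIntegrableOn hU.measurableSet)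
        (mkTest φ hφ hφc hφU)).integrableOn
    have e4 := h.2 c e φ₁ φ₂ h12
    rw [e1, e2, e3] at e4
    rw [← setIntegral_eq_integral_of_forall_compl_eq_zero (s := locDom id c e)]
    · simp only [smul_eq_mul, mul_comm (φ _), sub_mul]
      rw [integral_sub (hint hgU) (hint hfτ), e4, sub_self]
    · intro z hz
      rw [image_eq_zero_of_notMem_tsupport fun h => hz (hφU h), zero_smul]
  have h5 : (fun z => g z - f (locMap id c e z)) =ᵐ[volume.restrict (locDom id c e)] fun _ => 0 :=
    (ae_restrict_iff' hU.measurableSet).2 hae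
  exact sub_eq_zero.1 (Measure.eqOn_open_of_ae_eq h5 hU hd continuousOn_const hy)

/-- Elliptic regularity: a distribution with smooth `dd^c` is given by a smooth function. -/
theorem IsSmoothGreen.exists_smooth {h : Dist X} (hh : IsSmoothGreen 0 h) :
    ∃ s : X → ℝ, ContMDiff 𝓘(ℝ, ℂ) 𝓘(ℝ, ℝ) ∞ s ∧ IsGivenByFun h s := by
  have h1 : ∀ e : Chart X, ∃ r : ℂ → ℝ, ContDiffOn ℝ ∞ r e.1.target ∧ IsGivenBy (h.1 e) r := by
    intro e
    obtain ⟨w, hw, hwφ⟩ := isSmoothGreen_iff.1 hh e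
    refine weyl (h.1 e) (w := fun z => 4 * Real.pi * w z) (contDiffOn_const.mul hw) fun φ => ?_
    have h2 := hwφ φ
    rw [diracDivisor_apply, Finsupp.sum_zero_index, add_zero] at h2
    simp only [mul_assoc (4 * Real.pi)]
    rw [integral_const_mul, ← h2]
    have := Real.pi_ne_zero
    field_simp
  choose r hr hrh using h1
  have hs : ∀ (e : Chart X), ∀ z ∈ e.1.target,
      r (Chart.preferred (e.1.symm z)) ((Chart.preferred (e.1.symm z)).1 (e.1.symm z)) = r e z := by
    intro e z hz
    exact (isGivenBy_chart_change (Chart.preferred (e.1.symm z)) e (hrh _) (hrh e)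
      (hr _).continuousOn (hr e).continuousOn ⟨hz, mem_source_preferred _⟩).symm
  refine ⟨fun x => r (Chart.preferred x) ((Chart.preferred x).1 x),
    contMDiff_iff_chart.2 fun e => (hr e).congr fun z hz => hs e z hz, fun e => ?_⟩
  exact (hrh e).congr_ae (ae_of_all _ fun z hz => (hs e z hz).symm)

theorem IsSmoothGreen.sub {D E : X →₀ ℝ} {h k : Dist X} (hD : IsSmoothGreen D h)
    (hE : IsSmoothGreen E k) : IsSmoothGreen (D - E) (h - k) := by
  have := hD.add (hE.const_smul (-1))
  have h1 : h + (-1 : ℝ) • k = h - k := by module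
  rwa [neg_one_smul, ← sub_eq_add_neg, h1] at this

/-- A Green function with `C^∞` regularity is given by a function that is smooth outside the
support of the divisor, with logarithmic singularities. -/
theorem IsSmoothGreen.exists_logGreen {D : X →₀ ℝ} {h : Dist X} (hh : IsSmoothGreen D h) :
    ∃ u : X → ℝ, LogGreen D u ∧ IsGivenByFun h u ∧
      ContMDiffOn 𝓘(ℝ, ℂ) 𝓘(ℝ, ℝ) ∞ u (D.support : Set X)ᶜ := by
  -- Subtracting a reference Green function removes the point masses; elliptic regularity then gives
  -- a smooth function.
  obtain ⟨k, v, h1, h2, h3, h4⟩ := exists_green D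
  have h5 := hh.sub h1
  rw [sub_self] at h5
  obtain ⟨s, hs, hsg⟩ := h5.exists_smooth
  refine ⟨s + v, ?_, ?_, fun x hx => ((hs x).add (h4 x hx)).contMDiffWithinAt⟩
  · have := (logGreen_zero_of_contMDiff hs).add h3
    rwa [zero_add] at this
  · have h6 : h - k + k = h := by abel
    exact h6 ▸ hsg.add h2

/-- The two functions agree almost everywhere in charts and are continuous off S. Hence the function
chosen in `IsImageOfGreen` is determined outside the support of the divisor. -/
theorem eq_of_isGivenByFun {h : Dist X} {u v : X → ℝ} (hu : IsGivenByFun h u)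
    (hv : IsGivenByFun h v) {S : Set X} (hS : IsClosed S)
    (huS : ContMDiffOn 𝓘(ℝ, ℂ) 𝓘(ℝ, ℝ) ∞ u Sᶜ) (hvS : ContMDiffOn 𝓘(ℝ, ℂ) 𝓘(ℝ, ℝ) ∞ v Sᶜ) :
    ∀ x ∉ S, u x = v x := by
  intro x hx
  set e := Chart.preferred x with he
  have hxs := mem_source_preferred x
  set U := e.1.target ∩ e.1.symm ⁻¹' Sᶜ with hU
  have hUo : IsOpen U := e.1.isOpen_inter_preimage_symm hS.isOpen_compl
  have hc : ∀ {u : X → ℝ}, ContMDiffOn 𝓘(ℝ, ℂ) 𝓘(ℝ, ℝ) ∞ u Sᶜ →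
      ContinuousOn (fun z => u (e.1.symm z)) U := fun hu =>
    hu.continuousOn.comp (e.1.continuousOn_symm.mono inter_subset_left) fun z hz => hz.2
  have hae : (fun z => u (e.1.symm z)) =ᵐ[volume.restrict U] fun z => v (e.1.symm z) := by
    rw [EventuallyEq, ae_restrict_iff' hUo.measurableSet]
    filter_upwards [(hu e).ae_eq (hv e)] with z hz hzU
    exact hz hzU.1
  have hxU : e.1 x ∈ U := ⟨e.1.map_source hxs, by
    rw [mem_preimage, e.1.left_inv hxs]; exact hx⟩
  have := Measure.eqOn_open_of_ae_eq hae hUo (hc huS) (hc hvS) hxU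
  simpa only [e.1.left_inv hxs] using this

end Representation

/-! ### Images of L²₁-Green functions under bounded operators. -/

section Image

variable {X Y : Type*} [TopologicalSpace X] [ChartedSpace ℂ X] [IsManifold 𝓘(ℂ) ω X]
  [TopologicalSpace Y] [ChartedSpace ℂ Y] [IsManifold 𝓘(ℂ) ω Y]
  [T2Space X] [CompactSpace X] {Φ : (X → ℝ) → (Y → ℝ)}

/-- The definition says nothing about the singularities of u or its values on the support of D.
Comparison with the function v obtained from elliptic regularity shows that u has logarithmic
singularities up to a finite set. -/
theorem IsImageOfGreen.exists_logGreen {D : X →₀ ℝ} {h : Dist X} {T : Dist Y}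
    (hh : IsSmoothGreen D h) (hT : IsImageOfGreen Φ D h T) :
    ∃ u v : X → ℝ, LogGreen D v ∧ IsGivenByFun T (Φ u) ∧ IsGivenByFun h u ∧
      ∀ x ∉ (D.support : Set X), u x = v x := by
  obtain ⟨u, hu, hhu, hTu⟩ := hT
  obtain ⟨v, hv, hhv, hvs⟩ := hh.exists_logGreen
  exact ⟨u, v, hv, hTu, hhu,
    eq_of_isGivenByFun hhu hhv D.support.finite_toSet.isClosed hu hvs⟩

/-- Images of `L²₁`-Green functions under a bounded operator that respects logarithmic
singularities. -/
theorem IsBoundedOp.existsUnique_image (hΦ : IsBoundedOp Φ) {D : X →₀ ℝ} {D' : Y →₀ ℝ}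
    (hG : ∀ u, LogGreen D u → ∃ T, IsGivenByFun T (Φ u) ∧ IsL21Green D' T) {g : Dist X}
    (hg : IsL21Green D g) :
    (∃! T, IsImage Φ D g T) ∧ ∀ T, IsImage Φ D g T → IsL21Green D' T := by
  refine ⟨existsUnique_of_exists_of_unique ?_ ?_, ?_⟩
  · obtain ⟨h, ψ, hs⟩ := hg
    obtain ⟨u, hu, hhu, hus⟩ := hs.1.exists_logGreen
    obtain ⟨T, hT, -⟩ := hG u hu
    obtain ⟨η, hη⟩ := hΦ.exists_image hs.2.1
    exact ⟨T + η, h, ψ, hs, T, η, ⟨u, hus, hhu, hT⟩, hη, rfl⟩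
  -- The singularities of v and v' cancel, so ψ' - ψ = h - h' is given by a smooth function s. Then
  -- Φ s gives both T - T' and η' - η, so the two sums are equal.
  · rintro _ _ ⟨h, ψ, hs, T, η, hT, hη, rfl⟩ ⟨h', ψ', hs', T', η', hT', hη', rfl⟩
    obtain ⟨u, v, hv, hTu, hhu, huv⟩ := hT.exists_logGreen hs.1
    obtain ⟨u', v', hv', hTu', hhu', huv'⟩ := hT'.exists_logGreen hs'.1
    have h1 := hv.sub hv'
    rw [sub_self] at h1
    obtain ⟨s, N, hsm, hN, hvs⟩ := h1.exists_smooth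
    have hfin : (N ∪ (D.support : Set X)).Finite := hN.union D.support.finite_toSet
    have hus : ∀ x ∉ N ∪ (D.support : Set X), (u - u') x = s x := by
      intro x hx
      rw [Pi.sub_apply, huv x fun h => hx (Or.inr h), huv' x fun h => hx (Or.inr h)]
      exact hvs x fun h => hx (Or.inl h)
    have h2 : ψ' - ψ = h - h' := by
      have := hs.2.2.symm.trans hs'.2.2
      calc ψ' - ψ = h' + ψ' - h' - ψ := by abel
        _ = h + ψ - h' - ψ := by rw [this]
        _ = h - h' := by abel
    have h3 : IsGivenByFun (ψ' - ψ) s := by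
      rw [h2]
      exact (hhu.sub hhu').congr hfin hus
    have h4 := hΦ.image_sub hη hη' hsm h3
    obtain ⟨N', hN', hΦs⟩ := hΦ.congr_finite _ _ _ hfin hus
    have h5 := hTu.sub hTu'
    rw [← hΦ.sub] at h5
    have h6 := (h5.congr hN' hΦs).dist_eq h4
    calc T + η = T - T' + T' + η := by abel
      _ = η' - η + T' + η := by rw [h6]
      _ = T' + η' := by abel
  -- Replacing u by v changes the image only on a finite set, and the L²₁ remainder ξ of the image
  -- of h joins η.
  · rintro _ ⟨h, ψ, hs, T, η, hT, hη, rfl⟩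
    obtain ⟨u, v, hv, hTu, hhu, huv⟩ := hT.exists_logGreen hs.1
    obtain ⟨T', hT', k, ξ, hk, hξ, hT'k⟩ := hG v hv
    obtain ⟨N, hN, hΦN⟩ := hΦ.congr_finite _ _ _ D.support.finite_toSet huv
    refine ⟨k, ξ + η, hk, hξ.add (hΦ.isL21_image hη), ?_⟩
    rw [(hTu.congr hN hΦN).dist_eq hT', hT'k, add_assoc]

end Image

/-! ### Push-forward and pull-back of logarithmic singularities. -/

section PushPull

variable {X Y : Type*} [TopologicalSpace X] [ChartedSpace ℂ X] [IsManifold 𝓘(ℂ) ω X]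
  [TopologicalSpace Y] [ChartedSpace ℂ Y] [IsManifold 𝓘(ℂ) ω Y]
  [T2Space X] [CompactSpace X] [T2Space Y] [CompactSpace Y] {F : X → Y} (hF : MDifferentiable 𝓘(ℂ) 𝓘(ℂ) F)
  (hiso : ∀ (x : X) (y : Y), ∀ᶠ x' in 𝓝[≠] x, F x' ≠ y)

include hF hiso

theorem ramificationIndex_ne_zero (x : X) : ramificationIndex F x ≠ 0 := by
  set e := Chart.preferred x with he
  set c := Chart.preferred (F x) with hc
  have hd : e.1 x ∈ locDom F e c := mem_locDom (mem_source_preferred x) (mem_source_preferred (F x))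
  have ha := (analyticOnNhd_locMap hF e c _ hd).sub
    (analyticAt_const (v := locMap F e c (e.1 x)))
  have h0 := ha.analyticOrderAt_ne_zero.2 (by simp)
  have h1 := analyticOrderAt_ne_top_of_punctured (eventually_locMap_ne hF hiso e c hd)
  have h2 : ramificationIndex F x =
      analyticOrderNatAt (fun z => locMap F e c z - locMap F e c (e.1 x)) (e.1 x) := by
    rw [locMap_apply F c (mem_source_preferred x)]; rfl
  rw [h2, analyticOrderNatAt, Ne, ENat.toNat_eq_zero, not_or]
  exact ⟨h0, h1⟩

/-- A function with one logarithmic singularity at `P`, the push-forward of which has one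
logarithmic singularity at `F P`. -/
theorem exists_logGreen_push (P : X) : ∃ (l : X → ℝ) (κ : Y → ℝ) (N : Set Y),
    LogGreen (Finsupp.single P 1) l ∧ LogGreen (Finsupp.single (F P) 1) κ ∧ N.Finite ∧
      ∀ y ∉ N, pushFun F l y = κ y := by
  classical
  obtain ⟨W₁, -, hW₁, hPW₁, V₁, hV₁, hPV₁, hWP, hcard₁⟩ :=
    exists_branched_nhds_map hF hiso P univ_mem
  set e := Chart.preferred P with he
  have hP : P ∈ e.1.source := mem_source_preferred P
  have hPt := e.1.map_source hP
  obtain ⟨ξ, hξ, hξc, hξU, hξ1, -⟩ := exists_cutoff (isCompact_singleton (x := e.1 P))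
    (e.1.isOpen_inter_preimage_symm hW₁) (singleton_subset_iff.2 ⟨hPt, by
      rwa [mem_preimage, e.1.left_inv hP]⟩)
  have hξe : tsupport ξ ⊆ e.1.target := hξU.trans inter_subset_left
  set χ := extendChart e ξ with hχ
  have hχs := contMDiff_extendChart hξ hξc hξe Subset.rfl
  set Z := e.1.symm '' tsupport ξ with hZ
  have hZc : IsClosed Z :=
    (IsCompact.image_of_continuousOn hξc (e.1.continuousOn_symm.mono hξe)).isClosed
  have hZW : Z ⊆ W₁ := by
    rintro _ ⟨z, hz, rfl⟩
    exact (hξU hz).2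
  have hχ0 : ∀ x ∉ Z, χ x = 0 := by
    intro x hx
    by_cases hxs : x ∈ e.1.source
    · rw [hχ, extendChart_apply _ hxs]
      exact image_eq_zero_of_notMem_tsupport fun h => hx ⟨_, h, e.1.left_inv hxs⟩
    · exact extendChart_of_notMem _ hxs
  rw [nhdsSet_singleton] at hξ1
  have hχ1 : ∀ᶠ x in 𝓝 P, χ x = 1 := by
    filter_upwards [(e.1.continuousAt hP).eventually hξ1, e.1.open_source.mem_nhds hP] with x hx hxs
    rw [hχ, extendChart_apply _ hxs, hx]
  -- W₂ lies in W₁ and χ is 1 on it. A nearby fibre has e_P points in each of them, so all its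
  -- points in W₁ are in W₂, and χ is 1 at every point of the fibre in W₁.
  obtain ⟨W₂, hW₂s, -, -, V₂, hV₂, hPV₂, -, hcard₂⟩ :=
    exists_branched_nhds_map hF hiso P (inter_mem hχ1 (hW₁.mem_nhds hPW₁))
  obtain ⟨κ, hκ, hκs, hκ0⟩ := exists_logGreen_single (F P)
    ((hV₁.inter hV₂).mem_nhds ⟨hPV₁, hPV₂⟩)
  set m : ℝ := (ramificationIndex F P : ℝ) with hm
  have hm0 : m ≠ 0 := Nat.cast_ne_zero.2 (ramificationIndex_ne_zero hF hiso P)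
  -- κ ∘ F has coefficient m at P, while χ removes the other points above F P. Over an unramified y
  -- ≠ F P close to F P, each of the m points of the fibre near P contributes m⁻¹ κ(y). Further away
  -- κ vanishes.
  refine ⟨fun x => m⁻¹ * (χ x * κ (F x)), κ, {F P} ∪ F '' {x | ramificationIndex F x ≠ 1},
    logGreen_iff.2 fun x => ⟨_, mem_source_preferred x, ?_⟩, hκ,
    (finite_singleton _).union ((finite_ramified hF hiso).image F), fun y hy => ?_⟩
  · by_cases hx : x = P
    · subst hx
      have h1 := HasLogSing.comp_map hF hiso (hκ _ _ (mem_source_preferred (F x)))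
      have h2 := h1.const_mul m⁻¹
      rw [Finsupp.single_eq_same, one_mul, ← hm, inv_mul_cancel₀ hm0] at h2
      rw [Finsupp.single_eq_same]
      refine h2.congr (Eventually.filter_mono nhdsWithin_le_nhds ?_)
      filter_upwards [hξ1, e.1.open_target.mem_nhds hPt] with z hz hzt
      rw [hχ, extendChart_symm _ hzt, hz, one_mul]
    · rw [Finsupp.single_eq_of_ne (by exact hx)]
      by_cases hxZ : x ∈ Z
      · have hne : F x ≠ F P := fun h => hx (by
          have : x ∈ W₁ ∩ F ⁻¹' {F P} := ⟨hZW hxZ, h⟩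
          rwa [hWP] at this)
        have hxs := mem_source_preferred x
        have h1 : ContDiffAt ℝ ∞ ((κ ∘ F) ∘ (Chart.preferred x).1.symm)
            ((Chart.preferred x).1 x) := by
          refine contDiffAt_comp_map hF _ (Chart.preferred (F x))
            (mem_locDom hxs (mem_source_preferred _)) ?_
          rw [locMap_apply _ _ hxs]
          exact (contMDiffAt_iff_chart _ (mem_source_preferred (F x))).1 (hκs _ hne)
        exact hasLogSing_of_contDiffAt (contDiffAt_const.mul
          (((contMDiffAt_iff_chart _ hxs).1 (hχs x)).mul h1))
      · refine (hasLogSing_of_contDiffAt (contDiffAt_const (c := (0 : ℝ)))).congr ?_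
        have h1 : ∀ᶠ x' in 𝓝 x, x' ∉ Z := hZc.isOpen_compl.mem_nhds hxZ
        filter_upwards [(tendsto_symm_punctured _ (mem_source_preferred x)).eventually
          (h1.filter_mono nhdsWithin_le_nhds)] with z hz
        rw [hχ0 _ hz, zero_mul, mul_zero]
  · have hram : ∀ x, F x = y → ramificationIndex F x = 1 := fun x hx => by
      by_contra h
      exact hy (Or.inr ⟨x, h, hx⟩)
    have hyP : y ≠ F P := fun h => hy (Or.inl h)
    set t := (finite_fibre hF hiso y).toFinset with ht
    have hmem : ∀ {x}, x ∈ t ↔ F x = y := by simp [ht]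
    have h1 : pushFun F (fun x => m⁻¹ * (χ x * κ (F x))) y = m⁻¹ * (κ y * ∑ x ∈ t, χ x) := by
      rw [pushFun_eq_sum hF hiso, Finset.mul_sum, Finset.mul_sum]
      refine Finset.sum_congr rfl fun x hx => ?_
      rw [hram x (hmem.1 hx), hmem.1 hx, Nat.cast_one]
      ring
    rw [h1]
    by_cases hyV : y ∈ V₁ ∩ V₂
    · have hfin : (W₁ ∩ F ⁻¹' {y}).Finite := (finite_fibre hF hiso y).subset inter_subset_right
      have hsub : W₂ ∩ F ⁻¹' {y} ⊆ W₁ ∩ F ⁻¹' {y} :=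
        inter_subset_inter_left _ (hW₂s.trans inter_subset_right)
      have heq : W₂ ∩ F ⁻¹' {y} = W₁ ∩ F ⁻¹' {y} := Set.eq_of_subset_of_ncard_le hsub
        (by rw [hcard₁ y hyV.1 hyP, hcard₂ y hyV.2 hyP]) hfin
      have h2 : ∑ x ∈ t, χ x = m := by
        have h3 : ∀ x ∈ t, χ x = if x ∈ W₁ then 1 else 0 := by
          intro x hx
          split_ifs with h
          · have : x ∈ W₂ ∩ F ⁻¹' {y} := heq ▸ ⟨h, hmem.1 hx⟩
            exact (hW₂s this.1).1
          · exact hχ0 x fun h' => h (hZW h')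
        rw [Finset.sum_congr rfl h3, Finset.sum_boole, hm, ← hcard₁ y hyV.1 hyP,
          Set.ncard_eq_toFinset_card _ hfin]
        congr 2
        ext x
        simp [hmem, and_comm]
      rw [h2, mul_comm (κ y), inv_mul_cancel_left₀ hm0]
    · rw [hκ0 y hyV, zero_mul, mul_zero]

/-- Off a finite set, u is a combination of the models of `exists_logGreen_push` plus a smooth s.
The push-forward of s need not be smooth at branch values but lies in L²₁, so the image is only an
L²₁-Green function. -/
theorem exists_pushFun_green {D : X →₀ ℝ} {u : X → ℝ} (hu : LogGreen D u) :
    ∃ T : Dist Y, IsGivenByFun T (pushFun F u) ∧ IsL21Green (pushDivisor F D) T := by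
  choose l κ N hl hκ hN hlκ using exists_logGreen_push hF hiso
  have hD : ∑ P ∈ D.support, D P • Finsupp.single P (1 : ℝ) = D := by
    conv_rhs => rw [← Finsupp.sum_single D]
    exact Finset.sum_congr rfl fun P _ => by rw [Finsupp.smul_single, smul_eq_mul, mul_one]
  have hD' : ∑ P ∈ D.support, D P • Finsupp.single (F P) (1 : ℝ) = pushDivisor F D := by
    rw [pushDivisor, Finsupp.mapDomain]
    exact Finset.sum_congr rfl fun P _ => by rw [Finsupp.smul_single, smul_eq_mul, mul_one]
  have hlD : LogGreen D fun x => ∑ P ∈ D.support, D P * l P x := by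
    conv_lhs => rw [← hD]
    exact LogGreen.sum _ fun P _ => (hl P).const_mul (D P)
  have hκD : LogGreen (pushDivisor F D) fun y => ∑ P ∈ D.support, D P * κ P y := by
    rw [← hD']
    exact LogGreen.sum _ fun P _ => (hκ P).const_mul (D P)
  have h1 := hu.sub hlD
  rw [sub_self] at h1
  obtain ⟨s, M, hs, hM, hsM⟩ := h1.exists_smooth
  have hΦ := isBoundedOp_pushFun hF hiso
  obtain ⟨M', hM', hsM'⟩ := hΦ.congr_finite _ _ M hM hsM
  obtain ⟨T, hT⟩ := hΦ.isGivenBy s hs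
  obtain ⟨k, hk⟩ := hκD.exists_dist
  have hfin : (M' ∪ ⋃ P ∈ D.support, N P).Finite :=
    hM'.union (D.support.finite_toSet.biUnion fun P _ => hN P)
  refine ⟨k + T, (hk.add hT).congr hfin fun y hy => ?_, k, T, hκD.isSmoothGreen hk,
    hΦ.isL21 hs hT, rfl⟩
  have h2 := hsM' y fun h => hy (Or.inl h)
  rw [hΦ.sub, Pi.sub_apply, pushFun_sum hF hiso] at h2
  have h3 : ∀ P ∈ D.support, pushFun F (fun x => D P * l P x) y = D P * κ P y := by
    intro P hP
    rw [← hlκ P y fun h => hy (Or.inr (mem_biUnion hP h)), pushFun_eq_sum hF hiso,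
      pushFun_eq_sum hF hiso, Finset.mul_sum]
    exact Finset.sum_congr rfl fun x _ => by ring
  beta_reduce at h2
  rw [Finset.sum_congr rfl h3] at h2
  rw [Pi.add_apply, ← h2]
  ring

/-- Composition with F preserves logarithmic singularities, so the image has smooth regularity and
the L²₁ part of its splitting can be taken to be 0. -/
theorem exists_pullFun_green {E : Y →₀ ℝ} {k : Y → ℝ} (hk : LogGreen E k) :
    ∃ T : Dist X, IsGivenByFun T (pullFun F k) ∧ IsL21Green (pullDivisor F E) T := by
  have h1 := hk.pull hF hiso
  obtain ⟨T, hT⟩ := h1.exists_dist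
  refine ⟨T, hT, T, 0, h1.isSmoothGreen hT, fun e => ?_, (add_zero T).symm⟩
  obtain ⟨u, p, q, h, -⟩ := energyLE_zero (Ω := e.range) ∅
  exact ⟨u, p, q, h⟩

end PushPull

end RiemannSurface

end

theorem theorem2p11 {X Y : Type*}
    [TopologicalSpace X] [T2Space X] [CompactSpace X] [ChartedSpace ℂ X] [IsManifold 𝓘(ℂ) ω X]
    [TopologicalSpace Y] [T2Space Y] [CompactSpace Y] [ChartedSpace ℂ Y] [IsManifold 𝓘(ℂ) ω Y]
    (F : X → Y) (hF : MDifferentiable 𝓘(ℂ) 𝓘(ℂ) F)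
    (hnc : ∀ x : X, ∃ x' ∈ connectedComponent x, F x' ≠ F x) :
    (∀ (D : X →₀ ℝ) (g : RiemannSurface.Dist X), RiemannSurface.IsL21Green D g →
      (∃! T : RiemannSurface.Dist Y, RiemannSurface.IsPushforward F D g T) ∧
      ∀ T : RiemannSurface.Dist Y, RiemannSurface.IsPushforward F D g T →
        RiemannSurface.IsL21Green (RiemannSurface.pushDivisor F D) T) ∧
    (∀ (E : Y →₀ ℝ) (f : RiemannSurface.Dist Y), RiemannSurface.IsL21Green E f →
      (∃! T : RiemannSurface.Dist X, RiemannSurface.IsPullback F E f T) ∧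
      ∀ T : RiemannSurface.Dist X, RiemannSurface.IsPullback F E f T →
        RiemannSurface.IsL21Green (RiemannSurface.pullDivisor F E) T) := by
  -- Non-constancy on components enters only through the isolatedness of the points of each fibre.
  have hiso := fun x y => RiemannSurface.eventually_ne_of_nonconstant hF hnc x y
  exact ⟨fun D g hg => (RiemannSurface.isBoundedOp_pushFun hF hiso).existsUnique_image
      (fun _ hu => RiemannSurface.exists_pushFun_green hF hiso hu) hg,
    fun E f hf => (RiemannSurface.isBoundedOp_pullFun hF hiso).existsUnique_image
      (fun _ hk => RiemannSurface.exists_pullFun_green hF hiso hk) hf⟩
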